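/- **Setting.** Let $\mathcal X$ be a finite set, whose elements $x$ are identified with the unit vectors $e_x\in\mathbb R^{\mathcal X}$, and let $\gamma_{xy}\ge 0$ $(x,y\in\mathcal X)$ be the rates of an ergodic (irreducible) Markov jump process on $\mathcal X$. Put $\mathcal Z=\{(x,y):\gamma_{xy}>0\}$, $v_{xy}=e_y-e_x$, let $\mathcal P(\mathcal X)$ be the simplex of probability vectors, and for $n\ge 1$ put $\mathcal P^n(\mathcal X)=\mathcal P(\mathcal X)\cap\frac1n\mathbb Z^{\mathcal X}$ and $L(\boldsymbol x)=\frac1n\sum_{i=1}^n\delta_{x_i}$ for $\boldsymbol x\in\mathcal X^n$. **Assumption on the costs and the reward.** $R:\mathcal P(\mathcal X)\to[0,\infty)$ is continuous, and for every $(x,y)\in\mathcal Z$ the function $C_{xy}:[0,\infty)\to[0,\infty]$ is convex, $C_{xy}(1)=0$, and $u\mapsto uC_{xy}'(u)-u$ is nondecreasing on the maximal open interval where $C_{xy}$ is finite (if $C_{xy}$ is not differentiable, $C'_{xy}$ is the right derivative). With $\ell(q)=q\log q-q+1$ let $$F_{xy}(q)=\sup_{u>0}\Big[u\,\ell\big(\tfrac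 qu\big)-\gamma_{xy}C_{xy}\big(\tfrac u{\gamma_{xy}}\big)\Big],\qquad q\ge 0 .$$ **Controls.** For a finite index set $\kappa$ and $r>0$, consider the canonical space of families $(N_k)_{k\in\kappa}$ of locally finite measures on $[0,\infty)^2$, under the law which makes them independent Poisson random measures with intensity $r$ times Lebesgue measure, and the completed filtration generated by $N_k((0,s]\times A)$, $s\le t$, $A$ Borel. Let $\mathcal A_b^{r,\kappa}$ be the set of predictable processes $u=(u_k)_{k\in\kappa}$ with values in $[0,\infty)^\kappa$, each component of which is bounded above and below by strictly positive constants. **Many-agent problem.** For $\mathcal K\subset\mathcal X^n$, $\boldsymbol x\in\mathcal X^n$ and $\boldsymbol u\in\mathcal A_b^{1,\{1,\dots,n\}\times\mathcal Z}$ let $\boldsymbol\chi=(\chi_1,\dots,\chi_n)$ be the $\mathcal X^n$-valued càdlàg process with $$\chi_i(t)=x_i+\sum_{(x,y)\in\mathcal Z}v_{xy}\int_{(0,t]}\int_{[0,\infty)}1_{[0,\,1_x(\chi_i(s-))u_{xy}(s,i)]}(r)\,N_{i,xy}(ds\,dr),$$ and $T_{\mathcal K}=\inf\{t\ge0:\boldsymbol\chi(t)\in\mathcal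 K\}$ (with $\inf\emptyset=\infty$). Define $$\mathcal W^n_{\mathcal K}(\boldsymbol x)=\inf_{\boldsymbol u}\mathbb E\exp\int_0^{T_{\mathcal K}}\Big(\sum_{i=1}^n\ \sum_{y:(\chi_i(t),y)\in\mathcal Z}\gamma_{\chi_i(t)y}C_{\chi_i(t)y}\Big(\frac{u_{\chi_i(t)y}(t,i)}{\gamma_{\chi_i(t)y}}\Big)-nR(L(\boldsymbol\chi(t)))\Big)dt,$$ $$\mathcal V^n_{\mathcal K}(\boldsymbol x)=\inf_{\boldsymbol q}\mathbb E\int_0^{T_{\mathcal K}}\Big(\frac1n\sum_{i=1}^n\ \sum_{y:(\chi_i(t),y)\in\mathcal Z}F_{\chi_i(t)y}(q_{\chi_i(t)y}(t,i))+R(L(\boldsymbol\chi(t)))\Big)dt,$$ where in the second problem $\boldsymbol\chi$ is driven by the control $\boldsymbol q$, and both infima are over $\mathcal A_b^{1,\{1,\dots,n\}\times\mathcal Z}$. **Mean-field problem.** For $K\subset\mathcal P^n(\mathcal X)$, $\boldsymbol m\in\mathcal P^n(\mathcal X)$ and $\boldsymbol u\in\mathcal A_b^{n,\mathcal Z}$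 let $\boldsymbol\mu$ be the $\mathcal P^n(\mathcal X)$-valued càdlàg process with $$\boldsymbol\mu(t)=\boldsymbol m+\sum_{(x,y)\in\mathcal Z}v_{xy}\int_{(0,t]}\int_{[0,\infty)}1_{[0,\,\mu_x(s-)u_{xy}(s)]}(r)\,\tfrac1nN_{xy}(ds\,dr),$$ the $N_{xy}$ having intensity $n$, and $T_K=\inf\{t\ge0:\boldsymbol\mu(t)\in K\}$. Define $$W^n_K(\boldsymbol m)=\inf_{\boldsymbol u\in\mathcal A_b^{n,\mathcal Z}}\mathbb E\exp\Big(n\int_0^{T_K}\Big(\sum_{(x,y)\in\mathcal Z}\mu_x(t)\gamma_{xy}C_{xy}\Big(\frac{u_{xy}(t)}{\gamma_{xy}}\Big)-R(\boldsymbol\mu(t))\Big)dt\Big),$$ $$V^n_K(\boldsymbol m)=\inf_{\boldsymbol q\in\mathcal A_b^{n,\mathcal Z}}\mathbb E\int_0^{T_K}\Big(\sum_{(x,y)\in\mathcal Z}\mu_x(t)F_{xy}(q_{xy}(t))+R(\boldsymbol\mu(t))\Big)dt .$$ **Theorem.** Let $n\ge1$ and let $C,R$ satisfy the assumption above. With $-\log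 0=\infty$: 1. for all $K\subset\mathcal P^n(\mathcal X)$ and $\boldsymbol m\in\mathcal P^n(\mathcal X)$, $\;V^n_K(\boldsymbol m)=-\frac1n\log W^n_K(\boldsymbol m)$; 2. for all $\mathcal K\subset\mathcal X^n$ and $\boldsymbol x\in\mathcal X^n$, $\;\mathcal V^n_{\mathcal K}(\boldsymbol x)=-\frac1n\log\mathcal W^n_{\mathcal K}(\boldsymbol x)$; 3. if $\mathcal K\subset\mathcal X^n$ is invariant under permutations of the agents and $K=L(\mathcal K)=\{L(\boldsymbol x):\boldsymbol x\in\mathcal K\}$, then for all $\boldsymbol x\in\mathcal X^n$ $$-\tfrac1n\log W^n_K(L(\boldsymbol x))=V^n_K(L(\boldsymbol x))=\mathcal V^n_{\mathcal K}(\boldsymbol x)=-\tfrac1n\log\mathcal W^n_{\mathcal K}(\boldsymbol x).$$ -/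

import Mathlib

open MeasureTheory ProbabilityTheory Filter Topology Set
open scoped NNReal ENNReal

noncomputable section

namespace ExitControl

/-! ### Poisson random measures on the quarter plane -/

/-- Locally finite Borel measures on `[0,∞)²`, with the σ-algebra generated by the evaluations
`ν ↦ ν A`.  The first coordinate is time, the second one is the level. -/
abbrev PointSpace : Type := {ν : Measure (ℝ≥0 × ℝ≥0) // IsLocallyFiniteMeasure ν}

/-- Raw data for a random point configuration: for each unit cell `[i,i+1] × [j,j+1]` of the quarter
plane, a number of points and a sequence of positions relative to the cell's lower left corner. -/
abbrev CellData : Type := ℕ × ℕ → ℕ × (ℕ → unitInterval × unitInterval)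

/-- The `l`-th potential point of the cell `c`. -/
def cellPoint (d : CellData) (c : ℕ × ℕ) (l : ℕ) : ℝ≥0 × ℝ≥0 :=
  ((c.1 : ℝ≥0) + unitInterval.toNNReal ((d c).2 l).1,
    (c.2 : ℝ≥0) + unitInterval.toNNReal ((d c).2 l).2)

/-- The counting measure of the configuration: cell `c` contributes its first `(d c).1` points. -/
def configMeasure (d : CellData) : Measure (ℝ≥0 × ℝ≥0) :=
  Measure.sum fun c : ℕ × ℕ =>
    ∑ l ∈ Finset.range (d c).1, Measure.dirac (cellPoint d c l)

theorem configMeasure_isLocallyFinite (d : CellData) :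
    IsLocallyFiniteMeasure (configMeasure d) := by
  refine ⟨fun p => ?_⟩
  obtain ⟨k, hk⟩ := exists_nat_gt (max p.1 p.2)
  have hk1 : p.1 < k := (le_max_left _ _).trans_lt hk
  have hk2 : p.2 < k := (le_max_right _ _).trans_lt hk
  have hU : MeasurableSet (Iio (k : ℝ≥0) ×ˢ Iio (k : ℝ≥0)) :=
    measurableSet_Iio.prod measurableSet_Iio
  refine ⟨Iio (k : ℝ≥0) ×ˢ Iio (k : ℝ≥0),
    (isOpen_Iio.prod isOpen_Iio).mem_nhds ⟨hk1, hk2⟩, ?_⟩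
  rw [configMeasure, Measure.sum_apply _ hU,
    tsum_eq_sum (s := Finset.range k ×ˢ Finset.range k)]
  · refine ENNReal.sum_lt_top.2 fun c _ => ?_
    exact measure_lt_top _ _
  · intro c hc
    rw [Measure.finsetSum_apply]
    refine Finset.sum_eq_zero fun l _ => ?_
    rw [Measure.dirac_apply' _ hU, indicator_of_notMem]
    rintro ⟨h1, h2⟩
    apply hc
    simp only [cellPoint, mem_Iio] at h1 h2
    simp only [Finset.mem_product, Finset.mem_range]
    exact ⟨by exact_mod_cast (le_self_add).trans_lt h1, by exact_mod_cast (le_self_add).trans_lt h2⟩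

/-- The configuration as an element of the space of locally finite measures. -/
def config (d : CellData) : PointSpace := ⟨configMeasure d, configMeasure_isLocallyFinite d⟩

theorem measurable_cellPoint (c : ℕ × ℕ) (l : ℕ) :
    Measurable fun d : CellData => cellPoint d c l := by
  have h1 : Measurable fun d : CellData => (d c).2 l :=
    (measurable_pi_apply l).comp (measurable_snd.comp (measurable_pi_apply c))
  have h2 : Measurable unitInterval.toNNReal := unitInterval.toNNReal_continuous.measurable
  exact ((h2.comp (measurable_fst.comp h1)).const_add _).prodMk
    ((h2.comp (measurable_snd.comp h1)).const_add _)

theorem measurable_cellCount (c : ℕ × ℕ) {s : Set (ℝ≥0 × ℝ≥0)} (hs : MeasurableSet s) :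
    Measurable fun d : CellData =>
      ∑ l ∈ Finset.range (d c).1, Measure.dirac (cellPoint d c l) s := by
  have h3 : ∀ j : ℕ, Measurable fun d : CellData =>
      ∑ l ∈ Finset.range j, Measure.dirac (cellPoint d c l) s := by
    intro j
    refine Finset.measurable_sum _ fun l _ => ?_
    exact (Measure.measurable_coe hs).comp
      (Measure.measurable_dirac.comp (measurable_cellPoint c l))
  have h5 : Measurable fun d : CellData => (d c).1 :=
    measurable_fst.comp (measurable_pi_apply c)
  intro B hB
  have : (fun d : CellData =>
      ∑ l ∈ Finset.range (d c).1, Measure.dirac (cellPoint d c l) s) ⁻¹' B =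
      ⋃ j : ℕ, {d : CellData | (d c).1 = j} ∩ (fun d : CellData =>
        ∑ l ∈ Finset.range j, Measure.dirac (cellPoint d c l) s) ⁻¹' B := by
    ext d; simp
  rw [this]
  exact MeasurableSet.iUnion fun j => (h5 (measurableSet_singleton j)).inter (h3 j hB)

theorem measurable_config : Measurable config := by
  refine Measurable.subtype_mk (Measure.measurable_of_measurable_coe _ fun s hs => ?_)
  simp only [configMeasure, Measure.sum_apply _ hs, Measure.finsetSum_apply]
  exact Measurable.tsum fun c => measurable_cellCount c hs

/-- Law of the raw data: the cells are independent; the number of points of each cell is Poisson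
distributed with mean `r`, and the positions are independent and uniform on the cell. -/
def cellLaw (r : ℝ≥0) : Measure CellData :=
  Measure.infinitePi fun _ : ℕ × ℕ =>
    (poissonMeasure r).prod
      (Measure.infinitePi fun _ : ℕ => (volume : Measure (unitInterval × unitInterval)))

instance (r : ℝ≥0) : IsProbabilityMeasure (cellLaw r) := by
  unfold cellLaw; infer_instance

/-- The law, on the space of locally finite measures, of a Poisson random measure whose intensity
measure is `r` times Lebesgue measure on `[0,∞)²`. -/
def poissonLaw (r : ℝ≥0) : Measure PointSpace := (cellLaw r).map config

instance (r : ℝ≥0) : IsProbabilityMeasure (poissonLaw r) :=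
  Measure.isProbabilityMeasure_map measurable_config.aemeasurable

/-! ### The canonical space, its filtration, and admissible controls -/

section Canonical

variable (κ : Type*)

/-- Canonical sample space carrying one random measure for each index in `κ`. -/
abbrev Canon : Type _ := κ → PointSpace

/-- The probability measure under which the coordinates are independent Poisson random measures,
each of intensity `r` times Lebesgue measure. -/
def canonLaw [Fintype κ] (r : ℝ≥0) : Measure (Canon κ) := Measure.pi fun _ => poissonLaw r

instance [Fintype κ] (r : ℝ≥0) : IsProbabilityMeasure (canonLaw κ r) := by
  unfold canonLaw; infer_instance

/-- `𝒢_t = σ {N_k ((0,s] × A) : k ∈ κ, s ≤ t, A Borel}`. -/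
@[reducible]
def rawSigma (t : ℝ≥0) : MeasurableSpace (Canon κ) :=
  ⨆ (k : κ) (s : ℝ≥0) (_ : s ≤ t) (A : Set ℝ≥0) (_ : MeasurableSet A),
    MeasurableSpace.comap (fun ω : Canon κ => (ω k).1 (Ioc 0 s ×ˢ A)) inferInstance

theorem rawSigma_mono {s t : ℝ≥0} (h : s ≤ t) : rawSigma κ s ≤ rawSigma κ t := by
  refine iSup_mono fun k => iSup_mono fun a => ?_
  exact iSup_le fun ha => le_iSup_of_le (ha.trans h) le_rfl

theorem rawSigma_le (t : ℝ≥0) : rawSigma κ t ≤ (inferInstance : MeasurableSpace (Canon κ)) := by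
  refine iSup_le fun k => iSup_le fun a => iSup_le fun _ => iSup_le fun A => iSup_le fun hA => ?_
  refine Measurable.comap_le ?_
  exact (Measure.measurable_coe (measurableSet_Ioc.prod hA)).comp
    (measurable_subtype_coe.comp (measurable_pi_apply k))

/-- The completed σ-algebra of the canonical space. -/
@[reducible]
def fullSigma [Fintype κ] (r : ℝ≥0) : MeasurableSpace (Canon κ) :=
  eventuallyMeasurableSpace inferInstance (ae (canonLaw κ r))

/-- The filtration `(ℱ_t)`, where `ℱ_t` is the completion of `𝒢_t`: a set belongs to `ℱ_t` iff it
differs from a set of `𝒢_t` by a null set. -/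
def canonFiltration [Fintype κ] (r : ℝ≥0) : Filtration ℝ≥0 (fullSigma κ r) where
  seq t := @eventuallyMeasurableSpace _ (rawSigma κ t) (ae (canonLaw κ r)) _
  mono' := by
    rintro s t h A ⟨B, hB, hAB⟩
    exact ⟨B, rawSigma_mono κ h B hB, hAB⟩
  le' := by
    rintro t A ⟨B, hB, hAB⟩
    exact ⟨B, rawSigma_le κ t B hB, hAB⟩

/-- Admissible controls: predictable processes with values in `[0,∞)^κ` each of whose components is
uniformly bounded from below and from above by strictly positive constants. -/
def Admissible [Fintype κ] (r : ℝ≥0) : Set (ℝ≥0 × Canon κ → κ → ℝ≥0) :=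
  {u | Measurable[(canonFiltration κ r).predictable] u ∧
    ∀ k, ∃ a b : ℝ≥0, 0 < a ∧ ∀ p, a ≤ u p k ∧ u p k ≤ b}

end Canonical

/-! ### The model: rates, states, costs -/

section Model

variable {X : Type*} [Fintype X] [DecidableEq X]

/-- The rates `γ` are those of an ergodic (irreducible) Markov jump process on the finite set `X`:
any state can be reached from any other one by transitions of positive rate. -/
def Ergodic (γ : X → X → ℝ≥0) : Prop :=
  ∀ x y, Relation.ReflTransGen (fun a b => 0 < γ a b) x y

/-- The set `𝒵` of allowed transitions. -/
def Edge (γ : X → X → ℝ≥0) : Type _ := {z : X × X // 0 < γ z.1 z.2}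

instance (γ : X → X → ℝ≥0) : Fintype (Edge γ) :=
  @Fintype.ofFinite _ (inferInstanceAs (Finite {z : X × X // 0 < γ z.1 z.2}))

variable {γ : X → X → ℝ≥0}

namespace Edge

/-- Initial state of a transition. -/
def src (z : Edge γ) : X := z.1.1

/-- Final state of a transition. -/
def tgt (z : Edge γ) : X := z.1.2

/-- Nominal rate of a transition. -/
def rate (z : Edge γ) : ℝ≥0 := γ z.src z.tgt

end Edge

/-- The unit vector `e_x`, which represents the state `x` in `ℝ^X`. -/
def unitVec (x : X) : X → ℝ := Pi.single x 1

/-- The jump direction `v_{xy} = e_y - e_x`. -/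
def jumpVec (z : Edge γ) : X → ℝ := unitVec z.tgt - unitVec z.src

/-- The empirical measure `L(x) = (1/n) ∑ δ_{x_i}`. -/
def empirical {n : ℕ} (x : Fin n → X) : X → ℝ := (1 / n : ℝ) • ∑ i, unitVec (x i)

variable (X) in
/-- `𝒫ⁿ(X) = 𝒫(X) ∩ (1/n) ℤ^X`. -/
def gridSimplex (n : ℕ) : Set (X → ℝ) :=
  {m | m ∈ stdSimplex ℝ X ∧ ∀ x, ∃ k : ℤ, m x = (k : ℝ) / n}

/-- Right derivative at `u` of a (finite near `u`) cost function; for a convex function it exists at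
every interior point of the domain, and it is the derivative wherever the latter exists. -/
def rightDeriv (c : ℝ≥0 → ℝ≥0∞) (u : ℝ) : ℝ :=
  derivWithin (fun v : ℝ => (c v.toNNReal).toReal) (Ioi u) u

/-- The largest open interval on which `c` is finite. -/
def finiteInterval (c : ℝ≥0 → ℝ≥0∞) : Set ℝ :=
  interior {u : ℝ | 0 ≤ u ∧ c u.toNNReal ≠ ∞}

/-- The standing assumption on the costs and the reward: `R` is continuous on the simplex, and every
`C_{xy} : [0,∞) → [0,∞]` is convex, `u C_{xy}'(u) - u` is increasing (in the weak sense) on the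
maximal open interval where `C_{xy}` is finite, and `C_{xy}(1) = 0`. -/
structure CostAssumption (C : Edge γ → ℝ≥0 → ℝ≥0∞) (R : (X → ℝ) → ℝ≥0) : Prop where
  continuousOn_reward : ContinuousOn R (stdSimplex ℝ X)
  convex (z : Edge γ) : ConvexOn ℝ≥0 univ (C z)
  monotoneOn (z : Edge γ) :
    MonotoneOn (fun u : ℝ => u * rightDeriv (C z) u - u) (finiteInterval (C z))
  at_one (z : Edge γ) : C z 1 = 0

/-- `ℓ(q) = q log q - q + 1`. -/
def ell (q : ℝ) : ℝ := q * Real.log q - q + 1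

/-- The rate-weighted cost `γ_{xy} C_{xy}(u / γ_{xy})`. -/
def rateCost (C : Edge γ → ℝ≥0 → ℝ≥0∞) (z : Edge γ) (u : ℝ≥0) : ℝ≥0∞ :=
  (z.rate : ℝ≥0∞) * C z (u / z.rate)

/-- `G_{xy}(u,q) = u ℓ(q/u) - γ_{xy} C_{xy}(u / γ_{xy})`, with values in `[-∞,∞)`. -/
def costG (C : Edge γ → ℝ≥0 → ℝ≥0∞) (z : Edge γ) (u q : ℝ≥0) : EReal :=
  (((u : ℝ) * ell ((q : ℝ) / u) : ℝ) : EReal) - (rateCost C z u : EReal)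

/-- `F_{xy}(q) = sup_{u > 0} G_{xy}(u,q)`. -/
def costF (C : Edge γ → ℝ≥0 → ℝ≥0∞) (z : Edge γ) (q : ℝ≥0) : EReal :=
  ⨆ (u : ℝ≥0) (_ : 0 < u), costG C z u q

/-! ### Controlled dynamics -/

/-- Right-continuous paths with left limits. -/
def IsCadlag {E : Type*} [TopologicalSpace E] (f : ℝ≥0 → E) : Prop :=
  ∀ t, ContinuousWithinAt f (Ici t) t ∧ ∃ l, Tendsto f (𝓝[<] t) (𝓝 l)

/-- `∫_{(0,t]} ∫_{[0,∞)} 1_{[0, a(s)]}(r) N(ds dr)`. -/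
def thinnedCount (N : Measure (ℝ≥0 × ℝ≥0)) (a : ℝ≥0 → ℝ) (t : ℝ≥0) : ℝ :=
  ∫ p in Ioc 0 t ×ˢ univ, {p : ℝ≥0 × ℝ≥0 | (p.2 : ℝ) ≤ a p.1}.indicator 1 p ∂N

/-- The right-hand side of the stochastic equation, with noise scaled by `ε`:
`m + ∑_{(x,y) ∈ 𝒵} v_{xy} ∫_{(0,t]} ∫_{[0,∞)} 1_{[0, μ_x(s-) u_{xy}(s)]}(r) ε N_{xy}(ds dr)`. -/
def dynamicsMap (ε : ℝ) (m : X → ℝ) (μ : ℝ≥0 → X → ℝ) (u : ℝ≥0 → Edge γ → ℝ≥0)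
    (N : Edge γ → PointSpace) (t : ℝ≥0) : X → ℝ :=
  m + ∑ z, (ε * thinnedCount (N z).1
    (fun s => Function.leftLim μ s z.src * (u s z : ℝ)) t) • jumpVec z

/-- First hitting time of `K` by the path `f`, with `inf ∅ = ∞`. -/
def hittingTime {E : Type*} (f : ℝ≥0 → E) (K : Set E) : ℝ≥0∞ :=
  ⨅ (t : ℝ≥0) (_ : f t ∈ K), (t : ℝ≥0∞)

/-- `∫_0^T f(t) dt` for `T ∈ [0,∞]`. -/
def integralUpTo (T : ℝ≥0∞) (f : ℝ≥0 → ℝ≥0∞) : ℝ≥0∞ :=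
  ∫⁻ t in {t : ℝ | 0 ≤ t ∧ ENNReal.ofReal t < T}, f t.toNNReal

/-! ### The mean-field problems -/

/-- `μ` is the controlled empirical measure process with control `u` and initial condition `m`,
driven by one Poisson random measure of intensity `n` for each transition, scaled by `1/n`. -/
def IsMeanFieldProcess (n : ℕ) (m : X → ℝ) (u : ℝ≥0 × Canon (Edge γ) → Edge γ → ℝ≥0)
    (μ : ℝ≥0 → Canon (Edge γ) → X → ℝ) : Prop :=
  ∀ᵐ ω ∂(canonLaw (Edge γ) n),
    IsCadlag (fun t => μ t ω) ∧ (∀ t, μ t ω ∈ gridSimplex X n) ∧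
    ∀ t, μ t ω = dynamicsMap (1 / n) m (fun s => μ s ω) (fun s => u (s, ω)) ω t

/-- Risk-sensitive mean-field cost `I_K^n(m,u)`.  (The controlled process is almost surely unique, so
that the infimum over `μ` only inserts this process.  The two integrals can both be infinite with
positive probability only if `K` is empty; `∞ - ∞` is then read as `-∞`, which leaves the value
function unchanged.) -/
def meanI (C : Edge γ → ℝ≥0 → ℝ≥0∞) (R : (X → ℝ) → ℝ≥0) (n : ℕ) (K : Set (X → ℝ)) (m : X → ℝ)
    (u : ℝ≥0 × Canon (Edge γ) → Edge γ → ℝ≥0) : ℝ≥0∞ :=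
  ⨅ (μ : ℝ≥0 → Canon (Edge γ) → X → ℝ) (_ : IsMeanFieldProcess n m u μ),
    ∫⁻ ω, EReal.exp ((n : EReal) *
      ((integralUpTo (hittingTime (fun t => μ t ω) K) fun t =>
          ∑ z, ENNReal.ofReal (μ t ω z.src) * rateCost C z (u (t, ω) z) : ℝ≥0∞) -
        (integralUpTo (hittingTime (fun t => μ t ω) K) fun t => R (μ t ω) : ℝ≥0∞) : EReal))
      ∂(canonLaw (Edge γ) n)

/-- Risk-sensitive mean-field value function `W_K^n`. -/
def meanW (C : Edge γ → ℝ≥0 → ℝ≥0∞) (R : (X → ℝ) → ℝ≥0) (n : ℕ) (K : Set (X → ℝ))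
    (m : X → ℝ) : ℝ≥0∞ :=
  ⨅ u ∈ Admissible (Edge γ) n, meanI C R n K m u

/-- Ordinary mean-field cost `J_K^n(m,q)`.  (`F ≥ 0` when `C(1) = 0`, so `toENNReal` only changes
the type.) -/
def meanJ (C : Edge γ → ℝ≥0 → ℝ≥0∞) (R : (X → ℝ) → ℝ≥0) (n : ℕ) (K : Set (X → ℝ)) (m : X → ℝ)
    (q : ℝ≥0 × Canon (Edge γ) → Edge γ → ℝ≥0) : ℝ≥0∞ :=
  ⨅ (μ : ℝ≥0 → Canon (Edge γ) → X → ℝ) (_ : IsMeanFieldProcess n m q μ),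
    ∫⁻ ω, integralUpTo (hittingTime (fun t => μ t ω) K) (fun t =>
      (∑ z, ENNReal.ofReal (μ t ω z.src) * (costF C z (q (t, ω) z)).toENNReal) + R (μ t ω))
      ∂(canonLaw (Edge γ) n)

/-- Ordinary mean-field value function `V_K^n`. -/
def meanV (C : Edge γ → ℝ≥0 → ℝ≥0∞) (R : (X → ℝ) → ℝ≥0) (n : ℕ) (K : Set (X → ℝ))
    (m : X → ℝ) : ℝ≥0∞ :=
  ⨅ q ∈ Admissible (Edge γ) n, meanJ C R n K m q

/-! ### The many-agent problems -/

/-- `χ` is the controlled process of the `n` agents with control `u` and initial condition `x`,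
driven by one Poisson random measure of intensity `1` for each agent and each transition. -/
def IsAgentProcess {n : ℕ} (x : Fin n → X)
    (u : ℝ≥0 × Canon (Fin n × Edge γ) → Fin n × Edge γ → ℝ≥0)
    (χ : ℝ≥0 → Canon (Fin n × Edge γ) → Fin n → X) : Prop :=
  ∀ᵐ ω ∂(canonLaw (Fin n × Edge γ) 1), ∀ i,
    IsCadlag (fun t => unitVec (χ t ω i)) ∧
    ∀ t, unitVec (χ t ω i) = dynamicsMap 1 (unitVec (x i)) (fun s => unitVec (χ s ω i))
      (fun s z => u (s, ω) (i, z)) (fun z => ω (i, z)) t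

/-- `∑_i ∑_{y : (x_i,y) ∈ 𝒵} f(i, (x_i,y))`. -/
def agentSum {n : ℕ} (x : Fin n → X) (f : Fin n → Edge γ → ℝ≥0∞) : ℝ≥0∞ :=
  ∑ i, ∑ z, if z.src = x i then f i z else 0

/-- Risk-sensitive many-agent cost `ℐ_𝒦^n(x,u)`; again the infimum over `χ` only inserts the
almost surely unique controlled process. -/
def agentI (C : Edge γ → ℝ≥0 → ℝ≥0∞) (R : (X → ℝ) → ℝ≥0) {n : ℕ} (K : Set (Fin n → X))
    (x : Fin n → X) (u : ℝ≥0 × Canon (Fin n × Edge γ) → Fin n × Edge γ → ℝ≥0) : ℝ≥0∞ :=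
  ⨅ (χ : ℝ≥0 → Canon (Fin n × Edge γ) → Fin n → X) (_ : IsAgentProcess x u χ),
    ∫⁻ ω, EReal.exp
      ((integralUpTo (hittingTime (fun t => χ t ω) K) fun t =>
          agentSum (χ t ω) fun i z => rateCost C z (u (t, ω) (i, z)) : ℝ≥0∞) -
        (integralUpTo (hittingTime (fun t => χ t ω) K) fun t =>
          n * R (empirical (χ t ω)) : ℝ≥0∞) : EReal)
      ∂(canonLaw (Fin n × Edge γ) 1)

/-- Risk-sensitive many-agent value function `𝒲_𝒦^n`. -/
def agentW (C : Edge γ → ℝ≥0 → ℝ≥0∞) (R : (X → ℝ) → ℝ≥0) {n : ℕ} (K : Set (Fin n → X))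
    (x : Fin n → X) : ℝ≥0∞ :=
  ⨅ u ∈ Admissible (Fin n × Edge γ) 1, agentI C R K x u

/-- Ordinary many-agent cost `𝒥_𝒦^n(x,q)`. -/
def agentJ (C : Edge γ → ℝ≥0 → ℝ≥0∞) (R : (X → ℝ) → ℝ≥0) {n : ℕ} (K : Set (Fin n → X))
    (x : Fin n → X) (q : ℝ≥0 × Canon (Fin n × Edge γ) → Fin n × Edge γ → ℝ≥0) : ℝ≥0∞ :=
  ⨅ (χ : ℝ≥0 → Canon (Fin n × Edge γ) → Fin n → X) (_ : IsAgentProcess x q χ),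
    ∫⁻ ω, integralUpTo (hittingTime (fun t => χ t ω) K) (fun t =>
      (n : ℝ≥0∞)⁻¹ * agentSum (χ t ω) (fun i z => (costF C z (q (t, ω) (i, z))).toENNReal) +
        R (empirical (χ t ω)))
      ∂(canonLaw (Fin n × Edge γ) 1)

/-- Ordinary many-agent value function `𝒱_𝒦^n`. -/
def agentV (C : Edge γ → ℝ≥0 → ℝ≥0∞) (R : (X → ℝ) → ℝ≥0) {n : ℕ} (K : Set (Fin n → X))
    (x : Fin n → X) : ℝ≥0∞ :=
  ⨅ q ∈ Admissible (Fin n × Edge γ) 1, agentJ C R K x q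

/-- `-(1/n) log w` for `w ∈ [0,∞]`, with `-log 0 = ∞` and `-log ∞ = -∞`. -/
def negLogScaled (n : ℕ) (w : ℝ≥0∞) : EReal :=
  -(((1 / n : ℝ) : EReal) * ENNReal.log w)

end Model

end ExitControl

end

open ExitControl

/-!
The four value functions are all read off from one finite system of equations, the dynamic
programming equation `∑_k q_k(y) H_k (ψ (next y k) - ψ y) + ρ y = 0` for `y ∉ K`, with `ψ = 0` on
`K`. Here the `q_k` are the nominal jump intensities and `H_k` is the Hamiltonian of a transition,
which is at the same time the minimum over `q` of `F q + q p` and minus the infimum over `u` of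
`c u + u (exp (-p) - 1)` (`IsDualCost`). Thus `ψ` solves the Bellman equation of the ordinary
problem if and only if `exp (-ψ)` solves the one of the risk-sensitive problem.

The duality rests on the standing assumption: monotonicity of `u C' u - u` says that
`v ↦ exp v - C (exp v)` is concave (`IsCost.concaveOn_logGain`). With `q = exp (v - p)`, where `v`
maximises `exp v - C (exp v) - exp (v - p)`, a supergradient of the concave function at `v` shows
that the supremum which defines `F q` is approached at `exp v`, so that sup and inf may be exchanged
(`IsCost.exists_dual`, `isDualCost`). The maximiser need not exist inside the domain, because `C`
may jump to `∞` at an end point; this is why optimal controls of the risk-sensitive problem are only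
approximate.

For a nonempty target set the equation is solved by Perron's method (`exists_isValue`).
Irreducibility provides a Lyapunov function which grows along every controlled process whose
controls stay between positive bounds (`exists_lyapunov`). Hence the target is reached almost
surely, with exponential tails, and the solution is identified with both value functions by
verification arguments (`ControlledPath.le_lintegral_pathCost`,
`ControlledPath.lintegral_pathCost_le`, `ControlledPath.le_lintegral_exp_riskCost`,
`exists_feedback_riskCost_le`). In the risk-sensitive problem no integrability is available for
lower bounds; there the Lyapunov function is used to show that the weight of the paths which have
not reached the target cannot be lost. If the target is empty, the role of `ψ` is played by the
constant `0` or `∞`.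

The verification arguments need Dynkin's formula with an exponential weight (`dynkin`). It is
derived from the compensation formula for the Poisson random measures
(`Hist.lintegral_compensation`), which in turn comes from Mecke's formula for the number of points
in a cell (`lintegral_cell_mecke`). Every controlled process has an admissible control which agrees,
outside a null set, with a control that is predictable for the uncompleted filtration
(`Hist.exists_raw_version`), and its left limits form a predictable pure jump path
(`JumpModel.Solves.exists_jumpPath`, `exists_jumpPath`), to which the formula applies.

Both control problems are instances of a `JumpModel`. Summing over the agents in a given state shows
that a solution of the mean-field equation, composed with the empirical measure, solves the equation
of the agents if the target is invariant under permutations (`IsExtendedValue.comp_empirical`); this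
gives the equality of the two pairs of value functions.
-/

open MeasureTheory ProbabilityTheory Filter Topology Set
open scoped NNReal ENNReal

noncomputable section

namespace ExitControl

/-! ### Resampling coordinates of product measures -/

theorem measurable_update_pair {ι : Type*} [DecidableEq ι] {X : ι → Type*}
    [∀ i, MeasurableSpace (X i)] (i : ι) :
    Measurable fun p : (∀ i, X i) × X i => Function.update p.1 i p.2 := by
  refine measurable_pi_lambda _ fun j => ?_
  by_cases h : j = i
  · subst h; simpa using measurable_snd
  · simp only [Function.update_of_ne h]; fun_prop

theorem infinitePi_map_update {ι : Type*} [DecidableEq ι] {X : ι → Type*}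
    [∀ i, MeasurableSpace (X i)] (μ : ∀ i, Measure (X i)) [∀ i, IsProbabilityMeasure (μ i)]
      (i : ι) :
    ((Measure.infinitePi μ).prod (μ i)).map (fun p => Function.update p.1 i p.2) =
      Measure.infinitePi μ := by
  have hm := measurable_update_pair (X := X) i
  refine Measure.eq_infinitePi _ fun s t ht => ?_
  rw [Measure.map_apply hm (MeasurableSet.pi s.countable_toSet fun j _ => ht j)]
  by_cases hi : i ∈ s
  · have : (fun p : (∀ i, X i) × X i => Function.update p.1 i p.2) ⁻¹' (Set.pi s t) =
        Set.pi (s.erase i : Finset ι) t ×ˢ t i := by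
      ext p
      simp only [mem_preimage, Set.mem_pi, mem_prod, Finset.mem_coe, Finset.mem_erase]
      constructor
      · intro h
        refine ⟨fun j hj => ?_, ?_⟩
        · simpa [hj.1] using h j hj.2
        · simpa using h i hi
      · rintro ⟨h1, h2⟩ j hj
        by_cases hji : j = i
        · subst hji; simpa using h2
        · simpa [hji] using h1 j ⟨hji, hj⟩
    rw [this, Measure.prod_prod, Measure.infinitePi_pi _ fun j _ => ht j, mul_comm,
      Finset.mul_prod_erase s (fun j => μ j (t j)) hi]
  · have : (fun p : (∀ i, X i) × X i => Function.update p.1 i p.2) ⁻¹' (Set.pi s t) =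
        Set.pi s t ×ˢ univ := by
      ext p
      simp only [mem_preimage, Set.mem_pi, mem_prod, Finset.mem_coe, mem_univ, and_true]
      refine forall_congr' fun j => forall_congr' fun hj => ?_
      have : j ≠ i := fun h => hi (h ▸ hj)
      simp [this]
    rw [this, Measure.prod_prod, Measure.infinitePi_pi _ fun j _ => ht j, measure_univ, mul_one]

theorem lintegral_infinitePi_update {ι : Type*} [DecidableEq ι] {X : ι → Type*}
    [∀ i, MeasurableSpace (X i)] (μ : ∀ i, Measure (X i)) [∀ i, IsProbabilityMeasure (μ i)] (i : ι)
    {f : (∀ i, X i) → ℝ≥0∞} (hf : Measurable f) :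
    ∫⁻ D, f D ∂Measure.infinitePi μ =
      ∫⁻ D, ∫⁻ y, f (Function.update D i y) ∂μ i ∂Measure.infinitePi μ := by
  conv_lhs => rw [← infinitePi_map_update μ i]
  rw [lintegral_map hf (measurable_update_pair i), lintegral_prod]
  exact (hf.comp (measurable_update_pair i)).aemeasurable

/-- If the law of one coordinate is invariant under a randomised modification `T`, so is the
product measure under the same modification of that coordinate. -/
theorem lintegral_infinitePi_modify {ι : Type*} [DecidableEq ι] {X : ι → Type*}
    [∀ i, MeasurableSpace (X i)] (μ : ∀ i, Measure (X i)) [∀ i, IsProbabilityMeasure (μ i)] (i : ι)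
    {Q : Type*} [MeasurableSpace Q] (ν : Measure Q) [SFinite ν] {T : X i → Q → X i}
    (hT : Measurable fun p : X i × Q => T p.1 p.2)
    (hμ : ∀ g : X i → ℝ≥0∞, Measurable g → ∫⁻ y, g y ∂μ i = ∫⁻ y, ∫⁻ q, g (T y q) ∂ν ∂μ i)
    {f : (∀ i, X i) → ℝ≥0∞} (hf : Measurable f) :
    ∫⁻ D, f D ∂Measure.infinitePi μ =
      ∫⁻ D, ∫⁻ q, f (Function.update D i (T (D i) q)) ∂ν ∂Measure.infinitePi μ := by
  have hm : Measurable fun p : (∀ i, X i) × Q => Function.update p.1 i (T (p.1 i) p.2) :=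
    (measurable_update_pair i).comp (measurable_fst.prodMk
      (hT.comp (((measurable_pi_apply i).comp measurable_fst).prodMk measurable_snd)))
  rw [lintegral_infinitePi_update μ i hf, lintegral_infinitePi_update μ i
    (f := fun D => ∫⁻ q, f (Function.update D i (T (D i) q)) ∂ν)
    (Measurable.lintegral_prod_right (hf.comp hm))]
  refine lintegral_congr fun D => ?_
  rw [hμ (fun y => f (Function.update D i y)) (hf.comp (measurable_update D))]
  simp

/-! ### The time measure -/

/-- Lebesgue measure on `[0,∞)`. -/
def lam : Measure ℝ≥0 := Measure.comap ((↑) : ℝ≥0 → ℝ) volume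

theorem measurableEmbedding_nnreal_coe : MeasurableEmbedding ((↑) : ℝ≥0 → ℝ) :=
  MeasurableEmbedding.subtype_coe measurableSet_Ici

theorem lam_map_coe : lam.map ((↑) : ℝ≥0 → ℝ) = volume.restrict (Ici 0) := by
  rw [lam, measurableEmbedding_nnreal_coe.map_comap]
  congr 1
  ext x
  simp

theorem lintegral_lam (f : ℝ → ℝ≥0∞) : ∫⁻ s, f s ∂lam = ∫⁻ t in Ici (0 : ℝ), f t := by
  rw [← lam_map_coe, measurableEmbedding_nnreal_coe.lintegral_map]

theorem lam_apply (A : Set ℝ≥0) : lam A = volume ((↑) '' A : Set ℝ) := by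
  rw [lam, measurableEmbedding_nnreal_coe.comap_apply]

theorem lam_Iio (t : ℝ≥0) : lam (Iio t) = t := by
  rw [lam_apply]
  have : ((↑) '' Iio t : Set ℝ) = Ico 0 (t : ℝ) := by
    ext x
    simp only [mem_image, mem_Iio, mem_Ico]
    constructor
    · rintro ⟨y, hy, rfl⟩; exact ⟨y.2, by exact_mod_cast hy⟩
    · rintro ⟨h0, h1⟩; exact ⟨⟨x, h0⟩, by exact_mod_cast h1, rfl⟩
  rw [this, Real.volume_Ico, sub_zero, ENNReal.ofReal_coe_nnreal]

instance : NullSingletonClass lam := ⟨fun x => by rw [lam_apply]; simp⟩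

instance : SigmaFinite lam := by
  refine ⟨⟨⟨fun n : ℕ => Iio (n : ℝ≥0), fun _ => trivial, fun n => ?_, ?_⟩⟩⟩
  · rw [lam_Iio]; exact ENNReal.coe_lt_top
  · exact eq_univ_of_forall fun x => mem_iUnion.2 (exists_nat_gt x)

/-- The uniform law on the unit interval, moved to `[i,i+1]`, is Lebesgue measure there; together
these pieces make up Lebesgue measure. -/
theorem sum_map_unitInterval : (Measure.sum fun i : ℕ =>
    (volume : Measure unitInterval).map (fun x => (i : ℝ≥0) + unitInterval.toNNReal x)) = lam := by
  have hmap : ∀ i : ℕ, Measurable fun x : unitInterval => (i : ℝ≥0) + unitInterval.toNNReal x :=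
    fun i => unitInterval.toNNReal_continuous.measurable.const_add _
  ext A hA
  rw [Measure.sum_apply _ hA]
  have hI : ∀ i : ℕ, (volume : Measure unitInterval).map
      (fun x => (i : ℝ≥0) + unitInterval.toNNReal x) A =
      volume ((↑) '' A ∩ Ico (i : ℝ) (i + 1)) := by
    intro i
    rw [Measure.map_apply (hmap i) hA]
    have h1 : (volume : Measure unitInterval)
        ((fun x => (i : ℝ≥0) + unitInterval.toNNReal x) ⁻¹' A) =
        volume ((↑) '' ((fun x : unitInterval => (i : ℝ≥0) + unitInterval.toNNReal x) ⁻¹' A) :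
          Set ℝ) := by
      change (Measure.comap _ volume) _ = _
      rw [(MeasurableEmbedding.subtype_coe measurableSet_Icc).comap_apply]
    have h2 : ((↑) '' ((fun x : unitInterval => (i : ℝ≥0) + unitInterval.toNNReal x) ⁻¹' A) :
        Set ℝ) = (fun x => (i : ℝ) + x) ⁻¹' ((↑) '' A ∩ Icc (i : ℝ) (i + 1)) := by
      ext x
      simp only [mem_image, mem_preimage, mem_inter_iff, mem_Icc, Subtype.exists]
      constructor
      · rintro ⟨y, hy, h, rfl⟩
        exact ⟨⟨_, h, rfl⟩, by linarith [hy.1], by linarith [hy.2]⟩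
      · rintro ⟨⟨y, h, hyx⟩, h3, h4⟩
        refine ⟨x, ⟨by linarith, by linarith⟩, ?_, rfl⟩
        convert! h using 1
        ext
        exact hyx.symm
    rw [h1, h2, measure_preimage_add]
    refine measure_congr ?_
    exact (ae_eq_refl _).inter Ico_ae_eq_Icc.symm
  simp_rw [hI]
  rw [lam_apply, ← measure_iUnion]
  · congr 1
    ext x
    simp only [mem_iUnion, mem_inter_iff, exists_and_left, and_iff_left_iff_imp]
    rintro ⟨y, -, rfl⟩
    exact ⟨⌊y⌋₊, by exact_mod_cast Nat.floor_le (zero_le : 0 ≤ y),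
      by exact_mod_cast Nat.lt_floor_add_one y⟩
  · intro i j hij
    refine Disjoint.mono inter_subset_right inter_subset_right ?_
    rw [Set.disjoint_left]
    rintro x ⟨h1, h2⟩ ⟨h3, h4⟩
    apply hij
    have : (i : ℝ) < j + 1 := by linarith
    have : (j : ℝ) < i + 1 := by linarith
    norm_cast at *
    omega
  · intro i
    exact (measurableEmbedding_nnreal_coe.measurableSet_image.2 hA).inter measurableSet_Ico

/-! ### Removing a point from a Poisson configuration -/

theorem poissonMeasure_succ (r : ℝ≥0) (m : ℕ) :
    poissonMeasure r {m + 1} * (m + 1 : ℕ) = r * poissonMeasure r {m} := by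
  rw [poissonMeasure_singleton, poissonMeasure_singleton,
    ← ENNReal.ofReal_natCast, ← ENNReal.ofReal_coe_nnreal,
    ← ENNReal.ofReal_mul (by positivity), ← ENNReal.ofReal_mul (by positivity)]
  congr 1
  have : ((m + 1).factorial : ℝ) = (m + 1) * m.factorial := by
    rw [Nat.factorial_succ]; push_cast; ring
  rw [this]
  push_cast
  have : (m.factorial : ℝ) ≠ 0 := by positivity
  field_simp
  ring

/-- Mecke's formula for the raw data of one cell.  The weight `G` may only depend on the actual
points, and it does not see the points at which `φ` is nonzero. -/
theorem lintegral_cell_mecke {Q : Type*} [MeasurableSpace Q] (ν : Measure Q)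
    [IsProbabilityMeasure ν] (r : ℝ≥0) {φ : Q → ℝ≥0∞} (hφ : Measurable φ)
    {G : ℕ → (ℕ → Q) → ℝ≥0∞} (hG : ∀ m, Measurable (G m))
    (hdep : ∀ m U x, G m (Function.update U m x) = G m U)
    (hdrop : ∀ m U l, l ≤ m → φ (U l) ≠ 0 → G (m + 1) U = G m (U ∘ Equiv.swap l m)) :
    ∫⁻ y, (∑ l ∈ Finset.range y.1, φ (y.2 l)) * G y.1 y.2
        ∂((poissonMeasure r).prod (Measure.infinitePi fun _ : ℕ => ν)) =
      r * (∫⁻ q, φ q ∂ν) *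
        ∫⁻ y, G y.1 y.2 ∂((poissonMeasure r).prod (Measure.infinitePi fun _ : ℕ => ν)) := by
  have hGm : Measurable fun y : ℕ × (ℕ → Q) => G y.1 y.2 :=
    measurable_from_prod_countable_right hG
  have hφl : ∀ l, Measurable fun U : ℕ → Q => φ (U l) := fun l =>
    hφ.comp (measurable_pi_apply l)
  have hS : Measurable fun y : ℕ × (ℕ → Q) => ∑ l ∈ Finset.range y.1, φ (y.2 l) := by
    refine measurable_from_prod_countable_right fun m => ?_
    exact Finset.measurable_fun_sum (Finset.range m) fun l _ => hφl l
  have hSG : Measurable fun y : ℕ × (ℕ → Q) =>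
      (∑ l ∈ Finset.range y.1, φ (y.2 l)) * G y.1 y.2 := hS.mul hGm
  rw [lintegral_prod _ hSG.aemeasurable, lintegral_prod _ hGm.aemeasurable,
    lintegral_countable' (μ := poissonMeasure r), lintegral_countable' (μ := poissonMeasure r)]
  have key : ∀ m, ∫⁻ U, (∑ l ∈ Finset.range (m + 1), φ (U l)) * G (m + 1) U
      ∂(Measure.infinitePi fun _ : ℕ => ν) =
      (m + 1 : ℕ) * ((∫⁻ q, φ q ∂ν) * ∫⁻ U, G m U ∂(Measure.infinitePi fun _ : ℕ => ν)) := by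
    intro m
    simp_rw [Finset.sum_mul]
    have hm' : ∀ l ∈ Finset.range (m + 1),
        Measurable fun U : ℕ → Q => φ (U l) * G (m + 1) U := fun l _ => (hφl l).mul (hG (m + 1))
    rw [lintegral_finsetSum _ hm']
    have : ∀ l ∈ Finset.range (m + 1), ∫⁻ U, φ (U l) * G (m + 1) U
        ∂(Measure.infinitePi fun _ : ℕ => ν) =
        (∫⁻ q, φ q ∂ν) * ∫⁻ U, G m U ∂(Measure.infinitePi fun _ : ℕ => ν) := by
      intro l hl
      have hl' : l ≤ m := Nat.lt_succ_iff.1 (Finset.mem_range.1 hl)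
      have h1 : ∀ U : ℕ → Q, φ (U l) * G (m + 1) U =
          (fun V : ℕ → Q => φ (V m) * G m V) (U ∘ Equiv.swap l m) := by
        intro U
        by_cases h : φ (U l) = 0
        · simp [h]
        · simp [hdrop m U l hl' h]
      have hmp : MeasurePreserving (fun U : ℕ → Q => U ∘ Equiv.swap l m)
          (Measure.infinitePi fun _ : ℕ => ν) (Measure.infinitePi fun _ : ℕ => ν) := by
        refine ⟨by fun_prop, ?_⟩
        convert! Measure.infinitePi_map_piCongrLeft (fun _ : ℕ => ν) (Equiv.swap l m) using 2
        ext U j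
        obtain ⟨i, rfl⟩ := (Equiv.swap l m).surjective j
        rw [MeasurableEquiv.coe_piCongrLeft, Equiv.piCongrLeft_apply_apply]
        simp
      simp_rw [h1]
      have hm : Measurable fun V : ℕ → Q => φ (V m) * G m V :=
        (hφ.comp (measurable_pi_apply m)).mul (hG m)
      rw [hmp.lintegral_comp hm, lintegral_infinitePi_update _ m hm]
      simp only [Function.update_self, hdep]
      simp_rw [lintegral_mul_const _ hφ]
      rw [lintegral_const_mul _ (hG m)]
    rw [Finset.sum_congr rfl this, Finset.sum_const, Finset.card_range, nsmul_eq_mul]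
  rw [tsum_eq_zero_add' ENNReal.summable]
  simp only [Finset.range_zero, Finset.sum_empty, zero_mul, lintegral_zero, zero_add, key]
  rw [← ENNReal.tsum_mul_left]
  refine tsum_congr fun m => ?_
  rw [mul_right_comm, mul_comm ((m + 1 : ℕ) : ℝ≥0∞), poissonMeasure_succ]
  ring

/-! ### Independence of the past and the future noise -/

/-- An event of `rawSigma κ s` only depends on the restrictions of the measures to `(0,s]`. -/
theorem mem_iff_of_rawSigma {κ : Type*} {s : ℝ≥0} {B : Set (Canon κ)}
    (hB : MeasurableSet[rawSigma κ s] B) {ω ω' : Canon κ}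
    (h : ∀ k, ∀ a ≤ s, ∀ A, MeasurableSet A → (ω k).1 (Ioc 0 a ×ˢ A) = (ω' k).1 (Ioc 0 a ×ˢ A)) :
    ω ∈ B ↔ ω' ∈ B := by
  let m : MeasurableSpace (Canon κ) :=
    { MeasurableSet' := fun B => ω ∈ B ↔ ω' ∈ B
      measurableSet_empty := by simp
      measurableSet_compl := fun B hB => by simp [hB]
      measurableSet_iUnion := fun f hf => by simp [hf] }
  have : rawSigma κ s ≤ m := by
    refine iSup_le fun k => iSup_le fun a => iSup_le fun ha => iSup_le fun A => iSup_le fun hA => ?_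
    rintro _ ⟨D, -, rfl⟩
    change (ω k).1 _ ∈ D ↔ (ω' k).1 _ ∈ D
    rw [h k a ha A hA]
  exact this B hB

/-- The configurations given by the raw data of all indices. -/
def configs {κ : Type*} (D : κ → CellData) : Canon κ := fun k => config (D k)

theorem measurable_configs {κ : Type*} : Measurable (configs (κ := κ)) :=
  measurable_pi_lambda _ fun k => measurable_config.comp (measurable_pi_apply k)

/-- Law of the raw data of all indices. -/
def dataLaw (κ : Type*) (r : ℝ≥0) : Measure (κ → CellData) := Measure.infinitePi fun _ => cellLaw r

theorem dataLaw_map_configs (κ : Type*) [Fintype κ] (r : ℝ≥0) :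
    (dataLaw κ r).map configs = canonLaw κ r := by
  unfold dataLaw canonLaw poissonLaw
  rw [Measure.infinitePi_eq_pi]
  exact Measure.pi_map_pi fun _ => measurable_config.aemeasurable

/-- Position of a point of the cell `c` with relative coordinates `q`. -/
def cellPos (c : ℕ × ℕ) (q : unitInterval × unitInterval) : ℝ≥0 × ℝ≥0 :=
  ((c.1 : ℝ≥0) + unitInterval.toNNReal q.1, (c.2 : ℝ≥0) + unitInterval.toNNReal q.2)

theorem measurable_cellPos (c : ℕ × ℕ) : Measurable (cellPos c) := by
  have := unitInterval.toNNReal_continuous.measurable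
  unfold cellPos
  fun_prop

theorem cellPoint_eq (d : CellData) (c : ℕ × ℕ) (l : ℕ) :
    cellPoint d c l = cellPos c ((d c).2 l) := rfl

theorem sum_map_cellPos :
    (Measure.sum fun c : ℕ × ℕ => (volume : Measure (unitInterval × unitInterval)).map
      (cellPos c)) =
      lam.prod lam := by
  have hm : ∀ i : ℕ, Measurable fun x : unitInterval => (i : ℝ≥0) + unitInterval.toNNReal x :=
    fun i => unitInterval.toNNReal_continuous.measurable.const_add _
  conv_rhs => rw [← sum_map_unitInterval, Measure.prod_sum]
  congr 1
  ext c : 1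
  rw [Measure.map_prod_map _ _ (hm _) (hm _)]
  rfl

theorem config_apply (d : CellData) {E : Set (ℝ≥0 × ℝ≥0)} (hE : MeasurableSet E) :
    (config d).1 E = ∑' c, ∑ l ∈ Finset.range (d c).1, E.indicator 1 (cellPos c ((d c).2 l)) := by
  change configMeasure d E = _
  rw [configMeasure, Measure.sum_apply _ hE]
  simp only [Measure.finsetSum_apply, Measure.dirac_apply' _ hE, cellPoint_eq]

/-- The restriction of a Poisson random measure to times after `s` is independent of the past up to
time `s`, to first order: the mean number of points in `E`, restricted to a past event `B`, is
`P(B) r |E|`. -/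
theorem setLIntegral_rawSigma {κ : Type*} [Fintype κ] (r : ℝ≥0) {s : ℝ≥0} {B : Set (Canon κ)}
    (hB : MeasurableSet[rawSigma κ s] B) {E : Set (ℝ≥0 × ℝ≥0)} (hE : MeasurableSet E)
    (hEs : E ⊆ Ioi s ×ˢ univ) (k : κ) :
    ∫⁻ ω in B, (ω k).1 E ∂canonLaw κ r = canonLaw κ r B * (r * lam.prod lam E) := by
  classical
  have hB' : MeasurableSet B := rawSigma_le κ s B hB
  set b : Canon κ → ℝ≥0∞ := B.indicator 1 with hb
  have hbm : Measurable b := measurable_one.indicator hB'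
  have hNm : Measurable fun ω : Canon κ => (ω k).1 E :=
    (Measure.measurable_coe hE).comp (measurable_subtype_coe.comp (measurable_pi_apply k))
  have hbm' : Measurable fun D : κ → CellData => b (configs D) := hbm.comp measurable_configs
  set φ : ℕ × ℕ → unitInterval × unitInterval → ℝ≥0∞ := fun c q => E.indicator 1 (cellPos c q)
  have hφ : ∀ c, Measurable (φ c) := fun c =>
    (measurable_one.indicator hE).comp (measurable_cellPos c)
  have hPB : ∫⁻ D, b (configs D) ∂dataLaw κ r = canonLaw κ r B := by
    rw [← lintegral_map hbm measurable_configs, dataLaw_map_configs, hb,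
      lintegral_indicator_one hB']
  have hcm : ∀ c, Measurable fun y : CellData => ∑ l ∈ Finset.range (y c).1, φ c ((y c).2 l) := by
    intro c
    have hφl : ∀ l, Measurable fun U : ℕ → unitInterval × unitInterval => φ c (U l) := fun l =>
      (hφ c).comp (measurable_pi_apply l)
    have : Measurable fun y : ℕ × (ℕ → unitInterval × unitInterval) =>
        ∑ l ∈ Finset.range y.1, φ c (y.2 l) :=
      measurable_from_prod_countable_right fun m =>
        Finset.measurable_fun_sum (Finset.range m) fun l _ => hφl l
    exact this.comp (measurable_pi_apply c)
  -- the contribution of each cell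
  have h1 : ∫⁻ ω in B, (ω k).1 E ∂canonLaw κ r =
      ∑' c, ∫⁻ D, b (configs D) * ∑ l ∈ Finset.range (D k c).1, φ c ((D k c).2 l)
        ∂dataLaw κ r := by
    rw [← lintegral_indicator hB', ← dataLaw_map_configs,
      lintegral_map (hNm.indicator hB') measurable_configs, ← lintegral_tsum]
    · refine lintegral_congr fun D => ?_
      rw [ENNReal.tsum_mul_left, ← config_apply (D k) hE, hb]
      by_cases h : configs D ∈ B
      · rw [indicator_of_mem h, indicator_of_mem h]; simp [configs]
      · rw [indicator_of_notMem h, indicator_of_notMem h]; simp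
    · intro c
      exact (hbm'.mul ((hcm c).comp (measurable_pi_apply k))).aemeasurable
  have h2 : ∀ c, ∫⁻ D, b (configs D) * ∑ l ∈ Finset.range (D k c).1, φ c ((D k c).2 l)
      ∂dataLaw κ r = r * (∫⁻ q, φ c q) * canonLaw κ r B := by
    intro c
    have hu : Measurable fun p : CellData × (ℕ × (ℕ → unitInterval × unitInterval)) =>
        Function.update p.1 c p.2 := measurable_update_pair c
    have hmod : ∀ f : (κ → CellData) → ℝ≥0∞, Measurable f → ∫⁻ D, f D ∂dataLaw κ r =
        ∫⁻ D, ∫⁻ y, f (Function.update D k (Function.update (D k) c y))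
          ∂((poissonMeasure r).prod (Measure.infinitePi fun _ : ℕ =>
            (volume : Measure (unitInterval × unitInterval)))) ∂dataLaw κ r := by
      intro f hf
      refine lintegral_infinitePi_modify (fun _ : κ => cellLaw r) k _
        (T := fun y x => Function.update y c x) hu ?_ hf
      intro g hg
      exact lintegral_infinitePi_update _ c hg
    have hbs : Measurable fun D : κ → CellData =>
        b (configs D) * ∑ l ∈ Finset.range (D k c).1, φ c ((D k c).2 l) :=
      hbm'.mul ((hcm c).comp (measurable_pi_apply k))
    -- Mecke's formula for the cell `c` of the index `k`, given all other data
    rw [hmod _ hbs, ← hPB, hmod _ hbm',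
      ← lintegral_const_mul]
    · refine lintegral_congr fun D => ?_
      simp only [Function.update_self]
      simp_rw [mul_comm (b _)]
      have hup : ∀ m, Measurable fun U : ℕ → unitInterval × unitInterval =>
          Function.update D k (Function.update (D k) c (m, U)) := fun m =>
        (measurable_update D).comp ((measurable_update (D k)).comp (by fun_prop))
      refine lintegral_cell_mecke volume r (hφ c)
        (G := fun m U => b (configs (Function.update D k (Function.update (D k) c (m, U)))))
        (fun m => hbm'.comp (hup m)) ?_ ?_
      · intro m U x
        congr 1
        ext j : 1
        simp only [configs]
        by_cases hj : j = k
        · subst hj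
          simp only [Function.update_self]
          apply Subtype.ext
          ext A hA
          rw [config_apply _ hA, config_apply _ hA]
          refine tsum_congr fun c' => ?_
          by_cases hc : c' = c
          · subst hc
            simp only [Function.update_self]
            refine Finset.sum_congr rfl fun l hl => ?_
            rw [Function.update_of_ne (Finset.mem_range.1 hl).ne]
          · simp [hc]
        · simp [hj]
      · -- a point of `E` is later than `s`, and its removal does not affect the event `B`
        intro m U l hl hne
        have hlate : s < (cellPos c (U l)).1 := by
          have : cellPos c (U l) ∈ E := by
            by_contra h
            exact hne (indicator_of_notMem h _)
          exact (hEs this).1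
        simp only [hb]
        have : ∀ x y : Canon κ, (x ∈ B ↔ y ∈ B) →
            B.indicator (1 : Canon κ → ℝ≥0∞) x = B.indicator 1 y := by
          intro x y hxy
          by_cases hx : x ∈ B
          · rw [indicator_of_mem hx, indicator_of_mem (hxy.1 hx)]; rfl
          · rw [indicator_of_notMem hx, indicator_of_notMem (fun h => hx (hxy.2 h))]
        refine this _ _ (mem_iff_of_rawSigma hB fun j a ha A hA => ?_)
        simp only [configs]
        by_cases hj : j = k
        · subst hj
          simp only [Function.update_self]
          rw [config_apply _ (measurableSet_Ioc.prod hA), config_apply _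
            (measurableSet_Ioc.prod hA)]
          refine tsum_congr fun c' => ?_
          by_cases hc : c' = c
          · subst hc
            simp only [Function.update_self]
            set ψ : ℕ → ℝ≥0∞ := fun i => (Ioc 0 a ×ˢ A).indicator 1 (cellPos c' (U i)) with hψ
            have hz : ψ l = 0 := by
              refine indicator_of_notMem (fun h => ?_) _
              exact absurd (hlate.trans_le (h.1.2.trans ha)) (lt_irrefl _)
            change ∑ i ∈ Finset.range (m + 1), ψ i =
              ∑ i ∈ Finset.range m, ψ (Equiv.swap l m i)
            have h3 : ∑ i ∈ Finset.range (m + 1), ψ (Equiv.swap l m i) =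
                ∑ i ∈ Finset.range (m + 1), ψ i := by
              refine Finset.sum_equiv (Equiv.swap l m) ?_ (fun _ _ => rfl)
              intro i
              simp only [Finset.mem_range]
              by_cases hi1 : i = l
              · subst hi1; simp; omega
              · by_cases hi2 : i = m
                · subst hi2; simp; omega
                · rw [Equiv.swap_apply_of_ne_of_ne hi1 hi2]
            rw [← h3, Finset.sum_range_succ]
            simp [hz]
          · simp [hc]
        · simp [hj]
    · have hj : Measurable fun p : (κ → CellData) × (ℕ × (ℕ → unitInterval × unitInterval)) =>
          Function.update p.1 k (Function.update (p.1 k) c p.2) := by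
        have h2 : Measurable fun p : (κ → CellData) × (ℕ × (ℕ → unitInterval × unitInterval)) =>
            Function.update (p.1 k) c p.2 := by
          have h3 : Measurable fun p : (κ → CellData) × (ℕ × (ℕ → unitInterval × unitInterval)) =>
            (p.1 k, p.2) := ((measurable_pi_apply k).comp measurable_fst).prodMk measurable_snd
          exact hu.comp h3
        exact (measurable_update_pair k).comp (measurable_fst.prodMk h2)
      exact Measurable.lintegral_prod_right (hbm'.comp hj)
  rw [h1]
  simp_rw [h2]
  rw [ENNReal.tsum_mul_right, ENNReal.tsum_mul_left, mul_comm]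
  congr 2
  rw [← sum_map_cellPos, Measure.sum_apply _ hE]
  refine tsum_congr fun c => ?_
  rw [Measure.map_apply (measurable_cellPos c) hE]
  exact lintegral_indicator_one (measurable_cellPos c hE)

/-! ### Regularity of Poisson configurations -/

/-- The pathwise properties of the driving noise: the measures count points, no two points (even of
different measures) occur at the same time, and there are no points at level zero. -/
structure Regular {κ : Type*} [Fintype κ] (ω : Canon κ) : Prop where
  nat (k : κ) {E : Set (ℝ≥0 × ℝ≥0)} (hE : MeasurableSet E) (m : ℕ)
    (hm : E ⊆ Iic (m : ℝ≥0) ×ˢ Iic (m : ℝ≥0)) : ∃ j : ℕ, (ω k).1 E = j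
  simple (t : ℝ≥0) (ht : 0 < t) (b : ℝ≥0) : ∑ k, (ω k).1 ({t} ×ˢ Iic b) ≤ 1
  level (k : κ) : (ω k).1 (Ioi 0 ×ˢ {0}) = 0

theorem exists_natCast_eq_tsum {ι : Type*} {f : ι → ℝ≥0∞} (hf : ∀ i, ∃ j : ℕ, f i = j)
    (h : ∑' i, f i ≠ ∞) : ∃ j : ℕ, ∑' i, f i = j := by
  choose n hn using hf
  obtain rfl : f = fun i => (n i : ℝ≥0∞) := funext hn
  obtain ⟨M, hM⟩ := ENNReal.exists_nat_gt h
  rw [ENNReal.tsum_eq_iSup_sum] at hM ⊢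
  set S : Set ℕ := range fun s : Finset ι => ∑ i ∈ s, n i
  have hle : ∀ s : Finset ι, ∑ i ∈ s, n i ≤ M := fun s => by
    have := (le_iSup (fun s : Finset ι => ∑ i ∈ s, (n i : ℝ≥0∞)) s).trans hM.le
    exact_mod_cast this
  have hb : BddAbove S := ⟨M, by rintro _ ⟨s, rfl⟩; exact hle s⟩
  obtain ⟨s, hs⟩ := Nat.sSup_mem (range_nonempty _) hb
  refine ⟨sSup S, le_antisymm (iSup_le fun s' => ?_) ?_⟩
  · exact_mod_cast le_csSup hb ⟨s', rfl⟩
  · rw [← hs]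
    refine le_trans ?_ (le_iSup _ s)
    push_cast
    rfl

theorem config_apply_nat (d : CellData) {E : Set (ℝ≥0 × ℝ≥0)} (hE : MeasurableSet E)
    (h : (config d).1 E ≠ ∞) : ∃ j : ℕ, (config d).1 E = j := by
  rw [config_apply d hE] at h ⊢
  refine exists_natCast_eq_tsum (fun c => ?_) h
  classical
  refine ⟨∑ l ∈ Finset.range (d c).1, if cellPos c ((d c).2 l) ∈ E then 1 else 0, ?_⟩
  push_cast
  refine Finset.sum_congr rfl fun l _ => ?_
  by_cases h : cellPos c ((d c).2 l) ∈ E <;> simp [h]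

theorem pointSpace_box_lt_top (ν : PointSpace) {E : Set (ℝ≥0 × ℝ≥0)} {a b : ℝ≥0}
    (h : E ⊆ Iic a ×ˢ Iic b) : ν.1 E < ∞ := by
  have := ν.2
  have hc : IsCompact (Iic a ×ˢ Iic b : Set (ℝ≥0 × ℝ≥0)) := by
    rw [← Icc_bot, ← Icc_bot (a := b)]
    exact isCompact_Icc.prod isCompact_Icc
  exact (measure_mono h).trans_lt hc.measure_lt_top

theorem measurable_eval_canon {κ : Type*} (k : κ) {E : Set (ℝ≥0 × ℝ≥0)} (hE : MeasurableSet E) :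
    Measurable fun ω : Canon κ => (ω k).1 E :=
  (Measure.measurable_coe hE).comp (measurable_subtype_coe.comp (measurable_pi_apply k))

/-- Integer values on a countable generating algebra of sets propagate to all Borel sets. -/
theorem exists_natCast_of_algebra (ν : Measure (ℝ≥0 × ℝ≥0)) [IsFiniteMeasure ν]
    (h : ∀ E ∈ generateSetAlgebra (MeasurableSpace.countableGeneratingSet (ℝ≥0 × ℝ≥0)),
      ∃ j : ℕ, ν E = j) {E : Set (ℝ≥0 × ℝ≥0)} (hE : MeasurableSet E) : ∃ j : ℕ, ν E = j := by
  have halg := isSetAlgebra_generateSetAlgebra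
    (𝒜 := MeasurableSpace.countableGeneratingSet (ℝ≥0 × ℝ≥0))
  induction E, hE using MeasurableSpace.induction_on_inter
    (s := generateSetAlgebra (MeasurableSpace.countableGeneratingSet (ℝ≥0 × ℝ≥0))) with
  | h_eq =>
    rw [generateFrom_generateSetAlgebra_eq, MeasurableSpace.generateFrom_countableGeneratingSet]
  | h_inter =>
    exact fun s hs t ht _ => halg.inter_mem hs ht
  | empty => exact ⟨0, by simp⟩
  | basic t ht => exact h t ht
  | compl t ht ih =>
    obtain ⟨j, hj⟩ := ih
    obtain ⟨i, hi⟩ := h univ (halg.univ_mem)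
    refine ⟨i - j, ?_⟩
    rw [measure_compl ht (measure_ne_top _ _), hj, hi]
    simp
  | iUnion f hd hf ih =>
    rw [measure_iUnion hd hf]
    refine exists_natCast_eq_tsum ih ?_
    rw [← measure_iUnion hd hf]
    exact measure_ne_top _ _

/-- Time of the `l`-th potential point of the cell `c` of the index `k`. -/
def pointTime {κ : Type*} (D : κ → CellData) (j : κ × (ℕ × ℕ) × ℕ) : ℝ≥0 :=
  (cellPos j.2.1 ((D j.1 j.2.1).2 j.2.2)).1

/-- The law of the raw data does not change if a single position is replaced by an independent
uniform one. -/
theorem lintegral_dataLaw_point {κ : Type*} [DecidableEq κ] (r : ℝ≥0) (k : κ) (c : ℕ × ℕ) (l : ℕ)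
    {f : (κ → CellData) → ℝ≥0∞} (hf : Measurable f) :
    ∫⁻ D, f D ∂dataLaw κ r = ∫⁻ D, ∫⁻ q : unitInterval × unitInterval,
      f (Function.update D k (Function.update (D k) c
        ((D k c).1, Function.update (D k c).2 l q))) ∂volume ∂dataLaw κ r := by
  have h1 : Measurable fun p : (ℕ × (ℕ → unitInterval × unitInterval)) ×
      (unitInterval × unitInterval) => (p.1.1, Function.update p.1.2 l p.2) :=
    (measurable_fst.comp measurable_fst).prodMk ((measurable_update_pair l).comp
      ((measurable_snd.comp measurable_fst).prodMk measurable_snd))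
  have h2 : Measurable fun p : CellData × (unitInterval × unitInterval) =>
      Function.update p.1 c ((p.1 c).1, Function.update (p.1 c).2 l p.2) := by
    have h3 : Measurable fun p : CellData × (unitInterval × unitInterval) =>
        ((p.1 c).1, Function.update (p.1 c).2 l p.2) := by
      have : Measurable fun p : CellData × (unitInterval × unitInterval) => (p.1 c, p.2) :=
        ((measurable_pi_apply c).comp measurable_fst).prodMk measurable_snd
      exact h1.comp this
    exact (measurable_update_pair c).comp (measurable_fst.prodMk h3)
  refine lintegral_infinitePi_modify (fun _ : κ => cellLaw r) k volume
    (T := fun y q => Function.update y c ((y c).1, Function.update (y c).2 l q)) h2 ?_ hf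
  intro g hg
  refine lintegral_infinitePi_modify (fun _ : ℕ × ℕ => (poissonMeasure r).prod
    (Measure.infinitePi fun _ : ℕ => (volume : Measure (unitInterval × unitInterval)))) c volume
    (T := fun y q => (y.1, Function.update y.2 l q)) h1 ?_ hg
  intro g hg
  have h4 : Measurable fun y : ℕ × (ℕ → unitInterval × unitInterval) =>
      ∫⁻ q : unitInterval × unitInterval, g (y.1, Function.update y.2 l q) :=
    Measurable.lintegral_prod_right (hg.comp h1)
  rw [lintegral_prod _ hg.aemeasurable, lintegral_prod _ h4.aemeasurable]
  refine lintegral_congr fun m => ?_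
  exact lintegral_infinitePi_update _ l (hg.comp (by fun_prop : Measurable fun U => (m, U)))

theorem measurable_pointTime {κ : Type*} (j : κ × (ℕ × ℕ) × ℕ) :
    Measurable fun D : κ → CellData => pointTime D j := by
  have : Measurable fun D : κ → CellData => (D j.1 j.2.1).2 j.2.2 :=
    (measurable_pi_apply j.2.2).comp (measurable_snd.comp ((measurable_pi_apply j.2.1).comp
      (measurable_pi_apply j.1)))
  exact measurable_fst.comp ((measurable_cellPos _).comp this)

/-- Almost surely, no two potential points have the same time. -/
theorem ae_pointTime_injective (κ : Type*) [Countable κ] (r : ℝ≥0) :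
    ∀ᵐ D ∂dataLaw κ r, Function.Injective (pointTime D) := by
  classical
  have : ∀ᵐ D ∂dataLaw κ r, ∀ j j', j ≠ j' → pointTime D j ≠ pointTime D j' := by
    refine ae_all_iff.2 fun j => ae_all_iff.2 fun j' => ?_
    by_cases hj : j = j'
    · simp [hj]
    have hm : MeasurableSet {D : κ → CellData | pointTime D j = pointTime D j'} :=
      measurableSet_eq_fun (measurable_pointTime j) (measurable_pointTime j')
    have : dataLaw κ r {D | pointTime D j = pointTime D j'} = 0 := by
      obtain ⟨k, c, l⟩ := j
      rw [← lintegral_indicator_one hm,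
        lintegral_dataLaw_point r k c l (measurable_one.indicator hm)]
      refine lintegral_eq_zero_of_ae_eq_zero (ae_of_all _ fun D => ?_)
      refine lintegral_eq_zero_of_ae_eq_zero ?_
      have hn : ∀ x : unitInterval, ∀ᵐ q : unitInterval × unitInterval, q.1 ≠ x := by
        intro x
        rw [Measure.volume_eq_prod]
        exact Measure.quasiMeasurePreserving_fst.ae (Measure.ae_ne volume x)
      have hcell : ∀ q, pointTime (Function.update D k (Function.update (D k) c
          ((D k c).1, Function.update (D k c).2 l q))) (k, c, l) =
          (c.1 : ℝ≥0) + unitInterval.toNNReal q.1 := by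
        intro q; simp [pointTime, cellPos]
      have hother : ∀ q, pointTime (Function.update D k (Function.update (D k) c
          ((D k c).1, Function.update (D k c).2 l q))) j' = pointTime D j' := by
        intro q
        obtain ⟨k', c', l'⟩ := j'
        simp only [pointTime]
        by_cases hk : k' = k
        · subst hk
          by_cases hc : c' = c
          · subst hc
            have hl : l' ≠ l := by rintro rfl; exact hj rfl
            simp [hl]
          · simp [hc]
        · simp [hk]
      by_cases hx : ∃ x : unitInterval, (c.1 : ℝ≥0) + unitInterval.toNNReal x = pointTime D j'
      · obtain ⟨x, hx⟩ := hx
        filter_upwards [hn x] with q hq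
        refine indicator_of_notMem (fun h => hq ?_) _
        rw [mem_ofPred_eq, hcell, hother, ← hx] at h
        have h' := add_left_cancel h
        ext
        simpa using congrArg ((↑) : ℝ≥0 → ℝ) h'
      · refine ae_of_all _ fun q => indicator_of_notMem (fun h => hx ⟨q.1, ?_⟩) _
        rwa [mem_ofPred_eq, hcell, hother] at h
    rw [measure_eq_zero_iff_ae_notMem] at this
    filter_upwards [this] with D hD _ using hD
  filter_upwards [this] with D hD j j' h
  by_contra hne
  exact hD j j' hne h

/-- If all potential points have different times, then sufficiently thin time strips contain at most
one point up to a given level. -/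
theorem exists_strip_le_one {κ : Type*} [Fintype κ] {D : κ → CellData}
    (hD : Function.Injective (pointTime D)) (m : ℕ) :
    ∃ p : ℕ, ∀ i : ℕ, ∑ k, (configs D k).1
      ((Ioc ((i : ℝ≥0) / (p + 1)) ((i + 1) / (p + 1)) ∩ Iic (m : ℝ≥0)) ×ˢ Iic (m : ℝ≥0)) ≤ 1 := by
  classical
  -- the finitely many relevant points
  set A : Finset (κ × (ℕ × ℕ) × ℕ) := Finset.univ.biUnion fun k =>
    (Finset.range (m + 1) ×ˢ Finset.range (m + 1)).biUnion fun c =>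
      (Finset.range (D k c).1).image fun l => (k, c, l) with hA
  have hgap : ∀ᶠ p : ℕ in atTop, ∀ j ∈ A, ∀ j' ∈ A, j ≠ j' →
      (1 : ℝ) / (p + 1) < |(pointTime D j : ℝ) - pointTime D j'| := by
    simp only [Finset.eventually_all]
    intro j _ j' _
    by_cases hj : j = j'
    · simp [hj]
    · have hpos : 0 < |(pointTime D j : ℝ) - pointTime D j'| := by
        rw [abs_pos, sub_ne_zero]
        exact fun h => hj (hD (NNReal.coe_injective h))
      have := (tendsto_one_div_add_atTop_nhds_zero_nat (𝕜 := ℝ)).eventually (gt_mem_nhds hpos)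
      filter_upwards [this] with p hp _ using hp
  obtain ⟨p, hp⟩ := hgap.exists
  refine ⟨p, fun i => ?_⟩
  set E : Set (ℝ≥0 × ℝ≥0) :=
    (Ioc ((i : ℝ≥0) / (p + 1)) ((i + 1) / (p + 1)) ∩ Iic (m : ℝ≥0)) ×ˢ Iic (m : ℝ≥0) with hEdef
  have hE : MeasurableSet E := (measurableSet_Ioc.inter measurableSet_Iic).prod measurableSet_Iic
  set g : κ × (ℕ × ℕ) × ℕ → ℝ≥0∞ := fun j =>
    if j.2.2 < (D j.1 j.2.1).1 then E.indicator 1 (cellPos j.2.1 ((D j.1 j.2.1).2 j.2.2)) else 0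
    with hg
  have hsum : ∑ k, (configs D k).1 E = ∑' j, g j := by
    rw [ENNReal.tsum_prod (f := fun k q => g (k, q)), tsum_fintype]
    refine Finset.sum_congr rfl fun k _ => ?_
    rw [ENNReal.tsum_prod (f := fun c l => g (k, c, l)), configs, config_apply _ hE]
    refine tsum_congr fun c => ?_
    rw [tsum_eq_sum (s := Finset.range (D k c).1)]
    · refine Finset.sum_congr rfl fun l hl => ?_
      simp [hg, Finset.mem_range.1 hl]
    · intro l hl
      simp only [Finset.mem_range] at hl
      simp [hg, hl]
  rw [hsum]
  have hg1 : ∀ j, g j ≤ 1 := by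
    intro j
    simp only [hg]
    split_ifs
    · exact indicator_le_self' (fun _ _ => zero_le) _
    · exact zero_le
  have hmem : ∀ j, g j ≠ 0 → j ∈ A ∧ cellPos j.2.1 ((D j.1 j.2.1).2 j.2.2) ∈ E := by
    rintro ⟨k, c, l⟩ hj
    simp only [hg] at hj
    split_ifs at hj with hl
    · have hin : cellPos c ((D k c).2 l) ∈ E := by
        by_contra h; exact hj (indicator_of_notMem h _)
      refine ⟨?_, hin⟩
      have h1 : (c.1 : ℝ≥0) ≤ m := le_self_add.trans (hin.1.2 : (cellPos c ((D k c).2 l)).1 ≤ m)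
      have h2 : (c.2 : ℝ≥0) ≤ m := le_self_add.trans (hin.2 : (cellPos c ((D k c).2 l)).2 ≤ m)
      norm_cast at h1 h2
      simp only [hA, Finset.mem_biUnion, Finset.mem_univ, true_and, Finset.mem_product,
        Finset.mem_range, Finset.mem_image]
      exact ⟨k, c, ⟨by omega, by omega⟩, l, hl, rfl⟩
    · exact absurd rfl hj
  by_cases hex : ∃ j, g j ≠ 0
  · obtain ⟨j, hj⟩ := hex
    rw [tsum_eq_single j]
    · exact hg1 j
    · intro j' hne
      by_contra hj'
      obtain ⟨ha, hb⟩ := hmem j hj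
      obtain ⟨ha', hb'⟩ := hmem j' hj'
      have hlt := hp j' ha' j ha hne
      have e1 := hb.1.1
      have e2 := hb'.1.1
      change (i : ℝ≥0) / (p + 1) < pointTime D j ∧ pointTime D j ≤ (i + 1) / (p + 1) at e1
      change (i : ℝ≥0) / (p + 1) < pointTime D j' ∧ pointTime D j' ≤ (i + 1) / (p + 1) at e2
      have c1 : (i : ℝ) / (p + 1) < pointTime D j := by exact_mod_cast e1.1
      have c2 : (pointTime D j : ℝ) ≤ (i + 1) / (p + 1) := by exact_mod_cast e1.2
      have c3 : (i : ℝ) / (p + 1) < pointTime D j' := by exact_mod_cast e2.1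
      have c4 : (pointTime D j' : ℝ) ≤ (i + 1) / (p + 1) := by exact_mod_cast e2.2
      rw [add_div] at c2 c4
      rcases abs_cases ((pointTime D j' : ℝ) - pointTime D j) with h | h <;> linarith
  · push Not at hex
    simp [hex]

/-- Almost every configuration is regular. -/
theorem ae_regular (κ : Type*) [Fintype κ] (r : ℝ≥0) : ∀ᵐ ω ∂canonLaw κ r, Regular ω := by
  -- a countable algebra which generates the Borel sets
  set 𝒞 := generateSetAlgebra (MeasurableSpace.countableGeneratingSet (ℝ≥0 × ℝ≥0)) with h𝒞
  have hcount : 𝒞.Countable :=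
    countable_generateSetAlgebra (MeasurableSpace.countable_countableGeneratingSet)
  have h𝒞m : ∀ E ∈ 𝒞, MeasurableSet E := fun E hE => by
    have := MeasurableSpace.measurableSet_generateFrom (s := 𝒞) hE
    rwa [h𝒞, generateFrom_generateSetAlgebra_eq,
      MeasurableSpace.generateFrom_countableGeneratingSet] at this
  have hnat : ∀ᵐ ω ∂canonLaw κ r, ∀ k : κ, ∀ E ∈ 𝒞, ∀ m : ℕ,
      (ω k).1 (E ∩ Iic (m : ℝ≥0) ×ˢ Iic (m : ℝ≥0)) ∈ range ((↑) : ℕ → ℝ≥0∞) := by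
    rw [eventually_all]
    intro k
    rw [eventually_countable_ball hcount]
    intro E hE
    rw [eventually_countable_forall]
    intro m
    have hm : MeasurableSet (E ∩ Iic (m : ℝ≥0) ×ˢ Iic (m : ℝ≥0)) :=
      (h𝒞m E hE).inter (measurableSet_Iic.prod measurableSet_Iic)
    rw [← dataLaw_map_configs, ae_map_iff measurable_configs.aemeasurable
      (measurable_eval_canon k hm (countable_range _).measurableSet)]
    refine ae_of_all _ fun D => ?_
    obtain ⟨j, hj⟩ := config_apply_nat (D k) hm
      (pointSpace_box_lt_top _ (a := m) (b := m) inter_subset_right).ne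
    exact ⟨j, hj.symm⟩
  have hsimple : ∀ᵐ ω ∂canonLaw κ r, ∀ m : ℕ, ∃ p : ℕ, ∀ i : ℕ, ∑ k, (ω k).1
      ((Ioc ((i : ℝ≥0) / (p + 1)) ((i + 1) / (p + 1)) ∩ Iic (m : ℝ≥0)) ×ˢ Iic (m : ℝ≥0)) ≤ 1 := by
    rw [← dataLaw_map_configs, ae_map_iff measurable_configs.aemeasurable]
    · filter_upwards [ae_pointTime_injective κ r] with D hD m using exists_strip_le_one hD m
    · simp only [ofPred_forall, ofPred_exists]
      refine MeasurableSet.iInter fun m => MeasurableSet.iUnion fun p =>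
        MeasurableSet.iInter fun i =>
        measurableSet_le (Finset.measurable_fun_sum _ fun k _ => ?_) measurable_const
      exact measurable_eval_canon k
        ((measurableSet_Ioc.inter measurableSet_Iic).prod measurableSet_Iic)
  -- the level zero has intensity zero
  have hlevel : ∀ᵐ ω ∂canonLaw κ r, ∀ k : κ, (ω k).1 (Ioi 0 ×ˢ {0}) = 0 := by
    rw [eventually_all]
    intro k
    have hE : MeasurableSet (Ioi 0 ×ˢ {0} : Set (ℝ≥0 × ℝ≥0)) :=
      measurableSet_Ioi.prod (measurableSet_singleton 0)
    have h0 := setLIntegral_rawSigma r (s := 0) (B := univ) MeasurableSet.univ hE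
      (prod_mono_right (subset_univ _)) k
    rw [Measure.restrict_univ, Measure.prod_prod] at h0
    rw [show lam {(0 : ℝ≥0)} = 0 from measure_singleton _, mul_zero, mul_zero, mul_zero,
      lintegral_eq_zero_iff (measurable_eval_canon k hE)] at h0
    exact h0
  filter_upwards [hnat, hsimple, hlevel] with ω h1 h2 h3
  refine ⟨fun k E hE m hm => ?_, fun t ht b => ?_, h3⟩
  · have : IsFiniteMeasure ((ω k).1.restrict (Iic (m : ℝ≥0) ×ˢ Iic (m : ℝ≥0))) :=
      ⟨by rw [Measure.restrict_apply_univ]; exact pointSpace_box_lt_top _ subset_rfl⟩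
    obtain ⟨j, hj⟩ := exists_natCast_of_algebra
      ((ω k).1.restrict (Iic (m : ℝ≥0) ×ˢ Iic (m : ℝ≥0))) (fun E hE => by
        obtain ⟨j, hj⟩ := h1 k E hE m
        exact ⟨j, by rw [Measure.restrict_apply (h𝒞m E hE), hj]⟩) hE
    refine ⟨j, ?_⟩
    rw [← hj, Measure.restrict_apply hE, inter_eq_left.2 hm]
  · obtain ⟨m, hm⟩ := exists_nat_ge (max t b)
    obtain ⟨p, hp⟩ := h2 m
    have hpos : 0 < t * (p + 1) := by positivity
    obtain ⟨i, hi⟩ : ∃ i, ⌈t * (p + 1)⌉₊ = i + 1 := Nat.exists_eq_succ_of_ne_zero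
      (Nat.ceil_pos.2 hpos).ne'
    have hi2 : t * (p + 1) ≤ i + 1 := by
      have := Nat.le_ceil (t * (p + 1)); rw [hi] at this; exact_mod_cast this
    have hi1 : (i : ℝ≥0) < t * (p + 1) := Nat.lt_ceil.1 (by omega)
    refine le_trans (Finset.sum_le_sum fun k _ => measure_mono ?_) (hp i)
    rintro ⟨s, a⟩ ⟨hs, ha⟩
    simp only [mem_singleton_iff, mem_Iic] at hs ha
    subst hs
    have hp0 : (0 : ℝ≥0) < p + 1 := by positivity
    refine ⟨⟨⟨?_, ?_⟩, (le_max_left _ _).trans hm⟩, ha.trans ((le_max_right _ _).trans hm)⟩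
    · exact (div_lt_iff₀ hp0).2 hi1
    · exact (le_div_iff₀ hp0).2 hi2

/-! ### Predictable processes -/

/-- The filtration of the noise, without completion. -/
def rawFiltration (κ : Type*) : Filtration ℝ≥0 (inferInstance : MeasurableSpace (Canon κ)) where
  seq := rawSigma κ
  mono' := fun _ _ h => rawSigma_mono κ h
  le' := rawSigma_le κ

/-- The product of time and sample space, equipped with the predictable σ-algebra of the
uncompleted filtration. -/
def Hist (κ : Type*) : Type _ := ℝ≥0 × Canon κ

namespace Hist

variable {κ : Type*}

/-- The pair of a time and a sample point. -/
def mk (t : ℝ≥0) (ω : Canon κ) : Hist κ := (t, ω)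

/-- The time. -/
def time (h : Hist κ) : ℝ≥0 := h.1

/-- The sample point. -/
def noise (h : Hist κ) : Canon κ := h.2

@[simp] theorem time_mk (t : ℝ≥0) (ω : Canon κ) : (mk t ω).time = t := rfl
@[simp] theorem noise_mk (t : ℝ≥0) (ω : Canon κ) : (mk t ω).noise = ω := rfl

instance : MeasurableSpace (Hist κ) := (rawFiltration κ).predictable

/-- The generating sets of the predictable σ-algebra. -/
def generators (κ : Type*) : Set (Set (Hist κ)) :=
  {s | ∃ A, MeasurableSet[rawSigma κ 0] A ∧ s = {h | h.time = 0 ∧ h.noise ∈ A}} ∪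
    {s | ∃ i A, MeasurableSet[rawSigma κ i] A ∧ s = {h | i < h.time ∧ h.noise ∈ A}}

theorem generateFrom_generators :
    (inferInstance : MeasurableSpace (Hist κ)) = MeasurableSpace.generateFrom (generators κ) := rfl

theorem measurableSet_Ioi {i : ℝ≥0} {A : Set (Canon κ)} (hA : MeasurableSet[rawSigma κ i] A) :
    MeasurableSet {h : Hist κ | i < h.time ∧ h.noise ∈ A} :=
  MeasurableSpace.measurableSet_generateFrom (Or.inr ⟨i, A, hA, rfl⟩)

theorem isPiSystem_generators : IsPiSystem (generators κ) := by
  rintro _ (⟨A, hA, rfl⟩ | ⟨i, A, hA, rfl⟩) _ (⟨B, hB, rfl⟩ | ⟨j, B, hB, rfl⟩) -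
  · refine Or.inl ⟨A ∩ B, hA.inter hB, ?_⟩
    ext h; simp only [mem_inter_iff, mem_ofPred_eq]; tauto
  · refine Or.inl ⟨∅, @MeasurableSet.empty _ (rawSigma κ 0), ?_⟩
    ext h
    simp only [mem_inter_iff, mem_ofPred_eq, mem_empty_iff_false, and_false, iff_false]
    rintro ⟨⟨h0, -⟩, h1, -⟩
    rw [h0] at h1
    exact not_lt_zero h1
  · refine Or.inl ⟨∅, @MeasurableSet.empty _ (rawSigma κ 0), ?_⟩
    ext h
    simp only [mem_inter_iff, mem_ofPred_eq, mem_empty_iff_false, and_false, iff_false]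
    rintro ⟨⟨h1, -⟩, h0, -⟩
    rw [h0] at h1
    exact not_lt_zero h1
  · refine Or.inr ⟨max i j, A ∩ B, (rawSigma_mono κ (le_max_left i j) _ hA).inter
      (rawSigma_mono κ (le_max_right i j) _ hB), ?_⟩
    ext h; simp only [mem_inter_iff, mem_ofPred_eq, max_lt_iff]; tauto

theorem isCountablySpanning_generators : IsCountablySpanning (generators κ) := by
  refine ⟨fun n => if n = 0 then {h | h.time = 0 ∧ h.noise ∈ univ} else
    {h | 0 < h.time ∧ h.noise ∈ univ}, fun n => ?_, ?_⟩
  · dsimp only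
    split_ifs
    · exact Or.inl ⟨univ, MeasurableSet.univ, rfl⟩
    · exact Or.inr ⟨0, univ, MeasurableSet.univ, rfl⟩
  · refine eq_univ_of_forall fun h => mem_iUnion.2 ?_
    by_cases h0 : h.time = 0
    · exact ⟨0, by simp [h0]⟩
    · exact ⟨1, by simpa using pos_iff_ne_zero.2 h0⟩

/-- The rectangles which generate the product of the predictable and the Borel σ-algebra. -/
def rectangles (κ : Type*) : Set (Set (Hist κ × ℝ≥0)) :=
  image2 (· ×ˢ ·) (generators κ) {s | MeasurableSet s}

theorem generateFrom_rectangles : (inferInstance : MeasurableSpace (Hist κ × ℝ≥0)) =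
    MeasurableSpace.generateFrom (rectangles κ) := by
  have := generateFrom_prod_eq (isCountablySpanning_generators (κ := κ))
    (isCountablySpanning_measurableSet (α := ℝ≥0))
  rwa [MeasurableSpace.generateFrom_measurableSet] at this

theorem isPiSystem_rectangles : IsPiSystem (rectangles κ) :=
  isPiSystem_generators.prod MeasurableSpace.isPiSystem_measurableSet

theorem measurable_mk : Measurable fun p : ℝ≥0 × Canon κ => mk p.1 p.2 := by
  refine measurable_generateFrom ?_
  rintro _ (⟨A, hA, rfl⟩ | ⟨i, A, hA, rfl⟩)
  · exact (measurableSet_singleton (0 : ℝ≥0)).prod (rawSigma_le κ 0 A hA)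
  · exact (_root_.measurableSet_Ioi (a := i)).prod (rawSigma_le κ i A hA)

theorem measurable_time : Measurable (time (κ := κ)) := by
  refine measurable_of_Ioi fun i => ?_
  simpa [preimage] using measurableSet_Ioi (κ := κ) (i := i) MeasurableSet.univ

/-- A quantity which is known at time `q`, used after time `q`, is predictable. -/
theorem measurable_ite {q : ℝ≥0} {g : Canon κ → ℝ≥0∞} (hg : Measurable[rawSigma κ q] g) :
    Measurable fun h : Hist κ => if q < h.time then g h.noise else 0 := by
  intro S hS
  have h1 : MeasurableSet {h : Hist κ | q < h.time ∧ h.noise ∈ g ⁻¹' S} := measurableSet_Ioi (hg hS)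
  have h2 : MeasurableSet {h : Hist κ | q < h.time} := measurable_time _root_.measurableSet_Ioi
  by_cases h0 : (0 : ℝ≥0∞) ∈ S
  · convert! h1.union h2.compl using 1
    ext h
    by_cases hq : q < h.time <;> simp [hq, h0]
  · convert! h1 using 1
    ext h
    by_cases hq : q < h.time <;> simp [hq, h0]

theorem noise_Ioo_eq_iSup (ν : Measure (ℝ≥0 × ℝ≥0)) (i t : ℝ≥0) (D : Set ℝ≥0) :
    ν (Ioo i t ×ˢ D) =
      ⨆ q : ℚ, if Real.toNNReal q < t then ν (Ioc i (Real.toNNReal q) ×ˢ D) else 0 := by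
  have hU : Ioo i t ×ˢ D = ⋃ q : ℚ,
      if Real.toNNReal q < t then Ioc i (Real.toNNReal q) ×ˢ D else ∅ := by
    ext p
    simp only [mem_prod, mem_Ioo, mem_iUnion]
    constructor
    · rintro ⟨⟨h1, h2⟩, h3⟩
      obtain ⟨q, -, hq1, hq2⟩ := (NNReal.lt_iff_exists_rat_btwn _ _).1 h2
      exact ⟨q, by rw [if_pos hq2]; exact ⟨⟨h1, hq1.le⟩, h3⟩⟩
    · rintro ⟨q, hq⟩
      split_ifs at hq with h
      · exact ⟨⟨hq.1.1, hq.1.2.trans_lt h⟩, hq.2⟩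
      · exact absurd hq (notMem_empty _)
  rw [hU, Directed.measure_iUnion]
  · refine iSup_congr fun q => ?_
    split_ifs <;> simp
  · intro q1 q2
    by_cases h1 : Real.toNNReal q1 < t
    · by_cases h2 : Real.toNNReal q2 < t
      · rcases le_total q1 q2 with h | h
        · refine ⟨q2, ?_, subset_rfl⟩
          dsimp only
          rw [if_pos h1, if_pos h2]
          exact prod_mono_left (Ioc_subset_Ioc_right (Real.toNNReal_mono (by exact_mod_cast h)))
        · refine ⟨q1, subset_rfl, ?_⟩
          dsimp only
          rw [if_pos h1, if_pos h2]
          exact prod_mono_left (Ioc_subset_Ioc_right (Real.toNNReal_mono (by exact_mod_cast h)))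
      · exact ⟨q1, subset_rfl, by dsimp only; rw [if_neg h2]; exact empty_subset _⟩
    · exact ⟨q2, by dsimp only; rw [if_neg h1]; exact empty_subset _, subset_rfl⟩

theorem measurable_rawSigma_eval (k : κ) {s q : ℝ≥0} (hs : s ≤ q) {D : Set ℝ≥0}
    (hD : MeasurableSet D) :
    Measurable[rawSigma κ q] fun ω : Canon κ => (ω k).1 (Ioc 0 s ×ˢ D) := by
  refine measurable_iff_comap_le.2 ?_
  exact le_iSup_of_le k (le_iSup_of_le s (le_iSup_of_le hs (le_iSup_of_le D
    (le_iSup_of_le hD le_rfl))))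

theorem measurable_noise_Ioo (k : κ) (i b : ℝ≥0) {D : Set ℝ≥0} (hD : MeasurableSet D)
    (hDb : D ⊆ Iic b) : Measurable fun h : Hist κ => (h.noise k).1 (Ioo i h.time ×ˢ D) := by
  simp_rw [noise_Ioo_eq_iSup]
  refine Measurable.iSup fun q => ?_
  have hsub : ∀ ω : Canon κ, (ω k).1 (Ioc i (Real.toNNReal q) ×ˢ D) =
      (ω k).1 (Ioc 0 (Real.toNNReal q) ×ˢ D) -
        (ω k).1 (Ioc 0 (min i (Real.toNNReal q)) ×ˢ D) := by
    intro ω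
    rw [← measure_sdiff]
    · congr 1
      ext p
      simp only [mem_prod, mem_Ioc, Set.mem_sdiff, le_min_iff]
      constructor
      · rintro ⟨⟨h1, h2⟩, h3⟩
        exact ⟨⟨⟨(zero_le).trans_lt h1, h2⟩, h3⟩, fun h => absurd h.1.2.1 (not_le.2 h1)⟩
      · rintro ⟨⟨⟨h1, h2⟩, h3⟩, h4⟩
        refine ⟨⟨?_, h2⟩, h3⟩
        by_contra h5
        exact h4 ⟨⟨h1, not_lt.1 h5, h2⟩, h3⟩
    · exact prod_mono_left (Ioc_subset_Ioc_right (min_le_right _ _))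
    · exact (measurableSet_Ioc.prod hD).nullMeasurableSet
    · refine (pointSpace_box_lt_top (ω k) (a := min i (Real.toNNReal q)) (b := b) ?_).ne
      exact prod_mono (fun _ h => h.2) hDb
  simp_rw [hsub]
  exact measurable_ite ((measurable_rawSigma_eval k le_rfl hD).sub
    (measurable_rawSigma_eval k (min_le_right _ _) hD))

/-- The points of the noise before the current time and below the level `b`, as a measure on the
space on which predictable integrands live. -/
def pastNoise (k : κ) (b : ℝ≥0) (h : Hist κ) : Measure (Hist κ × ℝ≥0) :=
  ((h.noise k).1.restrict (Ioo 0 h.time ×ˢ Iic b)).map fun p => (mk p.1 h.noise, p.2)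

theorem measurable_section (ω : Canon κ) :
    Measurable fun p : ℝ≥0 × ℝ≥0 => (mk p.1 ω, p.2) :=
  (measurable_mk.comp (measurable_fst.prodMk measurable_const)).prodMk measurable_snd

theorem measurableSet_box (t b : ℝ≥0) : MeasurableSet (Ioo 0 t ×ˢ Iic b : Set (ℝ≥0 × ℝ≥0)) :=
  measurableSet_Ioo.prod measurableSet_Iic

theorem pastNoise_apply (k : κ) (b : ℝ≥0) (h : Hist κ) {A : Set (Hist κ × ℝ≥0)}
    (hA : MeasurableSet A) : pastNoise k b h A =
      (h.noise k).1 {p | (p.1 ∈ Ioo 0 h.time ∧ p.2 ≤ b) ∧ (mk p.1 h.noise, p.2) ∈ A} := by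
  rw [pastNoise, Measure.map_apply (measurable_section _) hA,
    Measure.restrict_apply (measurable_section _ hA), inter_comm]
  rfl

instance (k : κ) (b : ℝ≥0) (h : Hist κ) : IsFiniteMeasure (pastNoise k b h) := by
  constructor
  rw [pastNoise_apply k b h MeasurableSet.univ]
  exact pointSpace_box_lt_top _ (a := h.time) (b := b) fun p hp => ⟨hp.1.1.2.le, hp.1.2⟩

theorem box_inter_generator (t b i : ℝ≥0) (ω : Canon κ) (A : Set (Canon κ)) (D : Set ℝ≥0)
    (hω : ω ∈ A) : {p : ℝ≥0 × ℝ≥0 | (p.1 ∈ Ioo 0 t ∧ p.2 ≤ b) ∧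
      (mk p.1 ω, p.2) ∈ {h : Hist κ | i < h.time ∧ h.noise ∈ A} ×ˢ D} =
      Ioo i t ×ˢ (D ∩ Iic b) := by
  ext p
  simp only [mem_ofPred_eq, mem_prod, time_mk, noise_mk, hω, and_true, mem_Ioo, mem_inter_iff,
    mem_Iic]
  constructor
  · rintro ⟨⟨⟨h1, h2⟩, h3⟩, h4, h5⟩; exact ⟨⟨h4, h2⟩, h5, h3⟩
  · rintro ⟨⟨h4, h2⟩, h5, h3⟩; exact ⟨⟨⟨(zero_le).trans_lt h4, h2⟩, h3⟩, h4, h5⟩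

theorem measurable_pastNoise (k : κ) (b : ℝ≥0) : Measurable (pastNoise (κ := κ) k b) := by
  refine Measurable.measure_of_isPiSystem generateFrom_rectangles isPiSystem_rectangles ?_ ?_
  · rintro _ ⟨G, hG, D, hD, rfl⟩
    have hGm : MeasurableSet G := MeasurableSpace.measurableSet_generateFrom hG
    simp_rw [pastNoise_apply _ _ _ (hGm.prod hD)]
    rcases hG with ⟨A, hA, rfl⟩ | ⟨i, A, hA, rfl⟩
    · convert! measurable_const (a := (0 : ℝ≥0∞)) with h
      convert! measure_empty (μ := (h.noise k).1)
      ext p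
      simp only [mem_ofPred_eq, mem_prod, time_mk, mem_empty_iff_false, iff_false]
      rintro ⟨⟨h1, -⟩, ⟨h2, -⟩, -⟩
      exact h1.1.ne' h2
    · have h1 : Measurable fun h : Hist κ => {h : Hist κ | i < h.time ∧ h.noise ∈ A}.indicator
          (fun h => (h.noise k).1 (Ioo i h.time ×ˢ (D ∩ Iic b))) h :=
        (measurable_noise_Ioo k i b (MeasurableSet.inter hD measurableSet_Iic)
          inter_subset_right).indicator hGm
      convert! h1 using 2 with h
      by_cases hA' : h.noise ∈ A
      · rw [box_inter_generator _ _ _ _ _ _ hA']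
        by_cases hi : i < h.time
        · rw [indicator_of_mem (show h ∈ {h : Hist κ | i < h.time ∧ h.noise ∈ A} from ⟨hi, hA'⟩)]
        · rw [indicator_of_notMem (fun h => hi h.1), Ioo_eq_empty hi, empty_prod, measure_empty]
      · rw [indicator_of_notMem (fun h => hA' h.2)]
        convert! measure_empty (μ := (h.noise k).1)
        ext p
        simp [hA']
  · simp_rw [pastNoise_apply _ _ _ MeasurableSet.univ]
    convert! measurable_noise_Ioo k 0 b measurableSet_Iic subset_rfl using 3 with h
    ext p
    simp

/-- The number of points before the current time in a predictable set is predictable. -/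
theorem measurable_count (k : κ) (b : ℝ≥0) {A : Set (Hist κ × ℝ≥0)} (hA : MeasurableSet A) :
    Measurable fun h : Hist κ =>
      (h.noise k).1 {p | (p.1 ∈ Ioo 0 h.time ∧ p.2 ≤ b) ∧ (mk p.1 h.noise, p.2) ∈ A} := by
  simp_rw [← pastNoise_apply _ _ _ hA]
  exact (Measure.measurable_coe hA).comp (measurable_pastNoise k b)

/-- Lebesgue measure on the past, as a measure on the space of predictable integrands. -/
def pastTime (h : Hist κ) : Measure (Hist κ) :=
  (lam.restrict (Iio h.time)).map fun s => mk s h.noise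

theorem measurable_mk_left (ω : Canon κ) : Measurable fun s : ℝ≥0 => mk s ω :=
  measurable_mk.comp (measurable_id.prodMk measurable_const)

theorem pastTime_apply (h : Hist κ) {A : Set (Hist κ)} (hA : MeasurableSet A) :
    pastTime h A = lam ({s | mk s h.noise ∈ A} ∩ Iio h.time) := by
  rw [pastTime, Measure.map_apply (measurable_mk_left _) hA,
    Measure.restrict_apply (measurable_mk_left _ hA)]
  rfl

instance (h : Hist κ) : IsFiniteMeasure (pastTime h) := by
  constructor
  rw [pastTime_apply h MeasurableSet.univ]
  refine (measure_mono inter_subset_right).trans_lt ?_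
  rw [lam_Iio]
  exact ENNReal.coe_lt_top

theorem lam_Ioo (i t : ℝ≥0) : lam (Ioo i t) = t - i := by
  rcases le_total i t with h | h
  · have h1 : lam (Ioo i t) = lam (Ico i t) := by
      refine measure_congr ?_
      exact Ioo_ae_eq_Ico
    have h2 : Ico i t = Iio t \ Iio i := by ext x; simp
    rw [h1, h2, measure_sdiff (Iio_subset_Iio h) measurableSet_Iio.nullMeasurableSet, lam_Iio,
      lam_Iio]
    rw [lam_Iio]; exact ENNReal.coe_ne_top
  · rw [Ioo_eq_empty (not_lt.2 h), measure_empty, tsub_eq_zero_of_le (by exact_mod_cast h)]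

theorem measurable_pastTime : Measurable (pastTime (κ := κ)) := by
  refine Measurable.measure_of_isPiSystem generateFrom_generators isPiSystem_generators ?_ ?_
  · intro G hG
    have hGm : MeasurableSet G := MeasurableSpace.measurableSet_generateFrom hG
    simp_rw [pastTime_apply _ hGm]
    rcases hG with ⟨A, hA, rfl⟩ | ⟨i, A, hA, rfl⟩
    · convert! measurable_const (a := (0 : ℝ≥0∞)) with h
      refine measure_mono_null (t := {0}) ?_ (measure_singleton _)
      rintro s ⟨⟨h1, -⟩, -⟩
      exact h1
    · have h1 : Measurable fun h : Hist κ => {h : Hist κ | i < h.time ∧ h.noise ∈ A}.indicator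
          (fun h => (h.time : ℝ≥0∞) - i) h :=
        (measurable_time.coe_nnreal_ennreal.sub_const _).indicator hGm
      convert! h1 using 2 with h
      by_cases hA' : h.noise ∈ A
      · have : {s | mk s h.noise ∈ {h : Hist κ | i < h.time ∧ h.noise ∈ A}} ∩ Iio h.time =
            Ioo i h.time := by
          ext s; simp [hA']
        rw [this, lam_Ioo]
        by_cases hi : i < h.time
        · rw [indicator_of_mem (show h ∈ {h : Hist κ | i < h.time ∧ h.noise ∈ A} from ⟨hi, hA'⟩)]
        · rw [indicator_of_notMem (fun h => hi h.1), tsub_eq_zero_of_le]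
          exact_mod_cast not_lt.1 hi
      · rw [indicator_of_notMem (fun h => hA' h.2)]
        convert! measure_empty (μ := lam)
        ext p
        simp [hA']
  · simp_rw [pastTime_apply _ MeasurableSet.univ]
    convert! measurable_time.coe_nnreal_ennreal with h
    rw [← lam_Iio]
    congr 1
    ext; simp

/-- The time integral of a predictable process is predictable. -/
theorem measurable_lintegral_past {c : Hist κ → ℝ≥0∞} (hc : Measurable c) :
    Measurable fun h : Hist κ => ∫⁻ s in Iio h.time, c (mk s h.noise) ∂lam := by
  have h1 := (Measure.measurable_lintegral hc).comp (measurable_pastTime (κ := κ))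
  convert! h1 using 1
  ext h
  rw [Function.comp, pastTime, lintegral_map hc (measurable_mk_left _)]

/-! ### The compensation formula -/

theorem measurable_noise_lintegral [Fintype κ] (k : κ) (t b : ℝ≥0) {g : Hist κ × ℝ≥0 → ℝ≥0∞}
    (hg : Measurable g) : Measurable fun ω : Canon κ =>
      ∫⁻ p in Ioo 0 t ×ˢ Iic b, g (mk p.1 ω, p.2) ∂(ω k).1 := by
  have h0 : Measurable fun ω : Canon κ => mk t ω :=
    measurable_mk.comp (measurable_const.prodMk measurable_id)
  have h1 := ((Measure.measurable_lintegral hg).comp (measurable_pastNoise k b)).comp h0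
  convert! h1 using 1
  ext ω
  rw [Function.comp, Function.comp, pastNoise, lintegral_map hg (measurable_section _)]
  rfl

/-- For predictable integrands, the mean of the integral against a Poisson random measure is the
mean of the integral against its intensity. -/
theorem lintegral_compensation [Fintype κ] (r : ℝ≥0) (k : κ) (t b : ℝ≥0)
    {g : Hist κ × ℝ≥0 → ℝ≥0∞} (hg : Measurable g) :
    ∫⁻ ω, ∫⁻ p in Ioo 0 t ×ˢ Iic b, g (mk p.1 ω, p.2) ∂(ω k).1 ∂canonLaw κ r =
      r * ∫⁻ ω, ∫⁻ p in Ioo 0 t ×ˢ Iic b, g (mk p.1 ω, p.2) ∂(lam.prod lam) ∂canonLaw κ r := by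
  have h0 : Measurable fun ω : Canon κ => mk t ω :=
    measurable_mk.comp (measurable_const.prodMk measurable_id)
  have hK : Measurable fun ω : Canon κ => pastNoise k b (mk t ω) :=
    (measurable_pastNoise k b).comp h0
  have hm : Measurable fun q : Canon κ × (ℝ≥0 × ℝ≥0) => (mk q.2.1 q.1, q.2.2) := by
    have : Measurable fun q : Canon κ × (ℝ≥0 × ℝ≥0) => (q.2.1, q.1) := by fun_prop
    exact (measurable_mk.comp this).prodMk (by fun_prop)
  -- Both sides are integrals of `g` against finite measures, which are compared on rectangles.
  set M1 : Measure (Hist κ × ℝ≥0) := (canonLaw κ r).bind fun ω => pastNoise k b (mk t ω) with hM1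
  set M2 : Measure (Hist κ × ℝ≥0) := (r : ℝ≥0∞) • ((canonLaw κ r).prod
    ((lam.prod lam).restrict (Ioo 0 t ×ˢ Iic b))).map fun q => (mk q.2.1 q.1, q.2.2) with hM2
  have e1 : ∀ A, MeasurableSet A → M1 A = ∫⁻ ω, (ω k).1
      {p | (p.1 ∈ Ioo 0 t ∧ p.2 ≤ b) ∧ (mk p.1 ω, p.2) ∈ A} ∂canonLaw κ r := by
    intro A hA
    rw [hM1, Measure.bind_apply hA hK.aemeasurable]
    simp_rw [pastNoise_apply _ _ _ hA]
    rfl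
  have e2 : ∀ A, MeasurableSet A → M2 A = r * ∫⁻ ω, (lam.prod lam)
      {p | (p.1 ∈ Ioo 0 t ∧ p.2 ≤ b) ∧ (mk p.1 ω, p.2) ∈ A} ∂canonLaw κ r := by
    intro A hA
    rw [hM2, Measure.smul_apply, Measure.map_apply hm hA, Measure.prod_apply (hm hA), smul_eq_mul]
    congr 1
    refine lintegral_congr fun ω => ?_
    rw [Measure.restrict_apply (measurable_prodMk_left (hm hA)), inter_comm]
    rfl
  have key : M1 = M2 := by
    have huniv : M1 univ = M2 univ := by
      rw [e1 _ MeasurableSet.univ, e2 _ MeasurableSet.univ]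
      have hE := measurableSet_box t b
      have := setLIntegral_rawSigma r (s := 0) (B := univ) MeasurableSet.univ hE
        (fun p hp => ⟨hp.1.1, mem_univ _⟩) k
      have hset : ∀ ω : Canon κ, {p : ℝ≥0 × ℝ≥0 | (p.1 ∈ Ioo 0 t ∧ p.2 ≤ b) ∧
          (mk p.1 ω, p.2) ∈ (univ : Set (Hist κ × ℝ≥0))} = Ioo 0 t ×ˢ Iic b := by
        intro ω; ext p; simp
      simp_rw [hset]
      rw [Measure.restrict_univ, measure_univ, one_mul] at this
      rw [this, lintegral_const, measure_univ, mul_one]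
    have hfin : IsFiniteMeasure M1 := by
      constructor
      rw [huniv, e2 _ MeasurableSet.univ]
      refine ENNReal.mul_lt_top ENNReal.coe_lt_top ?_
      have : ∀ ω : Canon κ, (lam.prod lam) {p : ℝ≥0 × ℝ≥0 | (p.1 ∈ Ioo 0 t ∧ p.2 ≤ b) ∧
          (mk p.1 ω, p.2) ∈ (univ : Set (Hist κ × ℝ≥0))} ≤ (t : ℝ≥0∞) * b := by
        intro ω
        refine (measure_mono (t := Iio t ×ˢ Iic b) fun p hp => ⟨hp.1.1.2, hp.1.2⟩).trans ?_
        rw [Measure.prod_prod, lam_Iio, ← measure_congr (Iio_ae_eq_Iic (μ := lam)), lam_Iio]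
      refine (lintegral_mono this).trans_lt ?_
      rw [lintegral_const, measure_univ, mul_one]
      exact ENNReal.mul_lt_top ENNReal.coe_lt_top ENNReal.coe_lt_top
    refine ext_of_generate_finite _ generateFrom_rectangles isPiSystem_rectangles ?_ huniv
    rintro _ ⟨G, hG, D, hD, rfl⟩
    have hGm : MeasurableSet G := MeasurableSpace.measurableSet_generateFrom hG
    rw [e1 _ (hGm.prod hD), e2 _ (hGm.prod hD)]
    rcases hG with ⟨A, hA, rfl⟩ | ⟨i, A, hA, rfl⟩
    · have : ∀ ω : Canon κ, {p : ℝ≥0 × ℝ≥0 | (p.1 ∈ Ioo 0 t ∧ p.2 ≤ b) ∧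
          (mk p.1 ω, p.2) ∈ {h : Hist κ | h.time = 0 ∧ h.noise ∈ A} ×ˢ D} = ∅ := by
        intro ω
        ext p
        simp only [mem_ofPred_eq, mem_prod, time_mk, mem_empty_iff_false, iff_false]
        rintro ⟨⟨h1, -⟩, ⟨h2, -⟩, -⟩
        exact h1.1.ne' h2
      simp_rw [this]
      simp
    · have hA' : MeasurableSet A := rawSigma_le κ i A hA
      have hset : ∀ (ν : Canon κ → Measure (ℝ≥0 × ℝ≥0)) (ω : Canon κ),
          ν ω {p : ℝ≥0 × ℝ≥0 | (p.1 ∈ Ioo 0 t ∧ p.2 ≤ b) ∧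
          (mk p.1 ω, p.2) ∈ {h : Hist κ | i < h.time ∧ h.noise ∈ A} ×ˢ D} =
          A.indicator (fun ω => ν ω (Ioo i t ×ˢ (D ∩ Iic b))) ω := by
        intro ν ω
        by_cases hω : ω ∈ A
        · rw [box_inter_generator _ _ _ _ _ _ hω, indicator_of_mem hω]
        · rw [indicator_of_notMem hω]
          convert! measure_empty (μ := ν ω)
          ext p; simp [hω]
      rw [lintegral_congr (hset fun ω => (ω k).1), lintegral_congr (hset fun _ => lam.prod lam),
        lintegral_indicator hA', lintegral_indicator hA',
        setLIntegral_rawSigma r hA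
          (measurableSet_Ioo.prod (MeasurableSet.inter hD measurableSet_Iic))
          (fun p hp => ⟨hp.1.1, mem_univ _⟩) k, lintegral_const, Measure.restrict_apply_univ]
      ring
  have l1 : ∫⁻ ω, ∫⁻ p in Ioo 0 t ×ˢ Iic b, g (mk p.1 ω, p.2) ∂(ω k).1 ∂canonLaw κ r =
      ∫⁻ x, g x ∂M1 := by
    rw [hM1, Measure.lintegral_bind hK.aemeasurable hg.aemeasurable]
    refine lintegral_congr fun ω => ?_
    rw [pastNoise, lintegral_map hg (measurable_section _)]
    rfl
  have l2 : (r : ℝ≥0∞) * ∫⁻ ω, ∫⁻ p in Ioo 0 t ×ˢ Iic b, g (mk p.1 ω, p.2) ∂(lam.prod lam)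
      ∂canonLaw κ r = ∫⁻ x, g x ∂M2 := by
    have hgm : Measurable fun q : Canon κ × (ℝ≥0 × ℝ≥0) => g (mk q.2.1 q.1, q.2.2) := hg.comp hm
    rw [hM2, lintegral_smul_measure, lintegral_map hg hm, smul_eq_mul,
      lintegral_prod _ hgm.aemeasurable]
  rw [l1, l2, key]

/-! ### Removing the completion -/

/-- A set which is predictable for the completed filtration is, up to a null set of sample points,
predictable for the uncompleted filtration. -/
theorem exists_raw_set [Fintype κ] (r : ℝ≥0) {S : Set (ℝ≥0 × Canon κ)}
    (hS : MeasurableSet[(canonFiltration κ r).predictable] S) :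
    ∃ S' : Set (Hist κ), MeasurableSet S' ∧
      ∀ᵐ ω ∂canonLaw κ r, ∀ t, (t, ω) ∈ S ↔ mk t ω ∈ S' := by
  refine MeasurableSpace.generateFrom_induction
    (C := {s | ∃ A, MeasurableSet[canonFiltration κ r ⊥] A ∧ s = {⊥} ×ˢ A} ∪
      {s | ∃ i A, MeasurableSet[canonFiltration κ r i] A ∧ s = Ioi i ×ˢ A})
    (p := fun S _ => ∃ S' : Set (Hist κ), MeasurableSet S' ∧
      ∀ᵐ ω ∂canonLaw κ r, ∀ t, (t, ω) ∈ S ↔ mk t ω ∈ S') ?_ ?_ ?_ ?_ S hS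
  · rintro _ (⟨A, ⟨B, hB, hAB⟩, rfl⟩ | ⟨i, A, ⟨B, hB, hAB⟩, rfl⟩) -
    · refine ⟨_, MeasurableSpace.measurableSet_generateFrom (Or.inl ⟨B, hB, rfl⟩), ?_⟩
      filter_upwards [hAB.mem_iff] with ω hω t
      change t = 0 ∧ ω ∈ A ↔ t = 0 ∧ ω ∈ B
      rw [hω]
    · refine ⟨_, measurableSet_Ioi hB, ?_⟩
      filter_upwards [hAB.mem_iff] with ω hω t
      change i < t ∧ ω ∈ A ↔ i < t ∧ ω ∈ B
      rw [hω]
  · exact ⟨∅, MeasurableSet.empty, by simp⟩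
  · rintro S - ⟨S', hS', h⟩
    refine ⟨S'ᶜ, hS'.compl, ?_⟩
    filter_upwards [h] with ω hω t
    exact not_congr (hω t)
  · intro f _ hf
    choose S' hS' h using hf
    refine ⟨⋃ n, S' n, MeasurableSet.iUnion hS', ?_⟩
    filter_upwards [ae_all_iff.2 h] with ω hω t
    simp only [mem_iUnion]
    exact exists_congr fun n => hω n t

/-- A process which is predictable for the completed filtration is indistinguishable from one which
is predictable for the uncompleted filtration. -/
theorem exists_raw_version [Fintype κ] (r : ℝ≥0) {u : ℝ≥0 × Canon κ → κ → ℝ≥0}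
    (hu : Measurable[(canonFiltration κ r).predictable] u) :
    ∃ u' : Hist κ → κ → ℝ≥0, Measurable u' ∧ ∀ᵐ ω ∂canonLaw κ r, ∀ t, u (t, ω) = u' (mk t ω) := by
  have hS : ∀ (k : κ) (q : ℚ), MeasurableSet[(canonFiltration κ r).predictable]
      {p | Real.toNNReal q < u p k} := fun k q =>
    hu ((measurable_pi_apply k) (_root_.measurableSet_Ioi (a := Real.toNNReal q)))
  choose S' hS' h using fun k q => exists_raw_set r (hS k q)
  classical
  refine ⟨fun h k => (⨆ q : ℚ, if h ∈ S' k q then (Real.toNNReal q : ℝ≥0∞) else 0).toNNReal,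
    measurable_pi_lambda _ fun k => ?_, ?_⟩
  · exact (Measurable.iSup fun q => Measurable.ite (hS' k q) measurable_const
      measurable_const).ennreal_toNNReal
  · have h' := ae_all_iff.2 fun k => ae_all_iff.2 (h k)
    filter_upwards [h'] with ω hω t
    ext k : 1
    have : (⨆ q : ℚ, if mk t ω ∈ S' k q then (Real.toNNReal q : ℝ≥0∞) else 0) = u (t, ω) k := by
      refine le_antisymm (iSup_le fun q => ?_) (le_of_forall_lt fun c hc => ?_)
      · split_ifs with hq
        · have := (hω k q t).2 hq
          exact_mod_cast (le_of_lt this)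
        · exact zero_le
      · lift c to ℝ≥0 using (hc.trans_le le_top).ne
        rw [ENNReal.coe_lt_coe] at hc
        obtain ⟨q, -, hq1, hq2⟩ := (NNReal.lt_iff_exists_rat_btwn _ _).1 hc
        refine lt_of_lt_of_le (ENNReal.coe_lt_coe.2 hq1) (le_trans (le_of_eq ?_) (le_iSup _ q))
        rw [if_pos ((hω k q t).1 hq2)]
    rw [this, ENNReal.toNNReal_coe]

/-- Predictability for the uncompleted filtration implies predictability for the completed one. -/
theorem measurable_completed [Fintype κ] (r : ℝ≥0) {β : Type*} [MeasurableSpace β]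
    {u : Hist κ → β} (hu : Measurable u) :
    Measurable[(canonFiltration κ r).predictable] fun p : ℝ≥0 × Canon κ => u (mk p.1 p.2) := by
  refine Measurable.mono hu ?_ le_rfl
  refine measurableSpace_le_predictable_of_measurableSet ?_ ?_
  · intro A hA
    exact measurableSet_predictable_singleton_bot_prod ⟨A, hA, EventuallyEq.rfl⟩
  · intro i A hA
    exact measurableSet_predictable_Ioi_prod ⟨A, hA, EventuallyEq.rfl⟩

end Hist

/-! ### Jump paths driven by a point configuration -/

section Paths

variable {κ : Type*} {E : Type*}

/-- No point at a level at most `b` occurs strictly between the times `a` and `t`. -/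
def Quiet (ω : Canon κ) (b a t : ℝ≥0) : Prop := ∀ k, (ω k).1 (Ioo a t ×ˢ Iic b) = 0

theorem Quiet.mono {ω : Canon κ} {b a t a' t' : ℝ≥0} (h : Quiet ω b a t) (ha : a ≤ a')
    (ht : t' ≤ t) : Quiet ω b a' t' :=
  fun k => measure_mono_null (prod_mono_left (Ioo_subset_Ioo ha ht)) (h k)

theorem Regular.eq_zero_of_lt_one [Fintype κ] {ω : Canon κ} (hω : Regular ω) {k : κ}
    {s : Set (ℝ≥0 × ℝ≥0)}
    (hs : MeasurableSet s) {a b : ℝ≥0} (hsub : s ⊆ Iic a ×ˢ Iic b) (h : (ω k).1 s < 1) :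
    (ω k).1 s = 0 := by
  obtain ⟨m, hm⟩ := exists_nat_ge (max a b)
  obtain ⟨j, hj⟩ := hω.nat k hs m (hsub.trans (prod_mono
    (Iic_subset_Iic.2 ((le_max_left a b).trans hm))
      (Iic_subset_Iic.2 ((le_max_right a b).trans hm))))
  rw [hj] at h ⊢
  norm_cast at h ⊢
  omega

theorem Regular.eventually_null [Fintype κ] {ω : Canon κ} (hω : Regular ω) (s : ℕ → Set (ℝ≥0 × ℝ≥0))
    (hs : ∀ n, MeasurableSet (s n)) {a b : ℝ≥0} (hsub : ∀ n, s n ⊆ Iic a ×ˢ Iic b)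
    (hanti : Antitone s) (hemp : ⋂ n, s n = ∅) : ∃ n, ∀ k, (ω k).1 (s n) = 0 := by
  have h : ∀ k, ∀ᶠ n in atTop, (ω k).1 (s n) = 0 := by
    intro k
    have := tendsto_measure_iInter_atTop (μ := (ω k).1) (fun n => (hs n).nullMeasurableSet) hanti
      ⟨0, (pointSpace_box_lt_top (ω k) (hsub 0)).ne⟩
    rw [hemp, measure_empty] at this
    filter_upwards [this.eventually (gt_mem_nhds zero_lt_one)] with n hn
    exact hω.eq_zero_of_lt_one (hs n) (hsub n) hn
  exact (eventually_all.2 h).exists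

theorem Regular.exists_quiet_right [Fintype κ] {ω : Canon κ} (hω : Regular ω) (b t : ℝ≥0) :
    ∃ t', t < t' ∧ Quiet ω b t t' := by
  have hex : ∃ n : ℕ, ∀ k, (ω k).1 (Ioo t (t + 1 / ((n : ℝ≥0) + 1)) ×ˢ Iic b) = 0 := by
    refine hω.eventually_null (fun n : ℕ => Ioo t (t + 1 / ((n : ℝ≥0) + 1)) ×ˢ Iic b)
      (fun n => measurableSet_Ioo.prod measurableSet_Iic) (a := t + 1) (b := b) ?_ ?_ ?_
    · rintro n p ⟨h1, h2⟩
      refine ⟨h1.2.le.trans (add_le_add_right ?_ _), h2⟩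
      rw [div_le_iff₀ (by positivity)]
      simp
    · intro n m hnm
      refine prod_mono_left (Ioo_subset_Ioo_right (add_le_add_right ?_ _))
      exact one_div_le_one_div_of_le (by positivity) (by gcongr)
    · refine eq_empty_of_forall_notMem fun p hp => ?_
      rw [mem_iInter] at hp
      have h0 : 0 < (p.1 : ℝ) - t := sub_pos.2 (by exact_mod_cast (hp 0).1.1)
      obtain ⟨n, hn⟩ := exists_nat_one_div_lt h0
      have := (hp n).1.2
      have h2 : (p.1 : ℝ) < t + 1 / (n + 1) := by exact_mod_cast this
      linarith
  obtain ⟨n, hn⟩ := hex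
  exact ⟨t + 1 / (n + 1), lt_add_of_pos_right _ (by positivity), hn⟩

theorem Regular.exists_quiet_left [Fintype κ] {ω : Canon κ} (hω : Regular ω) (b : ℝ≥0)
    {t : ℝ≥0} (ht : 0 < t) : ∃ a, a < t ∧ Quiet ω b a t := by
  have hex : ∃ n : ℕ, ∀ k, (ω k).1 (Ioo (t - t / ((n : ℝ≥0) + 1)) t ×ˢ Iic b) = 0 := by
    refine hω.eventually_null (fun n : ℕ => Ioo (t - t / ((n : ℝ≥0) + 1)) t ×ˢ Iic b)
      (fun n => measurableSet_Ioo.prod measurableSet_Iic) (a := t) (b := b) ?_ ?_ ?_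
    · rintro n p ⟨h1, h2⟩
      exact ⟨h1.2.le, h2⟩
    · intro n m hnm
      refine prod_mono_left (Ioo_subset_Ioo_left (tsub_le_tsub_left ?_ _))
      exact div_le_div_of_nonneg_left zero_le (by positivity) (by gcongr)
    · refine eq_empty_of_forall_notMem fun p hp => ?_
      rw [mem_iInter] at hp
      have ht' : (0 : ℝ) < t := by exact_mod_cast ht
      have h0 : 0 < ((t : ℝ) - p.1) / t :=
        div_pos (sub_pos.2 (by exact_mod_cast (hp 0).1.2)) ht'
      obtain ⟨n, hn⟩ := exists_nat_one_div_lt h0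
      have h1 := (hp n).1.1
      rw [lt_div_iff₀ ht'] at hn
      have h2 : t < p.1 + t / (n + 1) := by
        rwa [tsub_lt_iff_right] at h1
        rw [div_le_iff₀ (by positivity)]
        exact le_mul_of_one_le_right zero_le (by simp)
      have h3 : (t : ℝ) < p.1 + t / (n + 1) := by exact_mod_cast h2
      have h4 : 1 / ((n : ℝ) + 1) * t = t / (n + 1) := by ring
      linarith
  obtain ⟨n, hn⟩ := hex
  exact ⟨t - t / (n + 1), tsub_lt_self ht (by positivity), hn⟩

/-- Induction along the points of a configuration: a property of times which holds at `0` and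
propagates over intervals whose interior contains no point holds at all times. -/
theorem Regular.step_induction [Fintype κ] {ω : Canon κ} (hω : Regular ω) (b : ℝ≥0)
    {P : ℝ≥0 → Prop} (h0 : P 0)
    (step : ∀ a t, a < t → Quiet ω b a t → P a → P t) (t : ℝ≥0) : P t := by
  by_contra hP
  set B : Set ℝ≥0 := {t | ¬ P t} with hB
  have hne : B.Nonempty := ⟨t, hP⟩
  set s := sInf B with hs
  have hlt : ∀ a < s, P a := fun a ha => by
    by_contra hPa
    exact (csInf_le (OrderBot.bddBelow B) hPa).not_gt ha
  have hPs : P s := by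
    rcases eq_or_ne s 0 with hs0 | hs0
    · rwa [hs0]
    · obtain ⟨a, ha, hq⟩ := hω.exists_quiet_left b (pos_iff_ne_zero.2 hs0)
      exact step a s ha hq (hlt a ha)
  obtain ⟨t', ht', hq⟩ := hω.exists_quiet_right b s
  obtain ⟨c, hc, hct⟩ := exists_lt_of_csInf_lt hne ht'
  have hsc : s ≤ c := csInf_le (OrderBot.bddBelow B) hc
  rcases hsc.eq_or_lt with h | h
  · exact hc (h ▸ hPs)
  · exact hc (step s c h (hq.mono le_rfl hct.le) hPs)

/-- At a given positive time there is at most one point below given levels, for all noises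
together. -/
theorem Regular.atom_cases [Fintype κ] {ω : Canon κ} (hω : Regular ω) {a b : ℝ≥0} (ha : 0 < a)
    {v : κ → ℝ≥0}
    (hv : ∀ k, v k ≤ b) : (∀ k, (ω k).1 ({a} ×ˢ Iic (v k)) = 0) ∨
      ∃ k₀, (ω k₀).1 ({a} ×ˢ Iic (v k₀)) = 1 ∧ ∀ k, k ≠ k₀ → (ω k).1 ({a} ×ˢ Iic (v k)) = 0 := by
  have hle : ∑ k, (ω k).1 ({a} ×ˢ Iic (v k)) ≤ 1 :=
    (Finset.sum_le_sum fun k _ => measure_mono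
      (prod_mono_right (Iic_subset_Iic.2 (hv k)))).trans (hω.simple a ha b)
  by_cases h : ∀ k, (ω k).1 ({a} ×ˢ Iic (v k)) = 0
  · exact Or.inl h
  · right
    push Not at h
    obtain ⟨k₀, hk₀⟩ := h
    have hms : ∀ k, MeasurableSet ({a} ×ˢ Iic (v k) : Set (ℝ≥0 × ℝ≥0)) := fun k =>
      (measurableSet_singleton a).prod measurableSet_Iic
    have hss : ∀ k, ({a} ×ˢ Iic (v k) : Set (ℝ≥0 × ℝ≥0)) ⊆ Iic a ×ˢ Iic b := fun k =>
      prod_mono (by simp) (Iic_subset_Iic.2 (hv k))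
    have h1 : 1 ≤ (ω k₀).1 ({a} ×ˢ Iic (v k₀)) := by
      by_contra hlt
      exact hk₀ (hω.eq_zero_of_lt_one (hms k₀) (hss k₀) (not_le.1 hlt))
    have h2 : (ω k₀).1 ({a} ×ˢ Iic (v k₀)) = 1 :=
      le_antisymm ((Finset.single_le_sum (f := fun k => (ω k).1 ({a} ×ˢ Iic (v k)))
        (fun k _ => zero_le) (Finset.mem_univ k₀)).trans hle) h1
    refine ⟨k₀, h2, fun k hk => ?_⟩
    classical
    have h3 : (ω k₀).1 ({a} ×ˢ Iic (v k₀)) + (ω k).1 ({a} ×ˢ Iic (v k)) ≤ 1 := by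
      refine le_trans ?_ hle
      rw [← Finset.sum_pair (f := fun k => (ω k).1 ({a} ×ˢ Iic (v k))) hk.symm]
      exact Finset.sum_le_sum_of_subset (Finset.subset_univ _)
    rw [h2] at h3
    by_contra h4
    exact absurd h3 (not_le.2 (ENNReal.lt_add_right ENNReal.one_ne_top h4))

theorem Quiet.restrict_eq {ω : Canon κ} {b a t : ℝ≥0} (h : Quiet ω b a t) (ha : 0 < a) (hat : a < t)
    (k : κ) : (ω k).1.restrict (Ioo 0 t ×ˢ Iic b) =
      (ω k).1.restrict (Ioo 0 a ×ˢ Iic b) + (ω k).1.restrict ({a} ×ˢ Iic b) := by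
  rw [← Measure.restrict_union]
  · have hU : Ioo 0 t ×ˢ Iic b = (Ioo 0 a ×ˢ Iic b ∪ {a} ×ˢ Iic b) ∪ Ioo a t ×ˢ Iic b := by
      rw [← union_prod, ← union_prod]
      congr 1
      ext s
      simp only [mem_Ioo, mem_union, mem_singleton_iff]
      constructor
      · rintro ⟨h1, h2⟩
        rcases lt_trichotomy s a with h3 | h3 | h3
        · exact Or.inl (Or.inl ⟨h1, h3⟩)
        · exact Or.inl (Or.inr h3)
        · exact Or.inr ⟨h3, h2⟩
      · rintro ((⟨h1, h2⟩ | rfl) | ⟨h1, h2⟩)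
        · exact ⟨h1, h2.trans hat⟩
        · exact ⟨ha, hat⟩
        · exact ⟨ha.trans h1, h2⟩
    rw [hU]
    refine Measure.restrict_congr_set ?_
    exact union_ae_eq_left_of_ae_eq_empty (ae_eq_empty.2 (h k))
  · refine disjoint_left.2 fun p hp hp' => ?_
    exact absurd hp.1.2 (by rw [mem_singleton_iff.1 hp'.1]; exact lt_irrefl _)
  · exact (measurableSet_singleton a).prod measurableSet_Iic

theorem Quiet.restrict_zero {ω : Canon κ} {b t : ℝ≥0} (h : Quiet ω b 0 t) (k : κ) :
    (ω k).1.restrict (Ioo 0 t ×ˢ Iic b) = 0 := Measure.restrict_eq_zero.2 (h k)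

/-- `L` is the left-continuous version of the pure jump path started at `y₀` which moves from `y`
to `next y k` at the time `a` of each point of the `k`-th noise whose level is at most `v a y k`.
The levels are assumed to be bounded by `b`. -/
structure IsJumpPath (next : E → κ → E) (b : ℝ≥0) (ω : Canon κ) (v : ℝ≥0 → E → κ → ℝ≥0) (y₀ : E)
    (L : ℝ≥0 → E) : Prop where
  zero : L 0 = y₀
  stay : ∀ a t, a < t → Quiet ω b a t →
    (0 < a → ∀ k, (ω k).1 ({a} ×ˢ Iic (v a (L a) k)) = 0) → L t = L a
  jump : ∀ a t k, 0 < a → a < t → Quiet ω b a t →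
    (ω k).1 ({a} ×ˢ Iic (v a (L a) k)) ≠ 0 → L t = next (L a) k

/-! ### Existence of predictable jump paths -/

section Existence

open Hist

/-- The number of points before the current time which are found when the path `f` is in the state
`y`, and at which the `k`-th jump out of `y` is accepted. -/
def acceptedCount (b : ℝ≥0) (v : Hist κ → E → κ → ℝ≥0) (f : Hist κ → E) (k : κ) (y : E)
    (h : Hist κ) : ℝ≥0∞ :=
  (h.noise k).1 {p | (p.1 ∈ Ioo 0 h.time ∧ p.2 ≤ b) ∧
    (mk p.1 h.noise, p.2) ∈ {q : Hist κ × ℝ≥0 | f q.1 = y ∧ q.2 ≤ v q.1 y k}}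

/-- The unit vector of the initial state plus the jumps of the unit vectors along the accepted
points. -/
def jumpSum [Fintype κ] [Fintype E] [DecidableEq E] (next : E → κ → E) (b : ℝ≥0)
    (v : Hist κ → E → κ → ℝ≥0) (y₀ : E) (f : Hist κ → E)
    (h : Hist κ) : E → ℝ :=
  Pi.single y₀ 1 + ∑ k, ∑ y, (acceptedCount b v f k y h).toReal •
    (Pi.single (next y k) 1 - Pi.single y 1)

/-- The state encoded by a unit vector; vectors of other form are sent to `y₀`. -/
def decode [DecidableEq E] (y₀ : E) (x : E → ℝ) : E :=
  haveI := Classical.propDecidable (∃ y, x = Pi.single y 1)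
  if h : ∃ y, x = Pi.single y 1 then h.choose else y₀

theorem decode_single [DecidableEq E] (y₀ y : E) : decode y₀ (Pi.single y (1 : ℝ)) = y := by
  have h : ∃ y', (Pi.single y (1 : ℝ) : E → ℝ) = Pi.single y' 1 := ⟨y, rfl⟩
  unfold decode
  rw [dif_pos h]
  have := congr_fun h.choose_spec y
  rw [Pi.single_eq_same] at this
  by_contra hne
  rw [Pi.single_eq_of_ne (Ne.symm hne)] at this
  exact one_ne_zero this

theorem measurable_decode [Fintype E] [DecidableEq E] [MeasurableSpace E] (y₀ : E) :
    Measurable (decode y₀) := by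
  classical
  intro T _
  have : decode y₀ ⁻¹' T = (⋃ y ∈ T, {Pi.single y (1 : ℝ)}) ∪
      (if y₀ ∈ T then (range fun y : E => (Pi.single y (1 : ℝ) : E → ℝ))ᶜ else ∅) := by
    ext x
    by_cases hx : ∃ y, x = Pi.single y 1
    · obtain ⟨y, rfl⟩ := hx
      rw [mem_preimage, decode_single]
      constructor
      · intro hy
        exact Or.inl (mem_biUnion hy rfl)
      · rintro (h | h)
        · simp only [mem_iUnion, mem_singleton_iff] at h
          obtain ⟨y', hy', h⟩ := h
          have := congr_arg (decode y₀) h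
          rw [decode_single, decode_single] at this
          rwa [this]
        · split_ifs at h
          · exact absurd (mem_range_self y) h
          · exact absurd h (notMem_empty _)
    · have hd : decode y₀ x = y₀ := dif_neg hx
      rw [mem_preimage, hd]
      have h1 : x ∉ ⋃ y ∈ T, {Pi.single y (1 : ℝ)} := by
        simp only [mem_iUnion, mem_singleton_iff]
        rintro ⟨y, -, h⟩
        exact hx ⟨y, h⟩
      have h2 : x ∈ (range fun y : E => (Pi.single y (1 : ℝ) : E → ℝ))ᶜ := by
        rintro ⟨y, h⟩
        exact hx ⟨y, h.symm⟩
      by_cases hy : y₀ ∈ T <;> simp only [hy, if_true, if_false, mem_union, h1, h2,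
        notMem_empty, or_true, or_false]
  rw [this]
  refine MeasurableSet.union ?_ ?_
  · exact (Set.toFinite T).measurableSet_biUnion fun y _ => measurableSet_singleton _
  · split_ifs
    · exact (Set.finite_range _).measurableSet.compl
    · exact MeasurableSet.empty

theorem measurableSet_accepted [MeasurableSpace E] [MeasurableSingletonClass E]
    {v : Hist κ → E → κ → ℝ≥0} (hv : ∀ y k, Measurable fun h => v h y k) {f : Hist κ → E}
    (hf : Measurable f) (k : κ) (y : E) :
    MeasurableSet {q : Hist κ × ℝ≥0 | f q.1 = y ∧ q.2 ≤ v q.1 y k} := by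
  have h1 : MeasurableSet {q : Hist κ × ℝ≥0 | f q.1 = y} :=
    (hf.comp measurable_fst) (measurableSet_singleton y)
  have h2 : MeasurableSet {q : Hist κ × ℝ≥0 | q.2 ≤ v q.1 y k} :=
    measurableSet_le measurable_snd ((hv y k).comp measurable_fst)
  exact h1.inter h2

theorem measurable_jumpSum [Fintype κ] [Fintype E] [DecidableEq E] [MeasurableSpace E]
    [MeasurableSingletonClass E] (next : E → κ → E)
    (b : ℝ≥0) {v : Hist κ → E → κ → ℝ≥0} (hv : ∀ y k, Measurable fun h => v h y k) (y₀ : E)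
    {f : Hist κ → E} (hf : Measurable f) : Measurable (jumpSum next b v y₀ f) := by
  refine measurable_const.add (Finset.measurable_sum _ fun k _ => Finset.measurable_sum _
    fun y _ => ?_)
  exact (measurable_count k b (measurableSet_accepted hv hf k y)).ennreal_toReal.smul_const _

theorem acceptedCount_zero (b : ℝ≥0) (v : Hist κ → E → κ → ℝ≥0) (f : Hist κ → E) (k : κ) (y : E)
    {ω : Canon κ} {t : ℝ≥0} (h : Quiet ω b 0 t) : acceptedCount b v f k y (mk t ω) = 0 :=
  measure_mono_null (t := Ioo 0 t ×ˢ Iic b) (fun _ hp => ⟨hp.1.1, hp.1.2⟩) (h k)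

theorem acceptedCount_step [DecidableEq E] [MeasurableSpace E] [MeasurableSingletonClass E]
    {b : ℝ≥0}
    {v : Hist κ → E → κ → ℝ≥0} (hv : ∀ y k, Measurable fun h => v h y k)
    (hb : ∀ h y k, v h y k ≤ b) {f : Hist κ → E} (hf : Measurable f) (k : κ) (y : E) {ω : Canon κ}
    {a t : ℝ≥0} (ha : 0 < a) (hat : a < t) (h : Quiet ω b a t) :
    acceptedCount b v f k y (mk t ω) = acceptedCount b v f k y (mk a ω) +
      if f (mk a ω) = y then (ω k).1 ({a} ×ˢ Iic (v (mk a ω) y k)) else 0 := by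
  have hA := measurable_section ω (measurableSet_accepted hv hf k y)
  have e : ∀ s : ℝ≥0, acceptedCount b v f k y (mk s ω) = (ω k).1.restrict (Ioo 0 s ×ˢ Iic b)
      ((fun p : ℝ≥0 × ℝ≥0 => (mk p.1 ω, p.2)) ⁻¹' {q | f q.1 = y ∧ q.2 ≤ v q.1 y k}) := by
    intro s
    rw [Measure.restrict_apply hA, inter_comm]
    rfl
  rw [e, e, h.restrict_eq ha hat, Measure.add_apply]
  congr 1
  rw [Measure.restrict_apply hA]
  split_ifs with hy
  · congr 1
    ext p
    simp only [mem_inter_iff, mem_preimage, mem_ofPred_eq, mem_prod, mem_singleton_iff, mem_Iic]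
    constructor
    · rintro ⟨⟨-, h1⟩, h2, -⟩
      rw [h2] at h1
      exact ⟨h2, h1⟩
    · rintro ⟨h1, h2⟩
      rw [h1]
      exact ⟨⟨hy, h2⟩, rfl, h2.trans (hb _ _ _)⟩
  · convert! measure_empty (μ := (ω k).1)
    ext p
    simp only [mem_inter_iff, mem_preimage, mem_ofPred_eq, mem_prod, mem_singleton_iff, mem_Iic,
      mem_empty_iff_false, iff_false]
    rintro ⟨⟨h1, -⟩, h2, -⟩
    rw [h2] at h1
    exact hy h1

/-- Successive approximations of the jump path. -/
def approxPath [Fintype κ] [Fintype E] [DecidableEq E] (next : E → κ → E) (b : ℝ≥0)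
    (v : Hist κ → E → κ → ℝ≥0) (y₀ : E) : ℕ → Hist κ → E
  | 0 => fun _ => y₀
  | j + 1 => fun h => decode y₀ (jumpSum next b v y₀ (approxPath next b v y₀ j) h)

theorem measurable_approxPath [Fintype κ] [Fintype E] [DecidableEq E] [MeasurableSpace E]
    [MeasurableSingletonClass E] (next : E → κ → E)
    (b : ℝ≥0) {v : Hist κ → E → κ → ℝ≥0} (hv : ∀ y k, Measurable fun h => v h y k) (y₀ : E)
    (j : ℕ) : Measurable (approxPath next b v y₀ j) := by
  induction j with
  | zero => exact measurable_const
  | succ j ih => exact (measurable_decode y₀).comp (measurable_jumpSum next b hv y₀ ih)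

theorem atom_ne_top {ω : Canon κ} (k : κ) {a c : ℝ≥0} : (ω k).1 ({a} ×ˢ Iic c) ≠ ∞ :=
  (pointSpace_box_lt_top (ω k) (a := a) (b := c) (prod_mono (by simp) subset_rfl)).ne

theorem acceptedCount_ne_top (b : ℝ≥0) (v : Hist κ → E → κ → ℝ≥0) (f : Hist κ → E) (k : κ) (y : E)
    (h : Hist κ) : acceptedCount b v f k y h ≠ ∞ :=
  (pointSpace_box_lt_top (h.noise k) (a := h.time) (b := b) fun _ hp => ⟨hp.1.1.2.le, hp.1.2⟩).ne

theorem jumpSum_step [Fintype κ] [Fintype E] [DecidableEq E] [MeasurableSpace E]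
    [MeasurableSingletonClass E] (next : E → κ → E) {b : ℝ≥0}
    {v : Hist κ → E → κ → ℝ≥0} (hv : ∀ y k, Measurable fun h => v h y k)
    (hb : ∀ h y k, v h y k ≤ b) (y₀ : E) {f : Hist κ → E} (hf : Measurable f) {ω : Canon κ}
    {a t : ℝ≥0} (ha : 0 < a) (hat : a < t) (h : Quiet ω b a t) :
    jumpSum next b v y₀ f (mk t ω) = jumpSum next b v y₀ f (mk a ω) +
      ∑ k, ((ω k).1 ({a} ×ˢ Iic (v (mk a ω) (f (mk a ω)) k))).toReal •
        (Pi.single (next (f (mk a ω)) k) 1 - Pi.single (f (mk a ω)) 1) := by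
  unfold jumpSum
  rw [add_assoc, ← Finset.sum_add_distrib]
  congr 1
  refine Finset.sum_congr rfl fun k _ => ?_
  have : ∀ y, (acceptedCount b v f k y (mk t ω)).toReal =
    (acceptedCount b v f k y (mk a ω)).toReal +
      if f (mk a ω) = y then ((ω k).1 ({a} ×ˢ Iic (v (mk a ω) y k))).toReal else 0 := by
    intro y
    rw [acceptedCount_step hv hb hf k y ha hat h, ENNReal.toReal_add
      (acceptedCount_ne_top b v f k y (mk a ω))]
    · split_ifs <;> simp
    · split_ifs
      · exact atom_ne_top k
      · exact ENNReal.zero_ne_top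
  simp_rw [this, add_smul, Finset.sum_add_distrib]
  congr 1
  simp_rw [ite_smul, zero_smul]
  rw [Finset.sum_ite_eq Finset.univ (f (mk a ω)), if_pos (Finset.mem_univ _)]

/-- Existence of predictable jump paths.  The approximations stabilise, because each of them is
correct up to one more jump than the previous one. -/
theorem exists_jumpPath [Fintype κ] [Fintype E] [MeasurableSpace E] [MeasurableSingletonClass E]
    (next : E → κ → E) {b : ℝ≥0}
    {v : Hist κ → E → κ → ℝ≥0} (hv : ∀ y k, Measurable fun h => v h y k)
    (hb : ∀ h y k, v h y k ≤ b) (y₀ : E) : ∃ L : Hist κ → E, Measurable L ∧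
      ∀ ω, Regular ω → IsJumpPath next b ω (fun s => v (mk s ω)) y₀ (fun s => L (mk s ω)) := by
  classical
  set A := approxPath next b v y₀ with hA
  have hAm : ∀ j, Measurable (A j) := measurable_approxPath next b hv y₀
  set L : Hist κ → E := fun h =>
    if h' : ∃ y, ∀ᶠ j in atTop, A j h = y then h'.choose else y₀ with hL
  have hLeq : ∀ h y, (∀ᶠ j in atTop, A j h = y) → L h = y := by
    intro h y hy
    have h' : ∃ y, ∀ᶠ j in atTop, A j h = y := ⟨y, hy⟩
    simp only [hL, dif_pos h']
    obtain ⟨j, h1, h2⟩ := (hy.and h'.choose_spec).exists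
    exact h2.symm.trans h1
  have hset : ∀ y, MeasurableSet {h | ∀ᶠ j in atTop, A j h = y} := by
    intro y
    simp_rw [eventually_atTop]
    have : {h | ∃ i, ∀ j ≥ i, A j h = y} = ⋃ i, ⋂ j, ⋂ (_ : j ≥ i), A j ⁻¹' {y} := by
      ext h; simp
    rw [this]
    exact MeasurableSet.iUnion fun i => MeasurableSet.iInter fun j => MeasurableSet.iInter fun _ =>
      hAm j (measurableSet_singleton y)
  have hLm : Measurable L := by
    intro T _
    have : L ⁻¹' T = (⋃ y ∈ T, {h | ∀ᶠ j in atTop, A j h = y}) ∪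
        (if y₀ ∈ T then (⋃ y, {h | ∀ᶠ j in atTop, A j h = y})ᶜ else ∅) := by
      ext h
      by_cases h' : ∃ y, ∀ᶠ j in atTop, A j h = y
      · have h2 : h ∉ (⋃ y, {h | ∀ᶠ j in atTop, A j h = y})ᶜ := fun hh => hh (mem_iUnion.2 h')
        have h3 : h ∈ (⋃ y ∈ T, {h | ∀ᶠ j in atTop, A j h = y}) ↔ L h ∈ T := by
          simp only [mem_iUnion]
          constructor
          · rintro ⟨y, hy, hh⟩
            rwa [hLeq h y hh]
          · intro hh
            obtain ⟨y, hy⟩ := h'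
            exact ⟨y, by rwa [hLeq h y hy] at hh, hy⟩
        rw [mem_union, h3, mem_preimage]
        by_cases hy : y₀ ∈ T <;> simp only [hy, if_true, if_false, h2, notMem_empty, or_false]
      · have hd : L h = y₀ := dif_neg h'
        have h2 : h ∈ (⋃ y, {h | ∀ᶠ j in atTop, A j h = y})ᶜ := fun hh => h' (mem_iUnion.1 hh)
        have h3 : h ∉ (⋃ y ∈ T, {h | ∀ᶠ j in atTop, A j h = y}) := by
          simp only [mem_iUnion]
          rintro ⟨y, -, hh⟩
          exact h' ⟨y, hh⟩
        rw [mem_union, mem_preimage, hd]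
        by_cases hy : y₀ ∈ T <;> simp only [hy, if_true, if_false, h2, h3, notMem_empty, or_false,
          or_true]
    rw [this]
    refine MeasurableSet.union ?_ ?_
    · exact (Set.toFinite T).measurableSet_biUnion fun y _ => hset y
    · split_ifs
      · exact (MeasurableSet.iUnion hset).compl
      · exact MeasurableSet.empty
  refine ⟨L, hLm, fun ω hω => ?_⟩
  -- After finitely many steps, the approximations agree up to time `t`, and the sum of the jumps
  -- is a unit vector.
  have main : ∀ t, ∃ J, ∀ j ≥ J, (∀ s ≤ t, A j (mk s ω) = A J (mk s ω)) ∧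
      jumpSum next b v y₀ (A j) (mk t ω) = Pi.single (A J (mk t ω)) 1 := by
    refine hω.step_induction b ⟨1, fun j hj => ?_⟩ ?_
    · have h0 : ∀ f, jumpSum next b v y₀ f (mk 0 ω) = Pi.single y₀ 1 := by
        intro f
        unfold jumpSum
        simp_rw [acceptedCount_zero b v f _ _ (t := 0) (ω := ω) (fun k => by simp)]
        simp
      have hA0 : ∀ j ≥ 1, A j (mk 0 ω) = y₀ := by
        intro j hj
        obtain ⟨i, rfl⟩ := Nat.exists_eq_add_of_le' hj
        simp only [hA, approxPath, h0, decode_single]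
      constructor
      · intro s hs
        rw [nonpos_iff_eq_zero.1 hs, hA0 j hj, hA0 1 le_rfl]
      · rw [h0, hA0 1 le_rfl]
    · rintro a t hat hq ⟨J, hJ⟩
      -- the value after the (possible) jump at time `a`
      have hval : ∃ y, ∀ j ≥ J, ∀ s, a < s → s ≤ t →
          jumpSum next b v y₀ (A j) (mk s ω) = Pi.single y 1 := by
        rcases eq_or_ne a 0 with rfl | ha
        · refine ⟨y₀, fun j _ s _ hs => ?_⟩
          unfold jumpSum
          simp_rw [acceptedCount_zero b v (A j) _ _ (hq.mono le_rfl hs)]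
          simp
        · have ha := pos_iff_ne_zero.2 ha
          set z := A J (mk a ω) with hz
          have hform : ∀ j ≥ J, ∀ s, a < s → s ≤ t → jumpSum next b v y₀ (A j) (mk s ω) =
              Pi.single z 1 + ∑ k, ((ω k).1 ({a} ×ˢ Iic (v (mk a ω) z k))).toReal •
                (Pi.single (next z k) 1 - Pi.single z 1) := by
            intro j hj s hs hst
            rw [jumpSum_step next hv hb y₀ (hAm j) ha hs (hq.mono le_rfl hst), (hJ j hj).2,
              (hJ j hj).1 a le_rfl]
          rcases hω.atom_cases ha (v := v (mk a ω) z) (fun k => hb _ _ k) with h | ⟨k₀, h1, h2⟩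
          · refine ⟨z, fun j hj s hs hst => ?_⟩
            rw [hform j hj s hs hst]
            simp [h]
          · refine ⟨next z k₀, fun j hj s hs hst => ?_⟩
            rw [hform j hj s hs hst, Finset.sum_eq_single k₀ (fun k _ hk => by simp [h2 k hk])
              (fun h => absurd (Finset.mem_univ _) h), h1]
            simp
      obtain ⟨y, hy⟩ := hval
      have hAy : ∀ j ≥ J + 1, ∀ s, a < s → s ≤ t → A j (mk s ω) = y := by
        intro j hj s hs hst
        obtain ⟨i, rfl⟩ : ∃ i, j = i + 1 := ⟨j - 1, by omega⟩
        simp only [hA, approxPath]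
        rw [← hA, hy i (by omega) s hs hst, decode_single]
      refine ⟨J + 1, fun j hj => ⟨fun s hs => ?_, ?_⟩⟩
      · rcases le_or_gt s a with h | h
        · rw [(hJ j (by omega)).1 s h, (hJ (J + 1) (by omega)).1 s h]
        · rw [hAy j hj s h hs, hAy (J + 1) le_rfl s h hs]
      · rw [hy j (by omega) t hat le_rfl, hAy (J + 1) le_rfl t hat le_rfl]
  have hLs : ∀ t, ∃ J, ∀ j ≥ J, A j (mk t ω) = L (mk t ω) ∧
      jumpSum next b v y₀ (A j) (mk t ω) = Pi.single (L (mk t ω)) 1 := by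
    intro t
    obtain ⟨J, hJ⟩ := main t
    have : L (mk t ω) = A J (mk t ω) :=
      hLeq _ _ (eventually_atTop.2 ⟨J, fun j hj => (hJ j hj).1 t le_rfl⟩)
    exact ⟨J, fun j hj => ⟨by rw [this]; exact (hJ j hj).1 t le_rfl, by rw [this]; exact
      (hJ j hj).2⟩⟩
  have hinj : ∀ y y' : E, (Pi.single y (1 : ℝ) : E → ℝ) = Pi.single y' 1 → y = y' := by
    intro y y' h
    rw [← decode_single y₀ y, h, decode_single]
  have hstep : ∀ a t, 0 < a → a < t → Quiet ω b a t → (Pi.single (L (mk t ω)) 1 : E → ℝ) =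
      Pi.single (L (mk a ω)) 1 + ∑ k, ((ω k).1 ({a} ×ˢ Iic (v (mk a ω) (L (mk a ω)) k))).toReal •
        (Pi.single (next (L (mk a ω)) k) 1 - Pi.single (L (mk a ω)) 1) := by
    intro a t ha hat hq
    obtain ⟨J, hJ⟩ := hLs t
    obtain ⟨J', hJ'⟩ := hLs a
    have h1 := hJ (max J J') (le_max_left _ _)
    have h2 := hJ' (max J J') (le_max_right _ _)
    rw [← h1.2, jumpSum_step next hv hb y₀ (hAm _) ha hat hq, h2.2, h2.1]
  have hzero : ∀ t, Quiet ω b 0 t → L (mk t ω) = y₀ := by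
    intro t hq
    obtain ⟨J, hJ⟩ := hLs t
    refine hinj _ _ ?_
    rw [← (hJ J le_rfl).2]
    unfold jumpSum
    simp_rw [acceptedCount_zero b v (A J) _ _ hq]
    simp
  refine ⟨hzero 0 fun k => by simp, fun a t hat hq h => ?_, fun a t k ha hat hq h => ?_⟩
  · rcases eq_or_ne a 0 with rfl | ha
    · rw [hzero t hq, hzero 0 fun k => by simp]
    · refine hinj _ _ ?_
      rw [hstep a t (pos_iff_ne_zero.2 ha) hat hq]
      simp [h (pos_iff_ne_zero.2 ha)]
  · refine hinj _ _ ?_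
    rw [hstep a t ha hat hq]
    rcases hω.atom_cases ha (v := v (mk a ω) (L (mk a ω))) (fun k => hb _ _ k) with h' |
      ⟨k₀, h1, h2⟩
    · exact absurd (h' k) h
    · have hk : k = k₀ := by
        by_contra hk
        exact h (h2 k hk)
      subst hk
      rw [Finset.sum_eq_single k (fun k' _ hk => by simp [h2 k' hk])
        (fun h => absurd (Finset.mem_univ _) h), h1]
      simp

end Existence

end Paths

/-! ### Stochastic equations and jump paths -/

/-- A finite family of jumps on a set `E` of states, which is embedded in a Euclidean space such
that each jump is a translation.  The rate of the `k`-th jump is proportional to a coordinate of the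
current state, and the jump has to be possible only if this coordinate is positive. -/
structure JumpModel (κ ι E : Type*) where
  emb : E → ι → ℝ
  emb_injective : Function.Injective emb
  emb_nonneg : ∀ y i, 0 ≤ emb y i
  coord : κ → ι
  jump : κ → ι → ℝ
  next : E → κ → E
  emb_next : ∀ y k, 0 < emb y (coord k) → emb (next y k) = emb y + jump k

namespace JumpModel

variable {κ ι E : Type*} (M : JumpModel κ ι E)

/-- The coordinate of the state which determines the rate of the `k`-th jump. -/
def rate (y : E) (k : κ) : ℝ≥0 := (M.emb y (M.coord k)).toNNReal

theorem coe_rate (y : E) (k : κ) : (M.rate y k : ℝ) = M.emb y (M.coord k) :=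
  Real.coe_toNNReal _ (M.emb_nonneg _ _)

/-- `Y` is a right-continuous solution of the stochastic equation with control `u`, along the sample
point `ω`. -/
def Solves [Fintype κ] (ω : Canon κ) (u : ℝ≥0 → κ → ℝ≥0) (y₀ : E) (Y : ℝ≥0 → E) : Prop :=
  IsCadlag (fun t => M.emb (Y t)) ∧ ∀ t, M.emb (Y t) = M.emb y₀ + ∑ k, thinnedCount (ω k).1
    (fun s => Function.leftLim (fun t => M.emb (Y t)) s (M.coord k) * (u s k : ℝ)) t • M.jump k

end JumpModel

theorem leftLim_zero {ι : Type*} (g : ℝ≥0 → ι → ℝ) : Function.leftLim g 0 = g 0 := by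
  refine leftLim_eq_of_eq_bot g ?_
  have : Iio (0 : ℝ≥0) = ∅ := by ext; simp
  rw [this, nhdsWithin_empty]

theorem IsCadlag.tendsto_leftLim {ι : Type*} {g : ℝ≥0 → ι → ℝ} (hg : IsCadlag g) {t : ℝ≥0}
    (ht : 0 < t) : Tendsto g (𝓝[<] t) (𝓝 (Function.leftLim g t)) := by
  obtain ⟨l, hl⟩ := (hg t).2
  have : (𝓝[<] t).NeBot := nhdsLT_neBot_of_exists_lt ⟨0, ht⟩
  rwa [leftLim_eq_of_tendsto hl]

theorem IsCadlag.measurable_leftLim {ι : Type*} [Finite ι] {g : ℝ≥0 → ι → ℝ} (hg : IsCadlag g) :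
    Measurable (Function.leftLim g) := by
  have hm : ∀ n : ℕ, Measurable fun s : ℝ≥0 =>
      g (((⌈s * (n + 1)⌉₊ - 1 : ℕ) : ℝ≥0) / (n + 1)) := by
    intro n
    have h1 : Measurable fun m : ℕ => g (((m - 1 : ℕ) : ℝ≥0) / (n + 1)) := measurable_of_countable _
    have h2 : Measurable fun s : ℝ≥0 => ⌈s * (n + 1)⌉₊ :=
      Nat.measurable_ceil.comp (measurable_id.mul_const _)
    exact h1.comp h2
  refine measurable_of_tendsto_metrizable hm (tendsto_pi_nhds.2 fun s => ?_)
  rcases eq_or_ne s 0 with rfl | hs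
  · simp [leftLim_zero]
  · have hs := pos_iff_ne_zero.2 hs
    refine (hg.tendsto_leftLim hs).comp (tendsto_nhdsWithin_iff.2 ⟨?_, ?_⟩)
    · rw [← NNReal.tendsto_coe]
      have hlow : Tendsto (fun n : ℕ => (s : ℝ) - 1 / ((n : ℝ) + 1)) atTop (𝓝 s) := by
        simpa using tendsto_const_nhds.sub (tendsto_one_div_add_atTop_nhds_zero_nat (𝕜 := ℝ))
      refine tendsto_of_tendsto_of_tendsto_of_le_of_le hlow tendsto_const_nhds ?_ ?_
      · intro n
        have hn : (0 : ℝ) < n + 1 := by positivity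
        have h1 : ((s * (n + 1) : ℝ≥0) : ℝ) ≤ (⌈s * (n + 1)⌉₊ : ℝ) := by
          exact_mod_cast Nat.le_ceil (s * (n + 1 : ℝ≥0))
        have h2 : (⌈s * (n + 1)⌉₊ : ℝ) ≤ ((⌈s * (n + 1)⌉₊ - 1 : ℕ) : ℝ) + 1 := by
          exact_mod_cast (by omega : ⌈s * (n + 1)⌉₊ ≤ ⌈s * (n + 1)⌉₊ - 1 + 1)
        rw [NNReal.coe_mul, NNReal.coe_add, NNReal.coe_natCast, NNReal.coe_one] at h1
        dsimp only
        rw [NNReal.coe_div, NNReal.coe_add, NNReal.coe_natCast, NNReal.coe_natCast, NNReal.coe_one,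
          le_div_iff₀ hn, sub_mul, one_div, inv_mul_cancel₀ hn.ne']
        linarith
      · intro n
        have hn : (0 : ℝ) < n + 1 := by positivity
        have h0 : ⌈s * (n + 1)⌉₊ ≠ 0 := (Nat.ceil_pos.2 (by positivity)).ne'
        have h1 : ((⌈s * (n + 1)⌉₊ - 1 : ℕ) : ℝ≥0) < s * (n + 1) := Nat.lt_ceil.1 (by omega)
        have h2 : (((⌈s * (n + 1)⌉₊ - 1 : ℕ) : ℝ≥0) : ℝ) < s * (n + 1) := by exact_mod_cast h1
        push_cast
        rw [div_le_iff₀ hn]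
        push_cast at h2
        exact h2.le
    · refine Eventually.of_forall fun n => ?_
      have h0 : ⌈s * (n + 1)⌉₊ ≠ 0 := (Nat.ceil_pos.2 (by positivity)).ne'
      have h1 : ((⌈s * (n + 1)⌉₊ - 1 : ℕ) : ℝ≥0) < s * (n + 1) := Nat.lt_ceil.1 (by omega)
      rw [mem_Iio, div_lt_iff₀ (by positivity)]
      exact h1

/-- `L` is the left-continuous version of the right-continuous pure jump path `Y`, whose jumps occur
at points with level at most `b`. -/
structure IsRightVersion {κ E : Type*} (b : ℝ≥0) (ω : Canon κ) (Y L : ℝ≥0 → E) : Prop where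
  zero : L 0 = Y 0
  right : ∀ a t, a < t → Quiet ω b a t → ∀ s, a ≤ s → s < t → Y s = Y a
  left : ∀ a t, a < t → Quiet ω b a t → L t = Y a

section Accepted

variable {κ : Type*}

/-- The accepted points up to time `t`. -/
def acceptedSet (α : ℝ≥0 → ℝ≥0) (t : ℝ≥0) : Set (ℝ≥0 × ℝ≥0) := {p | p.1 ∈ Ioc 0 t ∧ p.2 ≤ α p.1}

theorem measurableSet_acceptedSet {α : ℝ≥0 → ℝ≥0} (hα : Measurable α) (t : ℝ≥0) :
    MeasurableSet (acceptedSet α t) := by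
  have h1 : MeasurableSet {p : ℝ≥0 × ℝ≥0 | p.1 ∈ Ioc 0 t} := measurable_fst measurableSet_Ioc
  have h2 : MeasurableSet {p : ℝ≥0 × ℝ≥0 | p.2 ≤ α p.1} :=
    measurableSet_le measurable_snd (hα.comp measurable_fst)
  exact h1.inter h2

theorem acceptedSet_ne_top (ω : Canon κ) (k : κ) {α : ℝ≥0 → ℝ≥0} {b : ℝ≥0} (hb : ∀ s, α s ≤ b)
    (t : ℝ≥0) : (ω k).1 (acceptedSet α t) ≠ ∞ :=
  (pointSpace_box_lt_top (ω k) (a := t) (b := b) fun p hp => ⟨hp.1.2, hp.2.trans (hb p.1)⟩).ne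

theorem thinnedCount_eq (ω : Canon κ) (k : κ) {α : ℝ≥0 → ℝ≥0} (hα : Measurable α) (t : ℝ≥0)
    {a : ℝ≥0 → ℝ} (ha : ∀ s, 0 < s → a s = α s) :
    thinnedCount (ω k).1 a t = ((ω k).1 (acceptedSet α t)).toReal := by
  have hm := measurableSet_acceptedSet hα t
  have hms : MeasurableSet (Ioc 0 t ×ˢ univ : Set (ℝ≥0 × ℝ≥0)) := measurableSet_Ioc.prod .univ
  unfold thinnedCount
  have h1 : ∀ p ∈ (Ioc 0 t ×ˢ univ : Set (ℝ≥0 × ℝ≥0)),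
      {p : ℝ≥0 × ℝ≥0 | (p.2 : ℝ) ≤ a p.1}.indicator (1 : ℝ≥0 × ℝ≥0 → ℝ) p =
        (acceptedSet α t).indicator 1 p := by
    rintro p ⟨hp, -⟩
    by_cases h : p.2 ≤ α p.1
    · rw [indicator_of_mem (show p ∈ acceptedSet α t from ⟨hp, h⟩), indicator_of_mem]
      rw [mem_ofPred_eq, ha p.1 hp.1]
      exact_mod_cast h
    · rw [indicator_of_notMem (fun h' : p ∈ acceptedSet α t => h h'.2), indicator_of_notMem]
      rw [mem_ofPred_eq, ha p.1 hp.1]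
      exact_mod_cast h
  rw [setIntegral_congr_fun hms h1, integral_indicator_one hm, measureReal_restrict_apply hm]
  have h2 : acceptedSet α t ⊆ Ioc 0 t ×ˢ univ := fun p hp => ⟨hp.1, mem_univ _⟩
  rw [inter_eq_self_of_subset_left h2]
  rfl

theorem Quiet.accepted_eq {ω : Canon κ} {b a t : ℝ≥0} (h : Quiet ω b a t) (k : κ) {α : ℝ≥0 → ℝ≥0}
    (hb : ∀ s, α s ≤ b) {s : ℝ≥0} (has : a ≤ s) (hst : s < t) :
    (ω k).1 (acceptedSet α s) = (ω k).1 (acceptedSet α a) := by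
  have hU : acceptedSet α s ⊆ acceptedSet α a ∪ Ioo a t ×ˢ Iic b := by
    intro p hp
    rcases le_or_gt p.1 a with h1 | h1
    · exact Or.inl ⟨⟨hp.1.1, h1⟩, hp.2⟩
    · exact Or.inr ⟨⟨h1, hp.1.2.trans_lt hst⟩, hp.2.trans (hb _)⟩
  refine le_antisymm ?_ (measure_mono fun p hp => ⟨⟨hp.1.1, hp.1.2.trans has⟩, hp.2⟩)
  refine (measure_mono hU).trans ((measure_union_le _ _).trans ?_)
  rw [h k, add_zero]

theorem Quiet.accepted_step {ω : Canon κ} {b a t : ℝ≥0} (h : Quiet ω b a t) (hat : a < t) (k : κ)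
    {α : ℝ≥0 → ℝ≥0} (hb : ∀ s, α s ≤ b) : (ω k).1 (acceptedSet α t) =
      (ω k).1 (acceptedSet α a) + (ω k).1 ({t} ×ˢ Iic (α t)) := by
  rw [← measure_union]
  · have ht : 0 < t := (zero_le).trans_lt hat
    refine le_antisymm ?_ (measure_mono ?_)
    · have hU : acceptedSet α t ⊆ (acceptedSet α a ∪ {t} ×ˢ Iic (α t)) ∪ Ioo a t ×ˢ Iic b := by
        intro p hp
        rcases le_or_gt p.1 a with h1 | h1
        · exact Or.inl (Or.inl ⟨⟨hp.1.1, h1⟩, hp.2⟩)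
        · rcases hp.1.2.eq_or_lt with h2 | h2
          · refine Or.inl (Or.inr ⟨h2, ?_⟩)
            rw [mem_Iic, ← h2]
            exact hp.2
          · exact Or.inr ⟨⟨h1, h2⟩, hp.2.trans (hb _)⟩
      refine (measure_mono hU).trans ((measure_union_le _ _).trans ?_)
      rw [h k, add_zero]
    · rintro p (hp | ⟨hp1, hp2⟩)
      · exact ⟨⟨hp.1.1, hp.1.2.trans hat.le⟩, hp.2⟩
      · rw [mem_singleton_iff] at hp1
        refine ⟨⟨by rwa [hp1], hp1.le⟩, ?_⟩
        rw [hp1]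
        exact hp2
  · refine disjoint_left.2 fun p hp hp' => ?_
    have h1 : p.1 = t := hp'.1
    exact absurd hp.1.2 (not_le.2 (h1 ▸ hat))
  · exact (measurableSet_singleton t).prod measurableSet_Iic

theorem Regular.atom_zero_level [Fintype κ] {ω : Canon κ} (hω : Regular ω) {a : ℝ≥0} (ha : 0 < a)
    (k : κ) : (ω k).1 ({a} ×ˢ Iic 0) = 0 :=
  measure_mono_null (prod_mono (by simpa using ha) (fun x hx => nonpos_iff_eq_zero.1 hx))
    (hω.level k)

end Accepted

namespace JumpModel

variable {κ ι E : Type*} (M : JumpModel κ ι E)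

/-- Along a regular sample point, the left limits of a solution of the stochastic equation form a
jump path. -/
theorem Solves.exists_jumpPath {M : JumpModel κ ι E} [Fintype κ] [Finite ι] [Finite E]
    {ω : Canon κ} (hω : Regular ω)
    {u : ℝ≥0 → κ → ℝ≥0} (hu : ∀ k, Measurable fun s => u s k) {b : ℝ≥0}
    (hb : ∀ s y k, M.rate y k * u s k ≤ b) {y₀ : E} {Y : ℝ≥0 → E} (hY : M.Solves ω u y₀ Y) :
    ∃ L, IsRightVersion b ω Y L ∧
      IsJumpPath M.next b ω (fun s y k => M.rate y k * u s k) y₀ L := by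
  obtain ⟨hc, heq⟩ := hY
  set g : ℝ≥0 → ι → ℝ := fun t => M.emb (Y t) with hg
  -- the left limits of the path are states, because there are only finitely many states
  have hmem : ∀ s, ∃ y, M.emb y = Function.leftLim g s := by
    intro s
    rcases eq_or_ne s 0 with rfl | hs
    · exact ⟨Y 0, (leftLim_zero g).symm⟩
    · have hs := pos_iff_ne_zero.2 hs
      have : (𝓝[<] s).NeBot := nhdsLT_neBot_of_exists_lt ⟨0, hs⟩
      exact (Set.finite_range M.emb).isClosed.mem_of_tendsto (hc.tendsto_leftLim hs)
        (Eventually.of_forall fun t => mem_range_self (Y t))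
  choose L hL using hmem
  set α : κ → ℝ≥0 → ℝ≥0 := fun k s => M.rate (L s) k * u s k with hα
  have hαm : ∀ k, Measurable (α k) := by
    intro k
    have h1 : Measurable fun s => (Function.leftLim g s (M.coord k)).toNNReal :=
      ((measurable_pi_apply _).comp hc.measurable_leftLim).real_toNNReal
    have h2 : ∀ s, α k s = (Function.leftLim g s (M.coord k)).toNNReal * u s k := by
      intro s
      simp only [hα, rate, hL]
    rw [show α k = _ from funext h2]
    exact h1.mul (hu k)
  have hαb : ∀ k s, α k s ≤ b := fun k s => hb s _ k
  have heq' : ∀ t, M.emb (Y t) = M.emb y₀ +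
      ∑ k, ((ω k).1 (acceptedSet (α k) t)).toReal • M.jump k := by
    intro t
    rw [heq t]
    congr 1
    refine Finset.sum_congr rfl fun k _ => ?_
    rw [thinnedCount_eq ω k (hαm k) t]
    intro s _
    simp only [hα, NNReal.coe_mul, coe_rate, hL]
  have hY0 : Y 0 = y₀ := by
    refine M.emb_injective ?_
    rw [heq' 0]
    have : ∀ k, acceptedSet (α k) 0 = ∅ := by
      intro k
      refine eq_empty_of_forall_notMem fun p hp => ?_
      exact absurd (hp.1.1.trans_le hp.1.2) (lt_irrefl _)
    simp [this]
  have hright : ∀ a t, a < t → Quiet ω b a t → ∀ s, a ≤ s → s < t → Y s = Y a := by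
    intro a t hat hq s has hst
    refine M.emb_injective ?_
    rw [heq', heq']
    simp_rw [hq.accepted_eq _ (hαb _) has hst]
  have hleft : ∀ a t, a < t → Quiet ω b a t → L t = Y a := by
    intro a t hat hq
    refine M.emb_injective ?_
    rw [hL]
    have ht : 0 < t := (zero_le).trans_lt hat
    have : (𝓝[<] t).NeBot := nhdsLT_neBot_of_exists_lt ⟨0, ht⟩
    refine leftLim_eq_of_tendsto ?_
    refine tendsto_const_nhds.congr' ?_
    filter_upwards [Ioo_mem_nhdsLT hat] with s hs
    rw [hg]
    dsimp only
    rw [hright a t hat hq s hs.1.le hs.2]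
  have hL0 : L 0 = Y 0 := M.emb_injective (by rw [hL, leftLim_zero])
  have hatom : ∀ a, 0 < a → M.emb (Y a) = M.emb (L a) +
      ∑ k, ((ω k).1 ({a} ×ˢ Iic (α k a))).toReal • M.jump k := by
    intro a ha
    obtain ⟨a', ha', hq⟩ := hω.exists_quiet_left b ha
    rw [hleft a' a ha' hq, heq', heq', add_assoc, ← Finset.sum_add_distrib]
    congr 1
    refine Finset.sum_congr rfl fun k _ => ?_
    rw [hq.accepted_step ha' k (hαb k), ENNReal.toReal_add (acceptedSet_ne_top ω k (hαb k) _)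
      (atom_ne_top k), add_smul]
  refine ⟨L, ⟨hL0, hright, hleft⟩, ⟨hL0.trans hY0, fun a t hat hq h => ?_,
    fun a t k ha hat hq h => ?_⟩⟩
  · rw [hleft a t hat hq]
    rcases eq_or_ne a 0 with rfl | ha
    · exact hL0.symm
    · refine M.emb_injective ?_
      have ha := pos_iff_ne_zero.2 ha
      rw [hatom a ha]
      have h' : ∀ k, (ω k).1 ({a} ×ˢ Iic (α k a)) = 0 := h ha
      simp [h']
  · rw [hleft a t hat hq]
    refine M.emb_injective ?_
    have h' : (ω k).1 ({a} ×ˢ Iic (α k a)) ≠ 0 := h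
    have hpos : 0 < M.emb (L a) (M.coord k) := by
      rw [← coe_rate, NNReal.coe_pos, pos_iff_ne_zero]
      intro h0
      apply h'
      have : α k a = 0 := by simp [hα, h0]
      rw [this]
      exact hω.atom_zero_level ha k
    rw [hatom a ha, M.emb_next _ _ hpos]
    congr 1
    rcases hω.atom_cases ha (v := fun k => α k a) (fun k => hαb k a) with h2 | ⟨k₀, h1, h2⟩
    · exact absurd (h2 k) h'
    · have hk : k = k₀ := by
        by_contra hk
        exact h' (h2 k hk)
      subst hk
      rw [Finset.sum_eq_single k (fun k' _ hk => by simp [h2 k' hk])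
        (fun h => absurd (Finset.mem_univ _) h), h1]
      simp

end JumpModel

theorem IsJumpPath.const {κ E : Type*} [Fintype κ] {next : E → κ → E} {b : ℝ≥0} {ω : Canon κ}
    {v : ℝ≥0 → E → κ → ℝ≥0} {y₀ : E} {L : ℝ≥0 → E} (hL : IsJumpPath next b ω v y₀ L) {a t : ℝ≥0}
    (hq : Quiet ω b a t) {s s' : ℝ≥0} (hs : a < s) (hst : s ≤ t) (hs' : a < s') (hst' : s' ≤ t) :
    L s = L s' := by
  by_cases h : 0 < a → ∀ k, (ω k).1 ({a} ×ˢ Iic (v a (L a) k)) = 0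
  · rw [hL.stay a s hs (hq.mono le_rfl hst) h, hL.stay a s' hs' (hq.mono le_rfl hst') h]
  · push Not at h
    obtain ⟨ha, k, hk⟩ := h
    rw [hL.jump a s k ha hs (hq.mono le_rfl hst) hk, hL.jump a s' k ha hs' (hq.mono le_rfl hst') hk]

theorem IsJumpPath.exists_rightVersion {κ E : Type*} [Fintype κ] {next : E → κ → E} {b : ℝ≥0}
    {ω : Canon κ} (hω : Regular ω) {v : ℝ≥0 → E → κ → ℝ≥0} {y₀ : E} {L : ℝ≥0 → E}
    (hL : IsJumpPath next b ω v y₀ L) : ∃ Y, IsRightVersion b ω Y L := by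
  choose t' ht' hq' using hω.exists_quiet_right b
  have key : ∀ a t, a < t → Quiet ω b a t → ∀ s, a ≤ s → s < t → L (t' s) = L t := by
    intro a t hat hq s has hst
    have h1 : L (t' s) = L (min (t' s) t) := hL.const (hq' s) (ht' s) le_rfl
      (lt_min (ht' s) hst) (min_le_left _ _)
    rw [h1]
    exact hL.const hq (has.trans_lt (lt_min (ht' s) hst)) (min_le_right _ _) hat le_rfl
  refine ⟨fun t => L (t' t), ?_, fun a t hat hq s has hst => ?_, fun a t hat hq => ?_⟩
  · exact (hL.stay 0 (t' 0) (ht' 0) (hq' 0) fun h => absurd h (lt_irrefl _)).symm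
  · rw [key a t hat hq s has hst, key a t hat hq a le_rfl hat]
  · exact (key a t hat hq a le_rfl hat).symm

namespace JumpModel

variable {κ ι E : Type*} (M : JumpModel κ ι E)

/-- The right-continuous version of a jump path solves the stochastic equation. -/
theorem solves_of_jumpPath [Fintype κ] [Finite E] [MeasurableSpace E] [MeasurableSingletonClass E]
    {ω : Canon κ} (hω : Regular ω) {u : ℝ≥0 → κ → ℝ≥0} (hu : ∀ k, Measurable fun s => u s k)
      {b : ℝ≥0}
    (hb : ∀ s y k, M.rate y k * u s k ≤ b) {y₀ : E} {L Y : ℝ≥0 → E} (hLm : Measurable L)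
    (hL : IsJumpPath M.next b ω (fun s y k => M.rate y k * u s k) y₀ L)
    (hY : IsRightVersion b ω Y L) : M.Solves ω u y₀ Y := by
  have hc : IsCadlag fun t => M.emb (Y t) := by
    intro t
    constructor
    · obtain ⟨t', ht', hq⟩ := hω.exists_quiet_right b t
      refine (continuousWithinAt_const (b := M.emb (Y t))).congr_of_eventuallyEq ?_ rfl
      filter_upwards [Ico_mem_nhdsGE ht'] with s hs
      rw [hY.right t t' ht' hq s hs.1 hs.2]
    · rcases eq_or_ne t 0 with rfl | ht
      · have : Iio (0 : ℝ≥0) = ∅ := by ext; simp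
        exact ⟨0, by rw [this, nhdsWithin_empty]; exact tendsto_bot⟩
      · obtain ⟨a, ha, hq⟩ := hω.exists_quiet_left b (pos_iff_ne_zero.2 ht)
        refine ⟨M.emb (Y a), tendsto_const_nhds.congr' ?_⟩
        filter_upwards [Ioo_mem_nhdsLT ha] with s hs
        rw [hY.right a t ha hq s hs.1.le hs.2]
  have hlim : ∀ s, 0 < s → Function.leftLim (fun t => M.emb (Y t)) s = M.emb (L s) := by
    intro s hs
    obtain ⟨a, ha, hq⟩ := hω.exists_quiet_left b hs
    have : (𝓝[<] s).NeBot := nhdsLT_neBot_of_exists_lt ⟨0, hs⟩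
    refine leftLim_eq_of_tendsto (tendsto_const_nhds.congr' ?_)
    filter_upwards [Ioo_mem_nhdsLT ha] with t ht
    rw [hY.right a s ha hq t ht.1.le ht.2, hY.left a s ha hq]
  set α : κ → ℝ≥0 → ℝ≥0 := fun k s => M.rate (L s) k * u s k with hα
  have hαm : ∀ k, Measurable (α k) := fun k =>
    ((measurable_of_finite fun y => M.rate y k).comp hLm).mul (hu k)
  have hαb : ∀ k s, α k s ≤ b := fun k s => hb s _ k
  have hthin : ∀ t k, thinnedCount (ω k).1
      (fun s => Function.leftLim (fun t => M.emb (Y t)) s (M.coord k) * (u s k : ℝ)) t =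
      ((ω k).1 (acceptedSet (α k) t)).toReal := by
    intro t k
    refine thinnedCount_eq ω k (hαm k) t fun s hs => ?_
    rw [hlim s hs]
    simp only [hα, NNReal.coe_mul, coe_rate]
  refine ⟨hc, ?_⟩
  simp_rw [hthin]
  have hatom : ∀ a, 0 < a → M.emb (Y a) = M.emb (L a) +
      ∑ k, ((ω k).1 ({a} ×ˢ Iic (α k a))).toReal • M.jump k := by
    intro a ha
    obtain ⟨t, hat, hq⟩ := hω.exists_quiet_right b a
    rw [← hY.left a t hat hq]
    rcases hω.atom_cases ha (v := fun k => α k a) (fun k => hαb k a) with h2 | ⟨k₀, h1, h2⟩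
    · rw [hL.stay a t hat hq fun _ => h2]
      simp [h2]
    · have hk : (ω k₀).1 ({a} ×ˢ Iic (α k₀ a)) ≠ 0 := by rw [h1]; exact one_ne_zero
      have hpos : 0 < M.emb (L a) (M.coord k₀) := by
        rw [← coe_rate, NNReal.coe_pos, pos_iff_ne_zero]
        intro h0
        apply hk
        have : α k₀ a = 0 := by simp [hα, h0]
        rw [this]
        exact hω.atom_zero_level ha k₀
      rw [hL.jump a t k₀ ha hat hq hk, M.emb_next _ _ hpos,
        Finset.sum_eq_single k₀ (fun k' _ hk => by simp [h2 k' hk])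
        (fun h => absurd (Finset.mem_univ _) h), h1]
      simp
  refine hω.step_induction b ?_ ?_
  · have : ∀ k, acceptedSet (α k) 0 = ∅ := by
      intro k
      refine eq_empty_of_forall_notMem fun p hp => ?_
      exact absurd (hp.1.1.trans_le hp.1.2) (lt_irrefl _)
    rw [← hY.zero, hL.zero]
    simp [this]
  · intro a t hat hq ha
    rw [hatom t ((zero_le).trans_lt hat), hY.left a t hat hq, ha, add_assoc,
      ← Finset.sum_add_distrib]
    congr 1
    refine Finset.sum_congr rfl fun k _ => ?_
    rw [hq.accepted_step hat k (hαb k), ENNReal.toReal_add (acceptedSet_ne_top ω k (hαb k) _)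
      (atom_ne_top k), add_smul]

end JumpModel

/-! ### Absorption in the target set -/

section Absorption

variable {κ E : Type*} [Fintype κ] {next : E → κ → E} {b : ℝ≥0} {ω : Canon κ}

open Classical in
/-- The levels for the process which is stopped in `K`. -/
def stopLevel (K : Set E) (v : ℝ≥0 → E → κ → ℝ≥0) (s : ℝ≥0) (y : E) (k : κ) : ℝ≥0 :=
  if y ∈ K then 0 else v s y k

/-- The path stopped in `K` agrees with the path up to the hitting time, and is in `K`
afterwards. -/
theorem IsJumpPath.stopped (hω : Regular ω) {v : ℝ≥0 → E → κ → ℝ≥0} {y₀ : E} {L Y L' : ℝ≥0 → E}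
    (K : Set E) (hL : IsJumpPath next b ω v y₀ L) (hY : IsRightVersion b ω Y L)
    (hL' : IsJumpPath next b ω (stopLevel K v) y₀ L') (t : ℝ≥0) :
    ((t : ℝ≥0∞) ≤ hittingTime Y K → L' t = L t) ∧ (hittingTime Y K < t → L' t ∈ K) := by
  set T := hittingTime Y K with hT
  have hYK : ∀ s, Y s ∈ K → T ≤ s := fun s hs => iInf₂_le s hs
  revert t
  refine hω.step_induction b ⟨fun _ => by rw [hL.zero, hL'.zero], fun h => absurd h ?_⟩ ?_
  · simp
  · intro a t hat hq ⟨h1, h2⟩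
    have stopped : L' a ∈ K → L' t = L' a := by
      intro ha
      refine hL'.stay a t hat hq fun h0 k => ?_
      rw [stopLevel, if_pos ha]
      exact hω.atom_zero_level h0 k
    have stepL : L' a = L a → L' a ∉ K → L' t = L t := by
      intro he ha
      by_cases h : 0 < a → ∀ k, (ω k).1 ({a} ×ˢ Iic (v a (L a) k)) = 0
      · rw [hL.stay a t hat hq h, hL'.stay a t hat hq fun h0 k => ?_, he]
        rw [stopLevel, if_neg ha, he]
        exact h h0 k
      · push Not at h
        obtain ⟨ha0, k, hk⟩ := h
        rw [hL.jump a t k ha0 hat hq hk, hL'.jump a t k ha0 hat hq, he]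
        rw [stopLevel, if_neg ha, he]
        exact hk
    rcases lt_or_ge T a with hTa | hTa
    · have hK := h2 hTa
      refine ⟨fun h => absurd (h.trans_lt hTa) (not_lt.2 (by exact_mod_cast hat.le)), fun _ => ?_⟩
      rw [stopped hK]
      exact hK
    · have hLa := h1 hTa
      -- the path has not been in `K` before `a`
      have hna : 0 < a → L a ∉ K := by
        intro ha hK
        obtain ⟨a', ha', hq'⟩ := hω.exists_quiet_left b ha
        rw [hY.left a' a ha' hq'] at hK
        exact absurd (hTa.trans (hYK a' hK)) (not_le.2 (by exact_mod_cast ha'))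
      constructor
      · intro htT
        have hYa : Y a ∉ K := fun h =>
          absurd (htT.trans (hYK a h)) (not_le.2 (by exact_mod_cast hat))
        refine stepL hLa ?_
        rw [hLa]
        rcases eq_or_ne a 0 with rfl | ha
        · rwa [hY.zero]
        · exact hna (pos_iff_ne_zero.2 ha)
      · intro hTt
        obtain ⟨s, hs⟩ := iInf_lt_iff.1 hTt
        obtain ⟨hsK, hst⟩ := iInf_lt_iff.1 hs
        have hst' : s < t := by exact_mod_cast hst
        have has : a ≤ s := by exact_mod_cast hTa.trans (hYK s hsK)
        have hYa : Y a ∈ K := by rwa [hY.right a t hat hq s has hst'] at hsK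
        rcases eq_or_ne a 0 with rfl | ha
        · have h0 : L' 0 ∈ K := by rw [hLa, hY.zero]; exact hYa
          rw [stopped h0]
          exact h0
        · rw [stepL hLa (by rw [hLa]; exact hna (pos_iff_ne_zero.2 ha)), hY.left a t hat hq]
          exact hYa

theorem IsRightVersion.ae_eq (hω : Regular ω) {L Y : ℝ≥0 → E} (hY : IsRightVersion b ω Y L) :
    ∀ᵐ s ∂lam, Y s = L s := by
  have h : ∀ t, lam ({s | Y s ≠ L s} ∩ Iio t) = 0 := by
    refine hω.step_induction b (by simp) ?_
    intro a t hat hq ha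
    refine measure_mono_null (t := ({s | Y s ≠ L s} ∩ Iio a) ∪ {a}) ?_
      (measure_union_null ha (measure_singleton _))
    rintro s ⟨hs, hst⟩
    rcases lt_trichotomy s a with h | h | h
    · exact Or.inl ⟨hs, h⟩
    · exact Or.inr h
    · refine absurd ?_ hs
      rw [hY.right a t hat hq s h.le hst, hY.left a s h (hq.mono le_rfl (le_of_lt hst))]
  rw [ae_iff]
  have hU : {s | ¬ Y s = L s} ⊆ ⋃ m : ℕ, ({s | Y s ≠ L s} ∩ Iio (m : ℝ≥0)) := by
    intro s hs
    obtain ⟨m, hm⟩ := exists_nat_gt s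
    exact mem_iUnion.2 ⟨m, hs, hm⟩
  exact measure_mono_null hU (measure_iUnion_null fun m => h m)

open Classical in
/-- The running cost up to the hitting time, in terms of the path stopped in `K`. -/
theorem integralUpTo_hittingTime (hω : Regular ω) {v : ℝ≥0 → E → κ → ℝ≥0} {y₀ : E}
    {L Y L' : ℝ≥0 → E} (K : Set E) (hL : IsJumpPath next b ω v y₀ L)
    (hY : IsRightVersion b ω Y L) (hL' : IsJumpPath next b ω (stopLevel K v) y₀ L')
    (G : E → ℝ≥0 → ℝ≥0∞) : integralUpTo (hittingTime Y K) (fun t => G (Y t) t) =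
      ∫⁻ s, (if L' s ∈ K then 0 else G (L' s) s) ∂lam := by
  set T := hittingTime Y K with hT
  have hA : MeasurableSet {t : ℝ | ENNReal.ofReal t < T} :=
    measurableSet_lt ENNReal.measurable_ofReal measurable_const
  have h1 : integralUpTo T (fun t => G (Y t) t) = ∫⁻ s : ℝ≥0,
      {t : ℝ | ENNReal.ofReal t < T}.indicator (fun t => G (Y t.toNNReal) t.toNNReal) s ∂lam := by
    rw [lintegral_lam, lintegral_indicator hA, Measure.restrict_restrict hA, integralUpTo]
    congr 2
    ext t
    simp [and_comm]
  rw [h1]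
  refine lintegral_congr_ae ?_
  have hTne : ∀ᵐ s : ℝ≥0 ∂lam, (s : ℝ≥0∞) ≠ T := by
    rw [ae_iff]
    refine measure_mono_null (t := {T.toNNReal}) ?_ (measure_singleton _)
    intro s hs
    rw [mem_ofPred_eq, not_not] at hs
    rw [mem_singleton_iff, ← hs, ENNReal.toNNReal_coe]
  filter_upwards [hY.ae_eq hω, hTne] with s hs hsT
  have hhalt := hL.stopped hω K hY hL' s
  rcases lt_or_gt_of_ne hsT with h | h
  · have hs' : (s : ℝ) ∈ {t : ℝ | ENNReal.ofReal t < T} := by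
      rw [mem_ofPred_eq, ENNReal.ofReal_coe_nnreal]
      exact h
    rw [indicator_of_mem hs', Real.toNNReal_coe, hhalt.1 h.le, ← hs, if_neg]
    intro hK
    exact absurd (iInf₂_le s hK) (not_le.2 h)
  · have hs' : (s : ℝ) ∉ {t : ℝ | ENNReal.ofReal t < T} := by
      rw [mem_ofPred_eq, ENNReal.ofReal_coe_nnreal]
      exact not_lt.2 h.le
    rw [indicator_of_notMem hs', if_pos (hhalt.2 h)]

end Absorption

/-! ### Exponential weights -/

theorem setLIntegral_lam_Ico (F : ℝ → ℝ≥0∞) (a t : ℝ≥0) :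
    ∫⁻ s in Ico a t, F s ∂lam = ∫⁻ x in Ico (a : ℝ) t, F x := by
  rw [← lintegral_indicator measurableSet_Ico]
  have h : ∀ s : ℝ≥0, (Ico a t).indicator (fun s : ℝ≥0 => F s) s =
      (Ico (a : ℝ) t).indicator F s := by
    intro s
    by_cases hs : s ∈ Ico a t
    · rw [indicator_of_mem hs, indicator_of_mem]
      exact ⟨by exact_mod_cast hs.1, by exact_mod_cast hs.2⟩
    · rw [indicator_of_notMem hs, indicator_of_notMem]
      rintro ⟨h1, h2⟩
      exact hs ⟨by exact_mod_cast h1, by exact_mod_cast h2⟩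
  simp_rw [h]
  rw [lintegral_lam, lintegral_indicator measurableSet_Ico,
    Measure.restrict_restrict measurableSet_Ico,
    inter_eq_self_of_subset_left]
  exact fun x hx => a.2.trans hx.1

theorem Iio_eq_Ico_zero (t : ℝ≥0) : Iio t = Ico 0 t := by ext; simp

theorem toReal_lintegral_Iio {c : ℝ≥0 → ℝ≥0} (hc : Measurable c) (t : ℝ≥0) :
    (∫⁻ s in Iio t, c s ∂lam).toReal = ∫ x in (0 : ℝ)..t, (c x.toNNReal : ℝ) := by
  have h1 : ∫⁻ s in Iio t, c s ∂lam = ∫⁻ x in Ico ((0 : ℝ≥0) : ℝ) t, (c x.toNNReal : ℝ≥0∞) := by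
    rw [← setLIntegral_lam_Ico, Iio_eq_Ico_zero]
    simp
  rw [h1, intervalIntegral.integral_of_le (NNReal.coe_nonneg t),
    ← setIntegral_congr_set Ico_ae_eq_Ioc, integral_eq_lintegral_of_nonneg_ae
      (Eventually.of_forall fun _ => NNReal.coe_nonneg _)]
  · simp
  · exact (hc.comp measurable_real_toNNReal).coe_nnreal_real.aestronglyMeasurable

/-- The weight `exp ∫₀ᵗ (c⁺ - c⁻)`. -/
def weight (cp cm : ℝ≥0 → ℝ≥0) (t : ℝ≥0) : ℝ≥0∞ :=
  ENNReal.ofReal (Real.exp ((∫⁻ s in Iio t, cp s ∂lam).toReal - (∫⁻ s in Iio t, cm s ∂lam).toReal))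

theorem weight_zero (cp cm : ℝ≥0 → ℝ≥0) : weight cp cm 0 = 1 := by
  simp [weight]

theorem integral_mul_exp {c : ℝ → ℝ} (hc : Measurable c) {B : ℝ≥0} (hB : ∀ x, |c x| ≤ B)
    (a t : ℝ) : ∫ x in a..t, c x * Real.exp (∫ y in (0 : ℝ)..x, c y) =
      Real.exp (∫ y in (0 : ℝ)..t, c y) - Real.exp (∫ y in (0 : ℝ)..a, c y) := by
  set A : ℝ → ℝ := fun x => ∫ y in (0 : ℝ)..x, c y with hA
  have hloc : LocallyIntegrable c volume := by
    refine LocallyIntegrable.mono (g := c) (f := fun _ : ℝ => (B : ℝ)) (locallyIntegrable_const _)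
      hc.aestronglyMeasurable (Eventually.of_forall fun x => ?_)
    rw [Real.norm_eq_abs, Real.norm_eq_abs, abs_of_nonneg (NNReal.coe_nonneg B)]
    exact hB x
  have hint : ∀ x y, IntervalIntegrable c volume x y := fun x y =>
    intervalIntegrable_iff.2
      ((hloc.integrableOn_isCompact isCompact_uIcc).mono_set uIoc_subset_uIcc)
  have hAlip : LipschitzWith B A := by
    refine LipschitzWith.of_dist_le_mul fun x y => ?_
    rw [Real.dist_eq, Real.dist_eq, hA]
    dsimp only
    rw [intervalIntegral.integral_interval_sub_left (hint 0 x) (hint 0 y), ← Real.norm_eq_abs]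
    exact intervalIntegral.norm_integral_le_of_norm_le_const fun z _ => hB z
  obtain ⟨M, hM⟩ : ∃ M, ∀ x ∈ uIcc a t, A x ∈ Icc (-M) M := by
    obtain ⟨M, hM⟩ := isCompact_uIcc.exists_bound_of_continuousOn
      (hAlip.continuous.continuousOn (s := uIcc a t))
    exact ⟨M, fun x hx => abs_le.1 (hM x hx)⟩
  obtain ⟨K, hK⟩ := (Real.contDiff_exp (n := 1)).contDiffOn.exists_lipschitzOnWith
    (s := Icc (-M) M) (by decide) (convex_Icc _ _) isCompact_Icc
  -- `c` is only measurable, so that the chain rule holds only almost everywhere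
  have hAC : AbsolutelyContinuousOnInterval (fun x => Real.exp (A x)) a t := by
    refine LipschitzOnWith.absolutelyContinuousOnInterval (K := K * B) ?_
    exact hK.comp hAlip.lipschitzOnWith hM
  rw [← hAC.integral_deriv_eq_sub]
  refine intervalIntegral.integral_congr_ae ?_
  filter_upwards [LocallyIntegrable.ae_hasDerivAt_integral hloc] with x hx _
  rw [(hx 0).exp.deriv, mul_comm]

/-- The integral equation satisfied by an exponential weight. -/
theorem weight_add_lintegral {cp cm : ℝ≥0 → ℝ≥0} (hp : Measurable cp) (hm : Measurable cm) {B : ℝ≥0}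
    (hpB : ∀ s, cp s ≤ B) (hmB : ∀ s, cm s ≤ B) {a t : ℝ≥0} (hat : a ≤ t) :
    weight cp cm t + ∫⁻ s in Ico a t, weight cp cm s * cm s ∂lam =
      weight cp cm a + ∫⁻ s in Ico a t, weight cp cm s * cp s ∂lam := by
  set p : ℝ → ℝ := fun x => (cp x.toNNReal : ℝ) with hpdef
  set m : ℝ → ℝ := fun x => (cm x.toNNReal : ℝ) with hmdef
  have hpm : Measurable p := (hp.comp measurable_real_toNNReal).coe_nnreal_real
  have hmm : Measurable m := (hm.comp measurable_real_toNNReal).coe_nnreal_real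
  have hp0 : ∀ x, 0 ≤ p x := fun x => NNReal.coe_nonneg _
  have hm0 : ∀ x, 0 ≤ m x := fun x => NNReal.coe_nonneg _
  have hpB' : ∀ x, p x ≤ B := fun x => by exact_mod_cast hpB _
  have hmB' : ∀ x, m x ≤ B := fun x => by exact_mod_cast hmB _
  have hc : Measurable fun x => p x - m x := hpm.sub hmm
  have hcB : ∀ x, |p x - m x| ≤ B := fun x => by
    rw [abs_le]; constructor <;> linarith [hp0 x, hm0 x, hpB' x, hmB' x]
  have hpint : ∀ x y, IntervalIntegrable p volume x y := fun x y => by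
    refine (intervalIntegrable_const (c := (B : ℝ))).mono_fun hpm.aestronglyMeasurable
      (Eventually.of_forall fun z => ?_)
    dsimp only
    rw [Real.norm_eq_abs, Real.norm_eq_abs, abs_of_nonneg (hp0 z),
      abs_of_nonneg (NNReal.coe_nonneg B)]
    exact hpB' z
  have hmint : ∀ x y, IntervalIntegrable m volume x y := fun x y => by
    refine (intervalIntegrable_const (c := (B : ℝ))).mono_fun hmm.aestronglyMeasurable
      (Eventually.of_forall fun z => ?_)
    dsimp only
    rw [Real.norm_eq_abs, Real.norm_eq_abs, abs_of_nonneg (hm0 z),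
      abs_of_nonneg (NNReal.coe_nonneg B)]
    exact hmB' z
  set e : ℝ → ℝ := fun x => Real.exp (∫ y in (0 : ℝ)..x, (p y - m y)) with he
  have he0 : ∀ x, 0 ≤ e x := fun x => (Real.exp_pos _).le
  have hw : ∀ s : ℝ≥0, weight cp cm s = ENNReal.ofReal (e s) := by
    intro s
    rw [weight, toReal_lintegral_Iio hp, toReal_lintegral_Iio hm, he,
      ← intervalIntegral.integral_sub (hpint 0 s) (hmint 0 s)]
  have hecont : Continuous e := by
    have h1 : Continuous fun x => ∫ y in (0 : ℝ)..x, (p y - m y) :=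
      intervalIntegral.continuous_primitive (fun x y => (hpint x y).sub (hmint x y)) 0
    exact Real.continuous_exp.comp h1
  have hmain : ∫ x in (a : ℝ)..t, (p x - m x) * e x = e t - e a := integral_mul_exp hc hcB a t
  have hpe : IntervalIntegrable (fun x => p x * e x) volume a t :=
    (hpint a t).mul_continuousOn hecont.continuousOn
  have hme : IntervalIntegrable (fun x => m x * e x) volume a t :=
    (hmint a t).mul_continuousOn hecont.continuousOn
  have conv : ∀ (c : ℝ≥0 → ℝ≥0) (q : ℝ → ℝ), (∀ x, q x = (c x.toNNReal : ℝ)) →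
      IntervalIntegrable (fun x => q x * e x) volume a t →
      ∫⁻ s in Ico a t, weight cp cm s * c s ∂lam =
        ENNReal.ofReal (∫ x in (a : ℝ)..t, q x * e x) := by
    intro c q hq hi
    have hat' : (a : ℝ) ≤ t := by exact_mod_cast hat
    have h1 : ∀ s : ℝ≥0, weight cp cm s * c s = ENNReal.ofReal (q s * e s) := by
      intro s
      rw [hw, hq, Real.toNNReal_coe, mul_comm, ENNReal.ofReal_mul (NNReal.coe_nonneg _),
        ENNReal.ofReal_coe_nnreal]
    simp_rw [h1]
    rw [setLIntegral_lam_Ico (fun x => ENNReal.ofReal (q x * e x)),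
      intervalIntegral.integral_of_le hat',
      ofReal_integral_eq_lintegral_ofReal]
    · exact setLIntegral_congr Ico_ae_eq_Ioc
    · exact (intervalIntegrable_iff_integrableOn_Ioc_of_le hat').1 hi
    · exact Eventually.of_forall fun x =>
        mul_nonneg (by rw [hq]; exact NNReal.coe_nonneg _) (he0 x)
  have hat' : (a : ℝ) ≤ t := by exact_mod_cast hat
  rw [conv cm m (fun _ => rfl) hme, conv cp p (fun _ => rfl) hpe, hw, hw,
    ← ENNReal.ofReal_add (he0 _) (intervalIntegral.integral_nonneg hat'
      fun x _ => mul_nonneg (hm0 x) (he0 x)),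
    ← ENNReal.ofReal_add (he0 _) (intervalIntegral.integral_nonneg hat'
      fun x _ => mul_nonneg (hp0 x) (he0 x))]
  congr 1
  simp_rw [sub_mul] at hmain
  rw [intervalIntegral.integral_sub hpe hme] at hmain
  linarith

theorem weight_le (cp cm : ℝ≥0 → ℝ≥0) {B : ℝ≥0} (hpB : ∀ s, cp s ≤ B) (t : ℝ≥0) :
    weight cp cm t ≤ ENNReal.ofReal (Real.exp (B * t)) := by
  refine ENNReal.ofReal_le_ofReal (Real.exp_le_exp.2 ?_)
  have h1 : ∫⁻ s in Iio t, cp s ∂lam ≤ ((B * t : ℝ≥0) : ℝ≥0∞) := by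
    refine (lintegral_mono (g := fun _ => (B : ℝ≥0∞)) fun s => ENNReal.coe_le_coe.2
      (hpB s)).trans ?_
    rw [lintegral_const, Measure.restrict_apply_univ, lam_Iio, ENNReal.coe_mul]
  have h2 : (∫⁻ s in Iio t, cp s ∂lam).toReal ≤ ((B * t : ℝ≥0) : ℝ≥0∞).toReal :=
    ENNReal.toReal_mono ENNReal.coe_ne_top h1
  have h3 : 0 ≤ (∫⁻ s in Iio t, cm s ∂lam).toReal := ENNReal.toReal_nonneg
  rw [ENNReal.coe_toReal, NNReal.coe_mul] at h2
  linarith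

/-! ### The change of a function along a jump path -/

section Dynkin

variable {κ E : Type*}

theorem Quiet.lintegral_step {ω : Canon κ} {b a t : ℝ≥0} (h : Quiet ω b a t) (ha : 0 < a)
    (hat : a < t) (k : κ) {α : ℝ≥0 → ℝ≥0} (hα : ∀ s, α s ≤ b) (φ : ℝ≥0 → ℝ≥0∞) :
    ∫⁻ p in Ioo 0 t ×ˢ Iic b, (if p.2 ≤ α p.1 then φ p.1 else 0) ∂(ω k).1 =
      ∫⁻ p in Ioo 0 a ×ˢ Iic b, (if p.2 ≤ α p.1 then φ p.1 else 0) ∂(ω k).1 +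
        φ a * (ω k).1 ({a} ×ˢ Iic (α a)) := by
  rw [h.restrict_eq ha hat, lintegral_add_measure]
  congr 1
  have hms : MeasurableSet ({a} ×ˢ Iic b : Set (ℝ≥0 × ℝ≥0)) :=
    (measurableSet_singleton a).prod measurableSet_Iic
  have hms' : MeasurableSet ({p | p.2 ≤ α a} : Set (ℝ≥0 × ℝ≥0)) :=
    measurable_snd measurableSet_Iic
  have h1 : ∀ p ∈ ({a} ×ˢ Iic b : Set (ℝ≥0 × ℝ≥0)), (if p.2 ≤ α p.1 then φ p.1 else 0) =
      ({p | p.2 ≤ α a} : Set (ℝ≥0 × ℝ≥0)).indicator (fun _ => φ a) p := by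
    rintro p ⟨hp, -⟩
    rw [mem_singleton_iff] at hp
    rw [hp]
    by_cases h' : p.2 ≤ α a
    · rw [if_pos h', indicator_of_mem (show p ∈ {p : ℝ≥0 × ℝ≥0 | p.2 ≤ α a} from h')]
    · rw [if_neg h', indicator_of_notMem (show p ∉ {p : ℝ≥0 × ℝ≥0 | p.2 ≤ α a} from h')]
  rw [setLIntegral_congr_fun hms h1, lintegral_indicator hms', lintegral_const,
    Measure.restrict_apply_univ, Measure.restrict_apply hms']
  congr 2
  ext p
  simp only [mem_inter_iff, mem_ofPred_eq, mem_prod, mem_singleton_iff, mem_Iic]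
  constructor
  · rintro ⟨h2, h3, -⟩; exact ⟨h3, h2⟩
  · rintro ⟨h3, h2⟩; exact ⟨h2, h3, h2.trans (hα a)⟩

/-- Itô's formula for a jump path and an exponential weight, with all terms nonnegative. -/
theorem IsJumpPath.weight_formula [Fintype κ] {next : E → κ → E} {b : ℝ≥0} {ω : Canon κ}
    (hω : Regular ω) {v : ℝ≥0 → E → κ → ℝ≥0} (hv : ∀ s y k, v s y k ≤ b) {y₀ : E} {L : ℝ≥0 → E}
    (hL : IsJumpPath next b ω v y₀ L) {cp cm : ℝ≥0 → ℝ≥0} (hp : Measurable cp) (hm : Measurable cm)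
    {B : ℝ≥0} (hpB : ∀ s, cp s ≤ B) (hmB : ∀ s, cm s ≤ B) (f : E → ℝ≥0) (t : ℝ≥0) :
    weight cp cm t * f (L t) + ∫⁻ s in Iio t, weight cp cm s * cm s * f (L s) ∂lam +
      ∑ k, ∫⁻ p in Ioo 0 t ×ˢ Iic b, (if p.2 ≤ v p.1 (L p.1) k then
        weight cp cm p.1 * f (L p.1) else 0) ∂(ω k).1 =
    f y₀ + ∫⁻ s in Iio t, weight cp cm s * cp s * f (L s) ∂lam +
      ∑ k, ∫⁻ p in Ioo 0 t ×ˢ Iic b, (if p.2 ≤ v p.1 (L p.1) k then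
        weight cp cm p.1 * f (next (L p.1) k) else 0) ∂(ω k).1 := by
  set W := weight cp cm with hW
  revert t
  refine hω.step_induction b ?_ ?_
  · simp [hW, weight_zero, hL.zero]
  · intro a t hat hq ih
    have hsplit : ∀ c : ℝ≥0 → ℝ≥0, ∫⁻ s in Iio t, W s * c s * f (L s) ∂lam =
        ∫⁻ s in Iio a, W s * c s * f (L s) ∂lam + (∫⁻ s in Ico a t, W s * c s ∂lam) * f (L t) := by
      intro c
      have hU : Iio t = Iio a ∪ Ico a t := (Iio_union_Ico_eq_Iio hat.le).symm
      rw [hU, lintegral_union measurableSet_Ico]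
      · congr 1
        rw [← lintegral_mul_const' _ _ ENNReal.coe_ne_top]
        rw [setLIntegral_congr (Ioo_ae_eq_Ico (μ := lam)).symm, setLIntegral_congr
          (Ioo_ae_eq_Ico (μ := lam)).symm]
        refine setLIntegral_congr_fun measurableSet_Ioo fun s hs => ?_
        rw [hL.const hq hs.1 hs.2.le hat le_rfl]
      · exact disjoint_left.2 fun s hs hs' => absurd hs (not_lt.2 hs'.1)
    have hftc : W t * f (L t) + (∫⁻ s in Ico a t, W s * cm s ∂lam) * f (L t) =
        W a * f (L t) + (∫⁻ s in Ico a t, W s * cp s ∂lam) * f (L t) := by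
      rw [← add_mul, ← add_mul, hW, weight_add_lintegral hp hm hpB hmB hat.le]
    -- the contributions of a jump at time `a`
    obtain ⟨D, D', hD, hD', hDD⟩ : ∃ D D' : ℝ≥0∞,
        (∑ k, ∫⁻ p in Ioo 0 t ×ˢ Iic b, (if p.2 ≤ v p.1 (L p.1) k then W p.1 * f (L p.1) else 0)
          ∂(ω k).1 = ∑ k, ∫⁻ p in Ioo 0 a ×ˢ Iic b, (if p.2 ≤ v p.1 (L p.1) k then
            W p.1 * f (L p.1) else 0) ∂(ω k).1 + D) ∧
        (∑ k, ∫⁻ p in Ioo 0 t ×ˢ Iic b, (if p.2 ≤ v p.1 (L p.1) k then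
          W p.1 * f (next (L p.1) k) else 0) ∂(ω k).1 =
          ∑ k, ∫⁻ p in Ioo 0 a ×ˢ Iic b, (if p.2 ≤ v p.1 (L p.1) k then
            W p.1 * f (next (L p.1) k) else 0) ∂(ω k).1 + D') ∧
        W a * f (L t) + D = W a * f (L a) + D' := by
      rcases eq_or_ne a 0 with rfl | ha
      · refine ⟨0, 0, ?_, ?_, ?_⟩
        · simp_rw [hq.restrict_zero]; simp
        · simp_rw [hq.restrict_zero]; simp
        · rw [hL.stay 0 t hat hq fun h => absurd h (lt_irrefl _)]
      · have ha := pos_iff_ne_zero.2 ha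
        refine ⟨∑ k, W a * f (L a) * (ω k).1 ({a} ×ˢ Iic (v a (L a) k)),
          ∑ k, W a * f (next (L a) k) * (ω k).1 ({a} ×ˢ Iic (v a (L a) k)), ?_, ?_, ?_⟩
        · rw [← Finset.sum_add_distrib]
          exact Finset.sum_congr rfl fun k _ => hq.lintegral_step ha hat k
            (α := fun s => v s (L s) k) (fun s => hv _ _ _) (fun s => W s * f (L s))
        · rw [← Finset.sum_add_distrib]
          exact Finset.sum_congr rfl fun k _ => hq.lintegral_step ha hat k
            (α := fun s => v s (L s) k) (fun s => hv _ _ _) (fun s => W s * f (next (L s) k))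
        · rcases hω.atom_cases ha (v := fun k => v a (L a) k) (fun k => hv _ _ _) with
            h2 | ⟨k₀, h1, h2⟩
          · rw [hL.stay a t hat hq fun _ => h2]
            simp [h2]
          · have hk : (ω k₀).1 ({a} ×ˢ Iic (v a (L a) k₀)) ≠ 0 := by rw [h1]; exact one_ne_zero
            rw [hL.jump a t k₀ ha hat hq hk,
              Finset.sum_eq_single k₀ (fun k' _ hk => by simp [h2 k' hk])
                (fun h => absurd (Finset.mem_univ _) h),
              Finset.sum_eq_single k₀ (fun k' _ hk => by simp [h2 k' hk])
                (fun h => absurd (Finset.mem_univ _) h), h1, mul_one, mul_one, add_comm]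
    rw [hsplit cm, hsplit cp, hD, hD']
    calc _ = (W t * f (L t) + (∫⁻ s in Ico a t, W s * cm s ∂lam) * f (L t)) +
          ∫⁻ s in Iio a, W s * cm s * f (L s) ∂lam +
          ∑ k, ∫⁻ p in Ioo 0 a ×ˢ Iic b, (if p.2 ≤ v p.1 (L p.1) k then
            W p.1 * f (L p.1) else 0) ∂(ω k).1 + D := by ring
      _ = (W a * f (L t) + D) + (∫⁻ s in Ico a t, W s * cp s ∂lam) * f (L t) +
          ∫⁻ s in Iio a, W s * cm s * f (L s) ∂lam +
          ∑ k, ∫⁻ p in Ioo 0 a ×ˢ Iic b, (if p.2 ≤ v p.1 (L p.1) k then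
            W p.1 * f (L p.1) else 0) ∂(ω k).1 := by rw [hftc]; ring
      _ = (W a * f (L a) + ∫⁻ s in Iio a, W s * cm s * f (L s) ∂lam +
          ∑ k, ∫⁻ p in Ioo 0 a ×ˢ Iic b, (if p.2 ≤ v p.1 (L p.1) k then
            W p.1 * f (L p.1) else 0) ∂(ω k).1) + D' +
          (∫⁻ s in Ico a t, W s * cp s ∂lam) * f (L t) := by rw [hDD]; ring
      _ = _ := by rw [ih]; ring

/-! ### Dynkin's formula -/

open Hist

/-- The exponential weight as a predictable process. -/
def histWeight (cp cm : Hist κ → ℝ≥0) (h : Hist κ) : ℝ≥0∞ :=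
  weight (fun s => cp (mk s h.noise)) (fun s => cm (mk s h.noise)) h.time

theorem measurable_histWeight {cp cm : Hist κ → ℝ≥0} (hp : Measurable cp) (hm : Measurable cm) :
    Measurable (histWeight cp cm) :=
  (((measurable_lintegral_past hp.coe_nnreal_ennreal).ennreal_toReal.sub
    (measurable_lintegral_past hm.coe_nnreal_ennreal).ennreal_toReal).exp).ennreal_ofReal

theorem measurable_setLIntegral_mk {g : Hist κ → ℝ≥0∞} (hg : Measurable g) (t : ℝ≥0) :
    Measurable fun ω : Canon κ => ∫⁻ s in Iio t, g (mk s ω) ∂lam :=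
  (measurable_lintegral_past hg).comp (measurable_mk.comp (measurable_const.prodMk measurable_id))

theorem lintegral_accepted {b : ℝ≥0} {α : ℝ≥0 → ℝ≥0} (hα : Measurable α) (hb : ∀ s, α s ≤ b)
    {φ : ℝ≥0 → ℝ≥0∞} (hφ : Measurable φ) (t : ℝ≥0) :
    ∫⁻ p in Ioo 0 t ×ˢ Iic b, (if p.2 ≤ α p.1 then φ p.1 else 0) ∂(lam.prod lam) =
      ∫⁻ s in Iio t, φ s * α s ∂lam := by
  have hm : Measurable fun p : ℝ≥0 × ℝ≥0 => if p.2 ≤ α p.1 then φ p.1 else 0 :=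
    Measurable.ite (measurableSet_le measurable_snd (hα.comp measurable_fst))
      (hφ.comp measurable_fst) measurable_const
  rw [← Measure.prod_restrict, lintegral_prod _ hm.aemeasurable,
    Iio_eq_Ico_zero, setLIntegral_congr (Ioo_ae_eq_Ico (μ := lam)).symm]
  refine lintegral_congr fun s => ?_
  have h1 : ∀ ρ, (if ρ ≤ α s then φ s else 0) = (Iic (α s)).indicator (fun _ => φ s) ρ := by
    intro ρ
    by_cases h : ρ ≤ α s
    · rw [if_pos h, indicator_of_mem (show ρ ∈ Iic (α s) from h)]
    · rw [if_neg h, indicator_of_notMem (show ρ ∉ Iic (α s) from h)]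
  simp_rw [h1]
  rw [lintegral_indicator measurableSet_Iic, lintegral_const, Measure.restrict_apply_univ,
    Measure.restrict_apply measurableSet_Iic,
    inter_eq_self_of_subset_left (Iic_subset_Iic.2 (hb s)),
    ← measure_congr (Iio_ae_eq_Iic (μ := lam)), lam_Iio]

/-- Dynkin's formula for a predictable jump path and an exponential weight, with all terms
nonnegative. -/
theorem dynkin [Fintype κ] [MeasurableSpace E] [MeasurableSingletonClass E] [Finite E]
    {next : E → κ → E}
    (r : ℝ≥0) {b : ℝ≥0} {v : Hist κ → E → κ → ℝ≥0} (hvm : ∀ y k, Measurable fun h => v h y k)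
    (hv : ∀ h y k, v h y k ≤ b) {y₀ : E} {L : Hist κ → E} (hLm : Measurable L)
    (hL : ∀ᵐ ω ∂canonLaw κ r, IsJumpPath next b ω (fun s => v (mk s ω)) y₀ fun s => L (mk s ω))
    {cp cm : Hist κ → ℝ≥0} (hp : Measurable cp) (hm : Measurable cm) {B : ℝ≥0}
    (hpB : ∀ h, cp h ≤ B) (hmB : ∀ h, cm h ≤ B) (f : E → ℝ≥0) (t : ℝ≥0) :
    ∫⁻ ω, histWeight cp cm (mk t ω) * f (L (mk t ω)) ∂canonLaw κ r +
      ∫⁻ ω, ∫⁻ s in Iio t, histWeight cp cm (mk s ω) * ((cm (mk s ω) * f (L (mk s ω)) +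
        ∑ k, r * v (mk s ω) (L (mk s ω)) k * f (L (mk s ω)) : ℝ≥0) : ℝ≥0∞) ∂lam ∂canonLaw κ r =
    f y₀ + ∫⁻ ω, ∫⁻ s in Iio t, histWeight cp cm (mk s ω) * ((cp (mk s ω) * f (L (mk s ω)) +
        ∑ k, r * v (mk s ω) (L (mk s ω)) k * f (next (L (mk s ω)) k) : ℝ≥0) :
          ℝ≥0∞) ∂lam ∂canonLaw κ r := by
  have hLv : ∀ k, Measurable fun h => v h (L h) k := by
    intro k
    have : Measurable fun q : Hist κ × E => v q.1 q.2 k :=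
      measurable_from_prod_countable_left fun y => hvm y k
    exact this.comp (measurable_id.prodMk hLm)
  have hfL : ∀ g : E → ℝ≥0, Measurable fun h => (g (L h) : ℝ≥0∞) := fun g =>
    ((measurable_of_finite g).comp hLm).coe_nnreal_ennreal
  set W := histWeight cp cm with hW
  have hWm : Measurable W := measurable_histWeight hp hm
  have hmt : Measurable fun ω : Canon κ => mk t ω :=
    measurable_mk.comp (measurable_const.prodMk measurable_id)
  -- the mean of the jump terms
  have comp : ∀ g : E → κ → ℝ≥0,
      ∫⁻ ω, ∑ k, ∫⁻ p in Ioo 0 t ×ˢ Iic b, (if p.2 ≤ v (mk p.1 ω) (L (mk p.1 ω)) k then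
        W (mk p.1 ω) * g (L (mk p.1 ω)) k else 0) ∂(ω k).1 ∂canonLaw κ r =
      ∫⁻ ω, ∫⁻ s in Iio t, W (mk s ω) *
        ((∑ k, r * v (mk s ω) (L (mk s ω)) k * g (L (mk s ω)) k : ℝ≥0) : ℝ≥0∞)
          ∂lam ∂canonLaw κ r := by
    intro g
    have hgm : ∀ k, Measurable fun h => W h * g (L h) k := fun k => hWm.mul (hfL fun y => g y k)
    have hG : ∀ k, Measurable fun q : Hist κ × ℝ≥0 =>
        if q.2 ≤ v q.1 (L q.1) k then W q.1 * g (L q.1) k else 0 := fun k =>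
      Measurable.ite (measurableSet_le measurable_snd ((hLv k).comp measurable_fst))
        ((hgm k).comp measurable_fst) measurable_const
    have hk : ∀ k, Measurable fun h => W h * (r * v h (L h) k * g (L h) k) := fun k =>
      hWm.mul (((hLv k).coe_nnreal_ennreal.const_mul _).mul (hfL fun y => g y k))
    rw [lintegral_finsetSum _ fun k _ => measurable_noise_lintegral k t b (hG k)]
    simp_rw [ENNReal.ofNNReal_finsetSum, ENNReal.coe_mul, Finset.mul_sum]
    have e : ∀ ω : Canon κ, ∫⁻ s in Iio t, ∑ k, W (mk s ω) *
        (r * v (mk s ω) (L (mk s ω)) k * g (L (mk s ω)) k) ∂lam =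
        ∑ k, ∫⁻ s in Iio t, W (mk s ω) * (r * v (mk s ω) (L (mk s ω)) k * g (L (mk s ω)) k) ∂lam :=
      fun ω => lintegral_finsetSum _ fun k _ => (hk k).comp (measurable_mk_left ω)
    simp_rw [e]
    rw [lintegral_finsetSum _ fun k _ => measurable_setLIntegral_mk (hk k) t]
    refine Finset.sum_congr rfl fun k _ => ?_
    rw [lintegral_compensation r k t b (hG k)]
    have e2 : ∀ ω : Canon κ, ∫⁻ p in Ioo 0 t ×ˢ Iic b, (if p.2 ≤ v (mk p.1 ω) (L (mk p.1 ω)) k then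
        W (mk p.1 ω) * g (L (mk p.1 ω)) k else 0) ∂(lam.prod lam) =
        ∫⁻ s in Iio t, W (mk s ω) * g (L (mk s ω)) k * v (mk s ω) (L (mk s ω)) k ∂lam := fun ω =>
      lintegral_accepted (α := fun s => v (mk s ω) (L (mk s ω)) k)
        (φ := fun s => W (mk s ω) * g (L (mk s ω)) k) ((hLv k).comp (measurable_mk_left ω))
        (fun s => hv _ _ _) ((hgm k).comp (measurable_mk_left ω)) t
    simp only [e2]
    rw [← lintegral_const_mul' _ _ ENNReal.coe_ne_top]
    refine lintegral_congr fun ω => ?_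
    rw [← lintegral_const_mul' _ _ ENNReal.coe_ne_top]
    refine lintegral_congr fun s => ?_
    ring
  have split : ∀ (c : Hist κ → ℝ≥0) (_ : Measurable c) (g : E → κ → ℝ≥0),
      ∫⁻ ω, ∫⁻ s in Iio t, W (mk s ω) * ((c (mk s ω) * f (L (mk s ω)) +
        ∑ k, r * v (mk s ω) (L (mk s ω)) k * g (L (mk s ω)) k : ℝ≥0) : ℝ≥0∞) ∂lam ∂canonLaw κ r =
      ∫⁻ ω, ∫⁻ s in Iio t, W (mk s ω) * c (mk s ω) * f (L (mk s ω)) ∂lam ∂canonLaw κ r +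
      ∫⁻ ω, ∑ k, ∫⁻ p in Ioo 0 t ×ˢ Iic b, (if p.2 ≤ v (mk p.1 ω) (L (mk p.1 ω)) k then
        W (mk p.1 ω) * g (L (mk p.1 ω)) k else 0) ∂(ω k).1 ∂canonLaw κ r := by
    intro c hc g
    have hcm : Measurable fun h => W h * c h * f (L h) :=
      (hWm.mul hc.coe_nnreal_ennreal).mul (hfL f)
    rw [comp, ← lintegral_add_left (measurable_setLIntegral_mk hcm t)]
    refine lintegral_congr fun ω => ?_
    have hcω : Measurable fun s => W (mk s ω) * c (mk s ω) * f (L (mk s ω)) :=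
      hcm.comp (measurable_mk_left ω)
    rw [← lintegral_add_left hcω]
    refine lintegral_congr fun s => ?_
    rw [ENNReal.coe_add, ENNReal.coe_mul, mul_add, mul_assoc]
  rw [split cm hm fun y _ => f y, split cp hp fun y k => f (next y k)]
  have hm1 : Measurable fun ω => W (mk t ω) * f (L (mk t ω)) := (hWm.mul (hfL f)).comp hmt
  have hm2 : ∀ c : Hist κ → ℝ≥0, Measurable c → Measurable fun ω : Canon κ =>
      ∫⁻ s in Iio t, W (mk s ω) * c (mk s ω) * f (L (mk s ω)) ∂lam := fun c hc =>
    measurable_setLIntegral_mk ((hWm.mul hc.coe_nnreal_ennreal).mul (hfL f)) t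
  have hm3 : Measurable fun ω => W (mk t ω) * f (L (mk t ω)) +
      ∫⁻ s in Iio t, W (mk s ω) * cm (mk s ω) * f (L (mk s ω)) ∂lam := hm1.add (hm2 cm hm)
  have hm4 : Measurable fun ω : Canon κ => (f y₀ : ℝ≥0∞) +
      ∫⁻ s in Iio t, W (mk s ω) * cp (mk s ω) * f (L (mk s ω)) ∂lam :=
    measurable_const.add (hm2 cp hp)
  rw [← add_assoc, ← lintegral_add_left hm1, ← lintegral_add_left hm3, ← add_assoc]
  have hone : (f y₀ : ℝ≥0∞) = ∫⁻ _, (f y₀ : ℝ≥0∞) ∂canonLaw κ r := by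
    rw [lintegral_const, measure_univ, mul_one]
  have hone' : (f y₀ : ℝ≥0∞) + ∫⁻ ω, ∫⁻ s in Iio t, W (mk s ω) * cp (mk s ω) * f (L (mk s ω)) ∂lam
      ∂canonLaw κ r = ∫⁻ ω, (f y₀ + ∫⁻ s in Iio t, W (mk s ω) * cp (mk s ω) * f (L (mk s ω)) ∂lam)
      ∂canonLaw κ r := by
    rw [lintegral_add_left measurable_const, ← hone]
  rw [hone', ← lintegral_add_left hm4]
  refine lintegral_congr_ae ?_
  filter_upwards [hL, ae_regular κ r] with ω hLω hω
  exact hLω.weight_formula hω (fun s => hv _) (hp.comp (measurable_mk_left ω))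
    (hm.comp (measurable_mk_left ω)) (fun s => hpB _) (fun s => hmB _) f t

end Dynkin

/-! ### Concavity of the cost in logarithmic coordinates -/

/-- The part of the standing assumption which concerns a single cost function. -/
structure IsCost (C : ℝ≥0 → ℝ≥0∞) : Prop where
  convex : ConvexOn ℝ≥0 univ C
  monotoneOn : MonotoneOn (fun u : ℝ => u * rightDeriv C u - u) (finiteInterval C)
  at_one : C 1 = 0

/-- The real values of a cost function. -/
def realCost (C : ℝ≥0 → ℝ≥0∞) (u : ℝ) : ℝ := (C u.toNNReal).toReal

/-- The set on which a cost function is finite. -/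
def costDomain (C : ℝ≥0 → ℝ≥0∞) : Set ℝ := {u : ℝ | 0 ≤ u ∧ C u.toNNReal ≠ ∞}

/-- The set of `v` such that the cost is finite at `exp v`. -/
def logDomain (C : ℝ≥0 → ℝ≥0∞) : Set ℝ := {v : ℝ | Real.exp v ∈ costDomain C}

/-- The function `v ↦ exp v - C (exp v)`, whose concavity is the essential consequence of the
standing assumption. -/
def logGain (C : ℝ≥0 → ℝ≥0∞) (v : ℝ) : ℝ := Real.exp v - realCost C (Real.exp v)

theorem realCost_nonneg (C : ℝ≥0 → ℝ≥0∞) (u : ℝ) : 0 ≤ realCost C u := ENNReal.toReal_nonneg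

namespace IsCost

variable {C : ℝ≥0 → ℝ≥0∞}

theorem convexOn_realCost (hC : IsCost C) : ConvexOn ℝ (costDomain C) (realCost C) := by
  have key : ∀ ⦃x⦄, x ∈ costDomain C → ∀ ⦃y⦄, y ∈ costDomain C → ∀ ⦃a b : ℝ⦄, 0 ≤ a → 0 ≤ b →
      a + b = 1 → C (a • x + b • y).toNNReal ≤
        ENNReal.ofReal (a * realCost C x + b * realCost C y) := by
    intro x hx y hy a b ha hb hab
    have h := hC.convex.2 (mem_univ x.toNNReal) (mem_univ y.toNNReal) (zero_le (a := a.toNNReal))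
      (zero_le (a := b.toNNReal)) (by rw [← Real.toNNReal_add ha hb, hab, Real.toNNReal_one])
    have e : a.toNNReal • x.toNNReal + b.toNNReal • y.toNNReal = (a • x + b • y).toNNReal := by
      rw [smul_eq_mul, smul_eq_mul, smul_eq_mul, smul_eq_mul, Real.toNNReal_add (mul_nonneg ha hx.1)
        (mul_nonneg hb hy.1), Real.toNNReal_mul ha, Real.toNNReal_mul hb]
    rw [e] at h
    refine h.trans (le_of_eq ?_)
    rw [ENNReal.ofReal_add (mul_nonneg ha (realCost_nonneg _ _))
      (mul_nonneg hb (realCost_nonneg _ _)), ENNReal.ofReal_mul ha, ENNReal.ofReal_mul hb, realCost,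
      realCost, ENNReal.ofReal_toReal hx.2, ENNReal.ofReal_toReal hy.2]
    rfl
  refine ⟨fun x hx y hy a b ha hb hab => ⟨?_, ?_⟩, fun x hx y hy a b ha hb hab => ?_⟩
  · exact add_nonneg (mul_nonneg ha hx.1) (mul_nonneg hb hy.1)
  · exact ((key hx hy ha hb hab).trans_lt ENNReal.ofReal_lt_top).ne
  · exact ENNReal.toReal_le_of_le_ofReal (add_nonneg (mul_nonneg ha (realCost_nonneg _ _))
      (mul_nonneg hb (realCost_nonneg _ _))) (key hx hy ha hb hab)

theorem one_mem (hC : IsCost C) : (1 : ℝ) ∈ costDomain C := ⟨zero_le_one, by simp [hC.at_one]⟩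

theorem zero_mem_logDomain (hC : IsCost C) : (0 : ℝ) ∈ logDomain C := by
  simpa [logDomain] using hC.one_mem

theorem logGain_zero (hC : IsCost C) : logGain C 0 = 1 := by simp [logGain, realCost, hC.at_one]

theorem convex_logDomain (hC : IsCost C) : Convex ℝ (logDomain C) := by
  refine Set.OrdConnected.convex ⟨fun x hx y hy z hz => ?_⟩
  exact hC.convexOn_realCost.1.ordConnected.out hx hy
    ⟨Real.exp_le_exp.2 hz.1, Real.exp_le_exp.2 hz.2⟩

/-- Supergradients at the interior points of the logarithmic domain. -/
theorem exists_supergradient_interior (hC : IsCost C) {x : ℝ} (hx : Real.exp x ∈ finiteInterval C) :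
    ∃ m, ∀ v, Real.exp v ∈ finiteInterval C → logGain C v ≤ logGain C x + m * (v - x) := by
  have hconv := hC.convexOn_realCost
  have hI : finiteInterval C = interior (costDomain C) := rfl
  have hIconv : Convex ℝ (finiteInterval C) := hconv.1.interior
  set m : ℝ → ℝ := fun v => Real.exp v - Real.exp v * rightDeriv C (Real.exp v) with hm
  have hder : ∀ v, Real.exp v ∈ finiteInterval C →
      HasDerivWithinAt (logGain C) (m v) (Ici v) v := by
    intro v hv
    have h1 : HasDerivWithinAt (realCost C) (rightDeriv C (Real.exp v)) (Ici (Real.exp v))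
        (Real.exp v) :=
      (hconv.hasDerivWithinAt_rightDeriv_of_mem_interior hv).Ici_of_Ioi
    have h2 : HasDerivWithinAt Real.exp (Real.exp v) (Ici v) v :=
      (Real.hasDerivAt_exp v).hasDerivWithinAt
    have h3 := h1.comp v h2 fun y hy => Real.exp_le_exp.2 hy
    have h4 := h2.sub h3
    convert! h4 using 1
    rw [hm]
    ring
  have hmono : ∀ v w, v ≤ w → Real.exp v ∈ finiteInterval C → Real.exp w ∈ finiteInterval C →
      m w ≤ m v := by
    intro v w hvw hv hw
    have := hC.monotoneOn hv hw (Real.exp_le_exp.2 hvw)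
    simp only [hm] at this ⊢
    linarith
  have hmem : ∀ a b, Real.exp a ∈ finiteInterval C → Real.exp b ∈ finiteInterval C →
      ∀ v ∈ Icc a b, Real.exp v ∈ finiteInterval C := fun a b ha hb v hv =>
    hIconv.ordConnected.out ha hb ⟨Real.exp_le_exp.2 hv.1, Real.exp_le_exp.2 hv.2⟩
  have hcont : ∀ a b, Real.exp a ∈ finiteInterval C → Real.exp b ∈ finiteInterval C →
      ContinuousOn (logGain C) (Icc a b) := by
    intro a b ha hb
    refine Real.continuous_exp.continuousOn.sub ?_
    exact (hconv.continuousOn_interior.comp Real.continuous_exp.continuousOn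
      (fun v hv => hmem a b ha hb v hv))
  have hline : ∀ (y₀ s z : ℝ) (S : Set ℝ), HasDerivWithinAt (fun v => y₀ + s * (v - z)) s S z := by
    intro y₀ s z S
    have := (((hasDerivAt_id z).sub_const z).const_mul s).const_add y₀
    simpa using this.hasDerivWithinAt
  have hline' : ∀ (y₀ s z w : ℝ) (S : Set ℝ),
      HasDerivWithinAt (fun v => y₀ + s * (v - z)) s S w := by
    intro y₀ s z w S
    have := (((hasDerivAt_id w).sub_const z).const_mul s).const_add y₀
    simpa using this.hasDerivWithinAt
  refine ⟨m x, fun v hv => ?_⟩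
  rcases le_total x v with hxv | hxv
  · exact image_le_of_deriv_right_le_deriv_boundary (hcont x v hx hv)
      (fun y hy => hder y (hmem x v hx hv y ⟨hy.1, hy.2.le⟩))
      (B := fun w => logGain C x + m x * (w - x)) (B' := fun _ => m x) (by simp)
      (by fun_prop) (fun y _ => hline' _ _ _ _ _)
      (fun y hy => hmono x y hy.1 hx (hmem x v hx hv y ⟨hy.1, hy.2.le⟩)) ⟨hxv, le_rfl⟩
  · have := image_le_of_deriv_right_le_deriv_boundary (a := v) (b := x)
      (f := fun w => logGain C v + m x * (w - v)) (f' := fun _ => m x) (by fun_prop)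
      (fun y _ => hline' _ _ _ _ _) (B := logGain C) (B' := m) (by simp) (hcont v x hv hx)
      (fun y hy => hder y (hmem v x hv hx y ⟨hy.1, hy.2.le⟩))
      (fun y hy => hmono y x hy.2.le (hmem v x hv hx y ⟨hy.1, hy.2.le⟩) hx) ⟨hxv, le_rfl⟩
    linarith

/-- The supergradient inequality extends to the end points of the domain, where a convex function
is not smaller than its limits. -/
theorem exists_supergradient (hC : IsCost C) {x : ℝ} (hx : Real.exp x ∈ finiteInterval C) :
    ∃ m, ∀ v ∈ logDomain C, logGain C v ≤ logGain C x + m * (v - x) := by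
  obtain ⟨m, hm⟩ := hC.exists_supergradient_interior hx
  refine ⟨m, fun v hv => ?_⟩
  have hconv := hC.convexOn_realCost
  set u : ℝ → ℝ := fun t => (1 - t) * Real.exp v + t * Real.exp x with hu
  have hucont : Continuous u := by fun_prop
  have hu0 : u 0 = Real.exp v := by simp [hu]
  have hlhs : Tendsto (fun t : ℝ => u t - ((1 - t) * realCost C (Real.exp v) +
      t * realCost C (Real.exp x))) (𝓝[>] 0) (𝓝 (logGain C v)) := by
    have : Continuous fun t : ℝ => u t - ((1 - t) * realCost C (Real.exp v) +
      t * realCost C (Real.exp x)) := by fun_prop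
    have h := (this.tendsto 0).mono_left (nhdsWithin_le_nhds (s := Ioi 0))
    simpa [hu0, logGain] using h
  have hrhs : Tendsto (fun t : ℝ => logGain C x + m * (Real.log (u t) - x)) (𝓝[>] 0)
      (𝓝 (logGain C x + m * (v - x))) := by
    have h1 : Tendsto u (𝓝[>] 0) (𝓝 (Real.exp v)) := by
      have := (hucont.tendsto 0).mono_left (nhdsWithin_le_nhds (s := Ioi 0))
      rwa [hu0] at this
    have h2 := (Real.continuousAt_log (Real.exp_pos v).ne').tendsto.comp h1
    rw [Real.log_exp] at h2
    exact ((h2.sub_const x).const_mul m).const_add _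
  refine le_of_tendsto_of_tendsto hlhs hrhs ?_
  filter_upwards [Ioo_mem_nhdsGT (show (0 : ℝ) < 1 by norm_num)] with t ht
  have hut : u t ∈ finiteInterval C := by
    have := hconv.1.combo_self_interior_mem_interior (x := Real.exp v) (y := Real.exp x) hv hx
      (a := 1 - t) (b := t) (by linarith [ht.2]) ht.1 (by ring)
    exact this
  have hupos : 0 < u t := by
    have h1 := mul_pos (sub_pos.2 ht.2) (Real.exp_pos v)
    have h2 := mul_pos ht.1 (Real.exp_pos x)
    simp only [hu]
    linarith
  have h1 := hm (Real.log (u t)) (by rwa [Real.exp_log hupos])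
  have h2 : realCost C (u t) ≤ (1 - t) * realCost C (Real.exp v) + t * realCost C (Real.exp x) := by
    have := hconv.2 hv (interior_subset hx)
      (show (0 : ℝ) ≤ 1 - t by linarith [ht.2]) ht.1.le (by ring)
    simpa [hu] using this
  rw [logGain, Real.exp_log hupos] at h1
  linarith

theorem concaveOn_logGain (hC : IsCost C) : ConcaveOn ℝ (logDomain C) (logGain C) := by
  refine ⟨hC.convex_logDomain, fun v hv w hw a b ha hb hab => ?_⟩
  rcases eq_or_ne v w with rfl | hvw
  · rw [← add_smul, ← add_smul, hab, one_smul, one_smul]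
  · rcases ha.eq_or_lt with rfl | ha'
    · rw [zero_add] at hab; simp [hab]
    rcases hb.eq_or_lt with rfl | hb'
    · rw [add_zero] at hab; simp [hab]
    set x := a • v + b • w with hx
    have hmem : Real.exp x ∈ finiteInterval C := by
      have aux : ∀ v w : ℝ, v ∈ logDomain C → w ∈ logDomain C → v < x → x < w →
          Real.exp x ∈ finiteInterval C := by
        intro v w hv hw h1 h2
        have hsub : Ioo (Real.exp v) (Real.exp w) ⊆ costDomain C := fun z hz =>
          hC.convexOn_realCost.1.ordConnected.out hv hw ⟨hz.1.le, hz.2.le⟩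
        exact interior_maximal hsub isOpen_Ioo ⟨Real.exp_lt_exp.2 h1, Real.exp_lt_exp.2 h2⟩
      have hxv : x - v = b * (w - v) := by
        rw [hx, smul_eq_mul, smul_eq_mul, ← eq_sub_iff_add_eq] at *
        rw [hab]; ring
      have hwx : w - x = a * (w - v) := by
        rw [hx, smul_eq_mul, smul_eq_mul, ← eq_sub_iff_add_eq'] at *
        rw [hab]; ring
      rcases lt_or_gt_of_ne hvw with h | h
      · exact aux v w hv hw (by nlinarith) (by nlinarith)
      · exact aux w v hw hv (by nlinarith) (by nlinarith)
    obtain ⟨m, hm⟩ := hC.exists_supergradient hmem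
    have h1 := mul_le_mul_of_nonneg_left (hm v hv) ha
    have h2 := mul_le_mul_of_nonneg_left (hm w hw) hb
    have h3 : a * (m * (v - x)) + b * (m * (w - x)) = m * ((a • v + b • w) - (a + b) * x) := by
      rw [smul_eq_mul, smul_eq_mul]; ring
    rw [← hx, hab, one_mul, sub_self, mul_zero] at h3
    have h4 : a * logGain C x + b * logGain C x = logGain C x := by rw [← add_mul, hab, one_mul]
    rw [smul_eq_mul, smul_eq_mul]
    linarith

theorem logGain_le (hC : IsCost C) {v : ℝ} (hv : v ∈ logDomain C) : logGain C v ≤ 1 + v := by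
  have hconc := hC.concaveOn_logGain
  have hder : HasDerivWithinAt (fun t : ℝ => Real.exp (t * v)) v (Ioi 0) 0 := by
    have := ((hasDerivAt_id (0 : ℝ)).mul_const v).exp
    simpa using this.hasDerivWithinAt
  have hlim := hasDerivWithinAt_iff_tendsto_slope' (self_notMem_Ioi) |>.1 hder
  have : logGain C v - 1 ≤ v := by
    refine ge_of_tendsto hlim ?_
    filter_upwards [Ioo_mem_nhdsGT (show (0 : ℝ) < 1 by norm_num)] with t ht
    have h1 := hconc.2 hC.zero_mem_logDomain hv (show (0 : ℝ) ≤ 1 - t by linarith [ht.2]) ht.1.le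
      (by ring)
    rw [hC.logGain_zero] at h1
    simp only [smul_eq_mul, mul_zero, zero_add, mul_one] at h1
    have h2 : logGain C (t * v) ≤ Real.exp (t * v) := by
      have := realCost_nonneg C (Real.exp (t * v))
      rw [logGain]; linarith
    rw [slope_def_field, zero_mul, Real.exp_zero, sub_zero, le_div_iff₀ ht.1]
    linarith
  linarith

end IsCost

/-! ### The Hamiltonian -/

/-- The objective `u (1 - exp (-p)) - C u` at `u = exp v`. -/
def hamObjective (C : ℝ≥0 → ℝ≥0∞) (p v : ℝ) : ℝ := logGain C v - Real.exp (v - p)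

/-- The Hamiltonian `sup_u (u (1 - exp (-p)) - C u)`. -/
def hamiltonian (C : ℝ≥0 → ℝ≥0∞) (p : ℝ) : ℝ := sSup (hamObjective C p '' logDomain C)

namespace IsCost

variable {C : ℝ≥0 → ℝ≥0∞}

theorem hamObjective_le_self (hC : IsCost C) {p v : ℝ} (hv : v ∈ logDomain C) :
    hamObjective C p v ≤ p := by
  have h1 := hC.logGain_le hv
  have h2 := Real.add_one_le_exp (v - p)
  rw [hamObjective]; linarith

theorem bddAbove_hamObjective (hC : IsCost C) (p : ℝ) :
    BddAbove (hamObjective C p '' logDomain C) :=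
  ⟨p, by rintro _ ⟨v, hv, rfl⟩; exact hC.hamObjective_le_self hv⟩

theorem nonempty_hamObjective (hC : IsCost C) (p : ℝ) :
    (hamObjective C p '' logDomain C).Nonempty :=
  ⟨_, 0, hC.zero_mem_logDomain, rfl⟩

theorem hamObjective_le (hC : IsCost C) {p v : ℝ} (hv : v ∈ logDomain C) :
    hamObjective C p v ≤ hamiltonian C p :=
  le_csSup (hC.bddAbove_hamObjective p) ⟨v, hv, rfl⟩

theorem hamiltonian_le_self (hC : IsCost C) (p : ℝ) : hamiltonian C p ≤ p :=
  csSup_le (hC.nonempty_hamObjective p)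
    (by rintro _ ⟨v, hv, rfl⟩; exact hC.hamObjective_le_self hv)

theorem le_hamiltonian (hC : IsCost C) (p : ℝ) : 1 - Real.exp (-p) ≤ hamiltonian C p := by
  have := hC.hamObjective_le (p := p) hC.zero_mem_logDomain
  rwa [hamObjective, hC.logGain_zero, zero_sub] at this

/-- The objective can only be improved by moving to the interval between `0` and `p`. -/
theorem exists_mem_uIcc (hC : IsCost C) (p : ℝ) {w : ℝ} (hw : w ∈ logDomain C) :
    ∃ w' ∈ logDomain C, w' ∈ uIcc 0 p ∧ hamObjective C p w ≤ hamObjective C p w' := by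
  have h0 := hC.zero_mem_logDomain
  have hzero : 0 ≤ (1 - Real.exp w) * (1 - Real.exp (-p)) →
      hamObjective C p w ≤ hamObjective C p 0 := by
    intro h
    have := realCost_nonneg C (Real.exp w)
    rw [hamObjective, hamObjective, hC.logGain_zero, logGain, sub_eq_add_neg w, Real.exp_add,
      zero_sub]
    linarith
  -- beyond `p`, the exponential dominates the increments of the concave function
  have hfar : ∀ l : ℝ, 0 ≤ l → l ≤ 1 → p = l * w → hamObjective C p w ≤ hamObjective C p p ∧
      p ∈ logDomain C := by
    intro l hl0 hl1 hp
    have hmem : p ∈ logDomain C := by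
      have := hC.convex_logDomain h0 hw (a := 1 - l) (b := l) (by linarith) hl0 (by ring)
      simpa [hp] using this
    have h1 := hC.concaveOn_logGain.2 h0 hw (show (0 : ℝ) ≤ 1 - l by linarith) hl0 (by ring)
    rw [hC.logGain_zero] at h1
    simp only [smul_eq_mul, mul_zero, zero_add, mul_one] at h1
    rw [← hp] at h1
    have h2 := hC.logGain_le hw
    have h3 := Real.add_one_le_exp (w - p)
    have h4 : (1 - l) * (logGain C w - 1) ≤ (1 - l) * w :=
      mul_le_mul_of_nonneg_left (by linarith) (by linarith)
    refine ⟨?_, hmem⟩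
    rw [hamObjective, hamObjective, sub_self, Real.exp_zero]
    nlinarith
  rcases le_total 0 p with hp | hp
  · have he : 0 ≤ 1 - Real.exp (-p) := by
      have : Real.exp (-p) ≤ 1 := Real.exp_le_one_iff.2 (by linarith)
      linarith
    rcases le_total w 0 with hw0 | hw0
    · refine ⟨0, h0, left_mem_uIcc, hzero (mul_nonneg ?_ he)⟩
      have : Real.exp w ≤ 1 := Real.exp_le_one_iff.2 hw0
      linarith
    · rcases le_total w p with hwp | hwp
      · exact ⟨w, hw, by rw [uIcc_of_le hp]; exact ⟨hw0, hwp⟩, le_rfl⟩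
      · rcases hw0.eq_or_lt with rfl | hw1
        · exact ⟨0, h0, left_mem_uIcc, le_rfl⟩
        · obtain ⟨h1, h2⟩ := hfar (p / w) (div_nonneg hp hw0) ((div_le_one hw1).2 hwp)
            (by field_simp)
          exact ⟨p, h2, right_mem_uIcc, h1⟩
  · have he : 1 - Real.exp (-p) ≤ 0 := by
      have : 1 ≤ Real.exp (-p) := Real.one_le_exp (by linarith)
      linarith
    rcases le_total 0 w with hw0 | hw0
    · refine ⟨0, h0, left_mem_uIcc, hzero (mul_nonneg_of_nonpos_of_nonpos ?_ he)⟩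
      have : 1 ≤ Real.exp w := Real.one_le_exp hw0
      linarith
    · rcases le_total p w with hwp | hwp
      · exact ⟨w, hw, by rw [uIcc_of_ge hp]; exact ⟨hwp, hw0⟩, le_rfl⟩
      · rcases hw0.eq_or_lt with rfl | hw1
        · exact ⟨0, h0, left_mem_uIcc, le_rfl⟩
        · obtain ⟨h1, h2⟩ := hfar (p / w) (div_nonneg_of_nonpos hp hw0)
            ((div_le_one_of_neg hw1).2 hwp)
            (by rw [div_mul_cancel₀ _ hw1.ne])
          exact ⟨p, h2, right_mem_uIcc, h1⟩

theorem exists_near (hC : IsCost C) (p : ℝ) {ε : ℝ} (hε : 0 < ε) :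
    ∃ w ∈ logDomain C, w ∈ uIcc 0 p ∧ hamiltonian C p - ε < hamObjective C p w := by
  obtain ⟨_, ⟨w, hw, rfl⟩, h⟩ := exists_lt_of_lt_csSup (hC.nonempty_hamObjective p)
    (show hamiltonian C p - ε < sSup (hamObjective C p '' logDomain C) by
      rw [hamiltonian]; linarith)
  obtain ⟨w', hw', hm, hle⟩ := hC.exists_mem_uIcc p hw
  exact ⟨w', hw', hm, h.trans_le hle⟩

theorem monotone_hamiltonian (hC : IsCost C) : Monotone (hamiltonian C) := by
  intro p p' hpp
  refine csSup_le (hC.nonempty_hamObjective p) ?_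
  rintro _ ⟨v, hv, rfl⟩
  refine le_trans ?_ (hC.hamObjective_le hv)
  have : Real.exp (v - p') ≤ Real.exp (v - p) := Real.exp_le_exp.2 (by linarith)
  rw [hamObjective, hamObjective]
  linarith

theorem hamiltonian_le_add (hC : IsCost C) {p p' : ℝ} (hpp : p ≤ p') :
    hamiltonian C p' ≤ hamiltonian C p +
    Real.exp (max 0 p') * (Real.exp (-p) - Real.exp (-p')) := by
  refine le_of_forall_pos_le_add fun ε hε => ?_
  obtain ⟨w, hw, hm, h⟩ := hC.exists_near p' hε
  have h1 := hC.hamObjective_le (p := p) hw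
  have h2 : Real.exp w ≤ Real.exp (max 0 p') := Real.exp_le_exp.2 hm.2
  have h3 : 0 ≤ Real.exp (-p) - Real.exp (-p') :=
    sub_nonneg.2 (Real.exp_le_exp.2 (by linarith))
  have h4 := mul_le_mul_of_nonneg_right h2 h3
  have h5 : hamObjective C p' w = hamObjective C p w +
      Real.exp w * (Real.exp (-p) - Real.exp (-p')) := by
    rw [hamObjective, hamObjective, sub_eq_add_neg w p, sub_eq_add_neg w p', Real.exp_add,
      Real.exp_add]
    ring
  linarith

theorem continuous_hamiltonian (hC : IsCost C) : Continuous (hamiltonian C) := by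
  refine continuous_iff_continuousAt.2 fun p => ?_
  set b : ℝ → ℝ := fun p' => Real.exp (max 0 (max p p')) * |Real.exp (-p) - Real.exp (-p')| with hb
  have hbt : Tendsto b (𝓝 p) (𝓝 0) := by
    have : Continuous b := by fun_prop
    simpa [hb] using this.tendsto p
  refine tendsto_iff_dist_tendsto_zero.2 (squeeze_zero (fun _ => dist_nonneg) (fun p' => ?_) hbt)
  rw [Real.dist_eq]
  rcases le_total p p' with h | h
  · have h1 := hC.hamiltonian_le_add h
    have h2 := hC.monotone_hamiltonian h
    rw [abs_of_nonneg (by linarith), hb]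
    dsimp only
    rw [max_eq_right h, abs_of_nonneg (sub_nonneg.2 (Real.exp_le_exp.2 (by linarith)))]
    linarith
  · have h1 := hC.hamiltonian_le_add h
    have h2 := hC.monotone_hamiltonian h
    rw [abs_sub_comm, abs_of_nonneg (by linarith), hb]
    dsimp only
    rw [max_eq_left h, abs_sub_comm (Real.exp (-p)),
      abs_of_nonneg (sub_nonneg.2 (Real.exp_le_exp.2 (by linarith)))]
    linarith

/-- A supergradient of the logarithmic gain at the (possibly only approximate) maximiser of the
objective. -/
theorem exists_dual (hC : IsCost C) (p : ℝ) : ∃ v : ℝ, ∀ w ∈ logDomain C,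
    logGain C w ≤ hamiltonian C p + Real.exp (v - p) * (1 + (w - v)) := by
  set S := hamiltonian C p with hS
  have hseq : ∀ n : ℕ, ∃ w ∈ logDomain C, w ∈ uIcc 0 p ∧
      S - 1 / ((n : ℝ) + 1) < hamObjective C p w := fun n =>
    hC.exists_near p (by positivity)
  choose s hs1 hs2 hs3 using hseq
  obtain ⟨v, -, φ, hφ, hlim⟩ := (isCompact_uIcc (a := (0 : ℝ)) (b := p)).tendsto_subseq hs2
  refine ⟨v, fun w hw => ?_⟩
  have hobj : Tendsto (fun n => hamObjective C p (s (φ n))) atTop (𝓝 S) := by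
    refine tendsto_of_tendsto_of_tendsto_of_le_of_le (g := fun n => S - 1 / ((φ n : ℝ) + 1))
      (h := fun _ => S) ?_ tendsto_const_nhds (fun n => (hs3 (φ n)).le)
      (fun n => hC.hamObjective_le (hs1 _))
    simpa using tendsto_const_nhds.sub
      ((tendsto_one_div_add_atTop_nhds_zero_nat (𝕜 := ℝ)).comp hφ.tendsto_atTop)
  have hq : Tendsto (fun n => Real.exp (s (φ n) - p)) atTop (𝓝 (Real.exp (v - p))) :=
    (Real.continuous_exp.tendsto _).comp (hlim.sub_const p)
  -- concavity along the segment from `v` to `w`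
  have hl : ∀ l ∈ Ioo (0 : ℝ) 1, l * logGain C w ≤
      l * S + Real.exp (v - p + l * (w - v)) - (1 - l) * Real.exp (v - p) := by
    intro l hl
    have hlim2 : Tendsto (fun n => S + Real.exp (s (φ n) - p + l * (w - s (φ n))) -
        (1 - l) * (hamObjective C p (s (φ n)) + Real.exp (s (φ n) - p))) atTop
        (𝓝 (S + Real.exp (v - p + l * (w - v)) - (1 - l) * (S + Real.exp (v - p)))) := by
      refine (tendsto_const_nhds.add ?_).sub ((hobj.add hq).const_mul _)
      have : Tendsto (fun n => s (φ n) - p + l * (w - s (φ n))) atTop (𝓝 (v - p + l * (w - v))) :=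
        (hlim.sub_const p).add ((hlim.const_sub w).const_mul l)
      exact (Real.continuous_exp.tendsto _).comp this
    have h := ge_of_tendsto' hlim2 (b := l * logGain C w) fun n => by
      have h1 := hC.concaveOn_logGain.2 (hs1 (φ n)) hw (show (0 : ℝ) ≤ 1 - l by linarith [hl.2])
        hl.1.le (by ring)
      have h2 := hC.hamObjective_le (p := p) (hC.convex_logDomain (hs1 (φ n)) hw (a := 1 - l)
        (b := l)
        (by linarith [hl.2]) hl.1.le (by ring))
      simp only [smul_eq_mul] at h1 h2
      rw [hamObjective, show (1 - l) * s (φ n) + l * w - p = s (φ n) - p + l *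
        (w - s (φ n)) by ring]
        at h2
      rw [hamObjective]
      linarith
    linarith
  have hder : HasDerivWithinAt (fun l : ℝ => Real.exp (v - p + l * (w - v)))
      (Real.exp (v - p) * (w - v)) (Ioi 0) 0 := by
    have := (((hasDerivAt_id (0 : ℝ)).mul_const (w - v)).const_add (v - p)).exp
    simpa using this.hasDerivWithinAt
  have hslope := hasDerivWithinAt_iff_tendsto_slope' (self_notMem_Ioi) |>.1 hder
  have : logGain C w - S - Real.exp (v - p) ≤ Real.exp (v - p) * (w - v) := by
    refine ge_of_tendsto hslope ?_
    filter_upwards [Ioo_mem_nhdsGT (show (0 : ℝ) < 1 by norm_num)] with l hl'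
    rw [slope_def_field, zero_mul, add_zero, sub_zero, le_div_iff₀ hl'.1]
    linarith [hl l hl']
  linarith

end IsCost

/-! ### Duality between the two running costs -/

/-- The relations between the cost `c` of the risk-sensitive problem, the cost `F` of the ordinary
problem and the Hamiltonian `H` of a transition with nominal rate `g`, on which the verification
arguments rely.  For a difference `p` of values, `H p` is the minimum over `q` of `F q + q p`, and
`-H p` is the infimum over `u` of `c u + u (exp (-p) - 1)`. -/
structure IsDualCost (g : ℝ≥0) (c F : ℝ≥0 → ℝ≥0∞) (H : ℝ → ℝ) : Prop where
  pos : 0 < g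
  continuous : Continuous H
  monotone : Monotone H
  le : ∀ p, H p ≤ g * p
  ge : ∀ p, g * (1 - Real.exp (-p)) ≤ H p
  ofReal_le : ∀ p (q : ℝ≥0), 0 < q → ENNReal.ofReal (H p - q * p) ≤ F q
  exists_le : ∀ p, ∃ q : ℝ≥0, 0 < q ∧ q * p ≤ H p ∧ F q ≤ ENNReal.ofReal (H p - q * p)
  ofReal_le_cost : ∀ p (u : ℝ≥0), 0 < u → ENNReal.ofReal (-H p - u * (Real.exp (-p) - 1)) ≤ c u
  exists_cost_le : ∀ p, ∃ a b : ℝ≥0, 0 < a ∧ ∀ ε : ℝ, 0 < ε → ∃ u : ℝ≥0, a ≤ u ∧ u ≤ b ∧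
    0 ≤ -H p - u * (Real.exp (-p) - 1) + ε ∧
    c u ≤ ENNReal.ofReal (-H p - u * (Real.exp (-p) - 1) + ε)
  nominal : c g = 0

theorem IsDualCost.zero {g : ℝ≥0} {c F : ℝ≥0 → ℝ≥0∞} {H : ℝ → ℝ} (h : IsDualCost g c F H) :
    H 0 = 0 :=
  le_antisymm (by simpa using h.le 0) (by simpa using h.ge 0)

section Duality

variable {X : Type*} {γ : X → X → ℝ≥0}

theorem costG_eq (C : Edge γ → ℝ≥0 → ℝ≥0∞) (z : Edge γ) {v : ℝ} (hv : v ∈ logDomain (C z))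
    {u q : ℝ≥0}
    (hu : (u : ℝ) = z.rate * Real.exp v) (hq : 0 < q) : costG C z u q =
      ((q * Real.log (q / z.rate) - q - q * v + z.rate * logGain (C z) v : ℝ) : EReal) := by
  have hg : (0 : ℝ) < z.rate := NNReal.coe_pos.2 z.2
  have hq' : (0 : ℝ) < q := by exact_mod_cast hq
  have hdiv : u / z.rate = (Real.exp v).toNNReal := by
    rw [← NNReal.coe_inj, NNReal.coe_div, hu, Real.coe_toNNReal _ (Real.exp_pos v).le]
    field_simp
  have hcost : (rateCost C z u : EReal) = ((z.rate * realCost (C z) (Real.exp v) : ℝ) : EReal) := by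
    rw [rateCost, hdiv, realCost, ← ENNReal.coe_toReal, ← ENNReal.toReal_mul]
    rw [EReal.coe_ennreal_toReal (ENNReal.mul_ne_top ENNReal.coe_ne_top hv.2)]
  rw [costG, hcost, ← EReal.coe_sub]
  congr 1
  have he := (Real.exp_pos v).ne'
  have hlog : Real.log ((q : ℝ) / u) = Real.log (q / z.rate) - v := by
    rw [hu, ← div_div, Real.log_div (by positivity) he, Real.log_exp]
  rw [ell, hlog, logGain, hu]
  field_simp
  ring

/-- The standing assumption implies the duality relations. -/
theorem isDualCost {C : Edge γ → ℝ≥0 → ℝ≥0∞} {z : Edge γ} (hC : IsCost (C z)) :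
    IsDualCost z.rate (rateCost C z) (fun q => (costF C z q).toENNReal)
      (fun p => z.rate * hamiltonian (C z) p) := by
  have hg : (0 : ℝ) < z.rate := NNReal.coe_pos.2 z.2
  have hrate : ∀ (u : ℝ≥0) (v : ℝ), (u : ℝ) = z.rate * Real.exp v →
      u / z.rate = (Real.exp v).toNNReal := by
    intro u v hu
    rw [← NNReal.coe_inj, NNReal.coe_div, hu, Real.coe_toNNReal _ (Real.exp_pos v).le]
    field_simp
  have hlogu : ∀ u : ℝ≥0, 0 < u → (u : ℝ) = z.rate * Real.exp (Real.log (u / z.rate)) := by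
    intro u hu
    have hu' : (0 : ℝ) < u := by exact_mod_cast hu
    rw [Real.exp_log (by positivity)]
    field_simp
  refine ⟨z.2, ?_, ?_, ?_, ?_, ?_, ?_, ?_, ?_, ?_⟩
  · exact continuous_const.mul hC.continuous_hamiltonian
  · exact hC.monotone_hamiltonian.const_mul hg.le
  · exact fun p => mul_le_mul_of_nonneg_left (hC.hamiltonian_le_self p) hg.le
  · exact fun p => mul_le_mul_of_nonneg_left (hC.le_hamiltonian p) hg.le
  · intro p q hq
    have hq' : (0 : ℝ) < q := by exact_mod_cast hq
    have key : ((z.rate * hamiltonian (C z) p - q * p : ℝ) : EReal) ≤ costF C z q := by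
      have hv : ∀ v ∈ logDomain (C z),
          ((z.rate * hamObjective (C z) p v - q * p : ℝ) : EReal) ≤ costF C z q := by
        intro v hv
        set u : ℝ≥0 := z.rate * (Real.exp v).toNNReal with hu
        have hu' : (u : ℝ) = z.rate * Real.exp v := by
          rw [hu, NNReal.coe_mul, Real.coe_toNNReal _ (Real.exp_pos v).le]
        have hupos : 0 < u := by
          rw [← NNReal.coe_pos, hu']
          exact mul_pos hg (Real.exp_pos v)
        have h1 : costG C z u q ≤ costF C z q :=
          le_iSup₂ (f := fun (u : ℝ≥0) (_ : 0 < u) => costG C z u q) u hupos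
        refine le_trans ?_ h1
        rw [costG_eq C z hv hu' hq, EReal.coe_le_coe_iff, hamObjective]
        -- the exponential lies above its tangent
        have h2 := Real.add_one_le_exp (v - p - Real.log (q / z.rate))
        rw [Real.exp_sub, Real.exp_log (by positivity)] at h2
        have h3 : Real.exp (v - p) / (q / z.rate) * q = z.rate * Real.exp (v - p) := by
          field_simp
        have h4 := mul_le_mul_of_nonneg_right h2 hq'.le
        rw [h3] at h4
        nlinarith
      by_cases htop : costF C z q = ⊤
      · rw [htop]; exact le_top
      · have hbot : costF C z q ≠ ⊥ := by
          intro h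
          have := hv 0 hC.zero_mem_logDomain
          rw [h, le_bot_iff] at this
          exact EReal.coe_ne_bot _ this
        lift costF C z q to ℝ using ⟨htop, hbot⟩ with x
        rw [EReal.coe_le_coe_iff]
        have h1 : hamiltonian (C z) p ≤ (x + q * p) / z.rate := by
          refine csSup_le (hC.nonempty_hamObjective p) ?_
          rintro _ ⟨v, hv', rfl⟩
          have := EReal.coe_le_coe_iff.1 (hv v hv')
          rw [le_div_iff₀ hg]
          linarith
        rw [le_div_iff₀ hg] at h1
        linarith
    have := EReal.toENNReal_le_toENNReal key
    rwa [EReal.real_coe_toENNReal] at this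
  · intro p
    obtain ⟨v, hv⟩ := hC.exists_dual p
    set q : ℝ≥0 := z.rate * (Real.exp (v - p)).toNNReal with hq
    have hq' : (q : ℝ) = z.rate * Real.exp (v - p) := by
      rw [hq, NNReal.coe_mul, Real.coe_toNNReal _ (Real.exp_pos _).le]
    have hqpos : 0 < q := by
      rw [← NNReal.coe_pos, hq']
      exact mul_pos hg (Real.exp_pos _)
    have key : costF C z q ≤ ((z.rate * hamiltonian (C z) p - q * p : ℝ) : EReal) := by
      refine iSup₂_le fun u hu => ?_
      by_cases hfin : C z (u / z.rate) = ∞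
      · rw [costG, rateCost, hfin, ENNReal.mul_top (by exact_mod_cast z.2.ne'),
        EReal.coe_ennreal_top,
          EReal.sub_top]
        exact bot_le
      · set w := Real.log (u / z.rate) with hw
        have hu' := hlogu u hu
        have hmem : w ∈ logDomain (C z) := by
          refine ⟨(Real.exp_pos _).le, ?_⟩
          rwa [← hrate u w hu']
        rw [costG_eq C z hmem hu' hqpos, EReal.coe_le_coe_iff, hq']
        have h1 := mul_le_mul_of_nonneg_left (hv w hmem) hg.le
        have h2 : Real.log (z.rate * Real.exp (v - p) / z.rate) = v - p := by
          rw [mul_div_cancel_left₀ _ hg.ne', Real.log_exp]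
        rw [h2]
        linarith
    have hnonneg : (0 : EReal) ≤ ((z.rate * hamiltonian (C z) p - q * p : ℝ) : EReal) := by
      refine le_trans ?_ ((le_iSup₂ (f := fun (u : ℝ≥0) (_ : 0 < u) => costG C z u q) z.rate
        z.2).trans key)
      have hq0 : (0 : ℝ) < q := by exact_mod_cast hqpos
      rw [costG_eq C z hC.zero_mem_logDomain (by simp) hqpos, hC.logGain_zero, ← EReal.coe_zero,
        EReal.coe_le_coe_iff]
      have h1 := Real.one_sub_inv_le_log_of_pos (show (0 : ℝ) < q / z.rate by positivity)
      have h2 := mul_le_mul_of_nonneg_left h1 hq0.le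
      rw [mul_sub, inv_div, mul_div_cancel₀ _ hq0.ne'] at h2
      linarith
    refine ⟨q, hqpos, ?_, ?_⟩
    · have := EReal.coe_le_coe_iff.1 hnonneg
      linarith
    have := EReal.toENNReal_le_toENNReal key
    rwa [EReal.real_coe_toENNReal] at this
  · intro p u hu
    by_cases hfin : C z (u / z.rate) = ∞
    · rw [rateCost, hfin, ENNReal.mul_top (by exact_mod_cast z.2.ne')]
      exact le_top
    · set w := Real.log (u / z.rate) with hw
      have hu' := hlogu u hu
      have hmem : w ∈ logDomain (C z) := by
        refine ⟨(Real.exp_pos _).le, ?_⟩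
        rwa [← hrate u w hu']
      have h1 : rateCost C z u = ENNReal.ofReal (z.rate * realCost (C z) (Real.exp w)) := by
        rw [rateCost, hrate u w hu', ENNReal.ofReal_mul hg.le, ENNReal.ofReal_coe_nnreal, realCost,
          ENNReal.ofReal_toReal hmem.2]
      rw [h1]
      refine ENNReal.ofReal_le_ofReal ?_
      have h2 := mul_le_mul_of_nonneg_left (hC.hamObjective_le (p := p) hmem) hg.le
      rw [hamObjective, logGain, sub_eq_add_neg w p, Real.exp_add] at h2
      rw [hu']
      linarith
  · intro p
    refine ⟨z.rate * (Real.exp (min 0 p)).toNNReal, z.rate * (Real.exp (max 0 p)).toNNReal,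
      mul_pos z.2 (Real.toNNReal_pos.2 (Real.exp_pos _)), fun ε hε => ?_⟩
    obtain ⟨w, hw, hm, h⟩ := hC.exists_near p (div_pos hε hg)
    set u : ℝ≥0 := z.rate * (Real.exp w).toNNReal with hu
    have hu' : (u : ℝ) = z.rate * Real.exp w := by
      rw [hu, NNReal.coe_mul, Real.coe_toNNReal _ (Real.exp_pos w).le]
    refine ⟨u, mul_le_mul_right (Real.toNNReal_mono (Real.exp_le_exp.2 hm.1)) _,
      mul_le_mul_right (Real.toNNReal_mono (Real.exp_le_exp.2 hm.2)) _, ?_⟩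
    have h1 : rateCost C z u = ENNReal.ofReal (z.rate * realCost (C z) (Real.exp w)) := by
      rw [rateCost, hrate u w hu', ENNReal.ofReal_mul hg.le, ENNReal.ofReal_coe_nnreal, realCost,
        ENNReal.ofReal_toReal hw.2]
    have h2 := mul_lt_mul_of_pos_left h hg
    rw [hamObjective, logGain, sub_eq_add_neg w p, Real.exp_add, mul_sub,
      mul_div_cancel₀ _ hg.ne'] at h2
    have h3 : z.rate * realCost (C z) (Real.exp w) ≤
        -(z.rate * hamiltonian (C z) p) - u * (Real.exp (-p) - 1) + ε := by
      rw [hu']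
      linarith
    have h4 : 0 ≤ z.rate * realCost (C z) (Real.exp w) := mul_nonneg hg.le ENNReal.toReal_nonneg
    exact ⟨h4.trans h3, h1.trans_le (ENNReal.ofReal_le_ofReal h3)⟩
  · rw [rateCost, div_self (NNReal.coe_pos.1 hg).ne', hC.at_one, mul_zero]

end Duality

/-! ### Lyapunov functions and the dynamic programming equation -/

section Potential

variable {κ E : Type*}

/-- One state can be reached from another one in a single jump of positive rate. -/
def JumpStep (q : E → κ → ℝ≥0) (next : E → κ → E) (y z : E) : Prop := ∃ k, 0 < q y k ∧ next y k = z

/-- The distance to the target set in the graph of the jumps. -/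
theorem exists_level {q : E → κ → ℝ≥0} {next : E → κ → E} {K : Set E}
    (hreach : ∀ y, ∃ z ∈ K, Relation.ReflTransGen (JumpStep q next) y z) :
    ∃ d : E → ℕ, (∀ y ∈ K, d y = 0) ∧ ∀ y ∉ K, ∃ k, 0 < q y k ∧ d (next y k) < d y := by
  classical
  let P : ℕ → E → Prop := fun n => Nat.rec (motive := fun _ => E → Prop) (fun y => y ∈ K)
    (fun _ Q y => ∃ k, 0 < q y k ∧ Q (next y k)) n
  have hP : ∀ y, ∃ n, P n y := by
    intro y
    obtain ⟨z, hz, h⟩ := hreach y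
    induction h using Relation.ReflTransGen.head_induction_on with
    | refl => exact ⟨0, hz⟩
    | head hab _ ih =>
      obtain ⟨k, hk, rfl⟩ := hab
      obtain ⟨n, hn⟩ := ih
      exact ⟨n + 1, k, hk, hn⟩
  refine ⟨fun y => Nat.find (hP y), fun y hy => ?_, fun y hy => ?_⟩
  · exact (Nat.find_eq_zero _).2 hy
  · have h0 : Nat.find (hP y) ≠ 0 := fun h => hy ((Nat.find_eq_zero _).1 h)
    obtain ⟨m, hm⟩ := Nat.exists_eq_succ_of_ne_zero h0
    have hs := Nat.find_spec (hP y)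
    rw [hm] at hs
    obtain ⟨k, hk, hn⟩ := hs
    refine ⟨k, hk, ?_⟩
    have := Nat.find_min' (hP (next y k)) hn
    show Nat.find (hP (next y k)) < Nat.find (hP y)
    omega

/-- A function which equals one on the target set, and which grows exponentially along every
controlled process, as long as the controls stay between fixed bounds. -/
theorem exists_lyapunov [Fintype κ] [Finite E] {q : E → κ → ℝ≥0} {next : E → κ → E} {K : Set E}
    (hreach : ∀ y, ∃ z ∈ K, Relation.ReflTransGen (JumpStep q next) y z) {a : ℝ≥0} (ha : 0 < a)
    (b : ℝ≥0) (β : ℝ) : ∃ (h : E → ℝ≥0) (m : ℝ≥0), 0 < m ∧ (∀ y, m ≤ h y) ∧ (∀ y, h y ≤ 1) ∧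
      (∀ y ∈ K, h y = 1) ∧ (∀ y ∉ K, h y ≤ 1 / 2) ∧ ∀ y ∉ K, ∀ u : κ → ℝ≥0,
        (∀ k, a ≤ u k ∧ u k ≤ b) →
        β * h y ≤ ∑ k, (q y k * u k : ℝ) * (h (next y k) - h y) := by
  classical
  obtain ⟨_⟩ := nonempty_fintype E
  obtain ⟨d, hd0, hd⟩ := exists_level hreach
  obtain ⟨ρ, hρ, hρq⟩ : ∃ ρ : ℝ, 0 < ρ ∧ ∀ y k, 0 < q y k → ρ ≤ q y k := by
    have : ∀ p : E × κ, ∃ ρ : ℝ, 0 < ρ ∧ (0 < q p.1 p.2 → ρ ≤ q p.1 p.2) := by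
      intro p
      by_cases h : 0 < q p.1 p.2
      · exact ⟨q p.1 p.2, h, fun _ => le_rfl⟩
      · exact ⟨1, one_pos, fun h' => absurd h' h⟩
    choose f hf hfq using this
    obtain ⟨ρ, hρ, h⟩ : ∃ ρ : ℝ, 0 < ρ ∧ ∀ p, ρ ≤ f p := by
      rcases isEmpty_or_nonempty (E × κ) with h | h
      · exact ⟨1, one_pos, fun p => (h.false p).elim⟩
      · obtain ⟨p, hp⟩ := Finite.exists_min f
        exact ⟨f p, hf p, hp⟩
    exact ⟨ρ, hρ, fun y k hk => (h (y, k)).trans (hfq (y, k) hk)⟩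
  set Λ : ℝ := ∑ y, ∑ k, (q y k : ℝ) * b with hΛ
  have hΛy : ∀ y, ∑ k, (q y k : ℝ) * b ≤ Λ := fun y =>
    Finset.single_le_sum (f := fun y => ∑ k, (q y k : ℝ) * b)
      (fun y _ => Finset.sum_nonneg fun k _ => by positivity) (Finset.mem_univ y)
  have hΛ0 : 0 ≤ Λ := Finset.sum_nonneg fun y _ => Finset.sum_nonneg fun k _ => by positivity
  have ha' : (0 : ℝ) < a := by exact_mod_cast ha
  -- a small base for the powers of the distance to the target
  obtain ⟨η, hη0, hη1, hη2⟩ : ∃ η : ℝ, 0 < η ∧ η ≤ 1 / 2 ∧ (Λ + |β|) * η ≤ ρ * a * (1 - η) := by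
    refine ⟨min (1 / 2) (ρ * a / (2 * (Λ + |β| + 1))), ?_, min_le_left _ _, ?_⟩
    · have : 0 < Λ + |β| + 1 := by positivity
      exact lt_min (by norm_num) (by positivity)
    · set η := min (1 / 2 : ℝ) (ρ * a / (2 * (Λ + |β| + 1))) with hη
      have h1 : η ≤ 1 / 2 := min_le_left _ _
      have h2 : η ≤ ρ * a / (2 * (Λ + |β| + 1)) := min_le_right _ _
      have h3 : 0 < 2 * (Λ + |β| + 1) := by positivity
      have h0 : 0 ≤ η := le_min (by norm_num) (by positivity)
      rw [le_div_iff₀ h3] at h2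
      have h4 : ρ * a * (1 / 2) ≤ ρ * a * (1 - η) :=
        mul_le_mul_of_nonneg_left (by linarith) (by positivity)
      nlinarith
  have hη1' : η ≤ 1 := by linarith
  set η' : ℝ≥0 := ⟨η, hη0.le⟩ with hη'
  have hη'1 : η' ≤ 1 := by rw [← NNReal.coe_le_coe]; exact hη1'
  have hη'2 : η' ≤ 1 / 2 := by
    rw [← NNReal.coe_le_coe]
    push_cast
    exact hη1
  have hcoe : ∀ n : ℕ, ((η' ^ n : ℝ≥0) : ℝ) = η ^ n := fun n => by rw [NNReal.coe_pow]; rfl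
  refine ⟨fun y => η' ^ d y, η' ^ (∑ y, d y), pow_pos hη0 _, fun y => ?_, fun y => ?_,
    fun y hy => ?_, fun y hy => ?_, fun y hy u hu => ?_⟩
  · exact pow_le_pow_of_le_one zero_le hη'1 (Finset.single_le_sum (f := d)
      (fun _ _ => Nat.zero_le _) (Finset.mem_univ y))
  · exact pow_le_one₀ zero_le hη'1
  · simp [hd0 y hy]
  · obtain ⟨k, -, hk⟩ := hd y hy
    have h1 : η' ^ d y ≤ η' ^ 1 := pow_le_pow_of_le_one zero_le hη'1 (by omega)
    exact h1.trans (by rwa [pow_one])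
  · obtain ⟨k₀, hk₀, hlt⟩ := hd y hy
    simp only [hcoe]
    have hpow : 0 < η ^ d y := pow_pos hη0 _
    obtain ⟨j, hj⟩ : ∃ j, d y = j + 1 := Nat.exists_eq_succ_of_ne_zero (by omega)
    have hterm : ∀ k, -((q y k : ℝ) * b * η ^ d y) ≤
        (q y k * u k : ℝ) * (η ^ d (next y k) - η ^ d y) := by
      intro k
      have h1 : (q y k * u k : ℝ) ≤ q y k * b :=
        mul_le_mul_of_nonneg_left (by exact_mod_cast (hu k).2) (NNReal.coe_nonneg _)
      have h2 : 0 ≤ η ^ d (next y k) := (pow_pos hη0 _).le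
      have h3 : (0 : ℝ) ≤ q y k * u k := by positivity
      nlinarith
    have hgood : ρ * a * (η ^ j - η ^ d y) - (q y k₀ : ℝ) * b * η ^ d y ≤
        (q y k₀ * u k₀ : ℝ) * (η ^ d (next y k₀) - η ^ d y) := by
      have h1 : ρ * a ≤ q y k₀ * u k₀ := mul_le_mul (hρq y k₀ hk₀)
        (by exact_mod_cast (hu k₀).1) ha'.le (NNReal.coe_nonneg _)
      have h2 : η ^ j ≤ η ^ d (next y k₀) := pow_le_pow_of_le_one hη0.le hη1' (by omega)
      have h3 : η ^ d y ≤ η ^ j := pow_le_pow_of_le_one hη0.le hη1' (by omega)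
      have h4 : 0 ≤ (q y k₀ : ℝ) * b * η ^ d y := by positivity
      have h5 : ρ * a * (η ^ j - η ^ d y) ≤ q y k₀ * u k₀ * (η ^ j - η ^ d y) :=
        mul_le_mul_of_nonneg_right h1 (by linarith)
      have h6 : (0 : ℝ) ≤ q y k₀ * u k₀ := by positivity
      have h7 := mul_le_mul_of_nonneg_left (show η ^ j - η ^ d y ≤ η ^ d (next y k₀) - η ^ d y by
        linarith) h6
      linarith
    have hsum : ρ * a * (η ^ j - η ^ d y) - (∑ k, (q y k : ℝ) * b) * η ^ d y ≤
        ∑ k, (q y k * u k : ℝ) * (η ^ d (next y k) - η ^ d y) := by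
      have e1 := Finset.add_sum_erase Finset.univ (fun k => (q y k : ℝ) * b * η ^ d y)
        (Finset.mem_univ k₀)
      have e2 := Finset.add_sum_erase Finset.univ
        (fun k => (q y k * u k : ℝ) * (η ^ d (next y k) - η ^ d y)) (Finset.mem_univ k₀)
      beta_reduce at e1 e2
      rw [Finset.sum_mul]
      have : -∑ k ∈ Finset.univ.erase k₀, (q y k : ℝ) * b * η ^ d y ≤
          ∑ k ∈ Finset.univ.erase k₀, (q y k * u k : ℝ) * (η ^ d (next y k) - η ^ d y) := by
        rw [← Finset.sum_neg_distrib]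
        exact Finset.sum_le_sum fun k _ => hterm k
      linarith
    refine le_trans ?_ hsum
    have h1 : (∑ k, (q y k : ℝ) * b) * η ^ d y ≤ Λ * η ^ d y :=
      mul_le_mul_of_nonneg_right (hΛy y) hpow.le
    have h2 : β * η ^ d y ≤ |β| * η ^ d y := mul_le_mul_of_nonneg_right (le_abs_self β) hpow.le
    have h3 : η ^ d y = η ^ j * η := by rw [hj, pow_succ]
    have h4 := mul_le_mul_of_nonneg_left hη2 (pow_pos hη0 j).le
    have h5 : (Λ + |β|) * η ^ d y ≤ ρ * a * (η ^ j - η ^ d y) := by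
      rw [h3]; linarith
    linarith

/-- `ψ` solves the dynamic programming equation, with zero boundary values on `K`. -/
structure IsValue [Fintype κ] (q : E → κ → ℝ≥0) (next : E → κ → E) (H : κ → ℝ → ℝ)
    (ρ : E → ℝ≥0) (K : Set E) (ψ : E → ℝ) : Prop where
  nonneg : ∀ y, 0 ≤ ψ y
  boundary : ∀ y ∈ K, ψ y = 0
  equation : ∀ y ∉ K, ∑ k, q y k * H k (ψ (next y k) - ψ y) + ρ y = 0

/-- Existence of a solution of the dynamic programming equation, by Perron's method: a largest
subsolution is a solution, because the Hamiltonians are monotone and continuous.  The subsolutions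
are bounded by the comparison with a Lyapunov function. -/
theorem exists_isValue [Fintype κ] [Finite E] {q : E → κ → ℝ≥0} {next : E → κ → E} {K : Set E}
    (hreach : ∀ y, ∃ z ∈ K, Relation.ReflTransGen (JumpStep q next) y z) {g : κ → ℝ≥0}
    {H : κ → ℝ → ℝ} (hg : ∀ k, 0 < g k) (hcont : ∀ k, Continuous (H k))
      (hmono : ∀ k, Monotone (H k))
    (hle : ∀ k p, H k p ≤ g k * p) (hH0 : ∀ k, H k 0 = 0) (ρ : E → ℝ≥0) :
    ∃ ψ, IsValue q next H ρ K ψ := by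
  classical
  obtain ⟨_⟩ := nonempty_fintype E
  rcases isEmpty_or_nonempty E with hE | hE
  · exact ⟨fun _ => 0, fun y => (hE.false y).elim, fun y => (hE.false y).elim,
      fun y => (hE.false y).elim⟩
  set N : (E → ℝ) → E → ℝ := fun φ y => ∑ k, q y k * H k (φ (next y k) - φ y) + ρ y with hN
  have hNcont : ∀ y, Continuous fun φ => N φ y := by
    intro y
    refine (continuous_finsetSum _ fun k _ => continuous_const.mul ?_).add continuous_const
    exact (hcont k).comp ((continuous_apply _).sub (continuous_apply _))
  set A : Set (E → ℝ) := {φ | (∀ y, 0 ≤ φ y) ∧ (∀ y ∈ K, φ y = 0) ∧ ∀ y ∉ K, 0 ≤ N φ y} with hA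
  have hA0 : (fun _ => 0) ∈ A := by
    refine ⟨fun _ => le_rfl, fun _ _ => rfl, fun y _ => ?_⟩
    simp [hN, hH0]
  obtain ⟨a, b, ha, hab⟩ : ∃ a b : ℝ≥0, 0 < a ∧ ∀ k, a ≤ g k ∧ g k ≤ b := by
    rcases isEmpty_or_nonempty κ with h | h
    · exact ⟨1, 1, one_pos, fun k => (h.false k).elim⟩
    · obtain ⟨k1, h1⟩ := Finite.exists_min g
      obtain ⟨k2, h2⟩ := Finite.exists_max g
      exact ⟨g k1, g k2, hg k1, fun k => ⟨h1 k, h2 k⟩⟩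
  obtain ⟨h, m, hm, hmh, -, hK1, -, hLy⟩ := exists_lyapunov hreach ha b 1
  obtain ⟨y1, hy1⟩ := Finite.exists_max ρ
  have hm' : (0 : ℝ) < m := by exact_mod_cast hm
  set T : ℝ := (ρ y1 + 1) / m with hT
  have hT0 : 0 ≤ T := by positivity
  have hbound : ∀ φ ∈ A, ∀ y, φ y ≤ T := by
    rintro φ ⟨hφ0, hφK, hφN⟩
    -- maximum principle for the difference of the subsolution and a strict supersolution
    obtain ⟨y2, hy2⟩ := Finite.exists_max fun y => φ y - T * (1 - h y)
    have hle0 : φ y2 - T * (1 - h y2) ≤ 0 := by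
      by_cases hyK : y2 ∈ K
      · simp [hφK y2 hyK, hK1 y2 hyK]
      · exfalso
        have h1 := hφN y2 hyK
        have h2 := hLy y2 hyK g hab
        have h3 : N φ y2 ≤ ∑ k, (q y2 k * g k : ℝ) * (φ (next y2 k) - φ y2) + ρ y2 := by
          refine add_le_add_left (Finset.sum_le_sum fun k _ => ?_) _
          rw [mul_assoc]
          exact mul_le_mul_of_nonneg_left (hle k _) (NNReal.coe_nonneg _)
        have h4 : ∑ k, (q y2 k * g k : ℝ) * (φ (next y2 k) - φ y2) +
            T * ∑ k, (q y2 k * g k : ℝ) * (h (next y2 k) - h y2) ≤ 0 := by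
          rw [Finset.mul_sum, ← Finset.sum_add_distrib]
          refine Finset.sum_nonpos fun k _ => ?_
          have h5 := hy2 (next y2 k)
          have h6 : (0 : ℝ) ≤ q y2 k * g k := by positivity
          have h7 : φ (next y2 k) - φ y2 + T * (h (next y2 k) - h y2) ≤ 0 := by linarith
          have := mul_nonpos_of_nonneg_of_nonpos h6 h7
          linarith
        have h5 : T * (h y2 : ℝ) ≤ T * ∑ k, (q y2 k * g k : ℝ) * (h (next y2 k) - h y2) :=
          mul_le_mul_of_nonneg_left (by linarith) hT0
        have h6 : T * m ≤ T * (h y2 : ℝ) :=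
          mul_le_mul_of_nonneg_left (by exact_mod_cast hmh y2) hT0
        have h7 : T * m = ρ y1 + 1 := by rw [hT, div_mul_cancel₀ _ hm'.ne']
        have h8 : (ρ y2 : ℝ) ≤ ρ y1 := by exact_mod_cast hy1 y2
        linarith
    intro y
    have h1 := (hy2 y).trans hle0
    have h2 : (0 : ℝ) ≤ h y := NNReal.coe_nonneg _
    nlinarith
  have hAc : IsCompact A := by
    have hsub : A ⊆ Icc (fun _ => 0) (fun _ => T) := fun φ hφ => ⟨hφ.1, fun y => hbound φ hφ y⟩
    refine isCompact_Icc.of_isClosed_subset ?_ hsub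
    have e : A = (⋂ y, {φ | 0 ≤ φ y}) ∩ ((⋂ y ∈ K, {φ | φ y = 0}) ∩ ⋂ y ∈ Kᶜ, {φ | 0 ≤ N φ y}) := by
      ext φ
      simp [hA]
    rw [e]
    refine (isClosed_iInter fun y => isClosed_le continuous_const (continuous_apply y)).inter
      (IsClosed.inter ?_ ?_)
    · exact isClosed_biInter fun y _ => isClosed_eq (continuous_apply y) continuous_const
    · exact isClosed_biInter fun y _ => isClosed_le continuous_const (hNcont y)
  obtain ⟨ψ, hψA, hψmax⟩ := hAc.exists_isMaxOn ⟨_, hA0⟩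
    (f := fun φ : E → ℝ => ∑ y, φ y) (by fun_prop)
  refine ⟨ψ, hψA.1, hψA.2.1, fun y₀ hy₀ => ?_⟩
  by_contra hne
  have hpos : 0 < N ψ y₀ := lt_of_le_of_ne (hψA.2.2 y₀ hy₀) (Ne.symm hne)
  -- the subsolution can be increased at `y₀`
  set φ : ℝ → E → ℝ := fun ε => ψ + Pi.single y₀ ε with hφ
  have hφc : Continuous φ := continuous_const.add (continuous_single (A := fun _ : E => ℝ) y₀)
  have hφ0 : φ 0 = ψ := by simp [hφ]
  have hev : ∀ᶠ ε in 𝓝[>] (0 : ℝ), 0 < N (φ ε) y₀ := by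
    have : Tendsto (fun ε => N (φ ε) y₀) (𝓝[>] 0) (𝓝 (N ψ y₀)) := by
      have := (((hNcont y₀).comp hφc).tendsto 0).mono_left (nhdsWithin_le_nhds (s := Ioi 0))
      rwa [Function.comp_apply, hφ0] at this
    exact this.eventually (lt_mem_nhds hpos)
  obtain ⟨ε, hεN, hε⟩ := (hev.and self_mem_nhdsWithin).exists
  have hε : 0 < ε := hε
  have hsame : φ ε y₀ = ψ y₀ + ε := by simp [hφ]
  have hother : ∀ y, y ≠ y₀ → φ ε y = ψ y := fun y hy => by simp [hφ, hy]
  have hge : ∀ y, ψ y ≤ φ ε y := by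
    intro y
    by_cases hy : y = y₀
    · rw [hy, hsame]; linarith
    · rw [hother y hy]
  have hmem : φ ε ∈ A := by
    refine ⟨fun y => (hψA.1 y).trans (hge y), fun y hy => ?_, fun y hy => ?_⟩
    · rw [hother y (fun h => hy₀ (h ▸ hy)), hψA.2.1 y hy]
    · by_cases hyy : y = y₀
      · rw [hyy]; exact hεN.le
      · refine (hψA.2.2 y hy).trans (add_le_add_left (Finset.sum_le_sum fun k _ => ?_) _)
        refine mul_le_mul_of_nonneg_left (hmono k ?_) (NNReal.coe_nonneg _)
        rw [hother y hyy]
        linarith [hge (next y k)]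
  have h1 : ∑ y, φ ε y ≤ ∑ y, ψ y := hψmax hmem
  have h2 : ∑ y, φ ε y = ∑ y, ψ y + ε := by
    simp [hφ, Finset.sum_add_distrib]
  linarith

end Potential

/-! ### Controlled paths and the evolution of expectations -/

section Verification

open Hist

variable {κ E : Type*}

/-- The acceptance levels of a path with transition rates `rate` and control `u`, which is stopped
in `K`. -/
def killedLevel (rate : E → κ → ℝ≥0) (K : Set E) (u : Hist κ → κ → ℝ≥0) (h : Hist κ) (y : E)
    (k : κ) : ℝ≥0 :=
  open Classical in if y ∈ K then 0 else rate y k * u h k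

/-- `L` is the (left-continuous) path from `y₀`, stopped in `K`, with the predictable control `u`,
whose values lie in the interval `[a, b]`. -/
structure ControlledPath [Fintype κ] [MeasurableSpace E] (next : E → κ → E) (rate : E → κ → ℝ≥0)
    (r : ℝ≥0) (K : Set E) (y₀ : E) (a b : ℝ≥0) (u : Hist κ → κ → ℝ≥0) (L : Hist κ → E) : Prop where
  intro ::
  pos : 0 < a
  bounds : ∀ h k, a ≤ u h k ∧ u h k ≤ b
  measurable_control : ∀ k, Measurable fun h => u h k
  measurable_path : Measurable L
  path : ∃ D, (∀ h y k, killedLevel rate K u h y k ≤ D) ∧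
    ∀ᵐ ω ∂canonLaw κ r, IsJumpPath next D ω (fun s => killedLevel rate K u (mk s ω)) y₀
      fun s => L (mk s ω)

/-- The transition rates, for a noise of intensity `r`. -/
def scaledRate (r : ℝ≥0) (rate : E → κ → ℝ≥0) (y : E) (k : κ) : ℝ≥0 := r * rate y k

/-- The action on `f` of the generator with total rates `q` and control values `u`, which is stopped
in `K`, plus a potential `c`. -/
def drift [Fintype κ] (next : E → κ → E) (q : E → κ → ℝ≥0) (K : Set E) (c : ℝ) (f : E → ℝ≥0) (y : E)
    (u : κ → ℝ≥0) : ℝ :=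
  open Classical in
  c * f y + if y ∈ K then 0 else ∑ k, (q y k * u k : ℝ) * (f (next y k) - f y)

theorem drift_of_mem [Fintype κ] {next : E → κ → E} {q : E → κ → ℝ≥0} {K : Set E} (c : ℝ)
    (f : E → ℝ≥0) {y : E} (hy : y ∈ K) (u : κ → ℝ≥0) : drift next q K c f y u = c * f y := by
  rw [drift, if_pos hy, add_zero]

theorem drift_of_notMem [Fintype κ] {next : E → κ → E} {q : E → κ → ℝ≥0} {K : Set E} (c : ℝ)
    (f : E → ℝ≥0) {y : E} (hy : y ∉ K) (u : κ → ℝ≥0) :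
    drift next q K c f y u = c * f y + ∑ k, (q y k * u k : ℝ) * (f (next y k) - f y) := by
  rw [drift, if_neg hy]

/-- The expectation under the weight with exponent `∫ (cp - cm)` of `f` at time `t`. -/
def weightedMean [Fintype κ] (r : ℝ≥0) (L : Hist κ → E) (cp cm : Hist κ → ℝ≥0) (f : E → ℝ≥0∞)
    (t : ℝ≥0) : ℝ≥0∞ :=
  ∫⁻ ω, histWeight cp cm (mk t ω) * f (L (mk t ω)) ∂canonLaw κ r

namespace ControlledPath

variable [Fintype κ] [MeasurableSpace E] {next : E → κ → E} {rate : E → κ → ℝ≥0} {r : ℝ≥0}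
  {K : Set E} {y₀ : E} {a b : ℝ≥0}
  {u : Hist κ → κ → ℝ≥0} {L : Hist κ → E}

/-- The target set is absorbing. -/
theorem absorbed (P : ControlledPath next rate r K y₀ a b u L) : ∀ᵐ ω ∂canonLaw κ r,
    ∀ s t, s ≤ t → L (mk s ω) ∈ K → L (mk t ω) ∈ K := by
  obtain ⟨D, -, hpath⟩ := P.path
  filter_upwards [hpath, ae_regular κ r] with ω hL hω s t
  revert t
  refine hω.step_induction D (fun h hs => ?_) fun a t hat hq ih hst hs => ?_
  · rwa [← nonpos_iff_eq_zero.1 h]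
  · rcases le_or_gt s a with hsa | has
    · have ha := ih hsa hs
      have : L (mk t ω) = L (mk a ω) := by
        refine hL.stay a t hat hq fun h0 k => ?_
        simp only [killedLevel, if_pos ha]
        exact hω.atom_zero_level h0 k
      rwa [this]
    · rwa [← hL.const hq has hst hat le_rfl]

variable [Finite E] [MeasurableSingletonClass E]

theorem measurable_state (P : ControlledPath next rate r K y₀ a b u L) {β : Type*}
    [MeasurableSpace β] (g : E → β) : Measurable fun h => g (L h) :=
  (measurable_of_finite g).comp P.measurable_path

/-- Dynkin's formula, as an identity between the four nonnegative parts. -/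
theorem exists_dynkin (P : ControlledPath next rate r K y₀ a b u L) {cp cm : Hist κ → ℝ≥0}
    (hp : Measurable cp) (hm : Measurable cm) {B : ℝ≥0} (hpB : ∀ h, cp h ≤ B) (hmB : ∀ h, cm h ≤ B)
    (f : E → ℝ≥0) : ∃ out inn : Hist κ → ℝ≥0, Measurable out ∧ Measurable inn ∧
      (∀ h, (inn h : ℝ) - out h =
        drift next (scaledRate r rate) K (cp h - cm h) f (L h) (u h)) ∧
      ∀ t, weightedMean r L cp cm (fun y => f y) t +
        ∫⁻ ω, ∫⁻ s in Iio t, histWeight cp cm (mk s ω) * out (mk s ω) ∂lam ∂canonLaw κ r =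
      f y₀ + ∫⁻ ω, ∫⁻ s in Iio t, histWeight cp cm (mk s ω) * inn (mk s ω) ∂lam ∂canonLaw κ r ∧
      ∫⁻ ω, ∫⁻ s in Iio t, histWeight cp cm (mk s ω) * out (mk s ω) ∂lam ∂canonLaw κ r ≠ ∞ ∧
      ∫⁻ ω, ∫⁻ s in Iio t, histWeight cp cm (mk s ω) * inn (mk s ω) ∂lam ∂canonLaw κ r ≠ ∞ := by
  classical
  obtain ⟨D, hD, hpath⟩ := P.path
  have hvm : ∀ y k, Measurable fun h => killedLevel rate K u h y k := by
    intro y k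
    unfold killedLevel
    by_cases hy : y ∈ K
    · simp only [if_pos hy]; exact measurable_const
    · simp only [if_neg hy]; exact (P.measurable_control k).const_mul _
  have hLv : ∀ k, Measurable fun h => killedLevel rate K u h (L h) k := by
    intro k
    have : Measurable fun q : Hist κ × E => killedLevel rate K u q.1 q.2 k :=
      measurable_from_prod_countable_left fun y => hvm y k
    exact this.comp (measurable_id.prodMk P.measurable_path)
  have hs : ∀ g : E → κ → ℝ≥0,
      Measurable fun h => ∑ k, r * killedLevel rate K u h (L h) k * g (L h) k := fun g =>
    Finset.measurable_fun_sum _ fun k _ =>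
      ((hLv k).const_mul r).mul (P.measurable_state fun y => g y k)
  have hf := P.measurable_state f
  set out : Hist κ → ℝ≥0 := fun h =>
    cm h * f (L h) + ∑ k, r * killedLevel rate K u h (L h) k * f (L h) with hout
  set inn : Hist κ → ℝ≥0 := fun h =>
    cp h * f (L h) + ∑ k, r * killedLevel rate K u h (L h) k * f (next (L h) k) with hinn
  have hom : Measurable out := (hm.mul hf).add (hs fun y _ => f y)
  have him : Measurable inn := (hp.mul hf).add (hs fun y k => f (next y k))
  obtain ⟨M, hM⟩ : ∃ M : ℝ≥0, ∀ y, f y ≤ M := by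
    rcases isEmpty_or_nonempty E with h | h
    · exact ⟨0, fun y => (h.false y).elim⟩
    · obtain ⟨y, hy⟩ := Finite.exists_max f
      exact ⟨f y, hy⟩
  have hfin : ∀ g : Hist κ → ℝ≥0, (∀ h, g h ≤ B * M + ∑ _k : κ, r * D * M) → ∀ t,
      ∫⁻ ω, ∫⁻ s in Iio t, histWeight cp cm (mk s ω) * g (mk s ω) ∂lam ∂canonLaw κ r ≠ ∞ := by
    intro g hg t
    refine ne_top_of_le_ne_top (b := ∫⁻ _ω, ∫⁻ _s in Iio t, ENNReal.ofReal (Real.exp (B * t)) *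
      ((B * M + ∑ _k : κ, r * D * M : ℝ≥0) : ℝ≥0∞) ∂lam ∂canonLaw κ r) ?_ ?_
    · rw [lintegral_const, measure_univ, mul_one, lintegral_const, Measure.restrict_apply_univ,
        lam_Iio]
      exact ENNReal.mul_ne_top (ENNReal.mul_ne_top ENNReal.ofReal_ne_top ENNReal.coe_ne_top)
        ENNReal.coe_ne_top
    · refine lintegral_mono fun ω => setLIntegral_mono measurable_const fun s hs => ?_
      refine mul_le_mul' ((weight_le _ _ (fun s => hpB _) s).trans (ENNReal.ofReal_le_ofReal
        (Real.exp_le_exp.2 (mul_le_mul_of_nonneg_left ?_ (NNReal.coe_nonneg _)))))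
        (ENNReal.coe_le_coe.2 (hg _))
      exact_mod_cast (mem_Iio.1 hs).le
  refine ⟨out, inn, hom, him, fun h => ?_, fun t => ⟨?_, ?_, ?_⟩⟩
  · simp only [hout, hinn, drift, killedLevel, scaledRate]
    push_cast
    by_cases hy : L h ∈ K
    · simp only [hy, if_true, NNReal.coe_zero]
      simp [sub_mul]
    · simp only [hy, if_false, NNReal.coe_mul, mul_sub, Finset.sum_sub_distrib]
      simp only [mul_assoc]
      ring
  · exact dynkin r hvm hD P.measurable_path hpath hp hm hpB hmB f t
  · refine hfin out (fun h => add_le_add (mul_le_mul' (hmB h) (hM _))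
      (Finset.sum_le_sum fun k _ => mul_le_mul' (mul_le_mul' le_rfl (hD _ _ _)) (hM _))) t
  · refine hfin inn (fun h => add_le_add (mul_le_mul' (hpB h) (hM _))
      (Finset.sum_le_sum fun k _ => mul_le_mul' (mul_le_mul' le_rfl (hD _ _ _)) (hM _))) t

theorem lintegral_histWeight_add {cp cm g₁ : Hist κ → ℝ≥0} (hp : Measurable cp)
    (hm : Measurable cm) (hg : Measurable g₁) (g₂ : Hist κ → ℝ≥0∞) (t : ℝ≥0) :
    ∫⁻ ω, ∫⁻ s in Iio t, histWeight cp cm (mk s ω) * (g₁ (mk s ω) + g₂ (mk s ω)) ∂lam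
      ∂canonLaw κ r =
    ∫⁻ ω, ∫⁻ s in Iio t, histWeight cp cm (mk s ω) * g₁ (mk s ω) ∂lam ∂canonLaw κ r +
    ∫⁻ ω, ∫⁻ s in Iio t, histWeight cp cm (mk s ω) * g₂ (mk s ω) ∂lam ∂canonLaw κ r := by
  have h1 : Measurable fun h => histWeight cp cm h * g₁ h :=
    (measurable_histWeight hp hm).mul hg.coe_nnreal_ennreal
  rw [← lintegral_add_left (measurable_setLIntegral_mk h1 t)]
  refine lintegral_congr fun ω => ?_
  have h2 : Measurable fun s => histWeight cp cm (mk s ω) * g₁ (mk s ω) :=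
    h1.comp (measurable_mk_left ω)
  rw [← lintegral_add_left h2]
  exact lintegral_congr fun s => mul_add _ _ _

/-- Lower bound for weighted expectations of a function whose drift is bounded below. -/
theorem le_weightedMean (P : ControlledPath next rate r K y₀ a b u L) {cp cm : Hist κ → ℝ≥0}
    (hp : Measurable cp) (hm : Measurable cm) {B : ℝ≥0} (hpB : ∀ h, cp h ≤ B) (hmB : ∀ h, cm h ≤ B)
    (f : E → ℝ≥0) (g₁ : Hist κ → ℝ≥0) (g₂ : Hist κ → ℝ≥0∞)
    (hd : ∀ h, ENNReal.ofReal (g₁ h -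
      drift next (scaledRate r rate) K (cp h - cm h) f (L h) (u h)) ≤ g₂ h) (t : ℝ≥0) :
    f y₀ + ∫⁻ ω, ∫⁻ s in Iio t, histWeight cp cm (mk s ω) * g₁ (mk s ω) ∂lam ∂canonLaw κ r ≤
      weightedMean r L cp cm (fun y => f y) t +
        ∫⁻ ω, ∫⁻ s in Iio t, histWeight cp cm (mk s ω) * g₂ (mk s ω) ∂lam ∂canonLaw κ r := by
  obtain ⟨out, inn, hom, him, hdr, hdy⟩ := P.exists_dynkin hp hm hpB hmB f
  obtain ⟨h1, -, h3⟩ := hdy t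
  have hle : ∀ h, (out h : ℝ≥0∞) + g₁ h ≤ inn h + g₂ h := by
    intro h
    refine le_trans ?_ (add_le_add_right (hd h) _)
    rw [← hdr h, ← ENNReal.ofReal_coe_nnreal (p := inn h), ← ENNReal.coe_add,
      ← ENNReal.ofReal_coe_nnreal]
    refine le_trans (ENNReal.ofReal_le_ofReal ?_) ENNReal.ofReal_add_le
    push_cast
    linarith
  have h4 : ∫⁻ ω, ∫⁻ s in Iio t, histWeight cp cm (mk s ω) * out (mk s ω) ∂lam ∂canonLaw κ r +
      ∫⁻ ω, ∫⁻ s in Iio t, histWeight cp cm (mk s ω) * g₁ (mk s ω) ∂lam ∂canonLaw κ r ≤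
      ∫⁻ ω, ∫⁻ s in Iio t, histWeight cp cm (mk s ω) * inn (mk s ω) ∂lam ∂canonLaw κ r +
      ∫⁻ ω, ∫⁻ s in Iio t, histWeight cp cm (mk s ω) * g₂ (mk s ω) ∂lam ∂canonLaw κ r := by
    rw [← lintegral_histWeight_add hp hm him,
      ← lintegral_histWeight_add hp hm hom fun h => (g₁ h : ℝ≥0∞)]
    exact lintegral_mono fun ω => lintegral_mono fun s => mul_le_mul' le_rfl (hle _)
  refine (ENNReal.add_le_add_iff_right h3).1 ?_
  rw [add_right_comm, ← h1, add_assoc]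
  refine (add_le_add_right h4 _).trans_eq ?_
  ring

/-- Upper bound for weighted expectations of a function whose drift is nonpositive. -/
theorem weightedMean_le (P : ControlledPath next rate r K y₀ a b u L) {cp cm : Hist κ → ℝ≥0}
    (hp : Measurable cp) (hm : Measurable cm) {B : ℝ≥0} (hpB : ∀ h, cp h ≤ B) (hmB : ∀ h, cm h ≤ B)
    (f : E → ℝ≥0) (g : Hist κ → ℝ≥0∞)
    (hd0 : ∀ h, drift next (scaledRate r rate) K (cp h - cm h) f (L h) (u h) ≤ 0)
    (hd : ∀ h, g h ≤ ENNReal.ofReal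
      (-drift next (scaledRate r rate) K (cp h - cm h) f (L h) (u h))) (t : ℝ≥0) :
    weightedMean r L cp cm (fun y => f y) t +
      ∫⁻ ω, ∫⁻ s in Iio t, histWeight cp cm (mk s ω) * g (mk s ω) ∂lam ∂canonLaw κ r ≤ f y₀ := by
  obtain ⟨out, inn, hom, him, hdr, hdy⟩ := P.exists_dynkin hp hm hpB hmB f
  obtain ⟨h1, h2, -⟩ := hdy t
  have hle : ∀ h, (inn h : ℝ≥0∞) + g h ≤ out h := by
    intro h
    refine (add_le_add_right (hd h) _).trans ?_
    have h0 := hd0 h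
    rw [← hdr h] at h0 ⊢
    rw [← ENNReal.ofReal_coe_nnreal (p := inn h), ← ENNReal.ofReal_coe_nnreal (p := out h),
      ← ENNReal.ofReal_add (NNReal.coe_nonneg _) (by linarith)]
    exact ENNReal.ofReal_le_ofReal (by linarith)
  have h4 : ∫⁻ ω, ∫⁻ s in Iio t, histWeight cp cm (mk s ω) * inn (mk s ω) ∂lam ∂canonLaw κ r +
      ∫⁻ ω, ∫⁻ s in Iio t, histWeight cp cm (mk s ω) * g (mk s ω) ∂lam ∂canonLaw κ r ≤
      ∫⁻ ω, ∫⁻ s in Iio t, histWeight cp cm (mk s ω) * out (mk s ω) ∂lam ∂canonLaw κ r := by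
    rw [← lintegral_histWeight_add hp hm him]
    exact lintegral_mono fun ω => lintegral_mono fun s => mul_le_mul' le_rfl (hle _)
  refine (ENNReal.add_le_add_iff_right h2).1 ?_
  rw [add_right_comm, h1, add_assoc]
  exact add_le_add_right h4 _

end ControlledPath

end Verification

/-! ### The ordinary control problem -/

section OrdinaryControl

open Hist

variable {κ E : Type*}

/-- The running cost before the target is reached. -/
def runningCost [Fintype κ] (q : E → κ → ℝ≥0) (K : Set E) (φ : κ → ℝ≥0 → ℝ≥0∞) (ρ : E → ℝ≥0)
    (y : E) (u : κ → ℝ≥0) : ℝ≥0∞ :=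
  open Classical in if y ∈ K then 0 else ∑ k, q y k * φ k (u k) + ρ y

/-- The total running cost along a path. -/
def pathCost [Fintype κ] (q : E → κ → ℝ≥0) (K : Set E) (φ : κ → ℝ≥0 → ℝ≥0∞) (ρ : E → ℝ≥0)
    (u : Hist κ → κ → ℝ≥0) (L : Hist κ → E) (ω : Canon κ) : ℝ≥0∞ :=
  ∫⁻ s, runningCost q K φ ρ (L (mk s ω)) (u (mk s ω)) ∂lam

theorem setLIntegral_const_lam (c : ℝ≥0∞) (t : ℝ≥0) : ∫⁻ _ in Iio t, c ∂lam = c * t := by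
  rw [lintegral_const, Measure.restrict_apply_univ, lam_Iio]

theorem histWeight_const (c d : ℝ≥0) (t : ℝ≥0) (ω : Canon κ) :
    histWeight (fun _ => c) (fun _ => d) (mk t ω) = ENNReal.ofReal (Real.exp ((c - d) * t)) := by
  show weight _ _ t = _
  rw [weight, setLIntegral_const_lam, setLIntegral_const_lam]
  simp [sub_mul]

theorem histWeight_zero (t : ℝ≥0) (ω : Canon κ) :
    histWeight (fun _ => 0) (fun _ => 0) (mk t ω) = 1 := by
  simp [histWeight_const]

theorem ofReal_sum_mul_le [Fintype κ] (q : κ → ℝ≥0) (x : κ → ℝ) (ρ : ℝ≥0) :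
    ENNReal.ofReal (∑ k, q k * x k + ρ) ≤ ∑ k, q k * ENNReal.ofReal (x k) + ρ := by
  refine ENNReal.ofReal_add_le.trans ?_
  rw [ENNReal.ofReal_coe_nnreal]
  refine add_le_add_left ?_ _
  have h : ∑ k, (q k : ℝ≥0∞) * ENNReal.ofReal (x k) =
      ENNReal.ofReal (∑ k, q k * max (x k) 0) := by
    rw [ENNReal.ofReal_sum_of_nonneg fun k _ => by positivity]
    refine Finset.sum_congr rfl fun k _ => ?_
    rw [ENNReal.ofReal_mul (NNReal.coe_nonneg _), ENNReal.ofReal_coe_nnreal, ENNReal.ofReal_max]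
    simp
  rw [h]
  exact ENNReal.ofReal_le_ofReal (Finset.sum_le_sum fun k _ =>
    mul_le_mul_of_nonneg_left (le_max_left _ _) (NNReal.coe_nonneg _))

theorem sum_mul_ofReal [Fintype κ] (q : κ → ℝ≥0) {x : κ → ℝ} (hx : ∀ k, 0 ≤ x k) (ρ : ℝ≥0) :
    ∑ k, q k * ENNReal.ofReal (x k) + ρ = ENNReal.ofReal (∑ k, q k * x k + ρ) := by
  rw [ENNReal.ofReal_add (Finset.sum_nonneg fun k _ => mul_nonneg (NNReal.coe_nonneg _) (hx k))
    (NNReal.coe_nonneg _), ENNReal.ofReal_coe_nnreal,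
    ENNReal.ofReal_sum_of_nonneg fun k _ => mul_nonneg (NNReal.coe_nonneg _) (hx k)]
  congr 1
  refine Finset.sum_congr rfl fun k _ => ?_
  rw [ENNReal.ofReal_mul (NNReal.coe_nonneg _), ENNReal.ofReal_coe_nnreal]

theorem runningCost_of_notMem [Fintype κ] {q : E → κ → ℝ≥0} {K : Set E} (φ : κ → ℝ≥0 → ℝ≥0∞)
    (ρ : E → ℝ≥0) {y : E} (hy : y ∉ K) (u : κ → ℝ≥0) :
    runningCost q K φ ρ y u = ∑ k, q y k * φ k (u k) + ρ y := by
  rw [runningCost, if_neg hy]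

theorem runningCost_of_mem [Fintype κ] {q : E → κ → ℝ≥0} {K : Set E} (φ : κ → ℝ≥0 → ℝ≥0∞)
    (ρ : E → ℝ≥0) {y : E} (hy : y ∈ K) (u : κ → ℝ≥0) : runningCost q K φ ρ y u = 0 := by
  rw [runningCost, if_pos hy]

/-- Monotone convergence for running costs. -/
theorem lintegral_le_of_forall_setLIntegral_le [Fintype κ] {r : ℝ≥0} {g : Hist κ → ℝ≥0∞}
    (hg : Measurable g) {A : ℝ≥0∞}
    (h : ∀ t, ∫⁻ ω, ∫⁻ s in Iio t, g (mk s ω) ∂lam ∂canonLaw κ r ≤ A) :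
    ∫⁻ ω, ∫⁻ s, g (mk s ω) ∂lam ∂canonLaw κ r ≤ A := by
  have e : ∀ ω : Canon κ, ∫⁻ s, g (mk s ω) ∂lam =
      ⨆ n : ℕ, ∫⁻ s in Iio (n : ℝ≥0), g (mk s ω) ∂lam := by
    intro ω
    have hu : ⋃ n : ℕ, Iio (n : ℝ≥0) = univ := by
      ext s
      simpa using exists_nat_gt s
    rw [← setLIntegral_univ, ← hu, setLIntegral_iUnion_of_directed]
    exact (monotone_nat_of_le_succ fun n =>
      Iio_subset_Iio (by exact_mod_cast Nat.le_succ n)).directed_le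
  simp_rw [e]
  rw [lintegral_iSup (fun n => measurable_setLIntegral_mk hg n)]
  · exact iSup_le fun n => h n
  · intro m n hmn ω
    exact lintegral_mono_set (Iio_subset_Iio (by exact_mod_cast hmn))

namespace ControlledPath

variable [Fintype κ] [MeasurableSpace E] [Finite E] [MeasurableSingletonClass E] {next : E → κ → E}
  {rate : E → κ → ℝ≥0} {r : ℝ≥0} {K : Set E} {y₀ : E} {a b : ℝ≥0} {u : Hist κ → κ → ℝ≥0}
  {L : Hist κ → E}

theorem measurable_at (P : ControlledPath next rate r K y₀ a b u L) {β : Type*}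
    [MeasurableSpace β] (g : E → β) (t : ℝ≥0) : Measurable fun ω => g (L (mk t ω)) :=
  (P.measurable_state g).comp (measurable_mk.comp (measurable_const.prodMk measurable_id))

theorem measurableSet_notMem (P : ControlledPath next rate r K y₀ a b u L) (t : ℝ≥0) :
    MeasurableSet {ω | L (mk t ω) ∉ K} :=
  (P.measurable_at id t) (toFinite Kᶜ).measurableSet

/-- The probability that the target has not been reached decays exponentially. -/
theorem exists_measure_le (P : ControlledPath next rate r K y₀ a b u L)
    (hreach : ∀ y, ∃ z ∈ K, Relation.ReflTransGen (JumpStep (scaledRate r rate) next) y z) :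
    ∃ δ : ℝ, 0 < δ ∧ ∀ t : ℝ≥0, canonLaw κ r {ω | L (mk t ω) ∉ K} ≤
      ENNReal.ofReal (2 * Real.exp (-δ * t)) := by
  obtain ⟨h, m, hm, hmh, h1, hK, hKc, hLy⟩ := exists_lyapunov hreach P.pos b 1
  refine ⟨m, by exact_mod_cast hm, fun t => ?_⟩
  have hco : ∀ y, ((1 - h y : ℝ≥0) : ℝ) = 1 - h y := fun y => by
    rw [NNReal.coe_sub (h1 y), NNReal.coe_one]
  -- `exp (m t) (1 - h)` is a supermartingale, and `1 - h ≥ 1/2` outside the target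
  have key := P.weightedMean_le (cp := fun _ => m) (cm := fun _ => 0) measurable_const
    measurable_const (B := m) (fun _ => le_rfl) (fun _ => zero_le) (fun y => 1 - h y)
    (fun _ => 0) (fun s => ?_) (fun _ => zero_le) t
  · simp only [mul_zero, lintegral_zero, add_zero, weightedMean, histWeight_const,
      NNReal.coe_zero, sub_zero] at key
    rw [lintegral_const_mul' _ _ ENNReal.ofReal_ne_top] at key
    have h2 : (2⁻¹ : ℝ≥0∞) * canonLaw κ r {ω | L (mk t ω) ∉ K} ≤
        ∫⁻ ω, ((1 - h (L (mk t ω)) : ℝ≥0) : ℝ≥0∞) ∂canonLaw κ r := by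
      have hms := P.measurableSet_notMem t
      rw [← setLIntegral_const]
      refine (setLIntegral_mono' hms (g := fun ω => ((1 - h (L (mk t ω)) : ℝ≥0) : ℝ≥0∞))
        fun ω hω => ?_).trans (setLIntegral_le_lintegral _ _)
      have : (2⁻¹ : ℝ≥0) ≤ 1 - h (L (mk t ω)) := by
        rw [← NNReal.coe_le_coe, hco]
        have h3 : (h (L (mk t ω)) : ℝ) ≤ 1 / 2 := by
          have := hKc _ hω
          rw [← NNReal.coe_le_coe] at this
          push_cast at this
          exact this
        push_cast
        linarith
      have h4 := ENNReal.coe_le_coe.2 this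
      rwa [ENNReal.coe_inv two_ne_zero] at h4
    have h3 : ENNReal.ofReal (Real.exp (m * t)) *
        (2⁻¹ * canonLaw κ r {ω | L (mk t ω) ∉ K}) ≤ 1 :=
      (mul_le_mul' le_rfl h2).trans (key.trans (by
        rw [← ENNReal.coe_one]
        exact ENNReal.coe_le_coe.2 tsub_le_self))
    calc canonLaw κ r {ω | L (mk t ω) ∉ K}
        = ENNReal.ofReal (2 * Real.exp (-m * t)) * (ENNReal.ofReal (Real.exp (m * t)) *
        (2⁻¹ * canonLaw κ r {ω | L (mk t ω) ∉ K})) := by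
          have h5 : (2⁻¹ : ℝ≥0∞) = ENNReal.ofReal 2⁻¹ := by
            rw [ENNReal.ofReal_inv_of_pos two_pos]
            simp
          rw [← mul_assoc, ← mul_assoc, h5, ← ENNReal.ofReal_mul (by positivity),
            ← ENNReal.ofReal_mul (by positivity)]
          have : 2 * Real.exp (-m * t) * Real.exp (m * t) * 2⁻¹ = 1 := by
            rw [mul_assoc 2, ← Real.exp_add]
            simp
          rw [this, ENNReal.ofReal_one, one_mul]
      _ ≤ _ := by
          refine (mul_le_mul' le_rfl h3).trans ?_
          rw [mul_one]
  · by_cases hy : L s ∈ K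
    · rw [drift_of_mem _ _ hy, hco, hK _ hy]
      simp
    · rw [drift_of_notMem _ _ hy]
      simp only [hco]
      have h2 := hLy _ hy (u s) (P.bounds s)
      have h3 : ∑ k, (scaledRate r rate (L s) k * u s k : ℝ) *
          (1 - h (next (L s) k) - (1 - h (L s))) =
          -∑ k, (scaledRate r rate (L s) k * u s k : ℝ) * (h (next (L s) k) - h (L s)) := by
        rw [← Finset.sum_neg_distrib]
        exact Finset.sum_congr rfl fun k _ => by ring
      rw [h3]
      have h4 : (m : ℝ) ≤ h (L s) := by exact_mod_cast hmh _
      have h5 : (0 : ℝ) ≤ m * h (L s) := by positivity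
      push_cast
      linarith

theorem tendsto_measure (P : ControlledPath next rate r K y₀ a b u L)
    (hreach : ∀ y, ∃ z ∈ K, Relation.ReflTransGen (JumpStep (scaledRate r rate) next) y z) :
    Tendsto (fun n : ℕ => canonLaw κ r {ω | L (mk n ω) ∉ K}) atTop (𝓝 0) := by
  obtain ⟨δ, hδ, h⟩ := P.exists_measure_le hreach
  have h1 : Tendsto (fun n : ℕ => 2 * Real.exp (-δ * n)) atTop (𝓝 (2 * 0)) := by
    refine Tendsto.const_mul _ (Real.tendsto_exp_atBot.comp ?_)
    exact tendsto_natCast_atTop_atTop.const_mul_atTop_of_neg (by linarith)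
  have h2 := ENNReal.tendsto_ofReal h1
  rw [mul_zero, ENNReal.ofReal_zero] at h2
  exact tendsto_of_tendsto_of_tendsto_of_le_of_le tendsto_const_nhds h2 (fun _ => zero_le)
    fun n => h n

/-- The target is reached almost surely. -/
theorem ae_exists_mem (P : ControlledPath next rate r K y₀ a b u L)
    (hreach : ∀ y, ∃ z ∈ K, Relation.ReflTransGen (JumpStep (scaledRate r rate) next) y z) :
    ∀ᵐ ω ∂canonLaw κ r, ∃ n : ℕ, L (mk n ω) ∈ K := by
  rw [ae_iff]
  refine le_antisymm (ge_of_tendsto' (P.tendsto_measure hreach) fun n => measure_mono ?_) zero_le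
  intro ω hω hn
  exact hω ⟨n, hn⟩

variable {g : κ → ℝ≥0} {c F : κ → ℝ≥0 → ℝ≥0∞} {H : κ → ℝ → ℝ} {ρ : E → ℝ≥0} {ψ : E → ℝ}

/-- The solution of the dynamic programming equation is a lower bound for the expected cost of every
control. -/
theorem le_lintegral_pathCost (P : ControlledPath next rate r K y₀ a b u L)
    (hreach : ∀ y, ∃ z ∈ K, Relation.ReflTransGen (JumpStep (scaledRate r rate) next) y z)
    (hD : ∀ k, IsDualCost (g k) (c k) (F k) (H k))
    (hψ : IsValue (scaledRate r rate) next H ρ K ψ) :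
    ENNReal.ofReal (ψ y₀) ≤ ∫⁻ ω, pathCost (scaledRate r rate) K F ρ u L ω ∂canonLaw κ r := by
  set f : E → ℝ≥0 := fun y => (ψ y).toNNReal with hf
  have hfψ : ∀ y, (f y : ℝ) = ψ y := fun y => Real.coe_toNNReal _ (hψ.nonneg y)
  have key : ∀ t : ℝ≥0, (f y₀ : ℝ≥0∞) ≤ ∫⁻ ω, f (L (mk t ω)) ∂canonLaw κ r +
      ∫⁻ ω, pathCost (scaledRate r rate) K F ρ u L ω ∂canonLaw κ r := by
    intro t
    have := P.le_weightedMean (cp := fun _ => 0) (cm := fun _ => 0) measurable_const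
      measurable_const (B := 0) (fun _ => le_rfl) (fun _ => zero_le) f (fun _ => 0)
      (fun h => runningCost (scaledRate r rate) K F ρ (L h) (u h)) (fun h => ?_) t
    · simp only [weightedMean, histWeight_zero, one_mul, ENNReal.coe_zero, lintegral_zero,
        add_zero] at this
      exact this.trans (add_le_add_right (lintegral_mono fun ω => setLIntegral_le_lintegral _ _) _)
    · by_cases hy : L h ∈ K
      · rw [drift_of_mem _ _ hy]
        simp
      · rw [drift_of_notMem _ _ hy, runningCost_of_notMem _ _ hy]
        refine le_trans ?_ (add_le_add_left (Finset.sum_le_sum fun k _ => mul_le_mul' le_rfl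
          ((hD k).ofReal_le (ψ (next (L h) k) - ψ (L h)) (u h k)
            (P.pos.trans_le (P.bounds h k).1))) _)
        refine le_trans (ENNReal.ofReal_le_ofReal ?_) (ofReal_sum_mul_le _ _ _)
        have h1 := hψ.equation _ hy
        simp only [hfψ, mul_sub, Finset.sum_sub_distrib, ← mul_assoc] at h1 ⊢
        simp only [NNReal.coe_zero]
        linarith
  obtain ⟨M, hM⟩ : ∃ M : ℝ≥0, ∀ y, f y ≤ M := by
    obtain ⟨y, hy⟩ := @Finite.exists_max _ _ _ ⟨y₀⟩ _ f
    exact ⟨f y, hy⟩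
  have hb : ∀ n : ℕ, (f y₀ : ℝ≥0∞) ≤ M * canonLaw κ r {ω | L (mk n ω) ∉ K} +
      ∫⁻ ω, pathCost (scaledRate r rate) K F ρ u L ω ∂canonLaw κ r := by
    intro n
    refine (key n).trans (add_le_add_left ?_ _)
    have hms := P.measurableSet_notMem n
    rw [← setLIntegral_const, ← lintegral_indicator hms]
    refine lintegral_mono fun ω => ?_
    by_cases hy : L (mk n ω) ∈ K
    · have h0 : f (L (mk n ω)) = 0 := by simp [hf, hψ.boundary _ hy]
      simp [h0]
    · rw [indicator_of_mem (show ω ∈ {ω | L (mk n ω) ∉ K} from hy)]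
      exact ENNReal.coe_le_coe.2 (hM _)
  have hlim : Tendsto (fun n : ℕ => M * canonLaw κ r {ω | L (mk n ω) ∉ K} +
      ∫⁻ ω, pathCost (scaledRate r rate) K F ρ u L ω ∂canonLaw κ r) atTop
      (𝓝 (M * 0 + ∫⁻ ω, pathCost (scaledRate r rate) K F ρ u L ω ∂canonLaw κ r)) :=
    (ENNReal.Tendsto.const_mul (P.tendsto_measure hreach) (Or.inr ENNReal.coe_ne_top)).add_const _
  rw [mul_zero, zero_add] at hlim
  exact ge_of_tendsto' hlim hb

/-- The feedback control which attains the minimum in the dynamic programming equation is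
optimal. -/
theorem lintegral_pathCost_le (P : ControlledPath next rate r K y₀ a b u L)
    (hψ : IsValue (scaledRate r rate) next H ρ K ψ) {v : E → κ → ℝ≥0} (hu : ∀ h, u h = v (L h))
    (hv : ∀ y k, v y k * (ψ (next y k) - ψ y) ≤ H k (ψ (next y k) - ψ y) ∧
      F k (v y k) ≤ ENNReal.ofReal
        (H k (ψ (next y k) - ψ y) - v y k * (ψ (next y k) - ψ y))) :
    ∫⁻ ω, pathCost (scaledRate r rate) K F ρ u L ω ∂canonLaw κ r ≤ ENNReal.ofReal (ψ y₀) := by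
  set f : E → ℝ≥0 := fun y => (ψ y).toNNReal with hf
  have hfψ : ∀ y, (f y : ℝ) = ψ y := fun y => Real.coe_toNNReal _ (hψ.nonneg y)
  have hd : ∀ y ∉ K, drift next (scaledRate r rate) K ((0 : ℝ≥0) - (0 : ℝ≥0)) f y (v y) =
      -(∑ k, scaledRate r rate y k * (H k (ψ (next y k) - ψ y) -
        v y k * (ψ (next y k) - ψ y)) + ρ y) := by
    intro y hy
    have h1 := hψ.equation _ hy
    rw [drift_of_notMem _ _ hy]
    simp only [hfψ, mul_sub, Finset.sum_sub_distrib, ← mul_assoc] at h1 ⊢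
    simp only [NNReal.coe_zero]
    linarith
  refine lintegral_le_of_forall_setLIntegral_le (g := fun h =>
    runningCost (scaledRate r rate) K F ρ (L h) (u h)) ?_ fun t => ?_
  · simp only [hu]
    exact P.measurable_state fun y => runningCost (scaledRate r rate) K F ρ y (v y)
  · have := P.weightedMean_le (cp := fun _ => 0) (cm := fun _ => 0) measurable_const
      measurable_const (B := 0) (fun _ => le_rfl) (fun _ => zero_le) f
      (fun h => runningCost (scaledRate r rate) K F ρ (L h) (u h)) (fun h => ?_) (fun h => ?_) t
    · simp only [histWeight_zero, one_mul] at this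
      exact le_add_self.trans this
    · by_cases hy : L h ∈ K
      · rw [drift_of_mem _ _ hy]
        simp
      · rw [hu, hd _ hy, neg_nonpos]
        exact add_nonneg (Finset.sum_nonneg fun k _ => mul_nonneg (NNReal.coe_nonneg _)
          (sub_nonneg.2 (hv _ k).1)) (NNReal.coe_nonneg _)
    · by_cases hy : L h ∈ K
      · rw [runningCost_of_mem _ _ hy]
        exact zero_le
      · rw [hu, hd _ hy, neg_neg, runningCost_of_notMem _ _ hy,
          ← sum_mul_ofReal _ fun k => sub_nonneg.2 (hv _ k).1]
        exact add_le_add_left (Finset.sum_le_sum fun k _ => mul_le_mul' le_rfl (hv _ k).2) _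

end ControlledPath

end OrdinaryControl

/-! ### The risk-sensitive control problem -/

section RiskSensitiveControl

open Hist

variable {κ E : Type*}

/-- The exponent of the risk-sensitive cost: control costs minus rewards. -/
def riskCost [Fintype κ] (q : E → κ → ℝ≥0) (K : Set E) (c : κ → ℝ≥0 → ℝ≥0∞) (ρ : E → ℝ≥0)
    (u : Hist κ → κ → ℝ≥0) (L : Hist κ → E) (ω : Canon κ) : EReal :=
  (pathCost q K c (fun _ => 0) u L ω : EReal) - (pathCost q K (fun _ _ => 0) ρ u L ω : EReal)

theorem setLIntegral_coe_le {c : ℝ≥0 → ℝ≥0} {B : ℝ≥0} (hc : ∀ s, c s ≤ B) (t : ℝ≥0) :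
    ∫⁻ s in Iio t, c s ∂lam ≤ ((B * t : ℝ≥0) : ℝ≥0∞) := by
  refine (lintegral_mono fun s => ENNReal.coe_le_coe.2 (hc s)).trans ?_
  rw [setLIntegral_const_lam, ENNReal.coe_mul]

theorem setLIntegral_coe_ne_top {c : ℝ≥0 → ℝ≥0} {B : ℝ≥0} (hc : ∀ s, c s ≤ B) (t : ℝ≥0) :
    ∫⁻ s in Iio t, c s ∂lam ≠ ∞ :=
  ne_top_of_le_ne_top ENNReal.coe_ne_top (setLIntegral_coe_le hc t)

theorem weight_eq_exp {cp cm : ℝ≥0 → ℝ≥0} {B : ℝ≥0} (hpB : ∀ s, cp s ≤ B) (hmB : ∀ s, cm s ≤ B)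
    (t : ℝ≥0) : weight cp cm t = EReal.exp
      (((∫⁻ s in Iio t, cp s ∂lam : ℝ≥0∞) : EReal) - (∫⁻ s in Iio t, cm s ∂lam : ℝ≥0∞)) := by
  rw [weight, ← EReal.coe_ennreal_toReal (setLIntegral_coe_ne_top hpB t),
    ← EReal.coe_ennreal_toReal (setLIntegral_coe_ne_top hmB t), ← EReal.coe_sub, EReal.exp_coe]

theorem pathCost_eq_of_mem [Fintype κ] {q : E → κ → ℝ≥0} {K : Set E} (φ : κ → ℝ≥0 → ℝ≥0∞)
    (ρ : E → ℝ≥0) {u : Hist κ → κ → ℝ≥0} {L : Hist κ → E} {ω : Canon κ}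
    (habs : ∀ s t, s ≤ t → L (mk s ω) ∈ K → L (mk t ω) ∈ K) {t : ℝ≥0} (ht : L (mk t ω) ∈ K) :
    pathCost q K φ ρ u L ω =
      ∫⁻ s in Iio t, runningCost q K φ ρ (L (mk s ω)) (u (mk s ω)) ∂lam := by
  rw [pathCost, ← lintegral_indicator measurableSet_Iio]
  refine lintegral_congr fun s => ?_
  by_cases hs : s ∈ Iio t
  · rw [indicator_of_mem hs]
  · rw [indicator_of_notMem hs, runningCost_of_mem _ _ (habs t s (not_lt.1 hs) ht)]

theorem histWeight_le_exp_riskCost [Fintype κ] {q : E → κ → ℝ≥0} {K : Set E}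
    {c : κ → ℝ≥0 → ℝ≥0∞} {ρ : E → ℝ≥0} {u : Hist κ → κ → ℝ≥0} {L : Hist κ → E} {ω : Canon κ}
    (habs : ∀ s t, s ≤ t → L (mk s ω) ∈ K → L (mk t ω) ∈ K) {t : ℝ≥0} (ht : L (mk t ω) ∈ K)
    {cp cm : Hist κ → ℝ≥0} {B : ℝ≥0} (hpB : ∀ h, cp h ≤ B) (hmB : ∀ h, cm h ≤ B)
    (hp : ∀ h, cp h ≤ runningCost q K c (fun _ => 0) (L h) (u h))
    (hm : ∀ h, runningCost q K (fun _ _ => 0) ρ (L h) (u h) ≤ cm h) :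
    histWeight cp cm (mk t ω) ≤ EReal.exp (riskCost q K c ρ u L ω) := by
  refine (weight_eq_exp (fun s => hpB (mk s ω)) (fun s => hmB (mk s ω)) t).trans_le
    (EReal.exp_monotone (EReal.sub_le_sub ?_ ?_))
  · rw [pathCost_eq_of_mem _ _ habs ht]
    exact EReal.coe_ennreal_le_coe_ennreal_iff.2 (lintegral_mono fun s => hp _)
  · rw [pathCost_eq_of_mem _ _ habs ht]
    exact EReal.coe_ennreal_le_coe_ennreal_iff.2 (lintegral_mono fun s => hm _)

theorem exp_riskCost_le_histWeight [Fintype κ] {q : E → κ → ℝ≥0} {K : Set E}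
    {c : κ → ℝ≥0 → ℝ≥0∞} {ρ : E → ℝ≥0} {u : Hist κ → κ → ℝ≥0} {L : Hist κ → E} {ω : Canon κ}
    (habs : ∀ s t, s ≤ t → L (mk s ω) ∈ K → L (mk t ω) ∈ K) {t : ℝ≥0} (ht : L (mk t ω) ∈ K)
    {cp cm : Hist κ → ℝ≥0} {B : ℝ≥0} (hpB : ∀ h, cp h ≤ B) (hmB : ∀ h, cm h ≤ B)
    (hp : ∀ h, runningCost q K c (fun _ => 0) (L h) (u h) ≤ cp h)
    (hm : ∀ h, cm h ≤ runningCost q K (fun _ _ => 0) ρ (L h) (u h)) :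
    EReal.exp (riskCost q K c ρ u L ω) ≤ histWeight cp cm (mk t ω) := by
  refine le_trans (EReal.exp_monotone (EReal.sub_le_sub ?_ ?_))
    (weight_eq_exp (fun s => hpB (mk s ω)) (fun s => hmB (mk s ω)) t).ge
  · rw [pathCost_eq_of_mem _ _ habs ht]
    exact EReal.coe_ennreal_le_coe_ennreal_iff.2 (lintegral_mono fun s => hp _)
  · rw [pathCost_eq_of_mem _ _ habs ht]
    exact EReal.coe_ennreal_le_coe_ennreal_iff.2 (lintegral_mono fun s => hm _)

/-- The reward rate, switched off in the target set. -/
def killedReward (K : Set E) (ρ : E → ℝ≥0) (y : E) : ℝ≥0 :=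
  open Classical in if y ∈ K then 0 else ρ y

theorem runningCost_reward [Fintype κ] (q : E → κ → ℝ≥0) (K : Set E) (ρ : E → ℝ≥0) (y : E)
    (u : κ → ℝ≥0) : runningCost q K (fun _ _ => 0) ρ y u = killedReward K ρ y := by
  by_cases hy : y ∈ K <;> simp [runningCost, killedReward, hy]

/-- A lower bound for the control costs, in terms of a solution of the dynamic programming
equation. -/
def dualCost [Fintype κ] (next : E → κ → E) (q : E → κ → ℝ≥0) (K : Set E) (H : κ → ℝ → ℝ)
    (ψ : E → ℝ) (y : E) (u : κ → ℝ≥0) : ℝ≥0 :=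
  open Classical in if y ∈ K then 0 else ∑ k, q y k *
    (-H k (ψ (next y k) - ψ y) - u k * (Real.exp (-(ψ (next y k) - ψ y)) - 1)).toNNReal

theorem weightedMean_eq_add [Fintype κ] [MeasurableSpace E] [Finite E] [MeasurableSingletonClass E]
    (r : ℝ≥0) {L : Hist κ → E} (hL : Measurable L) {cp cm : Hist κ → ℝ≥0} (hp : Measurable cp)
    (hm : Measurable cm) (K : Set E) (f : E → ℝ≥0∞) (t : ℝ≥0) : weightedMean r L cp cm f t =
      weightedMean r L cp cm (K.indicator f) t + weightedMean r L cp cm (Kᶜ.indicator f) t := by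
  have h1 : Measurable fun ω : Canon κ => histWeight cp cm (mk t ω) * K.indicator f (L (mk t ω)) :=
    ((measurable_histWeight hp hm).mul ((measurable_of_finite (K.indicator f)).comp hL)).comp
      (measurable_mk.comp (measurable_const.prodMk measurable_id))
  rw [weightedMean, weightedMean, weightedMean, ← lintegral_add_left h1]
  refine lintegral_congr fun ω => ?_
  rw [← mul_add, ← Pi.add_apply, indicator_self_add_compl]

theorem weightedMean_mono [Fintype κ] (r : ℝ≥0) (L : Hist κ → E) (cp cm : Hist κ → ℝ≥0)
    {f g : E → ℝ≥0∞} (h : ∀ y, f y ≤ g y) (t : ℝ≥0) :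
    weightedMean r L cp cm f t ≤ weightedMean r L cp cm g t :=
  lintegral_mono fun _ => mul_le_mul' le_rfl (h _)

theorem ControlledPath.exists_dualCost_le [Fintype κ] [MeasurableSpace E] [Finite E]
    {next : E → κ → E} {rate : E → κ → ℝ≥0} {r : ℝ≥0} {K : Set E} {y₀ : E} {a b : ℝ≥0}
    {u : Hist κ → κ → ℝ≥0} {L : Hist κ → E} (P : ControlledPath next rate r K y₀ a b u L)
      (H : κ → ℝ → ℝ)
    (ψ : E → ℝ) : ∃ B, ∀ h, dualCost next (scaledRate r rate) K H ψ (L h) (u h) ≤ B := by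
  classical
  obtain ⟨_⟩ := nonempty_fintype E
  refine ⟨∑ y, ∑ k, scaledRate r rate y k * (|H k (ψ (next y k) - ψ y)| + b).toNNReal,
    fun h => ?_⟩
  refine le_trans ?_ (Finset.single_le_sum (f := fun y => ∑ k, scaledRate r rate y k *
    (|H k (ψ (next y k) - ψ y)| + b).toNNReal) (fun _ _ => zero_le) (Finset.mem_univ (L h)))
  rw [dualCost]
  split_ifs
  · exact zero_le
  · refine Finset.sum_le_sum fun k _ => mul_le_mul' le_rfl (Real.toNNReal_mono ?_)
    have h1 := neg_le_abs (H k (ψ (next (L h) k) - ψ (L h)))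
    have h2 : (u h k : ℝ) ≤ b := by exact_mod_cast (P.bounds h k).2
    have h3 : 0 ≤ (u h k : ℝ) * Real.exp (-(ψ (next (L h) k) - ψ (L h))) := by positivity
    linarith

namespace ControlledPath

variable [Fintype κ] [MeasurableSpace E] [Finite E] [MeasurableSingletonClass E] {next : E → κ → E}
  {rate : E → κ → ℝ≥0} {r : ℝ≥0} {K : Set E} {y₀ : E} {a b : ℝ≥0} {u : Hist κ → κ → ℝ≥0}
  {L : Hist κ → E}

/-- A weighted expectation increases from the time on when the drift is nonnegative. -/
theorem weightedMean_le_weightedMean (P : ControlledPath next rate r K y₀ a b u L)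
    {cp cm : Hist κ → ℝ≥0} (hp : Measurable cp) (hm : Measurable cm) {B : ℝ≥0}
    (hpB : ∀ h, cp h ≤ B) (hmB : ∀ h, cm h ≤ B) (f : E → ℝ≥0) {t T : ℝ≥0} (htT : t ≤ T)
    (hd : ∀ h : Hist κ, t ≤ h.time →
      0 ≤ drift next (scaledRate r rate) K (cp h - cm h) f (L h) (u h)) :
    weightedMean r L cp cm (fun y => f y) t ≤ weightedMean r L cp cm (fun y => f y) T := by
  obtain ⟨out, inn, hom, him, hdr, hdy⟩ := P.exists_dynkin hp hm hpB hmB f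
  obtain ⟨h1, h2, h3⟩ := hdy t
  obtain ⟨h1', h2', h3'⟩ := hdy T
  have split : ∀ g : Hist κ → ℝ≥0, Measurable g →
      ∫⁻ ω, ∫⁻ s in Iio T, histWeight cp cm (mk s ω) * g (mk s ω) ∂lam ∂canonLaw κ r =
      ∫⁻ ω, ∫⁻ s in Iio t, histWeight cp cm (mk s ω) * g (mk s ω) ∂lam ∂canonLaw κ r +
      ∫⁻ ω, ∫⁻ s in Ico t T, histWeight cp cm (mk s ω) * g (mk s ω) ∂lam ∂canonLaw κ r := by
    intro g hg
    have hm1 : Measurable fun h => histWeight cp cm h * g h :=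
      (measurable_histWeight hp hm).mul hg.coe_nnreal_ennreal
    rw [← lintegral_add_left (measurable_setLIntegral_mk hm1 t)]
    refine lintegral_congr fun ω => ?_
    rw [← Iio_union_Ico_eq_Iio htT, lintegral_union measurableSet_Ico]
    exact disjoint_left.2 fun s hs hs' => not_lt.2 hs'.1 hs
  have h4 : ∫⁻ ω, ∫⁻ s in Ico t T, histWeight cp cm (mk s ω) * out (mk s ω) ∂lam ∂canonLaw κ r ≤
      ∫⁻ ω, ∫⁻ s in Ico t T, histWeight cp cm (mk s ω) * inn (mk s ω) ∂lam ∂canonLaw κ r := by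
    refine lintegral_mono fun ω => setLIntegral_mono' measurableSet_Ico fun s hs =>
      mul_le_mul' le_rfl (ENNReal.coe_le_coe.2 ?_)
    have := hd (mk s ω) hs.1
    rw [← hdr, sub_nonneg] at this
    exact_mod_cast this
  rw [split out hom] at h1' h2'
  rw [split inn him] at h1'
  set A := weightedMean r L cp cm (fun y => f y) t
  set A' := weightedMean r L cp cm (fun y => f y) T
  set O := ∫⁻ ω, ∫⁻ s in Iio t, histWeight cp cm (mk s ω) * out (mk s ω) ∂lam ∂canonLaw κ r
  set I := ∫⁻ ω, ∫⁻ s in Iio t, histWeight cp cm (mk s ω) * inn (mk s ω) ∂lam ∂canonLaw κ r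
  set O' := ∫⁻ ω, ∫⁻ s in Ico t T, histWeight cp cm (mk s ω) * out (mk s ω) ∂lam ∂canonLaw κ r
  set I' := ∫⁻ ω, ∫⁻ s in Ico t T, histWeight cp cm (mk s ω) * inn (mk s ω) ∂lam ∂canonLaw κ r
  refine (ENNReal.add_le_add_iff_right h2').1 ?_
  rw [h1', ← add_assoc, h1, ← add_assoc]
  exact add_le_add_right h4 _

variable {g : κ → ℝ≥0} {c F : κ → ℝ≥0 → ℝ≥0∞} {H : κ → ℝ → ℝ} {ρ : E → ℝ≥0} {ψ : E → ℝ}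

theorem measurable_state_control (P : ControlledPath next rate r K y₀ a b u L)
    {Φ : E → (κ → ℝ≥0) → ℝ≥0} (hΦ : ∀ y, Measurable (Φ y)) : Measurable fun h => Φ (L h) (u h) := by
  have h1 : Measurable fun q : Hist κ × E => Φ q.2 (u q.1) :=
    measurable_from_prod_countable_left fun y =>
      (hΦ y).comp (measurable_pi_lambda _ P.measurable_control)
  exact h1.comp (measurable_id.prodMk P.measurable_path)

/-- The exponential of minus the solution of the dynamic programming equation is a lower bound for
the risk-sensitive cost of every control.  On the event that the target has not been reached, the
weight is controlled by its later evolution: even if rewards are collected at a maximal rate, a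
fixed fraction of the weight is left when the target is reached. -/
theorem le_lintegral_exp_riskCost (P : ControlledPath next rate r K y₀ a b u L)
    (hreach : ∀ y, ∃ z ∈ K, Relation.ReflTransGen (JumpStep (scaledRate r rate) next) y z)
    (hD : ∀ k, IsDualCost (g k) (c k) (F k) (H k))
    (hψ : IsValue (scaledRate r rate) next H ρ K ψ) :
    ENNReal.ofReal (Real.exp (-ψ y₀)) ≤
      ∫⁻ ω, EReal.exp (riskCost (scaledRate r rate) K c ρ u L ω) ∂canonLaw κ r := by
  classical
  set q := scaledRate r rate with hq
  set Q := ∫⁻ ω, EReal.exp (riskCost q K c ρ u L ω) ∂canonLaw κ r with hQ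
  obtain ⟨B₀, hB₀⟩ := P.exists_dualCost_le H ψ
  obtain ⟨ρ₁, hρ₁⟩ : ∃ ρ₁ : ℝ≥0, ∀ y, ρ y ≤ ρ₁ := by
    obtain ⟨y, hy⟩ := @Finite.exists_max _ _ _ ⟨y₀⟩ _ ρ
    exact ⟨ρ y, hy⟩
  set Λ := ρ₁ + 1 with hΛ
  set B := B₀ + Λ with hB
  set cp : Hist κ → ℝ≥0 := fun h => dualCost next q K H ψ (L h) (u h) with hcp
  set cm : Hist κ → ℝ≥0 := fun h => killedReward K ρ (L h) with hcm
  have hpm : Measurable cp := by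
    refine P.measurable_state_control (Φ := dualCost next q K H ψ) fun y => ?_
    unfold dualCost
    by_cases hy : y ∈ K
    · simp only [if_pos hy]; exact measurable_const
    · simp only [if_neg hy]; fun_prop
  have hmm : Measurable cm := P.measurable_state _
  have hpB : ∀ h, cp h ≤ B := fun h => (hB₀ h).trans le_self_add
  have hkΛ : ∀ y, killedReward K ρ y ≤ Λ := by
    intro y
    rw [killedReward]
    split_ifs
    · exact zero_le
    · exact (hρ₁ y).trans le_self_add
  have hmB : ∀ h, cm h ≤ B := fun h => (hkΛ _).trans le_add_self
  have hcost : ∀ h, (cp h : ℝ≥0∞) ≤ runningCost q K c (fun _ => 0) (L h) (u h) := by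
    intro h
    simp only [hcp, dualCost, runningCost]
    split_ifs
    · simp
    · rw [ENNReal.coe_zero, add_zero, ENNReal.ofNNReal_finsetSum]
      refine Finset.sum_le_sum fun k _ => ?_
      rw [ENNReal.coe_mul]
      exact mul_le_mul' le_rfl ((hD k).ofReal_le_cost _ _ (P.pos.trans_le (P.bounds h k).1))
  set α : ℝ≥0 → ℝ≥0∞ := fun t => weightedMean r L cp cm (K.indicator 1) t with hα
  set ε : ℝ≥0 → ℝ≥0∞ := fun t => weightedMean r L cp cm (Kᶜ.indicator 1) t with hε
  have hαQ : ∀ t, α t ≤ Q := by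
    intro t
    refine lintegral_mono_ae ?_
    filter_upwards [P.absorbed] with ω habs
    by_cases hy : L (mk t ω) ∈ K
    · rw [indicator_of_mem hy, Pi.one_apply, mul_one]
      exact histWeight_le_exp_riskCost habs hy hpB hmB hcost fun h =>
        (runningCost_reward q K ρ (L h) (u h)).le
    · rw [indicator_of_notMem hy, mul_zero]
      exact zero_le
  -- the exponential of the value is a subsolution
  have hw : ∀ t, ENNReal.ofReal (Real.exp (-ψ y₀)) ≤ α t + ε t := by
    intro t
    set f : E → ℝ≥0 := fun y => (Real.exp (-ψ y)).toNNReal with hf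
    have hfψ : ∀ y, (f y : ℝ) = Real.exp (-ψ y) := fun y => Real.coe_toNNReal _ (Real.exp_pos _).le
    have h1 := P.le_weightedMean hpm hmm hpB hmB f (fun _ => 0) (fun _ => 0) (fun h => ?_) t
    · simp only [ENNReal.coe_zero, mul_zero, lintegral_zero, add_zero] at h1
      refine h1.trans ?_
      rw [weightedMean_eq_add r P.measurable_path hpm hmm K]
      have hf1 : ∀ y, (f y : ℝ≥0∞) ≤ 1 := fun y => by
        rw [← ENNReal.coe_one]
        refine ENNReal.coe_le_coe.2 ?_
        rw [← NNReal.coe_le_coe, hfψ, NNReal.coe_one, Real.exp_le_one_iff]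
        linarith [hψ.nonneg y]
      exact add_le_add (weightedMean_mono _ _ _ _ (fun y => indicator_le_indicator (hf1 y)) _)
        (weightedMean_mono _ _ _ _ (fun y => indicator_le_indicator (hf1 y)) _)
    · rw [nonpos_iff_eq_zero, ENNReal.ofReal_eq_zero, NNReal.coe_zero, zero_sub, neg_nonpos]
      by_cases hy : L h ∈ K
      · rw [drift_of_mem _ _ hy]
        simp [hcp, hcm, dualCost, killedReward, hy]
      · rw [drift_of_notMem _ _ hy]
        have e1 : (cm h : ℝ) = ρ (L h) := by simp [hcm, killedReward, hy]
        have e2 : ∑ k, (q (L h) k : ℝ) * (-H k (ψ (next (L h) k) - ψ (L h)) - u h k *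
            (Real.exp (-(ψ (next (L h) k) - ψ (L h))) - 1)) ≤ cp h := by
          simp only [hcp, dualCost, if_neg hy]
          push_cast
          exact Finset.sum_le_sum fun k _ =>
            mul_le_mul_of_nonneg_left (Real.le_coe_toNNReal _) (NNReal.coe_nonneg _)
        have e3 : ∀ k, (q (L h) k * u h k : ℝ) * (f (next (L h) k) - f (L h)) = f (L h) *
            (q (L h) k * (u h k * (Real.exp (-(ψ (next (L h) k) - ψ (L h))) - 1))) := by
          intro k
          have : (f (next (L h) k) : ℝ) =
              f (L h) * Real.exp (-(ψ (next (L h) k) - ψ (L h))) := by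
            rw [hfψ, hfψ, ← Real.exp_add]
            congr 1
            ring
          rw [this]
          ring
        have e4 := hψ.equation _ hy
        rw [Finset.sum_congr rfl fun k _ => e3 k, ← Finset.mul_sum, mul_comm (_ - _ : ℝ) _,
          ← mul_add]
        refine mul_nonneg (NNReal.coe_nonneg _) ?_
        rw [e1]
        simp only [mul_sub (q (L h) _ : ℝ) (-_), mul_neg, Finset.sum_sub_distrib,
          Finset.sum_neg_distrib] at e2
        linarith
  -- a fixed fraction of the weight of the paths which have not reached the target survives
  obtain ⟨h, m, hm0, hmh, h1, hK, -, hLy⟩ := exists_lyapunov hreach P.pos b Λ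
  have hsurv : ∀ t, α t + m * ε t ≤ ⨆ t, α t := by
    intro t
    -- from the time `t` on, control costs are ignored, and rewards are collected at the rate `Λ`
    set cp' : Hist κ → ℝ≥0 := fun h => if h.time < t then cp h else 0 with hcp'
    set cm' : Hist κ → ℝ≥0 := fun h =>
      if h.time < t then cm h else killedReward K (fun _ => Λ) (L h) with hcm'
    have htm : MeasurableSet {h : Hist κ | h.time < t} := measurable_time measurableSet_Iio
    have hpm' : Measurable cp' := Measurable.ite htm hpm measurable_const
    have hmm' : Measurable cm' := Measurable.ite htm hmm (P.measurable_state _)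
    have hkk : ∀ y, killedReward K (fun _ => Λ) y ≤ Λ := fun y => by
      rw [killedReward]
      split_ifs
      · exact zero_le
      · exact le_rfl
    have hpB' : ∀ h, cp' h ≤ B := fun h => by
      simp only [hcp']
      split_ifs
      · exact hpB h
      · exact zero_le
    have hmB' : ∀ h, cm' h ≤ B := fun h => by
      simp only [hcm']
      split_ifs
      · exact hmB h
      · exact (hkk _).trans le_add_self
    have s1 : α t + m * ε t ≤ weightedMean r L cp cm (fun y => h y) t := by
      rw [weightedMean_eq_add r P.measurable_path hpm hmm K]
      refine add_le_add (weightedMean_mono _ _ _ _ (fun y => ?_) _) ?_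
      · by_cases hy : y ∈ K <;> simp [hy, hK]
      · simp only [hε, weightedMean]
        rw [← lintegral_const_mul' _ _ ENNReal.coe_ne_top]
        refine lintegral_mono fun ω => ?_
        rw [mul_left_comm]
        refine mul_le_mul' le_rfl ?_
        by_cases hy : L (mk t ω) ∈ K
        · simp [hy]
        · simpa [hy] using hmh _
    have s2 :
        weightedMean r L cp cm (fun y => h y) t = weightedMean r L cp' cm' (fun y => h y) t := by
      refine lintegral_congr fun ω => ?_
      congr 1
      have e1 : ∫⁻ s in Iio t, (cp (mk s ω) : ℝ≥0∞) ∂lam = ∫⁻ s in Iio t, cp' (mk s ω) ∂lam :=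
        setLIntegral_congr_fun measurableSet_Iio fun s hs => by
          have : s < t := hs
          simp [hcp', this]
      have e2 : ∫⁻ s in Iio t, (cm (mk s ω) : ℝ≥0∞) ∂lam = ∫⁻ s in Iio t, cm' (mk s ω) ∂lam :=
        setLIntegral_congr_fun measurableSet_Iio fun s hs => by
          have : s < t := hs
          simp [hcm', this]
      show ENNReal.ofReal (Real.exp ((∫⁻ s in Iio t, (cp (mk s ω) : ℝ≥0∞) ∂lam).toReal -
        (∫⁻ s in Iio t, (cm (mk s ω) : ℝ≥0∞) ∂lam).toReal)) = _
      rw [e1, e2]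
      rfl
    have s3 : ∀ n : ℕ, weightedMean r L cp' cm' (fun y => h y) t ≤
        α (t + n) + ENNReal.ofReal (Real.exp (B * t - Λ * n)) := by
      intro n
      refine (P.weightedMean_le_weightedMean hpm' hmm' hpB' hmB' h (T := t + n) le_self_add
        fun s hs => ?_).trans ?_
      · have e1 : cp' s = 0 := by simp [hcp', not_lt.2 hs]
        have e2 : cm' s = killedReward K (fun _ => Λ) (L s) := by simp [hcm', not_lt.2 hs]
        rw [e1, e2]
        by_cases hy : L s ∈ K
        · rw [drift_of_mem _ _ hy]
          simp [killedReward, hy]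
        · rw [drift_of_notMem _ _ hy]
          have := hLy _ hy (u s) (P.bounds s)
          simp only [killedReward, if_neg hy, NNReal.coe_zero, zero_sub, neg_mul]
          linarith
      · rw [weightedMean_eq_add r P.measurable_path hpm' hmm' K]
        refine add_le_add ?_ ?_
        · refine lintegral_mono fun ω => mul_le_mul' ?_ ?_
          · refine ENNReal.ofReal_le_ofReal (Real.exp_le_exp.2 (sub_le_sub ?_ ?_))
            · refine ENNReal.toReal_mono (setLIntegral_coe_ne_top (fun s => hpB (mk s ω)) _)
                (lintegral_mono fun s => ENNReal.coe_le_coe.2 ?_)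
              simp only [hcp']
              split_ifs
              · exact le_rfl
              · exact zero_le
            · refine ENNReal.toReal_mono (setLIntegral_coe_ne_top (fun s => hmB' (mk s ω)) _)
                (lintegral_mono fun s => ENNReal.coe_le_coe.2 ?_)
              simp only [hcm']
              split_ifs
              · exact le_rfl
              · simp only [hcm, killedReward]
                split_ifs
                · exact le_rfl
                · exact (hρ₁ _).trans le_self_add
          · refine indicator_le_indicator ?_
            rw [Pi.one_apply, ← ENNReal.coe_one]
            exact ENNReal.coe_le_coe.2 (h1 _)
        · have : (∫⁻ _ω : Canon κ, ENNReal.ofReal (Real.exp (B * t - Λ * n)) ∂canonLaw κ r) =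
              ENNReal.ofReal (Real.exp (B * t - Λ * n)) := by
            rw [lintegral_const, measure_univ, mul_one]
          rw [← this]
          refine lintegral_mono_ae ?_
          filter_upwards [P.absorbed] with ω habs
          by_cases hy : L (mk (t + n) ω) ∈ K
          · simp [hy]
          refine le_trans (mul_le_mul' (b := _) (d := 1) le_rfl ?_) ?_
          · rw [indicator_of_mem (show L (mk (t + n) ω) ∈ Kᶜ from hy), ← ENNReal.coe_one]
            exact ENNReal.coe_le_coe.2 (h1 _)
          rw [mul_one]
          refine ENNReal.ofReal_le_ofReal (Real.exp_le_exp.2 (sub_le_sub ?_ ?_))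
          · have e1 : ∫⁻ s in Iio (t + n), (cp' (mk s ω) : ℝ≥0∞) ∂lam ≤ ((B * t : ℝ≥0) : ℝ≥0∞) := by
              refine le_trans ?_ (setLIntegral_coe_le (fun s => hpB (mk s ω)) t)
              rw [← lintegral_indicator (s := Iio t) measurableSet_Iio]
              refine (setLIntegral_le_lintegral _ _).trans (lintegral_mono fun s => ?_)
              by_cases hs : s < t
              · rw [indicator_of_mem (show s ∈ Iio t from hs)]
                simp [hcp', hs]
              · simp [hcp', hs]
            exact ENNReal.toReal_mono ENNReal.coe_ne_top e1
          · have e1 : ((Λ * n : ℝ≥0) : ℝ≥0∞) ≤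
                ∫⁻ s in Iio (t + n), (cm' (mk s ω) : ℝ≥0∞) ∂lam := by
              refine le_trans ?_ (lintegral_mono_set (s := Ico t (t + n)) fun s hs => hs.2)
              have e2 : lam (Ico t (t + n)) = n := by
                have h2 := measure_union (μ := lam) (s₁ := Iio t) (s₂ := Ico t (t + n))
                  (disjoint_left.2 fun s hs hs' => not_lt.2 hs'.1 hs) measurableSet_Ico
                rw [Iio_union_Ico_eq_Iio le_self_add, lam_Iio, lam_Iio, ENNReal.coe_add] at h2
                exact ((ENNReal.add_right_inj ENNReal.coe_ne_top).1 h2).symm.trans (by simp)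
              rw [ENNReal.coe_mul, ENNReal.coe_natCast, ← e2, ← setLIntegral_const]
              refine setLIntegral_mono' measurableSet_Ico fun s hs => ENNReal.coe_le_coe.2 ?_
              have e3 : ¬s < t := not_lt.2 hs.1
              have e4 : L (mk s ω) ∉ K := fun h' => hy (habs _ _ hs.2.le h')
              simp [hcm', e3, killedReward, e4]
            have := ENNReal.toReal_mono (setLIntegral_coe_ne_top (fun s => hmB' (mk s ω)) _) e1
            simpa using this
    have hlim : Tendsto (fun n : ℕ => (⨆ t, α t) + ENNReal.ofReal (Real.exp (B * t - Λ * n))) atTop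
        (𝓝 ((⨆ t, α t) + 0)) := by
      refine Tendsto.const_add _ ?_
      rw [← ENNReal.ofReal_zero]
      refine ENNReal.tendsto_ofReal (Real.tendsto_exp_atBot.comp ?_)
      refine tendsto_atBot_add_const_left _ _ (tendsto_neg_atTop_atBot.comp ?_)
      have hΛ0 : (0 : ℝ) < Λ := by
        rw [hΛ]
        positivity
      exact tendsto_natCast_atTop_atTop.const_mul_atTop hΛ0
    rw [add_zero] at hlim
    refine s1.trans (s2.trans_le (ge_of_tendsto' hlim fun n => (s3 n).trans ?_))
    exact add_le_add_left (le_iSup α (t + n)) _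
  -- conclusion
  refine le_trans ?_ (iSup_le hαQ)
  set S := ⨆ t, α t with hS
  rcases eq_or_ne S ∞ with hS' | hS'
  · rw [hS']
    exact le_top
  have hm1 : m ≠ 0 := hm0.ne'
  have key : ∀ t, m * ENNReal.ofReal (Real.exp (-ψ y₀)) + α t ≤ m * S + S := by
    intro t
    calc m * ENNReal.ofReal (Real.exp (-ψ y₀)) + α t ≤ m * (α t + ε t) + α t :=
          add_le_add_left (mul_le_mul' le_rfl (hw t)) _
      _ = m * α t + (α t + m * ε t) := by ring
      _ ≤ m * S + S := add_le_add (mul_le_mul' le_rfl (le_iSup α t)) (hsurv t)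
  have h5 : m * ENNReal.ofReal (Real.exp (-ψ y₀)) + S ≤ m * S + S := by
    rw [hS, ENNReal.add_iSup]
    exact iSup_le key
  have h6 := (ENNReal.add_le_add_iff_right hS').1 h5
  exact (ENNReal.mul_le_mul_iff_right (by exact_mod_cast hm1) ENNReal.coe_ne_top).1 h6

end ControlledPath

end RiskSensitiveControl

/-! ### Optimal feedback controls of the risk-sensitive problem -/

section RiskSensitiveFeedback

open Hist

variable {κ E : Type*} [Fintype κ] [MeasurableSpace E] [Finite E] [MeasurableSingletonClass E]
  {next : E → κ → E} {rate : E → κ → ℝ≥0} {r : ℝ≥0} {K : Set E} {y₀ : E} {a b : ℝ≥0}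
  {u : Hist κ → κ → ℝ≥0} {L : Hist κ → E} {g : κ → ℝ≥0} {c F : κ → ℝ≥0 → ℝ≥0∞} {H : κ → ℝ → ℝ}
  {ρ : E → ℝ≥0} {ψ : E → ℝ}

/-- If the function `w - s h`, where `w` is the exponential of minus the solution of the dynamic
programming equation and `h` is a Lyapunov function, has nonpositive drift, then `w` bounds the
risk-sensitive cost up to the factor `1 - s`. -/
theorem ControlledPath.lintegral_exp_riskCost_le (P : ControlledPath next rate r K y₀ a b u L)
    (hreach : ∀ y, ∃ z ∈ K, Relation.ReflTransGen (JumpStep (scaledRate r rate) next) y z)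
    {v : E → κ → ℝ≥0} (hu : ∀ h, u h = v (L h)) {χ : E → ℝ≥0}
    (hχ : ∀ y ∉ K, ∑ k, scaledRate r rate y k * c k (v y k) ≤ χ y) (hχ0 : ∀ y ∈ K, χ y = 0)
    {f : E → ℝ≥0} {s : ℝ≥0} (hfK : ∀ y ∈ K, s ≤ f y)
    (hd : ∀ y ∉ K, drift next (scaledRate r rate) K (χ y - ρ y) f y (v y) ≤ 0) :
    s * ∫⁻ ω, EReal.exp (riskCost (scaledRate r rate) K c ρ u L ω) ∂canonLaw κ r ≤ f y₀ := by
  classical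
  set q := scaledRate r rate with hq
  set cp : Hist κ → ℝ≥0 := fun h => χ (L h) with hcp
  set cm : Hist κ → ℝ≥0 := fun h => killedReward K ρ (L h) with hcm
  have hpm : Measurable cp := P.measurable_state _
  have hmm : Measurable cm := P.measurable_state _
  obtain ⟨B, hpB, hmB⟩ : ∃ B : ℝ≥0, (∀ h, cp h ≤ B) ∧ ∀ h, cm h ≤ B := by
    obtain ⟨y, hy⟩ := @Finite.exists_max _ _ _ ⟨y₀⟩ _ χ
    obtain ⟨z, hz⟩ := @Finite.exists_max _ _ _ ⟨y₀⟩ _ (killedReward K ρ)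
    exact ⟨χ y + killedReward K ρ z, fun h => (hy _).trans le_self_add,
      fun h => (hz _).trans le_add_self⟩
  have hmean : ∀ n : ℕ, ∫⁻ ω, histWeight cp cm (mk n ω) * K.indicator (fun _ => (s : ℝ≥0∞))
      (L (mk n ω)) ∂canonLaw κ r ≤ f y₀ := by
    intro n
    have h1 := P.weightedMean_le hpm hmm hpB hmB f (fun _ => 0) (fun h => ?_) (fun _ => zero_le) n
    · simp only [mul_zero, lintegral_zero, add_zero] at h1
      refine le_trans (weightedMean_mono r L cp cm (fun y => ?_) _) h1
      by_cases hy : y ∈ K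
      · simpa [hy] using hfK y hy
      · simp [hy]
    · by_cases hy : L h ∈ K
      · rw [drift_of_mem _ _ hy]
        simp [hcp, hcm, hχ0 _ hy, killedReward, hy]
      · rw [hu]
        simpa [hcp, hcm, killedReward, hy] using hd _ hy
  have hm1 : ∀ n : ℕ, Measurable fun ω : Canon κ => histWeight cp cm (mk n ω) *
      K.indicator (fun _ => (s : ℝ≥0∞)) (L (mk n ω)) := fun n =>
    ((measurable_histWeight hpm hmm).mul (P.measurable_state
      (K.indicator fun _ => (s : ℝ≥0∞)))).comp
      (measurable_mk.comp (measurable_const.prodMk measurable_id))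
  rw [← lintegral_const_mul' _ _ ENNReal.coe_ne_top]
  refine le_trans (lintegral_mono_ae (g := fun ω => liminf (fun n : ℕ =>
    histWeight cp cm (mk n ω) * K.indicator (fun _ => (s : ℝ≥0∞)) (L (mk n ω))) atTop) ?_) ?_
  · filter_upwards [P.absorbed, P.ae_exists_mem hreach] with ω habs ⟨N, hN⟩
    refine le_liminf_of_le (by isBoundedDefault) ?_
    filter_upwards [eventually_ge_atTop N] with n hn
    have hy : L (mk n ω) ∈ K := habs N n (by exact_mod_cast hn) hN
    rw [indicator_of_mem hy, mul_comm]
    refine mul_le_mul' (exp_riskCost_le_histWeight habs hy hpB hmB (fun h => ?_) fun h => ?_) le_rfl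
    · by_cases hyK : L h ∈ K
      · rw [runningCost_of_mem _ _ hyK]
        exact zero_le
      · rw [runningCost_of_notMem _ _ hyK, ENNReal.coe_zero, add_zero, hu]
        exact hχ _ hyK
    · exact (runningCost_reward q K ρ (L h) (u h)).ge
  · refine (lintegral_liminf_le hm1).trans ?_
    exact liminf_le_of_le (by isBoundedDefault) fun x hx => by
      obtain ⟨n, hn⟩ := hx.exists
      exact hn.trans (hmean n)

/-- Feedback controls which nearly attain the minimum in the dynamic programming equation are nearly
optimal. -/
theorem exists_feedback_riskCost_le {q : E → κ → ℝ≥0} (hq : q = scaledRate r rate)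
    (hreach : ∀ y, ∃ z ∈ K, Relation.ReflTransGen (JumpStep q next) y z)
    (hD : ∀ k, IsDualCost (g k) (c k) (F k) (H k)) (hψ : IsValue q next H ρ K ψ) {s : ℝ}
    (hs0 : 0 < s) : ∃ v : E → κ → ℝ≥0, (∀ y k, 0 < v y k) ∧
      ∀ y₀ a b u L, ControlledPath next rate r K y₀ a b u L → (∀ h, u h = v (L h)) →
        ENNReal.ofReal (1 - s) * ∫⁻ ω, EReal.exp (riskCost q K c ρ u L ω) ∂canonLaw κ r ≤
          ENNReal.ofReal (Real.exp (-ψ y₀)) := by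
  classical
  subst hq
  obtain ⟨_⟩ := nonempty_fintype E
  set q := scaledRate r rate with hq
  rcases isEmpty_or_nonempty E with hE | hE
  · exact ⟨fun _ _ => 1, fun _ _ => one_pos, fun y => (hE.false y).elim⟩
  choose a' b' ha' hab' using fun (y : E) (k : κ) =>
    (hD k).exists_cost_le (ψ (next y k) - ψ y)
  obtain ⟨a₁, b₁, ha₁, hab₁⟩ : ∃ a₁ b₁ : ℝ≥0, 0 < a₁ ∧ ∀ y k, a₁ ≤ a' y k ∧ b' y k ≤ b₁ := by
    rcases isEmpty_or_nonempty κ with h | h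
    · exact ⟨1, 1, one_pos, fun y k => (h.false k).elim⟩
    · obtain ⟨p1, h1⟩ := Finite.exists_min fun p : E × κ => a' p.1 p.2
      obtain ⟨p2, h2⟩ := Finite.exists_max fun p : E × κ => b' p.1 p.2
      exact ⟨a' p1.1 p1.2, b' p2.1 p2.2, ha' _ _, fun y k => ⟨h1 (y, k), h2 (y, k)⟩⟩
  obtain ⟨y1, hy1⟩ := Finite.exists_max ρ
  obtain ⟨h, m, hm0, hmh, h1, hK, -, hLy⟩ := exists_lyapunov hreach ha₁ b₁ (ρ y1 + 1)
  obtain ⟨y2, hy2⟩ := Finite.exists_max ψ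
  have hm0' : (0 : ℝ) < m := by exact_mod_cast hm0
  -- the weight of the Lyapunov function, and the accuracy of the controls
  set s' : ℝ := min s (Real.exp (-ψ y2)) with hs'
  have hs'0 : 0 < s' := lt_min hs0 (Real.exp_pos _)
  have hs'1 : s' ≤ 1 := (min_le_right _ _).trans
    (Real.exp_le_one_iff.2 (by linarith [hψ.nonneg y2]))
  set Λ : ℝ := ∑ y, ∑ k, (q y k : ℝ) with hΛ
  have hΛ0 : 0 ≤ Λ := Finset.sum_nonneg fun y _ => Finset.sum_nonneg fun k _ => NNReal.coe_nonneg _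
  have hΛy : ∀ y, ∑ k, (q y k : ℝ) ≤ Λ := fun y =>
    Finset.single_le_sum (f := fun y => ∑ k, (q y k : ℝ))
      (fun y _ => Finset.sum_nonneg fun k _ => NNReal.coe_nonneg _) (Finset.mem_univ y)
  set ε : ℝ := s' * m / (Λ + 1) with hε
  have hε0 : 0 < ε := by positivity
  have hεΛ : ε * Λ ≤ s' * m := by
    have : ε * (Λ + 1) = s' * m := div_mul_cancel₀ _ (by positivity)
    linarith
  choose v hva hvb hv0 hvc using fun y k => hab' y k ε hε0
  have hvpos : ∀ y k, 0 < v y k := fun y k => (ha' y k).trans_le (hva y k)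
  refine ⟨v, hvpos, fun y₀ a b u L P hu => ?_⟩
  set w : E → ℝ := fun y => Real.exp (-ψ y) with hw
  have hwle : ∀ y, w y ≤ 1 := fun y => Real.exp_le_one_iff.2 (by linarith [hψ.nonneg y])
  have hh1 : ∀ y, (h y : ℝ) ≤ 1 := fun y => by exact_mod_cast h1 y
  have hsw : ∀ y, s' * h y ≤ w y := by
    intro y
    have e1 : s' ≤ w y := (min_le_right _ _).trans (Real.exp_le_exp.2 (neg_le_neg (hy2 y)))
    have e2 : s' * h y ≤ s' * 1 := mul_le_mul_of_nonneg_left (hh1 y) hs'0.le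
    linarith
  set f : E → ℝ≥0 := fun y => (w y - s' * h y).toNNReal with hf
  have hfw : ∀ y, (f y : ℝ) = w y - s' * h y := fun y =>
    Real.coe_toNNReal _ (sub_nonneg.2 (hsw y))
  set x : E → κ → ℝ := fun y k => -H k (ψ (next y k) - ψ y) -
    v y k * (Real.exp (-(ψ (next y k) - ψ y)) - 1) + ε with hx
  set χ : E → ℝ≥0 := fun y => if y ∈ K then 0 else ∑ k, q y k * (x y k).toNNReal with hχ
  have key := P.lintegral_exp_riskCost_le hreach hu (c := c) (ρ := ρ) (χ := χ) (f := f)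
    (s := (1 - s').toNNReal) (fun y hy => ?_) (fun y hy => by simp [hχ, hy]) (fun y hy => ?_)
    (fun y hy => ?_)
  · refine le_trans (mul_le_mul' ?_ le_rfl) (key.trans ?_)
    · exact ENNReal.ofReal_le_ofReal (by linarith [min_le_left s (Real.exp (-ψ y2))])
    · exact ENNReal.ofReal_le_ofReal (sub_le_self _ (mul_nonneg hs'0.le (NNReal.coe_nonneg _)))
  · simp only [hχ, if_neg hy, ENNReal.ofNNReal_finsetSum, ENNReal.coe_mul]
    exact Finset.sum_le_sum fun k _ => mul_le_mul' le_rfl (hvc y k)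
  · rw [← NNReal.coe_le_coe, hfw, Real.coe_toNNReal _ (by linarith), hK y hy]
    simp only [hw, hψ.boundary y hy]
    simp
  · rw [drift_of_notMem _ _ hy]
    have e1 : (χ y : ℝ) = ∑ k, q y k * x y k := by
      simp only [hχ, if_neg hy]
      push_cast
      exact Finset.sum_congr rfl fun k _ => by rw [Real.coe_toNNReal _ (hv0 y k)]
    have e2 : ∀ k, (q y k * v y k : ℝ) * (f (next y k) - f y) =
        w y * (q y k * (v y k * (Real.exp (-(ψ (next y k) - ψ y)) - 1))) -
          s' * ((q y k * v y k : ℝ) * (h (next y k) - h y)) := by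
      intro k
      have : w (next y k) = w y * Real.exp (-(ψ (next y k) - ψ y)) := by
        show Real.exp (-ψ (next y k)) = Real.exp (-ψ y) * _
        rw [← Real.exp_add]
        congr 1
        ring
      rw [hfw, hfw, this]
      ring
    have e3 := hψ.equation y hy
    have e4 := hLy y hy (v y) fun k => ⟨(hab₁ y k).1.trans (hva y k), (hvb y k).trans (hab₁ y k).2⟩
    have e5 : (χ y : ℝ) = ρ y - ∑ k, (q y k : ℝ) *
        (v y k * (Real.exp (-(ψ (next y k) - ψ y)) - 1)) + ε * ∑ k, (q y k : ℝ) := by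
      rw [e1, Finset.mul_sum]
      simp only [hx, mul_add, mul_sub (q y _ : ℝ) (-_), mul_neg, Finset.sum_add_distrib,
        Finset.sum_sub_distrib, Finset.sum_neg_distrib]
      have : ∑ k, (q y k : ℝ) * ε = ∑ k, ε * (q y k : ℝ) :=
        Finset.sum_congr rfl fun k _ => mul_comm _ _
      linarith
    rw [Finset.sum_congr rfl fun k _ => e2 k, Finset.sum_sub_distrib, ← Finset.mul_sum,
      ← Finset.mul_sum, hfw]
    set S := ∑ k, (q y k : ℝ) * (v y k * (Real.exp (-(ψ (next y k) - ψ y)) - 1)) with hS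
    set T := ∑ k, (q y k * v y k : ℝ) * (h (next y k) - h y) with hT
    have e6 : ε * ∑ k, (q y k : ℝ) ≤ ε * Λ := mul_le_mul_of_nonneg_left (hΛy y) hε0.le
    have e7 : (0 : ℝ) ≤ χ y := NNReal.coe_nonneg _
    have e8 : (ρ y : ℝ) ≤ ρ y1 := by exact_mod_cast hy1 y
    have e9 : (m : ℝ) ≤ h y := by exact_mod_cast hmh y
    have e10 : (h y : ℝ) ≤ T + χ y * h y - ρ y * h y := by
      have : (ρ y : ℝ) * h y ≤ ρ y1 * h y := mul_le_mul_of_nonneg_right e8 (NNReal.coe_nonneg _)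
      have := mul_nonneg e7 (NNReal.coe_nonneg (h y))
      linarith
    have e11 := mul_le_mul_of_nonneg_left (e9.trans e10) hs'0.le
    have e12 : w y * (ε * ∑ k, (q y k : ℝ)) ≤ s' * m := by
      have e13 : 0 ≤ ε * ∑ k, (q y k : ℝ) :=
        mul_nonneg hε0.le (Finset.sum_nonneg fun k _ => NNReal.coe_nonneg _)
      have := mul_le_mul_of_nonneg_right (hwle y) e13
      linarith
    have e14 : w y * (χ y - ρ y + S) = w y * (ε * ∑ k, (q y k : ℝ)) := by
      rw [e5]
      ring
    linarith

/-! ### The case of an empty target set -/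

/-- If some state yields a positive reward, the expected reward up to infinity is infinite. -/
theorem ControlledPath.lintegral_pathCost_eq_top (P : ControlledPath next rate r ∅ y₀ a b u L)
    (φ : κ → ℝ≥0 → ℝ≥0∞) {s₀ : E} (hρ : 0 < ρ s₀)
    (hreach : ∀ y, Relation.ReflTransGen (JumpStep (scaledRate r rate) next) y s₀) :
    ∫⁻ ω, pathCost (scaledRate r rate) ∅ φ ρ u L ω ∂canonLaw κ r = ∞ := by
  classical
  set q := scaledRate r rate with hq
  obtain ⟨h, m, hm0, hmh, h1, -, -, hLy⟩ := exists_lyapunov (K := {s₀})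
    (fun y => ⟨s₀, rfl, hreach y⟩) P.pos b 1
  -- The Lyapunov function for the target `{s₀}` grows at least at the rate `m` outside of `s₀`.
  -- As it is bounded, the mean time `X` which is spent in `s₀` is infinite.
  set M : ℝ≥0 := ∑ k, q s₀ k * b with hM
  set X := ∫⁻ ω, ∫⁻ s, (if L (mk s ω) = s₀ then 1 else 0 : ℝ≥0∞) ∂lam ∂canonLaw κ r with hX
  have hle : ∀ n : ℕ, ((m * n : ℝ≥0) : ℝ≥0∞) ≤ 1 + ((m + M : ℝ≥0) : ℝ≥0∞) * X := by
    intro n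
    have key := P.le_weightedMean (cp := fun _ => 0) (cm := fun _ => 0) measurable_const
      measurable_const (B := 0) (fun _ => le_rfl) (fun _ => zero_le) h (fun _ => m)
      (fun s => ((m + M : ℝ≥0) : ℝ≥0∞) * if L s = s₀ then 1 else 0) (fun s => ?_) n
    · simp only [weightedMean, histWeight_zero, one_mul, setLIntegral_const_lam] at key
      rw [lintegral_const, measure_univ, mul_one] at key
      rw [ENNReal.coe_mul]
      refine le_add_self.trans (key.trans (add_le_add ?_ ?_))
      · refine (lintegral_mono (g := fun _ => 1) fun ω => ?_).trans (by simp)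
        rw [← ENNReal.coe_one]
        exact ENNReal.coe_le_coe.2 (h1 _)
      · rw [hX, ← lintegral_const_mul' _ _ ENNReal.coe_ne_top]
        refine lintegral_mono fun ω => ?_
        rw [← lintegral_const_mul' _ _ ENNReal.coe_ne_top]
        exact setLIntegral_le_lintegral _ _
    · rw [drift_of_notMem _ _ (notMem_empty _)]
      have hm' : (m : ℝ) ≤ h (L s) := by exact_mod_cast hmh _
      by_cases hy : L s = s₀
      · rw [if_pos hy, mul_one, ← ENNReal.ofReal_coe_nnreal]
        refine ENNReal.ofReal_le_ofReal ?_
        have e1 : ∀ k, -((q s₀ k : ℝ) * b) ≤ (q s₀ k * u s k : ℝ) * (h (next s₀ k) - h s₀) := by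
          intro k
          have e2 : (q s₀ k * u s k : ℝ) ≤ q s₀ k * b :=
            mul_le_mul_of_nonneg_left (by exact_mod_cast (P.bounds s k).2) (NNReal.coe_nonneg _)
          have e3 : (h s₀ : ℝ) ≤ 1 := by exact_mod_cast h1 s₀
          have e4 : (0 : ℝ) ≤ h (next s₀ k) := NNReal.coe_nonneg _
          have e5 : (0 : ℝ) ≤ q s₀ k * u s k := by positivity
          nlinarith
        have e6 := Finset.sum_le_sum fun k (_ : k ∈ Finset.univ) => e1 k
        rw [Finset.sum_neg_distrib] at e6
        rw [hy, hM]
        push_cast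
        linarith
      · rw [if_neg hy, mul_zero, nonpos_iff_eq_zero, ENNReal.ofReal_eq_zero]
        have := hLy _ hy (u s) (P.bounds s)
        push_cast
        linarith
  have hXtop : X = ∞ := by
    by_contra hX'
    have hm' : (0 : ℝ) < m := by exact_mod_cast hm0
    have hfin : 1 + ((m + M : ℝ≥0) : ℝ≥0∞) * X ≠ ∞ :=
      ENNReal.add_ne_top.2 ⟨ENNReal.one_ne_top, ENNReal.mul_ne_top ENNReal.coe_ne_top hX'⟩
    obtain ⟨n, hn⟩ := exists_nat_gt ((1 + ((m + M : ℝ≥0) : ℝ≥0∞) * X).toReal / m)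
    have h2 := ENNReal.toReal_mono hfin (hle n)
    rw [div_lt_iff₀ hm'] at hn
    rw [ENNReal.coe_toReal, NNReal.coe_mul, NNReal.coe_natCast] at h2
    linarith
  rw [eq_top_iff]
  calc ∞ = (ρ s₀ : ℝ≥0∞) * X := by
        rw [hXtop, ENNReal.mul_top (by exact_mod_cast hρ.ne')]
    _ = ∫⁻ ω, ∫⁻ s, ρ s₀ * (if L (mk s ω) = s₀ then 1 else 0 : ℝ≥0∞) ∂lam ∂canonLaw κ r := by
        rw [hX, ← lintegral_const_mul' _ _ ENNReal.coe_ne_top]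
        refine lintegral_congr fun ω => ?_
        rw [lintegral_const_mul' _ _ ENNReal.coe_ne_top]
    _ ≤ _ := by
        refine lintegral_mono fun ω => lintegral_mono fun s => ?_
        rw [runningCost_of_notMem _ _ (notMem_empty _)]
        by_cases hy : L (mk s ω) = s₀
        · rw [if_pos hy, mul_one, hy]
          exact le_add_self
        · rw [if_neg hy, mul_zero]
          exact zero_le

/-- If some state yields a positive reward, the exponential of minus the reward up to infinity
vanishes, whatever the control is. -/
theorem ControlledPath.lintegral_exp_neg_pathCost (P : ControlledPath next rate r ∅ y₀ a b u L)
    {s₀ : E} (hρ : 0 < ρ s₀)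
    (hreach : ∀ y, Relation.ReflTransGen (JumpStep (scaledRate r rate) next) y s₀) :
    ∫⁻ ω, EReal.exp (-(pathCost (scaledRate r rate) ∅ (fun _ _ => 0) ρ u L ω : EReal))
      ∂canonLaw κ r = 0 := by
  classical
  set q := scaledRate r rate with hq
  obtain ⟨h, m, hm0, hmh, h1, -, -, hLy⟩ := exists_lyapunov (K := {s₀})
    (fun y => ⟨s₀, rfl, hreach y⟩) P.pos b 1
  have hm0' : (0 : ℝ) < m := by exact_mod_cast hm0
  have hρ' : (0 : ℝ) < ρ s₀ := by exact_mod_cast hρ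
  set M : ℝ := ∑ k, (q s₀ k : ℝ) * b with hM
  have hM0 : 0 ≤ M := Finset.sum_nonneg fun k _ => by positivity
  -- `1 - ε h` decays at the rate `η`, under the exponential of minus the reward
  set ε : ℝ := min (1 / 2) (ρ s₀ / (4 * (M + 1))) with hε
  have hε0 : 0 < ε := lt_min (by norm_num) (by positivity)
  have hε1 : ε ≤ 1 / 2 := min_le_left _ _
  have hεM : ε * M ≤ ρ s₀ / 4 := by
    have e1 : ε * (4 * (M + 1)) ≤ ρ s₀ := by
      rw [← le_div_iff₀ (by positivity)]
      exact min_le_right _ _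
    linarith
  set η : ℝ := min (ε * m) (ρ s₀ / 4) with hη
  have hη0 : 0 < η := lt_min (by positivity) (by positivity)
  have hh1 : ∀ y, (h y : ℝ) ≤ 1 := fun y => by exact_mod_cast h1 y
  have hεh : ∀ y, ε * h y ≤ ε := fun y => mul_le_of_le_one_right hε0.le (hh1 y)
  set f : E → ℝ≥0 := fun y => (1 - ε * h y).toNNReal with hf
  have hfh : ∀ y, (f y : ℝ) = 1 - ε * h y := fun y => Real.coe_toNNReal _ (by linarith [hεh y])
  obtain ⟨y1, hy1⟩ := @Finite.exists_max _ _ _ ⟨y₀⟩ _ ρ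
  set Q := ∫⁻ ω, EReal.exp (-(pathCost q ∅ (fun _ _ => 0) ρ u L ω : EReal)) ∂canonLaw κ r with hQ
  have hle : ∀ n : ℕ, Q ≤ ENNReal.ofReal (2 * Real.exp (-(η * n))) := by
    intro n
    have hcm : Measurable fun h => ρ (L h) := P.measurable_state _
    have hηB : ∀ _h : Hist κ, η.toNNReal ≤ η.toNNReal + ρ y1 := fun _ => le_self_add
    have hmB : ∀ h : Hist κ, ρ (L h) ≤ η.toNNReal + ρ y1 := fun h => (hy1 _).trans le_add_self
    have key := P.weightedMean_le (cp := fun _ => η.toNNReal) (cm := fun h => ρ (L h))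
      measurable_const hcm hηB hmB f (fun _ => 0) (fun s => ?_) (fun _ => zero_le) n
    · simp only [mul_zero, lintegral_zero, add_zero] at key
      have e1 : ENNReal.ofReal (Real.exp (η * n) * 2⁻¹) * Q ≤ 1 := by
        rw [hQ, ← lintegral_const_mul' _ _ ENNReal.ofReal_ne_top]
        refine le_trans (lintegral_mono fun ω => ?_) (key.trans ?_)
        · rw [ENNReal.ofReal_mul (Real.exp_pos _).le, mul_right_comm]
          refine mul_le_mul' ?_ ?_
          · have e2 := weight_eq_exp (cp := fun _ => η.toNNReal) (cm := fun s => ρ (L (mk s ω)))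
              (B := η.toNNReal + ρ y1) (fun s => hηB (mk s ω)) (fun s => hmB (mk s ω)) n
            rw [setLIntegral_const_lam] at e2
            have e3 : ENNReal.ofReal (Real.exp (η * n)) = EReal.exp
                (((η.toNNReal * (n : ℝ≥0) : ℝ≥0∞)) : EReal) := by
              have : ((η.toNNReal : ℝ≥0∞) * ((n : ℝ≥0) : ℝ≥0∞)) = ENNReal.ofReal (η * n) := by
                rw [ENNReal.ofReal_mul hη0.le]
                simp [ENNReal.ofReal]
              rw [this, EReal.coe_ennreal_ofReal, max_eq_left (by positivity), EReal.exp_coe]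
            refine le_trans ?_ e2.ge
            rw [e3, ← EReal.exp_add, sub_eq_add_neg]
            refine EReal.exp_monotone (add_le_add_right (EReal.neg_le_neg_iff.2
              (EReal.coe_ennreal_le_coe_ennreal_iff.2 ?_)) _)
            refine (setLIntegral_le_lintegral _ _).trans (lintegral_mono fun s => ?_)
            rw [runningCost_of_notMem _ _ (notMem_empty _)]
            exact le_add_self
          · refine ENNReal.ofReal_le_ofReal ?_
            linarith [hεh (L (mk n ω))]
        · rw [← ENNReal.coe_one]
          refine ENNReal.coe_le_coe.2 ?_
          rw [← NNReal.coe_le_coe, hfh, NNReal.coe_one]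
          have := mul_nonneg hε0.le (NNReal.coe_nonneg (h y₀))
          linarith
      calc Q = ENNReal.ofReal (2 * Real.exp (-(η * n))) *
            (ENNReal.ofReal (Real.exp (η * n) * 2⁻¹) * Q) := by
            rw [← mul_assoc, ← ENNReal.ofReal_mul (by positivity)]
            have : 2 * Real.exp (-(η * n)) * (Real.exp (η * n) * 2⁻¹) = 1 := by
              rw [mul_comm (Real.exp _) 2⁻¹, mul_mul_mul_comm, ← Real.exp_add]
              simp
            rw [this, ENNReal.ofReal_one, one_mul]
        _ ≤ _ := by
            refine (mul_le_mul' le_rfl e1).trans ?_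
            rw [mul_one]
    · rw [drift_of_notMem _ _ (notMem_empty _), Real.coe_toNNReal _ hη0.le]
      have e1 : ∑ k, (q (L s) k * u s k : ℝ) * (f (next (L s) k) - f (L s)) =
          -(ε * ∑ k, (q (L s) k * u s k : ℝ) * (h (next (L s) k) - h (L s))) := by
        rw [Finset.mul_sum, ← Finset.sum_neg_distrib]
        refine Finset.sum_congr rfl fun k _ => ?_
        rw [hfh, hfh]
        ring
      rw [e1, hfh]
      have e2 : 0 ≤ ε * h (L s) := mul_nonneg hε0.le (NNReal.coe_nonneg _)
      have e3 : η * (1 - ε * h (L s)) ≤ η := mul_le_of_le_one_right hη0.le (by linarith)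
      have e4 := hεh (L s)
      by_cases hy : L s = s₀
      · have e5 : ∀ k, -((q s₀ k : ℝ) * b) ≤ (q s₀ k * u s k : ℝ) * (h (next s₀ k) - h s₀) := by
          intro k
          have e2 : (q s₀ k * u s k : ℝ) ≤ q s₀ k * b :=
            mul_le_mul_of_nonneg_left (by exact_mod_cast (P.bounds s k).2) (NNReal.coe_nonneg _)
          have e4 : (0 : ℝ) ≤ h (next s₀ k) := NNReal.coe_nonneg _
          have e5 : (0 : ℝ) ≤ q s₀ k * u s k := by positivity
          nlinarith [hh1 s₀]
        have e6 := Finset.sum_le_sum fun k (_ : k ∈ Finset.univ) => e5 k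
        rw [Finset.sum_neg_distrib] at e6
        have e7 := mul_le_mul_of_nonneg_left e6 hε0.le
        rw [hy] at e3 e4 ⊢
        have e8 : (ρ s₀ : ℝ) * (1 / 2) ≤ ρ s₀ * (1 - ε * h s₀) :=
          mul_le_mul_of_nonneg_left (by linarith) hρ'.le
        have e9 : η ≤ ρ s₀ / 4 := min_le_right _ _
        rw [sub_mul]
        linarith
      · have e5 := hLy _ hy (u s) (P.bounds s)
        have e6 : (m : ℝ) ≤ h (L s) := by exact_mod_cast hmh _
        have e7 := mul_le_mul_of_nonneg_left (e6.trans ((one_mul _).symm.trans_le e5)) hε0.le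
        have e8 : η ≤ ε * m := min_le_left _ _
        have e9 : 0 ≤ (ρ (L s) : ℝ) * (1 - ε * h (L s)) :=
          mul_nonneg (NNReal.coe_nonneg _) (by linarith)
        rw [sub_mul]
        linarith
  have hlim : Tendsto (fun n : ℕ => ENNReal.ofReal (2 * Real.exp (-(η * n)))) atTop (𝓝 0) := by
    rw [← ENNReal.ofReal_zero]
    refine ENNReal.tendsto_ofReal ?_
    rw [← mul_zero (2 : ℝ)]
    refine Tendsto.const_mul _ (Real.tendsto_exp_atBot.comp (tendsto_neg_atTop_atBot.comp ?_))
    exact tendsto_natCast_atTop_atTop.const_mul_atTop hη0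
  exact le_antisymm (ge_of_tendsto' hlim hle) zero_le

end RiskSensitiveFeedback

/-! ### Values of control problems with arbitrary target sets -/

section ExtendedValue

open Hist

variable {κ E : Type*} [Fintype κ]

/-- `Ψ` is the value function of the problem with target `K`.  For an empty target set, the value is
zero if there are no rewards, and infinite otherwise. -/
def IsExtendedValue (q : E → κ → ℝ≥0) (next : E → κ → E) (H : κ → ℝ → ℝ) (ρ : E → ℝ≥0) (K : Set E)
    (Ψ : E → ℝ≥0∞) : Prop :=
  (K.Nonempty ∧ ∃ ψ, IsValue q next H ρ K ψ ∧ ∀ y, Ψ y = ENNReal.ofReal (ψ y)) ∨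
    (K = ∅ ∧ (∀ y, ρ y = 0) ∧ ∀ y, Ψ y = 0) ∨ (K = ∅ ∧ (∃ y, 0 < ρ y) ∧ ∀ y, Ψ y = ∞)

theorem exists_isExtendedValue [Finite E] {q : E → κ → ℝ≥0} {next : E → κ → E}
    (hirr : ∀ y z, Relation.ReflTransGen (JumpStep q next) y z) {g : κ → ℝ≥0}
    {c F : κ → ℝ≥0 → ℝ≥0∞} {H : κ → ℝ → ℝ} (hD : ∀ k, IsDualCost (g k) (c k) (F k) (H k))
    (ρ : E → ℝ≥0) (K : Set E) : ∃ Ψ, IsExtendedValue q next H ρ K Ψ := by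
  rcases K.eq_empty_or_nonempty with hK | hK
  · by_cases h : ∀ y, ρ y = 0
    · exact ⟨fun _ => 0, Or.inr (Or.inl ⟨hK, h, fun _ => rfl⟩)⟩
    · push Not at h
      obtain ⟨y, hy⟩ := h
      exact ⟨fun _ => ∞, Or.inr (Or.inr ⟨hK, ⟨y, pos_iff_ne_zero.2 hy⟩, fun _ => rfl⟩)⟩
  · obtain ⟨z, hz⟩ := hK
    obtain ⟨ψ, hψ⟩ := exists_isValue (fun y => ⟨z, hz, hirr y z⟩) (fun k => (hD k).pos)
      (fun k => (hD k).continuous) (fun k => (hD k).monotone) (fun k => (hD k).le)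
      (fun k => (hD k).zero) ρ
    exact ⟨_, Or.inl ⟨⟨z, hz⟩, ψ, hψ, fun _ => rfl⟩⟩

theorem exp_neg_ofReal {x : ℝ} (hx : 0 ≤ x) :
    EReal.exp (-(ENNReal.ofReal x : EReal)) = ENNReal.ofReal (Real.exp (-x)) := by
  rw [EReal.coe_ennreal_ofReal, max_eq_left hx, ← EReal.coe_neg, EReal.exp_coe]

variable [MeasurableSpace E] [Finite E] [MeasurableSingletonClass E]
  {next : E → κ → E} {rate : E → κ → ℝ≥0} {r : ℝ≥0} {K : Set E} {y₀ : E} {a b : ℝ≥0}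
  {u : Hist κ → κ → ℝ≥0} {L : Hist κ → E} {g : κ → ℝ≥0} {c F : κ → ℝ≥0 → ℝ≥0∞} {H : κ → ℝ → ℝ}
  {ρ : E → ℝ≥0} {Ψ : E → ℝ≥0∞}

namespace IsExtendedValue

theorem le_lintegral_pathCost (hΨ : IsExtendedValue (scaledRate r rate) next H ρ K Ψ)
    (P : ControlledPath next rate r K y₀ a b u L)
    (hirr : ∀ y z, Relation.ReflTransGen (JumpStep (scaledRate r rate) next) y z)
    (hD : ∀ k, IsDualCost (g k) (c k) (F k) (H k)) :
    Ψ y₀ ≤ ∫⁻ ω, pathCost (scaledRate r rate) K F ρ u L ω ∂canonLaw κ r := by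
  rcases hΨ with ⟨⟨z, hz⟩, ψ, hψ, h⟩ | ⟨-, -, h⟩ | ⟨rfl, ⟨s₀, hs⟩, h⟩
  · rw [h]
    exact P.le_lintegral_pathCost (fun y => ⟨z, hz, hirr y z⟩) hD hψ
  · rw [h]
    exact zero_le
  · rw [P.lintegral_pathCost_eq_top F hs fun y => hirr y s₀]
    exact le_top

theorem le_lintegral_exp_riskCost (hΨ : IsExtendedValue (scaledRate r rate) next H ρ K Ψ)
    (P : ControlledPath next rate r K y₀ a b u L)
    (hirr : ∀ y z, Relation.ReflTransGen (JumpStep (scaledRate r rate) next) y z)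
    (hD : ∀ k, IsDualCost (g k) (c k) (F k) (H k)) :
    EReal.exp (-(Ψ y₀ : EReal)) ≤
      ∫⁻ ω, EReal.exp (riskCost (scaledRate r rate) K c ρ u L ω) ∂canonLaw κ r := by
  rcases hΨ with ⟨⟨z, hz⟩, ψ, hψ, h⟩ | ⟨rfl, hρ, h⟩ | ⟨rfl, ⟨s₀, hs⟩, h⟩
  · rw [h, exp_neg_ofReal (hψ.nonneg _)]
    exact P.le_lintegral_exp_riskCost (fun y => ⟨z, hz, hirr y z⟩) hD hψ
  · rw [h, EReal.coe_ennreal_zero, neg_zero, EReal.exp_zero]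
    have h1 : (1 : ℝ≥0∞) = ∫⁻ _, 1 ∂canonLaw κ r := by simp
    rw [h1]
    refine lintegral_mono fun ω => ?_
    rw [EReal.one_le_exp_iff, riskCost]
    have h2 : pathCost (scaledRate r rate) ∅ (fun _ _ => 0) ρ u L ω = 0 := by
      simp [pathCost, runningCost, hρ]
    rw [h2, EReal.coe_ennreal_zero, sub_zero]
    exact EReal.coe_ennreal_nonneg _
  · rw [h, EReal.coe_ennreal_top, EReal.neg_top, EReal.exp_bot]
    exact zero_le

theorem exists_lintegral_pathCost_le (hΨ : IsExtendedValue (scaledRate r rate) next H ρ K Ψ)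
    (hD : ∀ k, IsDualCost (g k) (c k) (F k) (H k)) : ∃ v : E → κ → ℝ≥0, (∀ y k, 0 < v y k) ∧
      ∀ y₀ a b u L, ControlledPath next rate r K y₀ a b u L → (∀ h, u h = v (L h)) →
        ∫⁻ ω, pathCost (scaledRate r rate) K F ρ u L ω ∂canonLaw κ r ≤ Ψ y₀ := by
  rcases hΨ with ⟨-, ψ, hψ, h⟩ | ⟨rfl, hρ, h⟩ | ⟨-, -, h⟩
  · choose v hv0 hv using fun (y : E) (k : κ) => (hD k).exists_le (ψ (next y k) - ψ y)
    refine ⟨v, hv0, fun y₀ a b u L P hu => ?_⟩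
    rw [h]
    exact P.lintegral_pathCost_le hψ hu hv
  · choose v hv0 hv using fun (_ : E) (k : κ) => (hD k).exists_le 0
    refine ⟨v, hv0, fun y₀ a b u L P hu => ?_⟩
    have h0 : ∀ y k, F k (v y k) = 0 := by
      intro y k
      have := (hv y k).2
      rwa [(hD k).zero, mul_zero, sub_zero, ENNReal.ofReal_zero, nonpos_iff_eq_zero] at this
    simp [pathCost, runningCost, hρ, hu, h0]
  · refine ⟨fun _ _ => 1, fun _ _ => one_pos, fun y₀ a b u L P hu => ?_⟩
    rw [h]
    exact le_top

theorem exists_lintegral_exp_riskCost_le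
    (hΨ : IsExtendedValue (scaledRate r rate) next H ρ K Ψ)
    (hirr : ∀ y z, Relation.ReflTransGen (JumpStep (scaledRate r rate) next) y z)
    (hD : ∀ k, IsDualCost (g k) (c k) (F k) (H k)) {s : ℝ} (hs0 : 0 < s) :
    ∃ v : E → κ → ℝ≥0, (∀ y k, 0 < v y k) ∧
      ∀ y₀ a b u L, ControlledPath next rate r K y₀ a b u L → (∀ h, u h = v (L h)) →
        ENNReal.ofReal (1 - s) *
          ∫⁻ ω, EReal.exp (riskCost (scaledRate r rate) K c ρ u L ω) ∂canonLaw κ r ≤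
        EReal.exp (-(Ψ y₀ : EReal)) := by
  have hcg : ∀ (K : Set E) u (L : Hist κ → E), (∀ h, u h = g) → ∀ ω,
      pathCost (scaledRate r rate) K c (fun _ => 0) u L ω = 0 := by
    intro K u L hu ω
    simp [pathCost, runningCost, hu, (hD _).nominal]
  rcases hΨ with ⟨⟨z, hz⟩, ψ, hψ, h⟩ | ⟨rfl, hρ, h⟩ | ⟨rfl, ⟨s₀, hs⟩, h⟩
  · obtain ⟨v, hv0, hv⟩ := exists_feedback_riskCost_le (rate := rate) (r := r) rfl
      (fun y => ⟨z, hz, hirr y z⟩) hD hψ hs0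
    refine ⟨v, hv0, fun y₀ a b u L P hu => ?_⟩
    rw [h, exp_neg_ofReal (hψ.nonneg _)]
    exact hv y₀ a b u L P hu
  · refine ⟨fun _ => g, fun _ k => (hD k).pos, fun y₀ a b u L P hu => ?_⟩
    have h2 : ∀ ω, pathCost (scaledRate r rate) ∅ (fun _ _ => 0) ρ u L ω = 0 := fun ω => by
      simp [pathCost, runningCost, hρ]
    simp only [riskCost, hcg ∅ u L hu, h2, h, EReal.coe_ennreal_zero, sub_zero, neg_zero,
      EReal.exp_zero, lintegral_const, measure_univ, mul_one]
    rw [← ENNReal.ofReal_one]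
    exact ENNReal.ofReal_le_ofReal (by linarith)
  · refine ⟨fun _ => g, fun _ k => (hD k).pos, fun y₀ a b u L P hu => ?_⟩
    simp only [riskCost, hcg ∅ u L hu, EReal.coe_ennreal_zero, zero_sub]
    rw [P.lintegral_exp_neg_pathCost hs fun y => hirr y s₀, mul_zero]
    exact zero_le

end IsExtendedValue

end ExtendedValue

/-! ### Controls and controlled processes of a jump model -/

section JumpModelControl

open Hist

/-- The path `L` with control `u'` has the same costs up to the hitting time of `K` as the process
`Y` with control `u`. -/
def SameCosts {κ E : Type*} [Fintype κ] (r : ℝ≥0) (K : Set E) (u : ℝ≥0 × Canon κ → κ → ℝ≥0)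
    (Y : ℝ≥0 → Canon κ → E)
    (u' : Hist κ → κ → ℝ≥0) (L : Hist κ → E) : Prop :=
  ∀ᵐ ω ∂canonLaw κ r, ∀ (q : E → κ → ℝ≥0) (φ : κ → ℝ≥0 → ℝ≥0∞) (ρ : E → ℝ≥0),
    integralUpTo (hittingTime (fun t => Y t ω) K)
      (fun t => ∑ k, q (Y t ω) k * φ k (u (t, ω) k) + ρ (Y t ω)) = pathCost q K φ ρ u' L ω

namespace JumpModel

variable {κ ι E : Type*} (M : JumpModel κ ι E)

theorem killedLevel_le (K : Set E) {b D : ℝ≥0} (hD : ∀ y k, M.rate y k * b ≤ D)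
    {u : Hist κ → κ → ℝ≥0} (hu : ∀ h k, u h k ≤ b) (h : Hist κ) (y : E) (k : κ) :
    killedLevel M.rate K u h y k ≤ D := by
  rw [killedLevel]
  split_ifs
  · exact zero_le
  · exact (mul_le_mul' le_rfl (hu h k)).trans (hD y k)

theorem measurable_killedLevel (K : Set E) {u : Hist κ → κ → ℝ≥0}
    (hu : ∀ k, Measurable fun h => u h k) (y : E) (k : κ) :
    Measurable fun h => killedLevel M.rate K u h y k := by
  unfold killedLevel
  by_cases hy : y ∈ K
  · simp only [if_pos hy]; exact measurable_const
  · simp only [if_neg hy]; exact (hu k).const_mul _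

variable [Fintype κ]

/-- `Y` is the process with values in `E` which solves the stochastic equation with control `u`. -/
def IsControlled (r : ℝ≥0) (u : ℝ≥0 × Canon κ → κ → ℝ≥0) (y₀ : E) (Y : ℝ≥0 → Canon κ → E) : Prop :=
  ∀ᵐ ω ∂canonLaw κ r, M.Solves ω (fun s => u (s, ω)) y₀ fun t => Y t ω

theorem exists_forall_mul_le [Finite E] (b : ℝ≥0) : ∃ D, ∀ y k, M.rate y k * b ≤ D := by
  obtain ⟨_⟩ := nonempty_fintype E
  refine ⟨∑ p : E × κ, M.rate p.1 p.2 * b, fun y k => ?_⟩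
  exact Finset.single_le_sum (f := fun p : E × κ => M.rate p.1 p.2 * b) (fun _ _ => zero_le)
    (Finset.mem_univ (y, k))

/-- The cost of the ordinary problem for a controlled process. -/
def processCost (r : ℝ≥0) (K : Set E) (F : κ → ℝ≥0 → ℝ≥0∞) (ρ : E → ℝ≥0)
    (u : ℝ≥0 × Canon κ → κ → ℝ≥0) (Y : ℝ≥0 → Canon κ → E) : ℝ≥0∞ :=
  ∫⁻ ω, integralUpTo (hittingTime (fun t => Y t ω) K)
    (fun t => ∑ k, scaledRate r M.rate (Y t ω) k * F k (u (t, ω) k) + ρ (Y t ω)) ∂canonLaw κ r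

/-- The cost of the risk-sensitive problem for a controlled process. -/
def processRisk (r : ℝ≥0) (K : Set E) (c : κ → ℝ≥0 → ℝ≥0∞) (ρ : E → ℝ≥0)
    (u : ℝ≥0 × Canon κ → κ → ℝ≥0) (Y : ℝ≥0 → Canon κ → E) : ℝ≥0∞ :=
  ∫⁻ ω, EReal.exp ((integralUpTo (hittingTime (fun t => Y t ω) K)
      (fun t => ∑ k, scaledRate r M.rate (Y t ω) k * c k (u (t, ω) k)) : ℝ≥0∞) -
    (integralUpTo (hittingTime (fun t => Y t ω) K) fun t => ρ (Y t ω) : ℝ≥0∞) : EReal)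
    ∂canonLaw κ r

variable {M}

theorem _root_.ExitControl.SameCosts.processCost_eq {r : ℝ≥0} {K : Set E}
    {u : ℝ≥0 × Canon κ → κ → ℝ≥0}
    {Y : ℝ≥0 → Canon κ → E} {u' : Hist κ → κ → ℝ≥0} {L : Hist κ → E}
    (h : SameCosts r K u Y u' L) (F : κ → ℝ≥0 → ℝ≥0∞) (ρ : E → ℝ≥0) :
    M.processCost r K F ρ u Y =
      ∫⁻ ω, pathCost (scaledRate r M.rate) K F ρ u' L ω ∂canonLaw κ r := by
  refine lintegral_congr_ae ?_
  filter_upwards [h] with ω hω using hω _ F ρ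

theorem _root_.ExitControl.SameCosts.processRisk_eq {r : ℝ≥0} {K : Set E}
    {u : ℝ≥0 × Canon κ → κ → ℝ≥0}
    {Y : ℝ≥0 → Canon κ → E} {u' : Hist κ → κ → ℝ≥0} {L : Hist κ → E}
    (h : SameCosts r K u Y u' L) (c : κ → ℝ≥0 → ℝ≥0∞) (ρ : E → ℝ≥0) :
    M.processRisk r K c ρ u Y =
      ∫⁻ ω, EReal.exp (riskCost (scaledRate r M.rate) K c ρ u' L ω) ∂canonLaw κ r := by
  refine lintegral_congr_ae ?_
  filter_upwards [h] with ω hω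
  have h1 := hω (scaledRate r M.rate) c fun _ => 0
  have h2 := hω (scaledRate r M.rate) (fun _ _ => 0) ρ
  simp only [ENNReal.coe_zero, add_zero] at h1
  simp only [mul_zero, Finset.sum_const_zero, zero_add] at h2
  rw [riskCost, ← h1, ← h2]

variable (M)

variable [Fintype E] [MeasurableSpace E] [MeasurableSingletonClass E]

/-- The history of the noise describes every controlled process up to the hitting time of `K`. -/
theorem exists_controlledPath [Finite ι] {r : ℝ≥0} (K : Set E) {u : ℝ≥0 × Canon κ → κ → ℝ≥0}
    (hu : u ∈ Admissible κ r) {y₀ : E} {Y : ℝ≥0 → Canon κ → E} (hY : M.IsControlled r u y₀ Y) :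
    ∃ a b u' L, ControlledPath M.next M.rate r K y₀ a b u' L ∧ SameCosts r K u Y u' L := by
  obtain ⟨hum, hub⟩ := hu
  choose a' b' ha' hab' using hub
  obtain ⟨a, b, ha, hab⟩ : ∃ a b : ℝ≥0, 0 < a ∧ ∀ p k, a ≤ u p k ∧ u p k ≤ b := by
    rcases isEmpty_or_nonempty κ with h | h
    · exact ⟨1, 1, one_pos, fun p k => (h.false k).elim⟩
    · obtain ⟨k1, h1⟩ := Finite.exists_min a'
      obtain ⟨k2, h2⟩ := Finite.exists_max b'
      exact ⟨a' k1, b' k2, ha' k1, fun p k =>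
        ⟨(h1 k).trans (hab' k p).1, (hab' k p).2.trans (h2 k)⟩⟩
  obtain ⟨u₀, hu₀, huu⟩ := exists_raw_version r hum
  set u' : Hist κ → κ → ℝ≥0 := fun h k => max a (min (u₀ h k) (max a b)) with hu'
  have hu'm : ∀ k, Measurable fun h => u' h k := fun k =>
    measurable_const.max (((measurable_pi_apply k).comp hu₀).min measurable_const)
  have hu'b : ∀ h k, a ≤ u' h k ∧ u' h k ≤ max a b := fun h k =>
    ⟨le_max_left _ _, max_le (le_max_left _ _) (min_le_right _ _)⟩
  have huu' : ∀ᵐ ω ∂canonLaw κ r, ∀ t, u (t, ω) = u' (Hist.mk t ω) := by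
    filter_upwards [huu] with ω h t
    funext k
    show u (t, ω) k = max a (min (u₀ (Hist.mk t ω) k) (max a b))
    rw [← h t, min_eq_left ((hab _ k).2.trans (le_max_right _ _)), max_eq_right (hab _ k).1]
  obtain ⟨D, hD⟩ := M.exists_forall_mul_le (max a b)
  obtain ⟨L, hLm, hL⟩ := exists_jumpPath M.next (M.measurable_killedLevel K hu'm)
    (M.killedLevel_le K hD fun h k => (hu'b h k).2) y₀
  refine ⟨a, max a b, u', L, ⟨ha, hu'b, hu'm, hLm, D,
    M.killedLevel_le K hD fun h k => (hu'b h k).2, ?_⟩, ?_⟩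
  · filter_upwards [ae_regular κ r] with ω hω using hL ω hω
  · filter_upwards [ae_regular κ r, huu', hY] with ω hω hωu hωY q φ ρ
    have hωu' : (fun s => u (s, ω)) = fun s => u' (Hist.mk s ω) := funext hωu
    rw [hωu'] at hωY
    obtain ⟨L₀, hYL, hL₀⟩ := JumpModel.Solves.exists_jumpPath hω
      (fun k => (hu'm k).comp (measurable_mk_left ω))
      (fun s y k => (mul_le_mul' le_rfl (hu'b (Hist.mk s ω) k).2).trans (hD y k)) hωY
    simp_rw [hωu]
    exact (integralUpTo_hittingTime hω K hL₀ hYL (hL ω hω) fun y s =>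
      ∑ k, q y k * φ k (u' (Hist.mk s ω) k) + ρ y)

/-- Every feedback law gives rise to an admissible control. -/
theorem exists_process_of_feedback (r : ℝ≥0) (K : Set E) {v : E → κ → ℝ≥0} (hv : ∀ y k, 0 < v y k)
    (y₀ : E) : ∃ u ∈ Admissible κ r, ∃ Y, M.IsControlled r u y₀ Y ∧
      ∃ a b u' L, ControlledPath M.next M.rate r K y₀ a b u' L ∧ (∀ h, u' h = v (L h)) ∧
        SameCosts r K u Y u' L := by
  classical
  obtain ⟨a, b, ha, hab⟩ : ∃ a b : ℝ≥0, 0 < a ∧ ∀ y k, a ≤ v y k ∧ v y k ≤ b := by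
    rcases isEmpty_or_nonempty κ with h | h
    · exact ⟨1, 1, one_pos, fun y k => (h.false k).elim⟩
    · have : Nonempty E := ⟨y₀⟩
      obtain ⟨p1, h1⟩ := Finite.exists_min fun p : E × κ => v p.1 p.2
      obtain ⟨p2, h2⟩ := Finite.exists_max fun p : E × κ => v p.1 p.2
      exact ⟨v p1.1 p1.2, v p2.1 p2.2, hv _ _, fun y k => ⟨h1 (y, k), h2 (y, k)⟩⟩
  obtain ⟨D, hD⟩ := M.exists_forall_mul_le b
  -- the stopped path determines the control
  obtain ⟨L, hLm, hL⟩ := exists_jumpPath M.next (b := D)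
    (v := fun _ y k => if y ∈ K then 0 else M.rate y k * v y k) (fun y k => measurable_const)
    (fun h y k => by
      split_ifs
      · exact zero_le
      · exact (mul_le_mul' le_rfl (hab y k).2).trans (hD y k)) y₀
  set u' : Hist κ → κ → ℝ≥0 := fun h => v (L h) with hu'
  have hu'm : Measurable u' := (measurable_of_finite v).comp hLm
  have hu'mk : ∀ k, Measurable fun h => u' h k := fun k => (measurable_pi_apply k).comp hu'm
  have hkL : ∀ ω, Regular ω → IsJumpPath M.next D ω
      (fun s => killedLevel M.rate K u' (Hist.mk s ω)) y₀ fun s => L (Hist.mk s ω) := by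
    intro ω hω
    have h := hL ω hω
    exact ⟨h.zero, fun a t hat hq h0 => h.stay a t hat hq h0,
      fun a t k ha hat hq h0 => h.jump a t k ha hat hq h0⟩
  obtain ⟨L₀, hL₀m, hL₀⟩ := exists_jumpPath M.next (b := D)
    (v := fun h y k => M.rate y k * u' h k) (fun y k => (hu'mk k).const_mul _)
    (fun h y k => (mul_le_mul' le_rfl (hab _ k).2).trans (hD y k)) y₀
  have : Nonempty E := ⟨y₀⟩
  choose! Y hY using fun ω (hω : Regular ω) => (hL₀ ω hω).exists_rightVersion hω
  refine ⟨fun p => u' (Hist.mk p.1 p.2), ⟨measurable_completed r hu'm, fun k =>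
    ⟨a, b, ha, fun p => hab _ k⟩⟩, fun t ω => Y ω t, ?_, a, b, u', L,
      ⟨ha, fun h k => hab _ k, hu'mk,
    hLm, D, M.killedLevel_le K hD fun h k => (hab _ k).2, ?_⟩, fun _ => rfl, ?_⟩
  · filter_upwards [ae_regular κ r] with ω hω
    exact JumpModel.solves_of_jumpPath M hω (fun k => (hu'mk k).comp (measurable_mk_left ω))
      (fun s y k => (mul_le_mul' le_rfl (hab _ k).2).trans (hD y k))
      (hL₀m.comp (measurable_mk_left ω)) (hL₀ ω hω) (hY ω hω)
  · filter_upwards [ae_regular κ r] with ω hω using hkL ω hω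
  · filter_upwards [ae_regular κ r] with ω hω q φ ρ
    exact (integralUpTo_hittingTime hω K (hL₀ ω hω) (hY ω hω) (hkL ω hω) fun y s =>
      ∑ k, q y k * φ k (u' (Hist.mk s ω) k) + ρ y)

variable {M}

variable {r : ℝ≥0} {K : Set E} {Ψ : E → ℝ≥0∞} {g : κ → ℝ≥0} {c F : κ → ℝ≥0 → ℝ≥0∞}
  {H : κ → ℝ → ℝ} {ρ : E → ℝ≥0}

theorem le_processCost [Finite ι] (hΨ : IsExtendedValue (scaledRate r M.rate) M.next H ρ K Ψ)
    (hirr : ∀ y z, Relation.ReflTransGen (JumpStep (scaledRate r M.rate) M.next) y z)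
    (hD : ∀ k, IsDualCost (g k) (c k) (F k) (H k)) {u : ℝ≥0 × Canon κ → κ → ℝ≥0}
    (hu : u ∈ Admissible κ r) {y₀ : E} {Y : ℝ≥0 → Canon κ → E} (hY : M.IsControlled r u y₀ Y) :
    Ψ y₀ ≤ M.processCost r K F ρ u Y := by
  obtain ⟨a, b, u', L, P, hS⟩ := M.exists_controlledPath K hu hY
  rw [hS.processCost_eq]
  exact hΨ.le_lintegral_pathCost P hirr hD

theorem le_processRisk [Finite ι] (hΨ : IsExtendedValue (scaledRate r M.rate) M.next H ρ K Ψ)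
    (hirr : ∀ y z, Relation.ReflTransGen (JumpStep (scaledRate r M.rate) M.next) y z)
    (hD : ∀ k, IsDualCost (g k) (c k) (F k) (H k)) {u : ℝ≥0 × Canon κ → κ → ℝ≥0}
    (hu : u ∈ Admissible κ r) {y₀ : E} {Y : ℝ≥0 → Canon κ → E} (hY : M.IsControlled r u y₀ Y) :
    EReal.exp (-(Ψ y₀ : EReal)) ≤ M.processRisk r K c ρ u Y := by
  obtain ⟨a, b, u', L, P, hS⟩ := M.exists_controlledPath K hu hY
  rw [hS.processRisk_eq]
  exact hΨ.le_lintegral_exp_riskCost P hirr hD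

theorem exists_processCost_le (hΨ : IsExtendedValue (scaledRate r M.rate) M.next H ρ K Ψ)
    (hD : ∀ k, IsDualCost (g k) (c k) (F k) (H k)) (y₀ : E) :
    ∃ u ∈ Admissible κ r, ∃ Y, M.IsControlled r u y₀ Y ∧ M.processCost r K F ρ u Y ≤ Ψ y₀ := by
  obtain ⟨v, hv, h⟩ := hΨ.exists_lintegral_pathCost_le hD
  obtain ⟨u, hu, Y, hY, a, b, u', L, P, hu', hS⟩ := M.exists_process_of_feedback r K hv y₀
  refine ⟨u, hu, Y, hY, ?_⟩
  rw [hS.processCost_eq]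
  exact h y₀ a b u' L P hu'

theorem exists_processRisk_le (hΨ : IsExtendedValue (scaledRate r M.rate) M.next H ρ K Ψ)
    (hirr : ∀ y z, Relation.ReflTransGen (JumpStep (scaledRate r M.rate) M.next) y z)
    (hD : ∀ k, IsDualCost (g k) (c k) (F k) (H k)) (y₀ : E) {s : ℝ} (hs0 : 0 < s) :
    ∃ u ∈ Admissible κ r, ∃ Y, M.IsControlled r u y₀ Y ∧
      ENNReal.ofReal (1 - s) * M.processRisk r K c ρ u Y ≤ EReal.exp (-(Ψ y₀ : EReal)) := by
  obtain ⟨v, hv, h⟩ := hΨ.exists_lintegral_exp_riskCost_le hirr hD hs0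
  obtain ⟨u, hu, Y, hY, a, b, u', L, P, hu', hS⟩ := M.exists_process_of_feedback r K hv y₀
  refine ⟨u, hu, Y, hY, ?_⟩
  rw [hS.processRisk_eq]
  exact h y₀ a b u' L P hu'

end JumpModel

end JumpModelControl

/-! ### The empirical measure -/

section Empirical

variable {X : Type*} [DecidableEq X] {γ : X → X → ℝ≥0} {n : ℕ}

theorem unitVec_apply (x a : X) : unitVec x a = if a = x then 1 else 0 := by
  rw [unitVec, Pi.single_apply]

theorem empirical_update (x : Fin n → X) {z : Edge γ} {i : Fin n} (hi : x i = z.src) :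
    empirical (Function.update x i z.tgt) = empirical x + (1 / n : ℝ) • jumpVec z := by
  rw [empirical, empirical, ← smul_add]
  congr 1
  rw [← Finset.add_sum_erase _ _ (Finset.mem_univ i),
    ← Finset.add_sum_erase _ (fun j => unitVec (x j)) (Finset.mem_univ i), Function.update_self,
    jumpVec, hi]
  have : ∑ j ∈ Finset.univ.erase i, unitVec (Function.update x i z.tgt j) =
      ∑ j ∈ Finset.univ.erase i, unitVec (x j) :=
    Finset.sum_congr rfl fun j hj => by rw [Function.update_of_ne (Finset.ne_of_mem_erase hj)]
  rw [this]
  abel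

theorem unitVec_injective : Function.Injective (unitVec : X → X → ℝ) := by
  intro x y h
  by_contra hne
  have := congrFun h x
  simp [unitVec_apply, hne] at this

theorem unitVec_nonneg (x a : X) : 0 ≤ unitVec x a := by
  rw [unitVec_apply]
  split_ifs <;> norm_num

theorem mul_empirical_apply (hn : 0 < n) (x : Fin n → X) (a : X) :
    n * empirical x a = ∑ i, if a = x i then 1 else 0 := by
  have : (n : ℝ) ≠ 0 := by exact_mod_cast hn.ne'
  simp only [empirical, Pi.smul_apply, Finset.sum_apply, smul_eq_mul, unitVec_apply]
  rw [← mul_assoc, mul_one_div_cancel this, one_mul]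

/-- Configurations with the same empirical measure differ by a permutation of the agents. -/
theorem exists_perm_of_empirical_eq (hn : 0 < n) {x y : Fin n → X} (h : empirical x = empirical y) :
    ∃ σ : Equiv.Perm (Fin n), y ∘ σ = x := by
  have hcard : ∀ a, Fintype.card {i // x i = a} = Fintype.card {i // y i = a} := by
    intro a
    have h1 := mul_empirical_apply hn x a
    rw [h, mul_empirical_apply hn y a] at h1
    simp only [Finset.sum_boole, Nat.cast_inj] at h1
    rw [Fintype.card_subtype, Fintype.card_subtype]
    simp only [eq_comm (b := a)]
    exact h1.symm
  refine ⟨(Equiv.sigmaFiberEquiv x).symm.trans ((Equiv.sigmaCongrRight fun a =>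
    Fintype.equivOfCardEq (hcard a)).trans (Equiv.sigmaFiberEquiv y)), ?_⟩
  ext i
  exact ((Fintype.equivOfCardEq (hcard (x i))) ⟨i, rfl⟩).2

variable [Fintype X]

theorem sum_unitVec (x : X) : ∑ a, unitVec x a = 1 := by
  simp [unitVec_apply]

theorem empirical_mem (hn : 0 < n) (x : Fin n → X) : empirical x ∈ gridSimplex X n := by
  have hn' : (n : ℝ) ≠ 0 := by exact_mod_cast hn.ne'
  refine ⟨⟨fun a => ?_, ?_⟩, fun a => ?_⟩
  · simp only [empirical, Pi.smul_apply, Finset.sum_apply, smul_eq_mul]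
    exact mul_nonneg (by positivity) (Finset.sum_nonneg fun i _ => unitVec_nonneg _ _)
  · refine mul_left_cancel₀ hn' ?_
    rw [Finset.mul_sum]
    simp_rw [mul_empirical_apply hn]
    rw [Finset.sum_comm]
    simp
  · refine ⟨∑ i, if a = x i then 1 else 0, ?_⟩
    rw [eq_div_iff hn', mul_comm, mul_empirical_apply hn]
    push_cast
    rfl

/-- Every vector of the grid is an empirical measure. -/
theorem exists_empirical_eq (hn : 0 < n) {m : X → ℝ} (hm : m ∈ gridSimplex X n) :
    ∃ x : Fin n → X, empirical x = m := by
  have hn' : (0 : ℝ) < n := by exact_mod_cast hn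
  obtain ⟨⟨h0, h1⟩, hk⟩ := hm
  choose k hk using hk
  have hk0 : ∀ a, 0 ≤ k a := by
    intro a
    have := h0 a
    rw [hk a, le_div_iff₀ hn', zero_mul] at this
    exact_mod_cast this
  lift k to X → ℕ using hk0
  have hsum : ∑ a, k a = n := by
    simp_rw [hk] at h1
    rw [← Finset.sum_div, div_eq_one_iff_eq hn'.ne'] at h1
    exact_mod_cast h1
  have hcard : Fintype.card (Σ a, Fin (k a)) = n := by simp [hsum]
  let e := Fintype.equivFinOfCardEq hcard
  refine ⟨fun i => (e.symm i).1, ?_⟩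
  ext a
  refine mul_left_cancel₀ hn'.ne' ?_
  rw [mul_empirical_apply hn, hk a, mul_div_cancel₀ _ hn'.ne',
    Equiv.sum_comp e.symm (fun p : Σ a, Fin (k a) => if a = p.1 then (1 : ℝ) else 0),
    Fintype.sum_sigma, Finset.sum_eq_single a (fun b _ hb => by simp [hb.symm]) (by simp)]
  simp

theorem finite_gridSimplex (hn : 0 < n) : Finite (gridSimplex X n) :=
  Finite.of_surjective (fun x : Fin n → X => (⟨empirical x, empirical_mem hn x⟩ : gridSimplex X n))
    fun m => by
      obtain ⟨x, hx⟩ := exists_empirical_eq hn m.2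
      exact ⟨x, Subtype.ext hx⟩

theorem add_jumpVec_mem (hn : 0 < n) {m : X → ℝ} (hm : m ∈ gridSimplex X n) (z : Edge γ)
    (hz : 0 < m z.src) : m + (1 / n : ℝ) • jumpVec z ∈ gridSimplex X n := by
  have hn' : (0 : ℝ) < n := by exact_mod_cast hn
  obtain ⟨⟨h0, h1⟩, hk⟩ := hm
  refine ⟨⟨fun a => ?_, ?_⟩, fun a => ?_⟩
  · obtain ⟨k, hk⟩ := hk z.src
    have hk1 : 1 ≤ k := by
      rw [hk, lt_div_iff₀ hn', zero_mul] at hz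
      have : 0 < k := by exact_mod_cast hz
      omega
    have hk1' : (1 : ℝ) ≤ k := by exact_mod_cast hk1
    have hsrc : 1 / (n : ℝ) ≤ m z.src := by
      rw [hk]
      exact div_le_div_of_nonneg_right hk1' hn'.le
    simp only [Pi.add_apply, Pi.smul_apply, jumpVec, Pi.sub_apply, smul_eq_mul]
    have h2 := mul_nonneg (one_div_nonneg.2 hn'.le) (unitVec_nonneg z.tgt a)
    have h3 : 1 / (n : ℝ) * unitVec z.src a ≤ m a := by
      rw [unitVec_apply]
      split_ifs with h
      · rw [mul_one, h]
        exact hsrc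
      · rw [mul_zero]
        exact h0 a
    rw [mul_sub]
    linarith
  · simp only [Pi.add_apply, Pi.smul_apply, jumpVec, Pi.sub_apply, smul_eq_mul,
      Finset.sum_add_distrib, ← Finset.mul_sum, Finset.sum_sub_distrib, sum_unitVec, h1]
    ring
  · obtain ⟨k, hk⟩ := hk a
    refine ⟨k + ((if a = z.tgt then 1 else 0) - if a = z.src then 1 else 0), ?_⟩
    simp only [Pi.add_apply, Pi.smul_apply, jumpVec, Pi.sub_apply, smul_eq_mul, unitVec_apply, hk]
    push_cast
    ring

end Empirical

/-! ### The two jump models -/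

section Models

variable {X : Type*} [DecidableEq X]

/-- The process of all agents as a jump model. -/
def agentModel (γ : X → X → ℝ≥0) (n : ℕ) : JumpModel (Fin n × Edge γ) (Fin n × X) (Fin n → X) where
  emb x p := unitVec (x p.1) p.2
  emb_injective x y h := by
    ext i
    exact unitVec_injective (funext fun a => congrFun h (i, a))
  emb_nonneg x p := unitVec_nonneg _ _
  coord k := (k.1, k.2.src)
  jump k p := if p.1 = k.1 then jumpVec k.2 p.2 else 0
  next x k := Function.update x k.1 k.2.tgt
  emb_next x k hk := by
    have h : x k.1 = k.2.src := by
      rw [unitVec_apply] at hk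
      by_contra hne
      rw [if_neg fun h => hne h.symm] at hk
      exact lt_irrefl _ hk
    ext ⟨i, a⟩
    simp only [Pi.add_apply]
    by_cases hi : i = k.1
    · subst hi
      simp [jumpVec, h]
    · simp [hi]

theorem agentModel_rate {γ : X → X → ℝ≥0} {n : ℕ} (x : Fin n → X) (k : Fin n × Edge γ) :
    (agentModel γ n).rate x k = if k.2.src = x k.1 then 1 else 0 := by
  show (unitVec (x k.1) k.2.src).toNNReal = _
  rw [unitVec_apply]
  split_ifs <;> simp

/-- In the agent model any configuration can be reached from any other one. -/
theorem agentModel_irreducible {γ : X → X → ℝ≥0} {n : ℕ} (hγ : Ergodic γ) (x y : Fin n → X) :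
    Relation.ReflTransGen (JumpStep (scaledRate 1 (agentModel γ n).rate) (agentModel γ n).next)
      x y := by
  have hone : ∀ (x : Fin n → X) (i : Fin n) (b : X), Relation.ReflTransGen
      (JumpStep (scaledRate 1 (agentModel γ n).rate) (agentModel γ n).next) x
      (Function.update x i b) := by
    intro x i b
    have := hγ (x i) b
    induction this with
    | refl => rw [Function.update_eq_self]
    | @tail b c _ hbc ih =>
      refine ih.tail ⟨(i, ⟨(b, c), hbc⟩), ?_, ?_⟩
      · rw [scaledRate, agentModel_rate]
        simp [Edge.src]
      · show Function.update (Function.update x i b) i c = _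
        rw [Function.update_idem]
  have hall : ∀ s : Finset (Fin n), Relation.ReflTransGen
      (JumpStep (scaledRate 1 (agentModel γ n).rate) (agentModel γ n).next) x
      (fun i => if i ∈ s then y i else x i) := by
    intro s
    induction s using Finset.induction_on with
    | empty => simp only [Finset.notMem_empty, if_false]; exact Relation.ReflTransGen.refl
    | insert i s _ ih =>
      refine ih.trans ?_
      have : (fun j => if j ∈ insert i s then y j else x j) =
          Function.update (fun j => if j ∈ s then y j else x j) i (y i) := by
        ext j
        by_cases hj : j = i
        · subst hj; simp
        · simp [hj]
      rw [this]
      exact hone _ i (y i)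
  simpa using hall Finset.univ

variable [Fintype X]

open Classical in
/-- The empirical measure process as a jump model.  The value of `next` for transitions of rate zero
is irrelevant. -/
def meanModel (γ : X → X → ℝ≥0) {n : ℕ} (hn : 0 < n) : JumpModel (Edge γ) X (gridSimplex X n) where
  emb m := m.1
  emb_injective := Subtype.val_injective
  emb_nonneg m := m.2.1.1
  coord z := z.src
  jump z := (1 / n : ℝ) • jumpVec z
  next m z := if h : m.1 + (1 / n : ℝ) • jumpVec z ∈ gridSimplex X n then ⟨_, h⟩ else m
  emb_next m z hz := by rw [dif_pos (add_jumpVec_mem hn m.2 z hz)]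

variable {γ : X → X → ℝ≥0} {n : ℕ}

theorem coe_meanModel_next (hn : 0 < n) (m : gridSimplex X n) (z : Edge γ) (hz : 0 < m.1 z.src) :
    ((meanModel γ hn).next m z).1 = m.1 + (1 / n : ℝ) • jumpVec z :=
  (meanModel γ hn).emb_next m z hz

theorem meanModel_rate (hn : 0 < n) (m : gridSimplex X n) (z : Edge γ) :
    (meanModel γ hn).rate m z = (m.1 z.src).toNNReal :=
  rfl

theorem empirical_next (hn : 0 < n) (x : Fin n → X) (k : Fin n × Edge γ) (hk : k.2.src = x k.1) :
    (⟨empirical ((agentModel γ n).next x k), empirical_mem hn _⟩ : gridSimplex X n) =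
      (meanModel γ hn).next ⟨empirical x, empirical_mem hn x⟩ k.2 := by
  have hpos : 0 < empirical x k.2.src := by
    have h1 := mul_empirical_apply hn x k.2.src
    have h2 : (1 : ℝ) ≤ ∑ i, if k.2.src = x i then (1 : ℝ) else 0 := by
      have := Finset.single_le_sum (f := fun i => if k.2.src = x i then (1 : ℝ) else 0)
        (fun i _ => by positivity) (Finset.mem_univ k.1)
      rwa [if_pos hk] at this
    rw [← h1] at h2
    exact pos_of_mul_pos_right (one_pos.trans_le h2) (Nat.cast_nonneg n)
  refine Subtype.ext ?_
  rw [coe_meanModel_next hn _ _ hpos]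
  exact empirical_update x hk.symm

theorem scaledRate_meanModel_empirical (hn : 0 < n) (x : Fin n → X) (z : Edge γ) :
    scaledRate (n : ℝ≥0) (meanModel γ hn).rate ⟨empirical x, empirical_mem hn x⟩ z =
      ∑ i, scaledRate 1 (agentModel γ n).rate x (i, z) := by
  rw [← NNReal.coe_inj, scaledRate, NNReal.coe_mul, meanModel_rate,
    Real.coe_toNNReal _ ((empirical_mem hn x).1.1 _), NNReal.coe_natCast, mul_empirical_apply hn]
  rw [NNReal.coe_sum]
  refine Finset.sum_congr rfl fun i _ => ?_
  rw [scaledRate, agentModel_rate, one_mul]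
  split_ifs <;> simp

/-- In the model of the empirical measure any state can be reached from any other one. -/
theorem meanModel_irreducible (hγ : Ergodic γ) (hn : 0 < n) (m m' : gridSimplex X n) :
    Relation.ReflTransGen (JumpStep (scaledRate (n : ℝ≥0) (meanModel γ hn).rate)
      (meanModel γ hn).next) m m' := by
  obtain ⟨x, hx⟩ := exists_empirical_eq hn m.2
  obtain ⟨y, hy⟩ := exists_empirical_eq hn m'.2
  have h := (agentModel_irreducible hγ x y).lift
    (p := JumpStep (scaledRate (n : ℝ≥0) (meanModel γ hn).rate) (meanModel γ hn).next)
    (fun x => (⟨empirical x, empirical_mem hn x⟩ : gridSimplex X n)) ?_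
  · have e1 : m = ⟨empirical x, empirical_mem hn x⟩ := Subtype.ext hx.symm
    have e2 : m' = ⟨empirical y, empirical_mem hn y⟩ := Subtype.ext hy.symm
    rw [e1, e2]
    exact h
  · rintro x _ ⟨k, hk, rfl⟩
    refine ⟨k.2, ?_, (empirical_next hn x k ?_).symm⟩
    · rw [scaledRate_meanModel_empirical]
      exact hk.trans_le (Finset.single_le_sum
        (f := fun i => scaledRate 1 (agentModel γ n).rate x (i, k.2)) (fun _ _ => zero_le)
        (Finset.mem_univ k.1))
    · rw [scaledRate, agentModel_rate] at hk
      by_contra hne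
      rw [if_neg hne, mul_zero] at hk
      exact lt_irrefl _ hk

/-- A solution of the dynamic programming equation of the mean-field problem solves the one of the
many-agent problem, as a function of the empirical measure. -/
theorem IsExtendedValue.comp_empirical (hn : 0 < n) {H : Edge γ → ℝ → ℝ} {ρ : (X → ℝ) → ℝ≥0}
    {K : Set (Fin n → X)}
    (hK : ∀ (σ : Equiv.Perm (Fin n)) (x : Fin n → X), x ∘ σ ∈ K ↔ x ∈ K)
    {Ψ : gridSimplex X n → ℝ≥0∞}
    (h : IsExtendedValue (scaledRate (n : ℝ≥0) (meanModel γ hn).rate) (meanModel γ hn).next H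
      (fun m => ρ m.1) {m | m.1 ∈ empirical '' K} Ψ) :
    IsExtendedValue (scaledRate 1 (agentModel γ n).rate) (agentModel γ n).next (fun k => H k.2)
      (fun x => ρ (empirical x)) K fun x => Ψ ⟨empirical x, empirical_mem hn x⟩ := by
  have hmem : ∀ x, empirical x ∈ empirical '' K ↔ x ∈ K := by
    refine fun x => ⟨?_, fun h => ⟨x, h, rfl⟩⟩
    rintro ⟨y, hy, hxy⟩
    obtain ⟨σ, rfl⟩ := exists_perm_of_empirical_eq hn hxy.symm
    exact (hK σ y).2 hy
  have hempty : {m : gridSimplex X n | m.1 ∈ empirical '' K} = ∅ → K = ∅ := by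
    intro he
    rw [eq_empty_iff_forall_notMem] at he ⊢
    exact fun x hx => he ⟨empirical x, empirical_mem hn x⟩ ⟨x, hx, rfl⟩
  rcases h with ⟨⟨⟨_, _⟩, ⟨x, hx, rfl⟩⟩, ψ, hψ, h⟩ | ⟨he, hρ, h⟩ | ⟨he, ⟨m, hm⟩, h⟩
  · refine Or.inl ⟨⟨x, hx⟩, fun x => ψ ⟨empirical x, empirical_mem hn x⟩,
      ⟨fun x => hψ.nonneg _, fun x hx => hψ.boundary _ ((hmem x).2 hx), fun x hx => ?_⟩,
      fun x => h _⟩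
    have := hψ.equation ⟨empirical x, empirical_mem hn x⟩ fun h' => hx ((hmem x).1 h')
    rw [← this]
    congr 1
    rw [Fintype.sum_prod_type, Finset.sum_comm]
    refine Finset.sum_congr rfl fun z _ => ?_
    rw [scaledRate_meanModel_empirical, NNReal.coe_sum, Finset.sum_mul]
    refine Finset.sum_congr rfl fun i _ => ?_
    by_cases hi : z.src = x i
    · rw [empirical_next hn x (i, z) hi]
    · have : scaledRate 1 (agentModel γ n).rate x (i, z) = 0 := by
        rw [scaledRate, agentModel_rate, if_neg hi, mul_zero]
      rw [this, NNReal.coe_zero, zero_mul, zero_mul]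
  · exact Or.inr (Or.inl ⟨hempty he, fun x => hρ ⟨empirical x, empirical_mem hn x⟩, fun x => h _⟩)
  · obtain ⟨x, hx⟩ := exists_empirical_eq hn m.2
    refine Or.inr (Or.inr ⟨hempty he, ⟨x, ?_⟩, fun x => h _⟩)
    show 0 < ρ (empirical x)
    rw [hx]
    exact hm

end Models

/-! ### The value functions -/

theorem le_of_forall_ofReal_one_sub_mul_le {w b : ℝ≥0∞}
    (h : ∀ s : ℝ, 0 < s → ENNReal.ofReal (1 - s) * w ≤ b) : w ≤ b := by
  have h1 : Tendsto (fun s : ℝ => ENNReal.ofReal (1 - s) * w) (𝓝[>] 0) (𝓝 (1 * w)) := by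
    refine ENNReal.Tendsto.mul_const ?_ (Or.inl one_ne_zero)
    have h2 : Tendsto (fun s : ℝ => 1 - s) (𝓝[>] 0) (𝓝 (1 - 0)) :=
      (tendsto_const_nhds.sub tendsto_id).mono_left nhdsWithin_le_nhds
    have := ENNReal.tendsto_ofReal h2
    rwa [sub_zero, ENNReal.ofReal_one] at this
  rw [one_mul] at h1
  refine le_of_tendsto h1 ?_
  filter_upwards [self_mem_nhdsWithin] with s hs using h s hs

namespace JumpModel

variable {κ ι E : Type*} [Fintype κ] [Finite ι] [Finite E] {M : JumpModel κ ι E} {r : ℝ≥0}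
  {K : Set E} {Ψ : E → ℝ≥0∞} {g : κ → ℝ≥0} {c F : κ → ℝ≥0 → ℝ≥0∞} {H : κ → ℝ → ℝ} {ρ : E → ℝ≥0}

/-- The value of the ordinary problem is the solution of the dynamic programming equation. -/
theorem iInf_processCost (hΨ : IsExtendedValue (scaledRate r M.rate) M.next H ρ K Ψ)
    (hirr : ∀ y z, Relation.ReflTransGen (JumpStep (scaledRate r M.rate) M.next) y z)
    (hD : ∀ k, IsDualCost (g k) (c k) (F k) (H k)) (y₀ : E) :
    ⨅ u ∈ Admissible κ r, ⨅ (Y) (_ : M.IsControlled r u y₀ Y), M.processCost r K F ρ u Y =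
      Ψ y₀ := by
  have := Fintype.ofFinite E
  let _ : MeasurableSpace E := ⊤
  have : MeasurableSingletonClass E := ⟨fun _ => trivial⟩
  refine le_antisymm ?_ (le_iInf₂ fun u hu => le_iInf₂ fun Y hY => le_processCost hΨ hirr hD hu hY)
  obtain ⟨u, hu, Y, hY, h⟩ := exists_processCost_le hΨ hD y₀
  exact (iInf₂_le_of_le u hu (iInf₂_le Y hY)).trans h

/-- The value of the risk-sensitive problem is the exponential of minus the solution of the dynamic
programming equation. -/
theorem iInf_processRisk (hΨ : IsExtendedValue (scaledRate r M.rate) M.next H ρ K Ψ)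
    (hirr : ∀ y z, Relation.ReflTransGen (JumpStep (scaledRate r M.rate) M.next) y z)
    (hD : ∀ k, IsDualCost (g k) (c k) (F k) (H k)) (y₀ : E) :
    ⨅ u ∈ Admissible κ r, ⨅ (Y) (_ : M.IsControlled r u y₀ Y), M.processRisk r K c ρ u Y =
      EReal.exp (-(Ψ y₀ : EReal)) := by
  have := Fintype.ofFinite E
  let _ : MeasurableSpace E := ⊤
  have : MeasurableSingletonClass E := ⟨fun _ => trivial⟩
  refine le_antisymm (le_of_forall_ofReal_one_sub_mul_le fun s hs => ?_)
    (le_iInf₂ fun u hu => le_iInf₂ fun Y hY => le_processRisk hΨ hirr hD hu hY)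
  obtain ⟨u, hu, Y, hY, h⟩ := exists_processRisk_le hΨ hirr hD y₀ hs
  exact (mul_le_mul' le_rfl (iInf₂_le_of_le u hu (iInf₂_le Y hY))).trans h

end JumpModel

section Values

variable {X : Type*} [Fintype X] {γ : X → X → ℝ≥0} {n : ℕ}

variable {C : Edge γ → ℝ≥0 → ℝ≥0∞} {R : (X → ℝ) → ℝ≥0}

theorem isCost_of_costAssumption (h : CostAssumption C R) (z : Edge γ) : IsCost (C z) :=
  ⟨h.convex z, h.monotoneOn z, h.at_one z⟩

/-- The Hamiltonian of a transition. -/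
def edgeHamiltonian (C : Edge γ → ℝ≥0 → ℝ≥0∞) (z : Edge γ) (p : ℝ) : ℝ :=
  z.rate * hamiltonian (C z) p

theorem isDualCost_agent (hCR : CostAssumption C R) (k : Fin n × Edge γ) :
    IsDualCost k.2.rate (rateCost C k.2) (fun q => (costF C k.2 q).toENNReal)
      (edgeHamiltonian C k.2) :=
  isDualCost (isCost_of_costAssumption hCR k.2)

theorem isDualCost_mean (hCR : CostAssumption C R) (z : Edge γ) :
    IsDualCost z.rate (rateCost C z) (fun q => (costF C z q).toENNReal) (edgeHamiltonian C z) :=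
  isDualCost (isCost_of_costAssumption hCR z)

variable [DecidableEq X]

theorem integralUpTo_const_mul (T : ℝ≥0∞) {c : ℝ≥0∞} (hc : c ≠ ∞) (f : ℝ≥0 → ℝ≥0∞) :
    integralUpTo T (fun t => c * f t) = c * integralUpTo T f :=
  lintegral_const_mul' _ _ hc

theorem hittingTime_congr {E E' : Type*} {f : ℝ≥0 → E} {f' : ℝ≥0 → E'} {K : Set E} {K' : Set E'}
    (h : ∀ t, f t ∈ K ↔ f' t ∈ K') : hittingTime f K = hittingTime f' K' := by
  simp only [hittingTime, h]

theorem meanModel_solves_iff (hn : 0 < n) {ω : Canon (Edge γ)} {u : ℝ≥0 → Edge γ → ℝ≥0}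
    {m : gridSimplex X n} {Y : ℝ≥0 → gridSimplex X n} : (meanModel γ hn).Solves ω u m Y ↔
      IsCadlag (fun t => (Y t).1) ∧
        ∀ t, (Y t).1 = dynamicsMap (1 / n) m.1 (fun s => (Y s).1) u ω t := by
  unfold JumpModel.Solves dynamicsMap
  refine and_congr Iff.rfl (forall_congr' fun t => ?_)
  have : ∀ z : Edge γ, (1 / (n : ℝ) * thinnedCount (ω z).1
      (fun s => Function.leftLim (fun s => (Y s).1) s z.src * (u s z : ℝ)) t) • jumpVec z =
      thinnedCount (ω z).1 (fun s => Function.leftLim (fun s => (Y s).1) s z.src * (u s z : ℝ)) t •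
        (1 / n : ℝ) • jumpVec z := fun z => by rw [smul_smul, mul_comm]
  simp_rw [this]
  rfl

theorem isCadlag_pi {ι : Type*} {f : ℝ≥0 → ι → ℝ} :
    IsCadlag f ↔ ∀ i, IsCadlag fun t => f t i := by
  constructor
  · intro h i t
    obtain ⟨h1, l, hl⟩ := h t
    exact ⟨continuousWithinAt_pi.1 h1 i, l i, tendsto_pi_nhds.1 hl i⟩
  · intro h t
    choose l hl using fun i => (h i t).2
    exact ⟨continuousWithinAt_pi.2 fun i => (h i t).1, l, tendsto_pi_nhds.2 hl⟩

theorem IsCadlag.leftLim_apply {ι ι' : Type*} {f : ℝ≥0 → ι → ℝ} (hf : IsCadlag f) (e : ι' → ι)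
    (t : ℝ≥0) (i : ι') :
    Function.leftLim (fun s j => f s (e j)) t i = Function.leftLim f t (e i) := by
  rcases eq_or_ne t 0 with rfl | ht
  · rw [leftLim_zero, leftLim_zero]
  · have h1 := hf.tendsto_leftLim (pos_iff_ne_zero.2 ht)
    have h2 : Tendsto (fun s j => f s (e j)) (𝓝[<] t) (𝓝 fun j => Function.leftLim f t (e j)) :=
      tendsto_pi_nhds.2 fun j => tendsto_pi_nhds.1 h1 (e j)
    have : (𝓝[<] t).NeBot := nhdsLT_neBot_of_exists_lt ⟨0, pos_iff_ne_zero.2 ht⟩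
    rw [leftLim_eq_of_tendsto h2]

theorem agentModel_solves_iff {ω : Canon (Fin n × Edge γ)} {u : ℝ≥0 → Fin n × Edge γ → ℝ≥0}
    {x : Fin n → X} {Y : ℝ≥0 → Fin n → X} : (agentModel γ n).Solves ω u x Y ↔
      ∀ i, IsCadlag (fun t => unitVec (Y t i)) ∧ ∀ t, unitVec (Y t i) =
        dynamicsMap 1 (unitVec (x i)) (fun s => unitVec (Y s i)) (fun s z => u s (i, z))
          (fun z => ω (i, z)) t := by
  have hc : IsCadlag (fun t => (agentModel γ n).emb (Y t)) ↔
      ∀ i, IsCadlag fun t => unitVec (Y t i) := by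
    rw [isCadlag_pi]
    refine ⟨fun h i => isCadlag_pi.2 fun a => h (i, a), fun h p => isCadlag_pi.1 (h p.1) p.2⟩
  unfold JumpModel.Solves
  rw [hc, forall_and]
  refine and_congr_right fun h => ?_
  have hlim : ∀ s i z, Function.leftLim (fun t => (agentModel γ n).emb (Y t)) s (i, Edge.src z) =
      Function.leftLim (fun t => unitVec (Y t i)) s (Edge.src (γ := γ) z) := fun s i z =>
    ((hc.2 h).leftLim_apply (fun a => (i, a)) s z.src).symm
  rw [forall_comm]
  refine forall_congr' fun t => ?_
  have hsum : ∀ i a, (∑ k : Fin n × Edge γ, thinnedCount (ω k).1 (fun s =>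
      Function.leftLim (fun t => (agentModel γ n).emb (Y t)) s ((agentModel γ n).coord k) *
        (u s k : ℝ)) t • (agentModel γ n).jump k) (i, a) =
      (∑ z : Edge γ, ((1 : ℝ) * thinnedCount (ω (i, z)).1 (fun s =>
        Function.leftLim (fun t => unitVec (Y t i)) s z.src * (u s (i, z) : ℝ)) t) •
          jumpVec z) a := by
    intro i a
    rw [Finset.sum_apply, Finset.sum_apply, Fintype.sum_prod_type, Finset.sum_eq_single i]
    · refine Finset.sum_congr rfl fun z _ => ?_
      have e : (agentModel γ n).coord (i, z) = (i, z.src) := rfl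
      simp only [e, hlim]
      simp [agentModel]
    · intro j _ hj
      refine Finset.sum_eq_zero fun z _ => ?_
      simp [agentModel, hj.symm]
    · simp
  constructor
  · intro heq i
    funext a
    have := congrFun heq (i, a)
    rw [Pi.add_apply, hsum] at this
    exact this
  · intro heq
    funext p
    have := congrFun (heq p.1) p.2
    rw [Pi.add_apply, hsum]
    exact this

theorem isAgentProcess_iff {x : Fin n → X} {u : ℝ≥0 × Canon (Fin n × Edge γ) → Fin n × Edge γ → ℝ≥0}
    {χ : ℝ≥0 → Canon (Fin n × Edge γ) → Fin n → X} :
    IsAgentProcess x u χ ↔ (agentModel γ n).IsControlled 1 u x χ := by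
  unfold IsAgentProcess JumpModel.IsControlled
  simp only [agentModel_solves_iff]

theorem agentSum_eq (x : Fin n → X) (f : Fin n → Edge γ → ℝ≥0∞) : agentSum x f =
    ∑ k : Fin n × Edge γ, scaledRate 1 (agentModel γ n).rate x k * f k.1 k.2 := by
  rw [agentSum, Fintype.sum_prod_type]
  refine Finset.sum_congr rfl fun i _ => Finset.sum_congr rfl fun z _ => ?_
  rw [scaledRate, agentModel_rate]
  split_ifs <;> simp

theorem agentCost_eq (hn : 0 < n) (K : Set (Fin n → X))
    (u : ℝ≥0 × Canon (Fin n × Edge γ) → Fin n × Edge γ → ℝ≥0)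
    (χ : ℝ≥0 → Canon (Fin n × Edge γ) → Fin n → X) :
    ∫⁻ ω, integralUpTo (hittingTime (fun t => χ t ω) K) (fun t =>
      (n : ℝ≥0∞)⁻¹ * agentSum (χ t ω) (fun i z => (costF C z (u (t, ω) (i, z))).toENNReal) +
        R (empirical (χ t ω))) ∂(canonLaw (Fin n × Edge γ) 1) =
    (n : ℝ≥0∞)⁻¹ * (agentModel γ n).processCost 1 K (fun k q => (costF C k.2 q).toENNReal)
      (fun x => n * R (empirical x)) u χ := by
  have hn0 : (n : ℝ≥0∞) ≠ 0 := by exact_mod_cast hn.ne'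
  have hi : (n : ℝ≥0∞)⁻¹ ≠ ∞ := ENNReal.inv_ne_top.2 hn0
  rw [JumpModel.processCost, ← lintegral_const_mul' _ _ hi]
  refine lintegral_congr fun ω => ?_
  rw [← integralUpTo_const_mul _ hi]
  congr 1
  funext t
  rw [agentSum_eq, mul_add, ENNReal.coe_mul, ENNReal.coe_natCast, ← mul_assoc _ (n : ℝ≥0∞),
    ENNReal.inv_mul_cancel hn0 (ENNReal.natCast_ne_top n), one_mul]

theorem agentRisk_eq (K : Set (Fin n → X))
    (u : ℝ≥0 × Canon (Fin n × Edge γ) → Fin n × Edge γ → ℝ≥0)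
    (χ : ℝ≥0 → Canon (Fin n × Edge γ) → Fin n → X) :
    ∫⁻ ω, EReal.exp
      ((integralUpTo (hittingTime (fun t => χ t ω) K) fun t =>
          agentSum (χ t ω) fun i z => rateCost C z (u (t, ω) (i, z)) : ℝ≥0∞) -
        (integralUpTo (hittingTime (fun t => χ t ω) K) fun t =>
          n * R (empirical (χ t ω)) : ℝ≥0∞) : EReal) ∂(canonLaw (Fin n × Edge γ) 1) =
    (agentModel γ n).processRisk 1 K (fun k => rateCost C k.2)
      (fun x => n * R (empirical x)) u χ := by
  rw [JumpModel.processRisk]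
  refine lintegral_congr fun ω => ?_
  simp_rw [agentSum_eq, ENNReal.coe_mul, ENNReal.coe_natCast]

theorem mul_iInf₂_iInf₂ {α β : Type*} {p : α → Prop} {q : α → β → Prop} {a : ℝ≥0∞} (h0 : a ≠ 0)
    (ht : a ≠ ∞) (f : α → β → ℝ≥0∞) :
    ⨅ (u) (_ : p u), ⨅ (Y) (_ : q u Y), a * f u Y =
      a * ⨅ (u) (_ : p u), ⨅ (Y) (_ : q u Y), f u Y := by
  simp_rw [ENNReal.mul_iInf_of_ne h0 ht]

/-- The value functions of the agents in terms of the solution of the dynamic programming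
equation. -/
theorem agent_values (hγ : Ergodic γ) (hCR : CostAssumption C R) (hn : 0 < n)
    {K : Set (Fin n → X)} {Ψ : (Fin n → X) → ℝ≥0∞}
    (hΨ : IsExtendedValue (scaledRate 1 (agentModel γ n).rate) (agentModel γ n).next
      (fun k => edgeHamiltonian C k.2) (fun x => n * R (empirical x)) K Ψ) (x : Fin n → X) :
    agentV C R K x = (n : ℝ≥0∞)⁻¹ * Ψ x ∧ agentW C R K x = EReal.exp (-(Ψ x : EReal)) := by
  have hn0 : (n : ℝ≥0∞) ≠ 0 := by exact_mod_cast hn.ne'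
  unfold agentV agentJ agentW agentI
  simp_rw [isAgentProcess_iff, agentCost_eq hn, agentRisk_eq]
  rw [mul_iInf₂_iInf₂ (ENNReal.inv_ne_zero.2 (ENNReal.natCast_ne_top n)) (ENNReal.inv_ne_top.2 hn0),
    JumpModel.iInf_processCost hΨ (agentModel_irreducible hγ) (isDualCost_agent hCR),
    JumpModel.iInf_processRisk hΨ (agentModel_irreducible hγ) (isDualCost_agent hCR)]
  exact ⟨rfl, rfl⟩

/-- The processes with values in the grid and those with values in `ℝ^X` are the same up to null
sets. -/
theorem iInf_isMeanFieldProcess (hn : 0 < n) (m : gridSimplex X n)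
    (u : ℝ≥0 × Canon (Edge γ) → Edge γ → ℝ≥0)
    {f : Canon (Edge γ) → (ℝ≥0 → X → ℝ) → ℝ≥0∞} :
    ⨅ (μ) (_ : IsMeanFieldProcess n m.1 u μ), ∫⁻ ω, f ω (fun t => μ t ω) ∂canonLaw (Edge γ) n =
    ⨅ (Y) (_ : (meanModel γ hn).IsControlled n u m Y),
      ∫⁻ ω, f ω (fun t => (Y t ω).1) ∂canonLaw (Edge γ) n := by
  classical
  refine le_antisymm (le_iInf₂ fun Y hY => iInf₂_le_of_le (fun t ω => (Y t ω).1) ?_ le_rfl)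
    (le_iInf₂ fun μ hμ => ?_)
  · filter_upwards [hY] with ω hω
    obtain ⟨h1, h2⟩ := (meanModel_solves_iff hn).1 hω
    exact ⟨h1, fun t => (Y t ω).2, h2⟩
  · set Y : ℝ≥0 → Canon (Edge γ) → gridSimplex X n := fun t ω =>
      if h : μ t ω ∈ gridSimplex X n then ⟨μ t ω, h⟩ else m with hY
    have hYμ : ∀ᵐ ω ∂canonLaw (Edge γ) n, (fun t => (Y t ω).1) = fun t => μ t ω := by
      filter_upwards [hμ] with ω hω
      funext t
      simp only [hY, dif_pos (hω.2.1 t)]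
    refine iInf₂_le_of_le Y ?_ (le_of_eq (lintegral_congr_ae ?_))
    · filter_upwards [hμ, hYμ] with ω hω hYω
      refine (meanModel_solves_iff hn).2 ⟨?_, fun t => ?_⟩
      · rw [hYω]
        exact hω.1
      · rw [hYω, ← hω.2.2 t]
        exact congrFun hYω t
    · filter_upwards [hYμ] with ω hω
      simp only [hω]

theorem meanCost_eq (hn : 0 < n) (K : Set (X → ℝ)) (u : ℝ≥0 × Canon (Edge γ) → Edge γ → ℝ≥0)
    (Y : ℝ≥0 → Canon (Edge γ) → gridSimplex X n) :
    ∫⁻ ω, integralUpTo (hittingTime (fun t => (Y t ω).1) K) (fun t =>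
      (∑ z, ENNReal.ofReal ((Y t ω).1 z.src) * (costF C z (u (t, ω) z)).toENNReal) + R (Y t ω).1)
      ∂canonLaw (Edge γ) n =
    (n : ℝ≥0∞)⁻¹ * (meanModel γ hn).processCost n {m | m.1 ∈ K}
      (fun z q => (costF C z q).toENNReal) (fun m => n * R m.1) u Y := by
  have hn0 : (n : ℝ≥0∞) ≠ 0 := by exact_mod_cast hn.ne'
  have hi : (n : ℝ≥0∞)⁻¹ ≠ ∞ := ENNReal.inv_ne_top.2 hn0
  rw [JumpModel.processCost, ← lintegral_const_mul' _ _ hi]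
  refine lintegral_congr fun ω => ?_
  rw [← integralUpTo_const_mul _ hi, hittingTime_congr (f' := fun t => Y t ω)
    (K' := {m : gridSimplex X n | m.1 ∈ K}) fun _ => Iff.rfl]
  congr 1
  funext t
  have h : ∀ a : ℝ≥0∞, (n : ℝ≥0∞)⁻¹ * (n * a) = a := fun a => by
    rw [← mul_assoc, ENNReal.inv_mul_cancel hn0 (ENNReal.natCast_ne_top n), one_mul]
  simp only [scaledRate, meanModel_rate, ENNReal.coe_mul, ENNReal.coe_natCast, mul_assoc]
  rw [← Finset.mul_sum, ← mul_add, h]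
  rfl

theorem coe_ennreal_natCast (n : ℕ) : ((n : ℝ≥0∞) : EReal) = n := by
  rw [← ENNReal.coe_natCast, EReal.coe_nnreal_eq_coe_real, NNReal.coe_natCast]
  rfl

theorem meanRisk_eq (hn : 0 < n) (K : Set (X → ℝ)) (u : ℝ≥0 × Canon (Edge γ) → Edge γ → ℝ≥0)
    (Y : ℝ≥0 → Canon (Edge γ) → gridSimplex X n) :
    ∫⁻ ω, EReal.exp ((n : EReal) *
      ((integralUpTo (hittingTime (fun t => (Y t ω).1) K) fun t =>
          ∑ z, ENNReal.ofReal ((Y t ω).1 z.src) * rateCost C z (u (t, ω) z) : ℝ≥0∞) -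
        (integralUpTo (hittingTime (fun t => (Y t ω).1) K) fun t => R (Y t ω).1 : ℝ≥0∞) : EReal))
      ∂canonLaw (Edge γ) n =
    (meanModel γ hn).processRisk n {m | m.1 ∈ K} (rateCost C) (fun m => n * R m.1) u Y := by
  have hnt : (n : ℝ≥0∞) ≠ ∞ := ENNReal.natCast_ne_top n
  rw [JumpModel.processRisk]
  refine lintegral_congr fun ω => ?_
  rw [hittingTime_congr (f' := fun t => Y t ω)
    (K' := {m : gridSimplex X n | m.1 ∈ K}) fun _ => Iff.rfl]
  simp only [scaledRate, meanModel_rate, ENNReal.coe_mul, ENNReal.coe_natCast, mul_assoc,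
    ← Finset.mul_sum, integralUpTo_const_mul _ hnt, EReal.coe_ennreal_mul,
    coe_ennreal_natCast]
  rw [sub_eq_add_neg, sub_eq_add_neg, EReal.left_distrib_of_nonneg_of_ne_top (by positivity)
    (EReal.natCast_ne_top n), mul_neg]
  rfl

/-- The mean-field value functions in terms of the solution of the dynamic programming equation. -/
theorem mean_values (hγ : Ergodic γ) (hCR : CostAssumption C R) (hn : 0 < n)
    {K : Set (X → ℝ)} {Ψ : gridSimplex X n → ℝ≥0∞}
    (hΨ : IsExtendedValue (scaledRate n (meanModel γ hn).rate) (meanModel γ hn).next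
      (edgeHamiltonian C) (fun m => n * R m.1) {m | m.1 ∈ K} Ψ) (m : gridSimplex X n) :
    meanV C R n K m.1 = (n : ℝ≥0∞)⁻¹ * Ψ m ∧ meanW C R n K m.1 = EReal.exp (-(Ψ m : EReal)) := by
  have hn0 : (n : ℝ≥0∞) ≠ 0 := by exact_mod_cast hn.ne'
  have := finite_gridSimplex (X := X) hn
  have hJ : ∀ u, meanJ C R n K m.1 u = ⨅ (Y) (_ : (meanModel γ hn).IsControlled n u m Y),
      (n : ℝ≥0∞)⁻¹ * (meanModel γ hn).processCost n {m | m.1 ∈ K}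
        (fun z q => (costF C z q).toENNReal) (fun m => n * R m.1) u Y := fun u => by
    simp_rw [← meanCost_eq]
    exact iInf_isMeanFieldProcess hn m u (f := fun ω μ => integralUpTo (hittingTime μ K) fun t =>
      (∑ z, ENNReal.ofReal (μ t z.src) * (costF C z (u (t, ω) z)).toENNReal) + R (μ t))
  have hI : ∀ u, meanI C R n K m.1 u = ⨅ (Y) (_ : (meanModel γ hn).IsControlled n u m Y),
      (meanModel γ hn).processRisk n {m | m.1 ∈ K} (rateCost C) (fun m => n * R m.1) u Y :=
    fun u => by
    simp_rw [← meanRisk_eq]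
    exact iInf_isMeanFieldProcess hn m u (f := fun ω μ => EReal.exp ((n : EReal) *
      ((integralUpTo (hittingTime μ K) fun t =>
          ∑ z, ENNReal.ofReal (μ t z.src) * rateCost C z (u (t, ω) z) : ℝ≥0∞) -
        (integralUpTo (hittingTime μ K) fun t => R (μ t) : ℝ≥0∞) : EReal)))
  unfold meanV meanW
  simp_rw [hJ, hI]
  rw [mul_iInf₂_iInf₂ (ENNReal.inv_ne_zero.2 (ENNReal.natCast_ne_top n)) (ENNReal.inv_ne_top.2 hn0),
    JumpModel.iInf_processCost hΨ (meanModel_irreducible hγ hn) (isDualCost_mean hCR),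
    JumpModel.iInf_processRisk hΨ (meanModel_irreducible hγ hn) (isDualCost_mean hCR)]
  exact ⟨rfl, rfl⟩

theorem coe_eq_negLogScaled {V W a : ℝ≥0∞} (hV : V = (n : ℝ≥0∞)⁻¹ * a)
    (hW : W = EReal.exp (-(a : EReal))) (hn : 0 < n) : (V : EReal) = negLogScaled n W := by
  have hn' : (n : ℝ≥0) ≠ 0 := by exact_mod_cast hn.ne'
  rw [negLogScaled, hW, EReal.log_exp, mul_neg, neg_neg, hV, EReal.coe_ennreal_mul]
  congr 1
  rw [← ENNReal.coe_natCast, ← ENNReal.coe_inv hn', EReal.coe_nnreal_eq_coe_real]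
  simp

end Values

end ExitControl

end

open ExitControl
theorem theorem3p4 {X : Type*} [Fintype X] [DecidableEq X]
    (γ : X → X → ℝ≥0) (hγ : ExitControl.Ergodic γ)
    (C : Edge γ → ℝ≥0 → ℝ≥0∞) (R : (X → ℝ) → ℝ≥0) (hCR : CostAssumption C R)
    (n : ℕ) (hn : 0 < n) :
    (∀ K : Set (X → ℝ), K ⊆ gridSimplex X n → ∀ m ∈ gridSimplex X n,
      (meanV C R n K m : EReal) = negLogScaled n (meanW C R n K m)) ∧
    (∀ (K : Set (Fin n → X)) (x : Fin n → X),
      (agentV C R K x : EReal) = negLogScaled n (agentW C R K x)) ∧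
    (∀ K : Set (Fin n → X), (∀ (σ : Equiv.Perm (Fin n)) (x : Fin n → X), x ∘ σ ∈ K ↔ x ∈ K) →
      ∀ x : Fin n → X,
        negLogScaled n (meanW C R n (empirical '' K) (empirical x)) =
          (meanV C R n (empirical '' K) (empirical x) : EReal) ∧
        (meanV C R n (empirical '' K) (empirical x) : EReal) = (agentV C R K x : EReal) ∧
        (agentV C R K x : EReal) = negLogScaled n (agentW C R K x)) := by
  have := finite_gridSimplex (X := X) hn
  have mean : ∀ K : Set (X → ℝ), ∃ Ψ, IsExtendedValue (scaledRate n (meanModel γ hn).rate)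
      (meanModel γ hn).next (edgeHamiltonian C) (fun m => n * R m.1) {m | m.1 ∈ K} Ψ := fun K =>
    exists_isExtendedValue (meanModel_irreducible hγ hn) (isDualCost_mean hCR) _ _
  refine ⟨fun K _ m hm => ?_, fun K x => ?_, fun K hK x => ?_⟩
  · obtain ⟨Ψ, hΨ⟩ := mean K
    obtain ⟨hV, hW⟩ := mean_values hγ hCR hn hΨ ⟨m, hm⟩
    exact coe_eq_negLogScaled hV hW hn
  · obtain ⟨Ψ, hΨ⟩ := exists_isExtendedValue (agentModel_irreducible (n := n) hγ)
      (isDualCost_agent hCR) (fun x => n * R (empirical x)) K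
    obtain ⟨hV, hW⟩ := agent_values hγ hCR hn hΨ x
    exact coe_eq_negLogScaled hV hW hn
  · -- one solution of the dynamic programming equation serves both problems
    obtain ⟨Ψ, hΨ⟩ := mean (empirical '' K)
    obtain ⟨hV, hW⟩ := mean_values hγ hCR hn hΨ ⟨empirical x, empirical_mem hn x⟩
    obtain ⟨hV', hW'⟩ := agent_values hγ hCR hn
      (hΨ.comp_empirical hn (ρ := fun m => n * R m) hK) x
    refine ⟨(coe_eq_negLogScaled hV hW hn).symm, ?_, coe_eq_negLogScaled hV' hW' hn⟩
    exact congrArg _ (hV.trans hV'.symm)
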